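/- \textbf{Geometry and spaces.} Let $\Omega=(0,R)\times(0,L)$ in the meridian half-plane with coordinates $(r,z)$, let $\Omega_0\subset\Omega$ be an open polygonal set (the workpiece) and $\Omega_1,\dots,\Omega_m\subset\Omega$ open sets (the coil rings), all pairwise disjoint; put $\Omega_C=\Omega_0\cup\dots\cup\Omega_m$, $\Omega_a=\Omega\setminus\overline{\Omega_C}$ (air), $\Gamma=\partial\Omega$, $\widehat\Gamma_1=\partial\Omega_0\setminus\{r=0\}$. For $\vartheta\subset\Omega$, $L^2_\alpha(\vartheta)$ has norm $(\int_\vartheta|G|^2r^\alpha\,dr\,dz)^{1/2}$, $H^1_1(\vartheta)$ is the space of $G\in L^2_1(\vartheta)$ with weak first derivatives in $L^2_1(\vartheta)$, and $\widetilde H^1_1(\vartheta)=H^1_1(\vartheta)\cap L^2_{-1}(\vartheta)$, each with its natural Hilbert norm. $\widetilde H^1_{1,\Gamma}(\Omega)$ is the space of $Z\in\widetilde H^1_1(\Omega)$ (complex valued) with $Z=0$ on $\Gamma$ in the sense of traces, and $L^2_1(\widehat\Gamma_1)$ has norm $(\int_{\widehat\Gamma_1}|g|^2r\,dl)^{1/2}$.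 \textbf{Coefficients.} Let $\omega>0$ and let $\sigma(x,u)$ be a real Carath\'eodory function on $\Omega\times\mathbb R$ with $0<\sigma_*\le\sigma\le\sigma^*$ and $|\sigma(x,u)-\sigma(x,v)|\le\sigma_p|u-v|$ for a.e. $x\in\Omega_0$ and all $u,v$, equal to a constant $\sigma_k>0$ in $\Omega_k$ ($k\ge1$) and to $0$ in $\Omega_a$. Let $\kappa$ on $\Omega_0$ and $\eta$ on $\widehat\Gamma_1$ be measurable, bounded, and bounded below by positive constants. Let $\nu_C:[0,\infty)\to\mathbb R$ satisfy, for some $\nu_{\min},\xi,\varrho>0$ and all $p,q\ge0$: $\nu_{\min}\le\nu_C(p)\le\nu_0$, $|\nu_C(p)p-\nu_C(q)q|\le\xi|p-q|$, $(\nu_C(p)p-\nu_C(q)q)(p-q)\ge\varrho|p-q|^2$. Put $\nu(x,p)=\nu_C(p)$ in $\Omega_C$ and $\nu(x,p)=\nu_0$ elsewhere, and, with $\operatorname{curl}(Ae_\theta)=(-\partial_zA,\ \tfrac1r\partial_r(rA))$, $$\langle\mathcal A(A),Z\rangle=\int_\Omega\nu(\cdot,|\operatorname{curl}(Ae_\theta)|)\operatorname{curl}(Ae_\theta)\cdot\operatorname{curl}(\bar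 Ze_\theta)\,r\,dr\,dz,$$ $$b(T,W)=\int_{\Omega_0}\kappa\nabla T\cdot\nabla W\,r\,dr\,dz+\int_{\widehat\Gamma_1}\eta TW\,r\,dl .$$ \textbf{Continuous problem.} Given $V\in\mathbb C^m$, $\mathcal T>0$, $T_c\in H^1(0,\mathcal T;L^2_1(\widehat\Gamma_1))$ (continuous representative) and $T_0\in H^1_1(\Omega_0)$, a solution is a pair $A\in L^2(0,\mathcal T;\widetilde H^1_{1,\Gamma}(\Omega))$, $T\in L^2(0,\mathcal T;H^1_1(\Omega_0))\cap H^1(0,\mathcal T;L^2_1(\Omega_0))$ with $T(0)=T_0$ such that for a.e. $t\in(0,\mathcal T)$ and all $Z\in\widetilde H^1_{1,\Gamma}(\Omega)$, $W\in H^1_1(\Omega_0)$, $$i\omega\int_{\Omega_C}\sigma(\cdot,T)A\bar Z\,r\,dr\,dz+\langle\mathcal A(A),Z\rangle=\sum_{k=1}^m\int_{\Omega_k}\sigma_kV_k\bar Z\,dr\,dz,$$ $$\int_{\Omega_0}\partial_tT\,W\,r\,dr\,dz+b(T,W)=\frac12\int_{\Omega_0}\omega^2\sigma(\cdot,T)|A|^2W\,r\,dr\,dz+\int_{\widehat\Gamma_1}\eta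 T_cW\,r\,dl .$$ \textbf{Discrete problem.} Let $\mathcal T_h$ be a conforming triangulation of $\overline\Omega$ each of whose triangles lies in the closure of $\Omega_a$ or of one $\Omega_k$, $0\le k\le m$. Let $\mathcal Y_h$ be the space of complex-valued continuous piecewise linear functions on $\overline\Omega$ vanishing on $\Gamma$, and $\mathcal X_h$ the space of real continuous piecewise linear functions on $\overline{\Omega_0}$. Let $I_h:\widetilde H^1_{1,\Gamma}(\Omega)\to\mathcal Y_h$ be any map and $Q_h:L^2_1(\Omega_0)\to\mathcal X_h$ any bounded linear operator (for instance, Cl\'ement-type operators). For $N\ge1$ put $\Delta t=\mathcal T/N$, $t_n=n\Delta t$, $v^n=v(t_n)$. The scheme: $T_h^0=Q_hT^0$; $A_h^n\in\mathcal Y_h$ ($0\le n\le N$) satisfies $$i\omega\int_{\Omega_C}\sigma(\cdot,T_h^n)A_h^n\bar Z_h\,r\,dr\,dz+\langle\mathcal A(A_h^n),Z_h\rangle=\sum_{k=1}^m\int_{\Omega_k}\sigma_kV_k\bar Z_h\,dr\,dz\quad\forall Z_h\in\mathcal Y_h,$$ and $T_h^{n+1}\in\mathcal X_h$ ($0\le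 n\le N-1$) satisfies, for all $W_h\in\mathcal X_h$, $$\int_{\Omega_0}\frac{T_h^{n+1}-T_h^n}{\Delta t}W_h\,r\,dr\,dz+b(T_h^{n+1},W_h)=\frac12\int_{\Omega_0}\omega^2\sigma(\cdot,T_h^n)|A_h^n|^2W_h\,r\,dr\,dz+\int_{\widehat\Gamma_1}\eta T_c^nW_h\,r\,dl .$$ \textbf{Theorem.} Given the geometry, the coefficients, $V$ and $\mathcal T$, there is a constant $C>0$ such that the following holds for all $T_c$, $T_0$ as above, all solutions $(A,T)$ of the continuous problem with $A\in\mathcal C([0,\mathcal T];\widetilde H^1_{1,\Gamma}(\Omega))$, $T\in\mathcal C([0,\mathcal T];H^1_1(\Omega_0))$, $A|_{\Omega_0}\in H^1(0,\mathcal T;H^1_1(\Omega_0))$ and $T\in H^2(0,\mathcal T;L^2_1(\Omega_0))$, all meshes $\mathcal T_h$, operators $I_h,Q_h$, numbers $N\ge1$, and all solutions $(A_h^n,T_h^n)_{0\le n\le N}$ of the discrete problem: $$\begin{aligned} &\max_{1\le n\le N}\|T_h^n-T^n\|^2_{L^2_1(\Omega_0)}+\Delta t\sum_{n=1}^N\|T_h^n-T^n\|^2_{H^1_1(\Omega_0)}+\max_{0\le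 n\le N}\|A_h^n-A^n\|^2_{\widetilde H^1_1(\Omega)}\\ &\le C\Big[\max_{0\le n\le N}\|A^n-I_hA^n\|^2_{\widetilde H^1_1(\Omega)}+\max_{0\le n\le N}\|T^n-Q_hT^n\|^2_{H^1_1(\Omega_0)}+\|(I-Q_h)\partial_tT\|^2_{L^2(0,\mathcal T;L^2_1(\Omega_0))}\\ &\quad+\Delta t^2\Big(\|\partial_tT_c\|^2_{L^2(0,\mathcal T;L^2_1(\widehat\Gamma_1))}+\|T\|^2_{H^2(0,\mathcal T;L^2_1(\Omega_0))}+\|\partial_tA\|^2_{L^2(0,\mathcal T;H^1_1(\Omega_0))}\Big)\Big]. \end{aligned}$$ -/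

import Mathlib

open MeasureTheory Set Filter Topology

noncomputable section

namespace InductionHeating

/-! ## Weighted spaces on subsets of the meridian half-plane -/

/-- The meridian plane; `x 0` is the radial coordinate `r` and `x 1` the axial coordinate `z`. -/
abbrev Plane := EuclideanSpace ℝ (Fin 2)

/-- The measure `r dr dz` on `ϑ`. -/
def axi (ϑ : Set Plane) : Measure Plane :=
  (volume.restrict ϑ).withDensity fun x => ENNReal.ofReal (x 0)

/-- The measure `r dl` (arc length weighted by `r`) on a curve `S`. -/
def axiCurve (S : Set Plane) : Measure Plane :=
  ((Measure.hausdorffMeasure 1).restrict S).withDensity fun x => ENNReal.ofReal (x 0)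

/-- `L²₁(ϑ)`. -/
abbrev L2 (𝕜 : Type) [RCLike 𝕜] (ϑ : Set Plane) := Lp 𝕜 2 (axi ϑ)

/-- `L²₁(S)` for a curve `S`. -/
abbrev L2Curve (𝕜 : Type) [RCLike 𝕜] (S : Set Plane) := Lp 𝕜 2 (axiCurve S)

/-- The partial derivative of `φ` in the direction of the coordinate `i`. -/
def partialDeriv (i : Fin 2) (φ : Plane → ℝ) (x : Plane) : ℝ :=
  fderiv ℝ φ x (EuclideanSpace.single i 1)

/-- Smooth test functions with compact support in `ϑ`, for `ϑ` in the half-plane `r > 0`. -/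
structure IsTest (ϑ : Set Plane) (φ : Plane → ℝ) : Prop where
  smooth : ContDiff ℝ (⊤ : ℕ∞) φ
  compact : HasCompactSupport φ
  support : tsupport φ ⊆ ϑ ∩ {x | 0 < x 0}

/-- `g` is the distributional partial derivative of `u` on `ϑ` in the direction `i`. -/
def IsWeakPartial {𝕜 : Type} [RCLike 𝕜] (i : Fin 2) (ϑ : Set Plane) (u g : Plane → 𝕜) : Prop :=
  ∀ φ : Plane → ℝ, IsTest ϑ φ →
    ∫ x in ϑ, partialDeriv i φ x • u x = - ∫ x in ϑ, φ x • g x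

/-- Pairing an element of `L²₁(ϑ)` with a compactly supported continuous function, in the
unweighted sense, is a bounded functional. -/
theorem exists_pairing {𝕜 : Type} [RCLike 𝕜] (ϑ : Set Plane) (ψ : Plane → ℝ)
    (hc : Continuous ψ) (hs : HasCompactSupport ψ) (hp : tsupport ψ ⊆ {x | 0 < x 0}) :
    ∃ p : L2 𝕜 ϑ, ∀ u : L2 𝕜 ϑ, ∫ x in ϑ, ψ x • u x = inner 𝕜 p u := by
  have hq : Continuous fun x : Plane => ψ x / x 0 := by
    rw [continuous_iff_continuousAt]
    intro x
    by_cases hx : x ∈ tsupport ψ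
    · have h0 : (x 0) ≠ 0 := ne_of_gt (hp hx)
      exact hc.continuousAt.div (by fun_prop) h0
    · have h1 : ψ =ᶠ[𝓝 x] 0 := notMem_tsupport_iff_eventuallyEq.1 hx
      have h2 : (fun x : Plane => ψ x / x 0) =ᶠ[𝓝 x] fun _ => 0 := by
        filter_upwards [h1] with y hy
        simp [hy]
      exact continuousAt_const.congr h2.symm
  have hqs : HasCompactSupport fun x : Plane => ψ x / x 0 := by
    refine hs.mono ?_
    intro x hx h
    exact hx (by simp [h])
  have : IsFiniteMeasureOnCompacts (axi ϑ) := by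
    have : IsLocallyFiniteMeasure (axi ϑ) := by
      unfold axi
      have : Continuous fun x : Plane => Real.toNNReal (x 0) := by fun_prop
      exact IsLocallyFiniteMeasure.withDensity_coe this
    infer_instance
  have hq' : Continuous fun x : Plane => ((ψ x / x 0 : ℝ) : 𝕜) := RCLike.continuous_ofReal.comp hq
  have hqs' : HasCompactSupport fun x : Plane => ((ψ x / x 0 : ℝ) : 𝕜) := by
    refine hqs.mono ?_
    intro x hx h
    exact hx (by simp only [h, RCLike.ofReal_zero])
  have hm : MemLp (fun x : Plane => ((ψ x / x 0 : ℝ) : 𝕜)) 2 (axi ϑ) :=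
    hq'.memLp_of_hasCompactSupport hqs'
  refine ⟨hm.toLp _, fun u => ?_⟩
  rw [MeasureTheory.L2.inner_def]
  have e1 : ∫ x, inner 𝕜 (hm.toLp _ x) (u x) ∂(axi ϑ)
      = ∫ x, (ψ x / x 0 : ℝ) • u x ∂(axi ϑ) := by
    refine integral_congr_ae ?_
    filter_upwards [hm.coeFn_toLp] with x hx
    rw [hx, RCLike.inner_apply, RCLike.conj_ofReal, RCLike.real_smul_eq_coe_mul, mul_comm]
  rw [e1]
  have hmeas : Measurable fun x : Plane => Real.toNNReal (x 0) := by fun_prop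
  have e2 := integral_withDensity_eq_integral_smul (μ := volume.restrict ϑ) hmeas
    (fun x => (ψ x / x 0 : ℝ) • u x)
  unfold axi at *
  refine Eq.trans ?_ e2.symm
  congr 1
  funext x
  by_cases hx : x ∈ tsupport ψ
  · have h0 : 0 < x 0 := hp hx
    rw [NNReal.smul_def, Real.coe_toNNReal _ h0.le, smul_smul, mul_div_cancel₀ _ h0.ne']
  · have h0 : ψ x = 0 := image_eq_zero_of_notMem_tsupport hx
    simp [h0]

theorem IsTest.pairing (𝕜 : Type) [RCLike 𝕜] {ϑ : Set Plane} {φ : Plane → ℝ} (h : IsTest ϑ φ) :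
    ∃ p : L2 𝕜 ϑ, ∀ u : L2 𝕜 ϑ, ∫ x in ϑ, φ x • u x = inner 𝕜 p u :=
  exists_pairing ϑ φ h.smooth.continuous h.compact (fun _ hx => (h.support hx).2)

theorem IsTest.pairing_deriv (𝕜 : Type) [RCLike 𝕜] {ϑ : Set Plane} {φ : Plane → ℝ}
    (h : IsTest ϑ φ) (i : Fin 2) :
    ∃ p : L2 𝕜 ϑ, ∀ u : L2 𝕜 ϑ, ∫ x in ϑ, partialDeriv i φ x • u x = inner 𝕜 p u := by
  have hsub : tsupport (partialDeriv i φ) ⊆ tsupport φ := by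
    refine (closure_mono ?_).trans (tsupport_fderiv_subset ℝ (f := φ))
    intro x hx h
    exact hx (by simp [partialDeriv, h])
  refine exists_pairing ϑ _ ?_ ?_ (fun _ hx => (h.support (hsub hx)).2)
  · have := h.smooth.continuous_fderiv (by simp)
    unfold partialDeriv
    fun_prop
  · exact h.compact.of_isClosed_subset (isClosed_tsupport _) hsub

theorem exists_weakPartial_functional (𝕜 : Type) [RCLike 𝕜] {ϑ : Set Plane} {φ : Plane → ℝ}
    (h : IsTest ϑ φ) (i : Fin 2) :
    ∃ p q : L2 𝕜 ϑ, ∀ u g : L2 𝕜 ϑ,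
      (∫ x in ϑ, partialDeriv i φ x • u x = - ∫ x in ϑ, φ x • g x) ↔
        inner 𝕜 p u + inner 𝕜 q g = 0 := by
  obtain ⟨p, hp⟩ := h.pairing_deriv 𝕜 i
  obtain ⟨q, hq⟩ := h.pairing 𝕜
  exact ⟨p, q, fun u g => by rw [hp, hq, eq_neg_iff_add_eq_zero]⟩

/-- Pairs `(u, g)` in `L²₁(ϑ)` with `g` the weak derivative of `u`, as a closed subspace. -/
theorem isWeakPartial_iff {𝕜 : Type} [RCLike 𝕜] (i : Fin 2) (ϑ : Set Plane) :
    ∃ S : Submodule 𝕜 (L2 𝕜 ϑ × L2 𝕜 ϑ), IsClosed (S : Set (L2 𝕜 ϑ × L2 𝕜 ϑ)) ∧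
      ∀ u g : L2 𝕜 ϑ, IsWeakPartial i ϑ u g ↔ (u, g) ∈ S := by
  choose p q hpq using fun φ : {φ : Plane → ℝ // IsTest ϑ φ} =>
    exists_weakPartial_functional 𝕜 φ.2 i
  refine ⟨⨅ φ, LinearMap.ker (((innerSL 𝕜 (p φ)).coprod (innerSL 𝕜 (q φ)) :
    L2 𝕜 ϑ × L2 𝕜 ϑ →L[𝕜] 𝕜) : L2 𝕜 ϑ × L2 𝕜 ϑ →ₗ[𝕜] 𝕜), ?_, ?_⟩
  · rw [Submodule.coe_iInf]
    exact isClosed_iInter fun φ => ContinuousLinearMap.isClosed_ker _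
  · intro u g
    simp only [Submodule.mem_iInf, LinearMap.mem_ker]
    constructor
    · intro h φ
      exact (hpq φ u g).1 (h φ.1 φ.2)
    · intro h φ hφ
      exact (hpq ⟨φ, hφ⟩ u g).2 (h ⟨φ, hφ⟩)

/-- `H¹₁(ϑ)`: the triples `(u, ∂_r u, ∂_z u)` of elements of `L²₁(ϑ)`. The inherited norm is
`‖u‖² = ‖u‖²_{L²₁} + ‖∂_r u‖²_{L²₁} + ‖∂_z u‖²_{L²₁}`. -/
def H1 (𝕜 : Type) [RCLike 𝕜] (ϑ : Set Plane) :
    Submodule 𝕜 (PiLp 2 fun _ : Fin 3 => L2 𝕜 ϑ) where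
  carrier := {u | IsWeakPartial 0 ϑ (u 0) (u 1) ∧ IsWeakPartial 1 ϑ (u 0) (u 2)}
  add_mem' := by
    obtain ⟨S, -, hS⟩ := isWeakPartial_iff (𝕜 := 𝕜) 0 ϑ
    obtain ⟨S', -, hS'⟩ := isWeakPartial_iff (𝕜 := 𝕜) 1 ϑ
    intro u v hu hv
    simp only [mem_ofPred_eq, hS, hS'] at *
    exact ⟨S.add_mem hu.1 hv.1, S'.add_mem hu.2 hv.2⟩
  zero_mem' := by
    obtain ⟨S, -, hS⟩ := isWeakPartial_iff (𝕜 := 𝕜) 0 ϑ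
    obtain ⟨S', -, hS'⟩ := isWeakPartial_iff (𝕜 := 𝕜) 1 ϑ
    simp only [mem_ofPred_eq, hS, hS']
    exact ⟨S.zero_mem, S'.zero_mem⟩
  smul_mem' := by
    obtain ⟨S, -, hS⟩ := isWeakPartial_iff (𝕜 := 𝕜) 0 ϑ
    obtain ⟨S', -, hS'⟩ := isWeakPartial_iff (𝕜 := 𝕜) 1 ϑ
    intro c u hu
    simp only [mem_ofPred_eq, hS, hS'] at *
    exact ⟨S.smul_mem c hu.1, S'.smul_mem c hu.2⟩

instance (𝕜 : Type) [RCLike 𝕜] (ϑ : Set Plane) : CompleteSpace (H1 𝕜 ϑ) := by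
  obtain ⟨S, hc, hS⟩ := isWeakPartial_iff (𝕜 := 𝕜) 0 ϑ
  obtain ⟨S', hc', hS'⟩ := isWeakPartial_iff (𝕜 := 𝕜) 1 ϑ
  have h : IsClosed (H1 𝕜 ϑ : Set (PiLp 2 fun _ : Fin 3 => L2 𝕜 ϑ)) := by
    have e : (H1 𝕜 ϑ : Set (PiLp 2 fun _ : Fin 3 => L2 𝕜 ϑ)) =
        (fun u : PiLp 2 fun _ : Fin 3 => L2 𝕜 ϑ => (u 0, u 1)) ⁻¹' S ∩
        (fun u : PiLp 2 fun _ : Fin 3 => L2 𝕜 ϑ => (u 0, u 2)) ⁻¹' S' := by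
      ext u
      exact and_congr (hS _ _) (hS' _ _)
    rw [e]
    exact (hc.preimage (by fun_prop)).inter (hc'.preimage (by fun_prop))
  exact h.completeSpace_coe

namespace H1

variable {𝕜 : Type} [RCLike 𝕜] {ϑ : Set Plane}

/-- The function itself. -/
def fn (u : H1 𝕜 ϑ) : L2 𝕜 ϑ := u.1 0

/-- The weak derivative `∂_r u`. -/
def dr (u : H1 𝕜 ϑ) : L2 𝕜 ϑ := u.1 1

/-- The weak derivative `∂_z u`. -/
def dz (u : H1 𝕜 ϑ) : L2 𝕜 ϑ := u.1 2

end H1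

/-- `g` is the trace on `S ⊆ ∂ϑ` of `u ∈ H¹₁(ϑ)`: there are functions `φ n ∈ C¹(ℝ²)` with
`φ n → u` in `H¹₁(ϑ)` and `φ n|_S → g` in `L²₁(S)`. -/
def IsTrace {𝕜 : Type} [RCLike 𝕜] {ϑ : Set Plane} (S : Set Plane) (u : H1 𝕜 ϑ)
    (g : L2Curve 𝕜 S) : Prop :=
  ∃ (φ : ℕ → Plane → 𝕜) (U : ℕ → H1 𝕜 ϑ) (g' : ℕ → L2Curve 𝕜 S),
    (∀ n, ContDiff ℝ 1 (φ n)) ∧ (∀ n, (H1.fn (U n)) =ᵐ[axi ϑ] φ n) ∧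
    (∀ n, g' n =ᵐ[axiCurve S] φ n) ∧ Tendsto U atTop (𝓝 u) ∧ Tendsto g' atTop (𝓝 g)

theorem IsTrace.zero {𝕜 : Type} [RCLike 𝕜] {ϑ S : Set Plane} :
    IsTrace S (0 : H1 𝕜 ϑ) (0 : L2Curve 𝕜 S) :=
  ⟨fun _ => 0, fun _ => 0, fun _ => 0, fun _ => contDiff_const,
    fun _ => Lp.coeFn_zero _ _ _, fun _ => Lp.coeFn_zero _ _ _,
    tendsto_const_nhds, tendsto_const_nhds⟩

theorem IsTrace.add {𝕜 : Type} [RCLike 𝕜] {ϑ S : Set Plane} {u v : H1 𝕜 ϑ}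
    {g h : L2Curve 𝕜 S} (hu : IsTrace S u g) (hv : IsTrace S v h) :
    IsTrace S (u + v) (g + h) := by
  obtain ⟨φ, U, g', a1, a2, a3, a4, a5⟩ := hu
  obtain ⟨ψ, W, h', b1, b2, b3, b4, b5⟩ := hv
  refine ⟨fun n => φ n + ψ n, fun n => U n + W n, fun n => g' n + h' n,
    fun n => (a1 n).add (b1 n), fun n => ?_, fun n => ?_, a4.add b4, a5.add b5⟩
  · exact (Lp.coeFn_add _ _).trans ((a2 n).add (b2 n))
  · exact (Lp.coeFn_add _ _).trans ((a3 n).add (b3 n))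

theorem IsTrace.smul {𝕜 : Type} [RCLike 𝕜] {ϑ S : Set Plane} {u : H1 𝕜 ϑ}
    {g : L2Curve 𝕜 S} (c : 𝕜) (hu : IsTrace S u g) : IsTrace S (c • u) (c • g) := by
  obtain ⟨φ, U, g', a1, a2, a3, a4, a5⟩ := hu
  refine ⟨fun n => c • φ n, fun n => c • U n, fun n => c • g' n,
    fun n => contDiff_const.smul (a1 n), fun n => ?_, fun n => ?_,
    a4.const_smul c, a5.const_smul c⟩
  · exact (Lp.coeFn_smul _ _).trans ((a2 n).const_smul c)
  · exact (Lp.coeFn_smul _ _).trans ((a3 n).const_smul c)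

theorem axi_mono {ϑ' ϑ : Set Plane} (h : ϑ' ⊆ ϑ) : axi ϑ' ≤ axi ϑ :=
  Measure.le_iff.2 fun s hs => by
    unfold axi
    rw [withDensity_apply _ hs, withDensity_apply _ hs]
    exact lintegral_mono' (Measure.restrict_mono_measure (Measure.restrict_mono h le_rfl) s) le_rfl

/-- Restriction `L²₁(ϑ) → L²₁(ϑ')` for `ϑ' ⊆ ϑ`. -/
def restrictL2 {𝕜 : Type} [RCLike 𝕜] {ϑ' ϑ : Set Plane} (h : ϑ' ⊆ ϑ) :
    L2 𝕜 ϑ →ₗ[𝕜] L2 𝕜 ϑ' where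
  toFun u := ((Lp.memLp u).mono_measure (axi_mono h)).toLp u
  map_add' u v := by
    rw [← MemLp.toLp_add, MemLp.toLp_eq_toLp_iff]
    exact (ae_mono (axi_mono h)) (Lp.coeFn_add u v)
  map_smul' c u := by
    rw [RingHom.id_apply, ← MemLp.toLp_const_smul, MemLp.toLp_eq_toLp_iff]
    exact (ae_mono (axi_mono h)) (Lp.coeFn_smul c u)

theorem restrictL2_ae {𝕜 : Type} [RCLike 𝕜] {ϑ' ϑ : Set Plane} (h : ϑ' ⊆ ϑ) (u : L2 𝕜 ϑ) :
    restrictL2 h u =ᵐ[axi ϑ'] u :=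
  MemLp.coeFn_toLp ((Lp.memLp u).mono_measure (axi_mono h))

theorem ae_axi_iff {ϑ : Set Plane} {P : Plane → Prop} :
    (∀ᵐ x ∂axi ϑ, P x) ↔ ∀ᵐ x ∂volume.restrict ϑ, 0 < x 0 → P x := by
  unfold axi
  rw [ae_withDensity_iff (by fun_prop)]
  simp [ENNReal.ofReal_eq_zero, not_le]

theorem integral_restrictL2 {𝕜 : Type} [RCLike 𝕜] {ϑ' ϑ : Set Plane} (h : ϑ' ⊆ ϑ)
    (u : L2 𝕜 ϑ) (ψ : Plane → ℝ) (hs : tsupport ψ ⊆ ϑ' ∩ {x | 0 < x 0}) :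
    ∫ x in ϑ', ψ x • restrictL2 h u x = ∫ x in ϑ, ψ x • u x := by
  have e1 : ∫ x in ϑ', ψ x • restrictL2 h u x = ∫ x in ϑ', ψ x • u x := by
    refine integral_congr_ae ?_
    filter_upwards [ae_axi_iff.1 (restrictL2_ae h u)] with x hx
    by_cases hp : 0 < x 0
    · rw [hx hp]
    · have : ψ x = 0 := image_eq_zero_of_notMem_tsupport fun hh => hp (hs hh).2
      simp [this]
  have e2 : ∀ s : Set Plane, ϑ' ⊆ s → ∫ x in s, ψ x • u x = ∫ x, ψ x • u x := by
    intro s hsub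
    refine setIntegral_eq_integral_of_forall_compl_eq_zero fun x hx => ?_
    have : ψ x = 0 := image_eq_zero_of_notMem_tsupport fun hh => hx (hsub (hs hh).1)
    simp [this]
  rw [e1, e2 _ subset_rfl, e2 _ h]

theorem IsWeakPartial.restrict {𝕜 : Type} [RCLike 𝕜] {ϑ' ϑ : Set Plane} (h : ϑ' ⊆ ϑ) {i : Fin 2}
    {u g : L2 𝕜 ϑ} (hu : IsWeakPartial i ϑ u g) :
    IsWeakPartial i ϑ' (restrictL2 h u) (restrictL2 h g) := by
  intro φ hφ
  have hsub : tsupport (partialDeriv i φ) ⊆ tsupport φ := by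
    refine (closure_mono ?_).trans (tsupport_fderiv_subset ℝ (f := φ))
    intro x hx h
    exact hx (by simp [partialDeriv, h])
  rw [integral_restrictL2 h u _ (hsub.trans hφ.support), integral_restrictL2 h g _ hφ.support]
  exact hu φ ⟨hφ.smooth, hφ.compact, hφ.support.trans (inter_subset_inter_left _ h)⟩

/-- `H̃¹₁(ϑ) = H¹₁(ϑ) ∩ L²₋₁(ϑ)` (complex valued): the quadruples `(Z, ∂_r Z, ∂_z Z, Z / r)` of
elements of `L²₁(ϑ)`. Since `‖Z / r‖_{L²₁} = ‖Z‖_{L²₋₁}`, the inherited norm is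
`‖Z‖² = ‖Z‖²_{H¹₁} + ‖Z‖²_{L²₋₁}`. -/
def HTilde (ϑ : Set Plane) : Submodule ℂ (PiLp 2 fun _ : Fin 4 => L2 ℂ ϑ) where
  carrier := {u | IsWeakPartial 0 ϑ (u 0) (u 1) ∧ IsWeakPartial 1 ϑ (u 0) (u 2) ∧
    u 3 =ᵐ[axi ϑ] fun x => u 0 x / (x 0 : ℂ)}
  add_mem' := by
    obtain ⟨S, -, hS⟩ := isWeakPartial_iff (𝕜 := ℂ) 0 ϑ
    obtain ⟨S', -, hS'⟩ := isWeakPartial_iff (𝕜 := ℂ) 1 ϑ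
    intro u v hu hv
    simp only [mem_ofPred_eq, hS, hS'] at *
    refine ⟨S.add_mem hu.1 hv.1, S'.add_mem hu.2.1 hv.2.1, ?_⟩
    filter_upwards [hu.2.2, hv.2.2, Lp.coeFn_add (u 3) (v 3), Lp.coeFn_add (u 0) (v 0)]
      with x h1 h2 h3 h4
    rw [PiLp.add_apply, PiLp.add_apply, h3, h4, Pi.add_apply, Pi.add_apply, h1, h2, add_div]
  zero_mem' := by
    obtain ⟨S, -, hS⟩ := isWeakPartial_iff (𝕜 := ℂ) 0 ϑ
    obtain ⟨S', -, hS'⟩ := isWeakPartial_iff (𝕜 := ℂ) 1 ϑ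
    simp only [mem_ofPred_eq, hS, hS']
    refine ⟨S.zero_mem, S'.zero_mem, ?_⟩
    filter_upwards [Lp.coeFn_zero ℂ 2 (axi ϑ)] with x h1
    rw [PiLp.zero_apply, PiLp.zero_apply, h1, Pi.zero_apply, zero_div]
  smul_mem' := by
    obtain ⟨S, -, hS⟩ := isWeakPartial_iff (𝕜 := ℂ) 0 ϑ
    obtain ⟨S', -, hS'⟩ := isWeakPartial_iff (𝕜 := ℂ) 1 ϑ
    intro c u hu
    simp only [mem_ofPred_eq, hS, hS'] at *
    refine ⟨S.smul_mem c hu.1, S'.smul_mem c hu.2.1, ?_⟩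
    filter_upwards [hu.2.2, Lp.coeFn_smul c (u 3), Lp.coeFn_smul c (u 0)] with x h1 h3 h4
    rw [PiLp.smul_apply, PiLp.smul_apply, h3, h4, Pi.smul_apply, Pi.smul_apply, h1,
      smul_eq_mul, smul_eq_mul, mul_div_assoc]

/-- Restriction `H̃¹₁(ϑ) → H¹₁(ϑ')` for `ϑ' ⊆ ϑ`. -/
def HTilde.restrict {ϑ' ϑ : Set Plane} (h : ϑ' ⊆ ϑ) : HTilde ϑ →ₗ[ℂ] H1 ℂ ϑ' where
  toFun u := ⟨WithLp.toLp 2 ![restrictL2 h (u.1 0), restrictL2 h (u.1 1), restrictL2 h (u.1 2)],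
    IsWeakPartial.restrict h u.2.1, IsWeakPartial.restrict h u.2.2.1⟩
  map_add' u v := by
    ext1
    ext1 i
    fin_cases i <;> exact map_add (restrictL2 h) _ _
  map_smul' c u := by
    ext1
    ext1 i
    fin_cases i <;> exact map_smul (restrictL2 h) _ _

/-- The space `H̃¹₁,Γ(ϑ)` of all `Z ∈ H̃¹₁(ϑ)` with zero trace on `Γ = ∂ϑ`. -/
def HTilde0 (ϑ : Set Plane) : Submodule ℂ (HTilde ϑ) where
  carrier := {Z | IsTrace (frontier ϑ) (HTilde.restrict subset_rfl Z) 0}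
  add_mem' hu hv := by
    have := IsTrace.add hu hv
    rwa [add_zero, ← map_add] at this
  zero_mem' := by
    have := IsTrace.zero (𝕜 := ℂ) (ϑ := ϑ) (S := frontier ϑ)
    rwa [← map_zero (HTilde.restrict (subset_refl ϑ))] at this
  smul_mem' c u hu := by
    have := IsTrace.smul c hu
    rwa [smul_zero, ← map_smul] at this

namespace HTilde0

variable {ϑ : Set Plane}

/-- The function itself. -/
def fn (Z : HTilde0 ϑ) : L2 ℂ ϑ := Z.1.1 0

/-- The weak derivative `∂_r Z`. -/
def dr (Z : HTilde0 ϑ) : L2 ℂ ϑ := Z.1.1 1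

/-- The weak derivative `∂_z Z`. -/
def dz (Z : HTilde0 ϑ) : L2 ℂ ϑ := Z.1.1 2

/-- `(1 / r) ∂_r (r Z) = ∂_r Z + Z / r`, the axial component of `curl (Z e_θ)`. -/
def curlZ (Z : HTilde0 ϑ) (x : Plane) : ℂ := (HTilde0.dr Z) x + (HTilde0.fn Z) x / (x 0 : ℂ)

/-- `- ∂_z Z`, the radial component of `curl (Z e_θ)`. -/
def curlR (Z : HTilde0 ϑ) (x : Plane) : ℂ := - (HTilde0.dz Z) x

/-- The length `|curl (Z e_θ)|`. -/
def curlNorm (Z : HTilde0 ϑ) (x : Plane) : ℝ := Real.sqrt (‖(HTilde0.curlR Z) x‖ ^ 2 + ‖(HTilde0.curlZ Z) x‖ ^ 2)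

end HTilde0

/-! ## Functions of time with values in a Banach space -/

/-- `g ∈ L²(0, τ; X)`. -/
def MemL2Time {X : Type*} [NormedAddCommGroup X] (τ : ℝ) (g : ℝ → X) : Prop :=
  MemLp g 2 (volume.restrict (Ioo 0 τ))

/-- `g ∈ H¹(0, τ; X)` with weak time derivative `g'`. -/
structure MemH1Time {X : Type*} [NormedAddCommGroup X] [NormedSpace ℝ X] (τ : ℝ)
    (g g' : ℝ → X) : Prop where
  mem : MemL2Time τ g
  deriv_mem : MemL2Time τ g'
  weak : ∀ φ : ℝ → ℝ, ContDiff ℝ (⊤ : ℕ∞) φ → HasCompactSupport φ → tsupport φ ⊆ Ioo 0 τ →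
    ∫ t in Ioo 0 τ, deriv φ t • g t = - ∫ t in Ioo 0 τ, φ t • g' t

/-- `g ∈ H²(0, τ; X)` with first and second weak time derivatives `g'` and `g''`. -/
def MemH2Time {X : Type*} [NormedAddCommGroup X] [NormedSpace ℝ X] (τ : ℝ)
    (g g' g'' : ℝ → X) : Prop :=
  MemH1Time τ g g' ∧ MemH1Time τ g' g''

/-! ## Geometry and data -/

/-- A polygonal open set: the interior of a finite union of nondegenerate closed triangles. -/
def IsPolygonal (U : Set Plane) : Prop :=
  ∃ (n : ℕ) (p : Fin n → Fin 3 → Plane), (∀ i, AffineIndependent ℝ (p i)) ∧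
    U = interior (⋃ i, convexHull ℝ (range (p i)))

/-- The open rectangle `(0, R) × (0, L)`. -/
def rectangle (R L : ℝ) : Set Plane := {x | 0 < x 0 ∧ x 0 < R ∧ 0 < x 1 ∧ x 1 < L}

/-- The meridian section: the rectangle `Ω = (0, R) × (0, L)`, the polygonal workpiece `Ω₀` and
the sections `Ω₁, …, Ω_m` of the coil rings. -/
structure Configuration (m : ℕ) where
  R : ℝ
  L : ℝ
  R_pos : 0 < R
  L_pos : 0 < L
  workpiece : Set Plane
  coil : Fin m → Set Plane
  workpiece_polygonal : IsPolygonal workpiece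
  workpiece_subset : workpiece ⊆ rectangle R L
  coil_open : ∀ k, IsOpen (coil k)
  coil_subset : ∀ k, coil k ⊆ rectangle R L
  coil_disjoint : ∀ j k, j ≠ k → Disjoint (coil j) (coil k)
  workpiece_disjoint : ∀ k, Disjoint workpiece (coil k)

namespace Configuration

variable {m : ℕ} (G : Configuration m)

/-- `Ω`. -/
def dom : Set Plane := rectangle G.R G.L

/-- `Ω_C = Ω₀ ∪ Ω₁ ∪ … ∪ Ω_m`. -/
def conductor : Set Plane := G.workpiece ∪ ⋃ k, G.coil k

/-- The air region `Ω_a`. -/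
def air : Set Plane := G.dom \ closure G.conductor

/-- `Γ̂₁`, the part of `∂Ω₀` off the symmetry axis. -/
def outer : Set Plane := frontier G.workpiece ∩ {x | x 0 ≠ 0}

theorem workpiece_subset_dom : G.workpiece ⊆ G.dom := G.workpiece_subset

end Configuration

/-- The physical coefficients and the assumptions on them. -/
structure Coefficients {m : ℕ} (G : Configuration m) where
  /-- angular frequency -/
  ω : ℝ
  /-- electrical conductivity as a function of position and temperature -/
  σ : Plane → ℝ → ℝ
  /-- conductivities of the coil rings -/
  σcoil : Fin m → ℝ
  /-- thermal conductivity of the workpiece -/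
  κ : Plane → ℝ
  /-- heat transfer coefficient -/
  η : Plane → ℝ
  /-- vacuum reluctivity -/
  ν₀ : ℝ
  /-- reluctivity of the conductors as a function of `|B|` -/
  νC : ℝ → ℝ
  ω_pos : 0 < ω
  σ_measurable : ∀ u, AEMeasurable (fun x => σ x u) (volume.restrict G.dom)
  σ_continuous : ∀ᵐ x ∂volume.restrict G.dom, Continuous (σ x)
  σ_bounds : ∃ lo hi : ℝ, 0 < lo ∧
    ∀ᵐ x ∂volume.restrict G.workpiece, ∀ u, lo ≤ σ x u ∧ σ x u ≤ hi
  σ_lipschitz : ∃ σp : ℝ, 0 < σp ∧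
    ∀ᵐ x ∂volume.restrict G.workpiece, ∀ u v, |σ x u - σ x v| ≤ σp * |u - v|
  σcoil_pos : ∀ k, 0 < σcoil k
  σ_coil : ∀ k, ∀ᵐ x ∂volume.restrict (G.coil k), ∀ u, σ x u = σcoil k
  σ_air : ∀ᵐ x ∂volume.restrict G.air, ∀ u, σ x u = 0
  κ_measurable : AEMeasurable κ (volume.restrict G.workpiece)
  κ_bounds : ∃ lo hi : ℝ, 0 < lo ∧ ∀ᵐ x ∂volume.restrict G.workpiece, lo ≤ κ x ∧ κ x ≤ hi
  η_measurable : AEMeasurable η ((Measure.hausdorffMeasure 1).restrict G.outer)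
  η_bounds : ∃ lo hi : ℝ, 0 < lo ∧
    ∀ᵐ x ∂(Measure.hausdorffMeasure 1).restrict G.outer, lo ≤ η x ∧ η x ≤ hi
  ν_bounds : ∃ νmin : ℝ, 0 < νmin ∧ ∀ p, 0 ≤ p → νmin ≤ νC p ∧ νC p ≤ ν₀
  ν_lipschitz : ∃ ξ : ℝ, 0 < ξ ∧
    ∀ p q, 0 ≤ p → 0 ≤ q → |νC p * p - νC q * q| ≤ ξ * |p - q|
  ν_monotone : ∃ ϱ : ℝ, 0 < ϱ ∧
    ∀ p q, 0 ≤ p → 0 ≤ q → ϱ * |p - q| ^ 2 ≤ (νC p * p - νC q * q) * (p - q)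

namespace Coefficients

variable {m : ℕ} {G : Configuration m} (D : Coefficients G)

open Classical in
/-- The reluctivity: `ν_C(|B|)` in the conductors and `ν₀` elsewhere. -/
def ν (x : Plane) (p : ℝ) : ℝ := if x ∈ G.conductor then D.νC p else D.ν₀

/-- `⟨𝒜(A), Z⟩ = ∫_Ω ν(|curl A|) curl A · curl Z̄ r dr dz`. -/
def magnetic (A Z : HTilde0 G.dom) : ℂ :=
  ∫ x, (D.ν x ((HTilde0.curlNorm A) x) : ℂ) *
    ((HTilde0.curlZ A) x * (starRingEnd ℂ) ((HTilde0.curlZ Z) x) + (HTilde0.curlR A) x * (starRingEnd ℂ) ((HTilde0.curlR Z) x))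
    ∂axi G.dom

/-- The electromagnetic equation for the potential `A` at temperature `S`, tested with `Z`:
`iω ∫_{Ω_C} σ(·,S) A Z̄ r + ⟨𝒜(A), Z⟩ = ∑ₖ ∫_{Ωₖ} σₖ Vₖ Z̄`. The values of `S` off `Ω₀` are
immaterial, since `σ` does not depend on the temperature there. -/
def ElectricEq (V : Fin m → ℂ) (S : L2 ℝ G.workpiece) (A Z : HTilde0 G.dom) : Prop :=
  Complex.I * D.ω *
      (∫ x, (D.σ x (S x) : ℂ) * (HTilde0.fn A) x * (starRingEnd ℂ) ((HTilde0.fn Z) x) ∂axi G.conductor)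
    + D.magnetic A Z
  = ∑ k, ∫ x in G.coil k, (D.σcoil k : ℂ) * V k * (starRingEnd ℂ) ((HTilde0.fn Z) x)

/-- `b(T, W)`, where `γT` and `γW` are the traces of `T` and `W` on `Γ̂₁`. -/
def heatForm (T W : H1 ℝ G.workpiece) (γT γW : L2Curve ℝ G.outer) : ℝ :=
  (∫ x, D.κ x * ((H1.dr T) x * (H1.dr W) x + (H1.dz T) x * (H1.dz W) x) ∂axi G.workpiece)
    + ∫ x, D.η x * γT x * γW x ∂axiCurve G.outer

/-- The heat equation tested with `W` (whose trace on `Γ̂₁` is `γW`):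
`∫ D W r + b(T, W) = ½ ∫ ω² σ(·,S) |A|² W r + ∫_{Γ̂₁} η g W r dl`.
Here `dT` stands for the (exact or discrete) time derivative, `T` has trace `γT`, and `S`, `A`
are the temperature and the potential in the Joule source. -/
def HeatEq (dT S : L2 ℝ G.workpiece) (A : HTilde0 G.dom) (g : L2Curve ℝ G.outer)
    (T W : H1 ℝ G.workpiece) (γT γW : L2Curve ℝ G.outer) : Prop :=
  (∫ x, dT x * (H1.fn W) x ∂axi G.workpiece) + D.heatForm T W γT γW
  = 1 / 2 * (∫ x, D.ω ^ 2 * D.σ x (S x) * ‖(HTilde0.fn A) x‖ ^ 2 * (H1.fn W) x ∂axi G.workpiece)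
    + ∫ x, D.η x * g x * γW x ∂axiCurve G.outer

/-- `(A, T)` is a weak solution of the coupled problem on `(0, τ)` with voltages `V`, external
temperature `Tc` and initial temperature `T₀`; `Tt` is the weak time derivative of `T`, and `T`
is represented by a function continuous into `L²₁(Ω₀)`. -/
structure IsSolution (τ : ℝ) (V : Fin m → ℂ) (Tc : ℝ → L2Curve ℝ G.outer)
    (T₀ : L2 ℝ G.workpiece) (A : ℝ → HTilde0 G.dom) (T : ℝ → H1 ℝ G.workpiece)
    (Tt : ℝ → L2 ℝ G.workpiece) : Prop where
  memA : MemL2Time τ A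
  memT : MemL2Time τ T
  memTt : MemH1Time τ (fun t => H1.fn (T t)) Tt
  cont : ContinuousOn (fun t => H1.fn (T t)) (Icc 0 τ)
  electric : ∀ᵐ t ∂volume.restrict (Ioo 0 τ), ∀ Z, D.ElectricEq V (H1.fn (T t)) (A t) Z
  heat : ∀ᵐ t ∂volume.restrict (Ioo 0 τ), ∃ γT, IsTrace G.outer (T t) γT ∧
    ∀ W γW, IsTrace G.outer W γW → D.HeatEq (Tt t) (H1.fn (T t)) (A t) (Tc t) (T t) W γT γW
  initial : (H1.fn (T 0)) = T₀

end Coefficients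

/-! ## The fully discrete scheme -/

/-- `𝒦` is a conforming triangulation of `[0, R] × [0, L]` each of whose triangles lies in the
closure of the workpiece, of one coil ring, or of the air region. -/
structure IsMesh {m : ℕ} (G : Configuration m) (𝒦 : Geometry.SimplicialComplex ℝ Plane) : Prop where
  finite : 𝒦.faces.Finite
  space_eq : 𝒦.space = closure G.dom
  resolves : ∀ K ∈ 𝒦.faces, K.card = 3 →
    convexHull ℝ (K : Set Plane) ⊆ closure G.workpiece ∨
    (∃ k, convexHull ℝ (K : Set Plane) ⊆ closure (G.coil k)) ∨
    convexHull ℝ (K : Set Plane) ⊆ closure G.air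

/-- The space `𝒴_h` of continuous piecewise linear functions on `Ω̄` vanishing on `Γ`. -/
def meshY {m : ℕ} (G : Configuration m) (𝒦 : Geometry.SimplicialComplex ℝ Plane) :
    Set (HTilde0 G.dom) :=
  {Z | ∃ f : Plane → ℂ, ContinuousOn f (closure G.dom) ∧
    (∀ K ∈ 𝒦.faces, K.card = 3 →
      ∃ a : Plane →ᵃ[ℝ] ℂ, EqOn f a (convexHull ℝ (K : Set Plane))) ∧
    (∀ x ∈ frontier G.dom, f x = 0) ∧ (HTilde0.fn Z) =ᵐ[axi G.dom] f}

/-- The space `𝒳_h` of continuous piecewise linear functions on `Ω̄₀`. -/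
def meshX {m : ℕ} (G : Configuration m) (𝒦 : Geometry.SimplicialComplex ℝ Plane) :
    Set (H1 ℝ G.workpiece) :=
  {W | ∃ f : Plane → ℝ, ContinuousOn f (closure G.workpiece) ∧
    (∀ K ∈ 𝒦.faces, K.card = 3 → convexHull ℝ (K : Set Plane) ⊆ closure G.workpiece →
      ∃ a : Plane →ᵃ[ℝ] ℝ, EqOn f a (convexHull ℝ (K : Set Plane))) ∧
    (H1.fn W) =ᵐ[axi G.workpiece] f}

/-- The time step `Δt = τ / N`. -/
def timeStep (τ : ℝ) (N : ℕ) : ℝ := τ / N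

/-- The time `t_n = n Δt`. -/
def timeNode (τ : ℝ) (N n : ℕ) : ℝ := n * timeStep τ N

/-- `(Aₕⁿ, Tₕⁿ)`, `0 ≤ n ≤ N`, solves the backward Euler / finite element scheme on the mesh `𝒦`
with initial temperature `Th₀`. -/
structure IsDiscreteSolution {m : ℕ} {G : Configuration m} (D : Coefficients G) (τ : ℝ)
    (V : Fin m → ℂ) (Tc : ℝ → L2Curve ℝ G.outer) (𝒦 : Geometry.SimplicialComplex ℝ Plane)
    (N : ℕ) (Th₀ : H1 ℝ G.workpiece) (Ah : ℕ → HTilde0 G.dom) (Th : ℕ → H1 ℝ G.workpiece) :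
    Prop where
  memY : ∀ n ≤ N, Ah n ∈ meshY G 𝒦
  memX : ∀ n ≤ N, Th n ∈ meshX G 𝒦
  initial : Th 0 = Th₀
  electric : ∀ n ≤ N, ∀ Z ∈ meshY G 𝒦, D.ElectricEq V (H1.fn (Th n)) (Ah n) Z
  heat : ∀ n < N, ∃ γT, IsTrace G.outer (Th (n + 1)) γT ∧
    ∀ W ∈ meshX G 𝒦, ∀ γW, IsTrace G.outer W γW →
      D.HeatEq ((timeStep τ N)⁻¹ • ((H1.fn (Th (n + 1))) - (H1.fn (Th n)))) (H1.fn (Th n)) (Ah n)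
        (Tc (timeNode τ N n)) (Th (n + 1)) W γT γW

end InductionHeating

end

open InductionHeating

namespace InductionHeating

noncomputable section

/-! The discrete solution is compared with `(I_h A, Q_h T)`: a Céa argument controls the potential
at each time level, an energy argument with Gronwall's lemma controls the temperature, and the two
are coupled through `σ` and the Joule heat.

Potential. On the diagonal the eddy current term is purely imaginary, so the real part of the
electromagnetic form is that of the magnetic operator. This operator is strongly monotone because `p
↦ ν(p)p` is, and because the curl controls the full norm: in `‖∂_r Z + Z/r‖²` the cross term is the
integral of `∂_r |Z|²` over the rectangle, which is nonnegative (`HTilde0.norm_sq_le`). Galerkin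
orthogonality then bounds `‖A_h^n - A^n‖` by `‖T_h^n - T^n‖` in `L²₁` plus the approximation error
of `A^n` (`exists_potential_error`). The equation is elliptic at each time, so no time
discretisation error arises here.

Coupling. The temperature error is available in `L²₁` only, and it is multiplied by `|A| |Z|` in the
potential equation and by `|A|² |W|` in the heat equation. Hölder's inequality therefore asks for
three factors in `L⁶₁`, and the critical embedding of `H¹₁` into `L⁶₁`, the Sobolev embedding of
three dimensions seen in the meridian plane, supplies them (`Configuration.exists_embedding`). It is
proved on parallelograms, where the weight `r` becomes affine. A Gagliardo–Nirenberg argument on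
lines bounds `∫ r u⁶` by the unweighted `∫ u⁴` and the energy; Hardy's inequality bounds `∫ u⁴` back
by `∫ r u⁶` and the energy (`weighted_sobolev_square`). A polygon is a finite union of
parallelograms, and the same decomposition gives the trace inequality.

Temperature. Subtracting the heat equations at `t_{n+1}` and testing with `T_h^{n+1} - Q_h T^{n+1}`
leaves the projection errors, the backward difference defect, the increments of `T`, `A` and `T_c`
over one step (the source is lagged), and the increment of `(I - Q_h)T` divided by `Δt`
(`exists_coupled_error_step`). Summation and a discrete Gronwall inequality, in which the coercivity
constant is lowered so that no restriction on `Δt` is needed, give the bound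
(`exists_temperature_error`).

Two matters of rigour take space. The continuous equations hold for almost every time, and
continuity carries them to the nodes (`electricEq_of_ae`, `exists_heat_equation`). The heat equation
is tested with functions that have a trace, so finite element functions must be shown to have one
(`exists_trace_of_mem_meshX`). -/

/-! ## Weighted inequalities on the unit interval and the unit square -/

/-- Lebesgue measure on `[0, 1]`. -/
abbrev unitMeasure : Measure ℝ := volume.restrict (Icc (0 : ℝ) 1)

/-- `w` is nonnegative on `[0, 1]` and, up to a factor `2`, does not decrease on the way from any
point to any point of the interval `I`. -/
def FlowsTo (w : ℝ → ℝ) (I : Set ℝ) : Prop :=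
  ∀ t ∈ Icc (0 : ℝ) 1, ∀ t' ∈ I, ∀ y ∈ uIcc t t', w t ≤ 2 * w y

theorem integrable_unit {f : ℝ → ℝ} (hf : Continuous f) : Integrable f unitMeasure :=
  hf.continuousOn.integrableOn_compact isCompact_Icc

/-- Write `f t` as `f t'` plus the integral of `f'` along the path to a point `t'` of the good
interval. On that path `w t ≤ 2 w y`, so the weight can be moved under the integral. Averaging over
`t'` gives the first integral. -/
theorem weighted_sup_of_flowsTo {w f f' : ℝ → ℝ} (hw : Continuous w)
    (hpos : ∀ t ∈ Icc (0 : ℝ) 1, 0 ≤ w t) (hf : ∀ t, HasDerivAt f (f' t) t) (hf' : Continuous f')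
    {p : ℝ} (hp : Icc p (p + 1 / 2) ⊆ Icc 0 1) (h : FlowsTo w (Icc p (p + 1 / 2)))
    {t : ℝ} (ht : t ∈ Icc (0 : ℝ) 1) :
    w t * |f t| ≤ 4 * ∫ y, w y * |f y| ∂unitMeasure + 2 * ∫ y, w y * |f' y| ∂unitMeasure := by
  have hfc : Continuous f := continuous_iff_continuousAt.2 fun x => (hf x).continuousAt
  set B := ∫ y, w y * |f' y| ∂unitMeasure with hB
  have key : ∀ t' ∈ Icc p (p + 1 / 2), w t * |f t| ≤ 2 * (w t' * |f t'|) + 2 * B := by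
    intro t' ht'
    have e1 : f t - f t' = ∫ y in t'..t, f' y :=
      (intervalIntegral.integral_eq_sub_of_hasDerivAt (fun x _ => hf x)
        (hf'.intervalIntegrable _ _)).symm
    have e2 : |f t - f t'| ≤ ∫ y in uIoc t' t, |f' y| := by
      rw [e1]
      simpa only [Real.norm_eq_abs] using
        intervalIntegral.norm_integral_le_integral_norm_uIoc (f := f') (a := t') (b := t)
          (μ := volume)
    have hsub : uIoc t' t ⊆ Icc 0 1 := by
      refine uIoc_subset_uIcc.trans ?_
      exact ordConnected_Icc.uIcc_subset (hp ht') ht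
    have e3 : w t * ∫ y in uIoc t' t, |f' y| ≤ 2 * B := by
      rw [← integral_const_mul]
      calc ∫ y in uIoc t' t, w t * |f' y| ≤ ∫ y in uIoc t' t, 2 * (w y * |f' y|) := by
            refine setIntegral_mono_on ?_ ?_ measurableSet_uIoc ?_
            · exact (intervalIntegrable_iff.1 (Continuous.intervalIntegrable (by fun_prop) t' t))
            · exact (intervalIntegrable_iff.1 (Continuous.intervalIntegrable (by fun_prop) t' t))
            · intro y hy
              have := h t ht t' ht' y (by rw [uIcc_comm]; exact uIoc_subset_uIcc hy)
              nlinarith [abs_nonneg (f' y)]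
        _ ≤ ∫ y in Icc 0 1, 2 * (w y * |f' y|) := by
            refine setIntegral_mono_set (integrable_unit (by fun_prop)) ?_
              (LE.le.eventuallyLE hsub)
            refine (ae_restrict_iff' measurableSet_Icc).2 (.of_forall fun y hy => ?_)
            have := hpos y hy
            simp only [Pi.zero_apply]
            positivity
        _ = 2 * B := by rw [integral_const_mul]
    have e4 : |f t| ≤ |f t'| + ∫ y in uIoc t' t, |f' y| := by
      have := abs_sub_abs_le_abs_sub (f t) (f t')
      linarith
    have e5 := h t ht t' ht' t' right_mem_uIcc
    calc w t * |f t| ≤ w t * (|f t'| + ∫ y in uIoc t' t, |f' y|) :=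
          mul_le_mul_of_nonneg_left e4 (hpos t ht)
      _ = w t * |f t'| + w t * ∫ y in uIoc t' t, |f' y| := by ring
      _ ≤ 2 * w t' * |f t'| + 2 * B := by
          gcongr
      _ = _ := by ring
  -- The interval has length `1/2`: averaging over it doubles the factor `2` of the first term to
  -- `4` and leaves `2 * B` unchanged.
  have e6 : ∫ _ in Icc p (p + 1 / 2), w t * |f t| ≤
      ∫ t' in Icc p (p + 1 / 2), (2 * (w t' * |f t'|) + 2 * B) := by
    refine setIntegral_mono_on ?_ ?_ measurableSet_Icc key
    · exact continuous_const.continuousOn.integrableOn_compact isCompact_Icc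
    · exact Continuous.continuousOn (by fun_prop) |>.integrableOn_compact isCompact_Icc
  rw [integral_add ((Continuous.continuousOn (by fun_prop)).integrableOn_compact isCompact_Icc)
    (continuous_const.continuousOn.integrableOn_compact isCompact_Icc)] at e6
  simp only [integral_const, MeasurableSet.univ, measureReal_restrict_apply, univ_inter,
    Real.volume_real_Icc, smul_eq_mul, integral_const_mul] at e6
  have e7 : ∫ y in Icc p (p + 1 / 2), w y * |f y| ≤ ∫ y, w y * |f y| ∂unitMeasure := by
    refine setIntegral_mono_set (integrable_unit (by fun_prop)) ?_
      (LE.le.eventuallyLE hp)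
    refine (ae_restrict_iff' measurableSet_Icc).2 (.of_forall fun y hy => ?_)
    have := hpos y hy
    simp only [Pi.zero_apply]
    positivity
  have e8 : max (p + 1 / 2 - p) 0 = (1 / 2 : ℝ) := by
    rw [add_sub_cancel_left]; norm_num
  rw [e8] at e6
  linarith

/-- Take the half of the interval on the side where the weight is larger. A path into it either
increases the weight or stays in that half, where a nonnegative affine function is at least half its
maximum. -/
theorem flowsTo_affine (α β : ℝ) (h : ∀ t ∈ Icc (0 : ℝ) 1, 0 ≤ α + β * t) :
    ∃ p : ℝ, Icc p (p + 1 / 2) ⊆ Icc 0 1 ∧ FlowsTo (fun t => α + β * t) (Icc p (p + 1 / 2)) := by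
  have h0 := h 0 (by simp)
  have h1 := h 1 (by simp)
  rcases le_total 0 β with hβ | hβ
  · refine ⟨1 / 2, Icc_subset_Icc (by norm_num) (by norm_num), fun t ht t' ht' y hy => ?_⟩
    have hty : min t t' ≤ y := hy.1
    norm_num at ht ht'
    rcases min_le_iff.1 hty with h2 | h2
    · nlinarith [mul_le_mul_of_nonneg_left h2 hβ, mul_nonneg hβ ht.1]
    · nlinarith [mul_le_mul_of_nonneg_left h2 hβ, mul_le_mul_of_nonneg_left ht.2 hβ,
        mul_le_mul_of_nonneg_left ht'.1 hβ]
  · refine ⟨0, Icc_subset_Icc (by norm_num) (by norm_num), fun t ht t' ht' y hy => ?_⟩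
    have hty : y ≤ max t t' := hy.2
    norm_num at ht ht'
    have hβ' : 0 ≤ -β := by linarith
    rcases le_max_iff.1 hty with h2 | h2
    · nlinarith [mul_le_mul_of_nonneg_left h2 hβ', h t ⟨ht.1, ht.2⟩]
    · nlinarith [mul_le_mul_of_nonneg_left h2 hβ', mul_le_mul_of_nonneg_left ht.1 hβ',
        mul_le_mul_of_nonneg_left ht'.2 hβ']

/-- Weighted one-dimensional Sobolev inequality with a nonnegative affine weight. -/
theorem weighted_sup {α β : ℝ} (h : ∀ t ∈ Icc (0 : ℝ) 1, 0 ≤ α + β * t) {f f' : ℝ → ℝ}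
    (hf : ∀ t, HasDerivAt f (f' t) t) (hf' : Continuous f') {t : ℝ} (ht : t ∈ Icc (0 : ℝ) 1) :
    (α + β * t) * |f t| ≤ 4 * ∫ y, (α + β * y) * |f y| ∂unitMeasure
      + 2 * ∫ y, (α + β * y) * |f' y| ∂unitMeasure := by
  obtain ⟨p, hp, hF⟩ := flowsTo_affine α β h
  exact weighted_sup_of_flowsTo (w := fun t => α + β * t) (by fun_prop) h hf hf' hp hF ht

/-- Weighted one-dimensional Sobolev inequality with the square root of an affine weight. -/
theorem weighted_sup_sqrt {α β : ℝ} (h : ∀ t ∈ Icc (0 : ℝ) 1, 0 ≤ α + β * t) {f f' : ℝ → ℝ}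
    (hf : ∀ t, HasDerivAt f (f' t) t) (hf' : Continuous f') {t : ℝ} (ht : t ∈ Icc (0 : ℝ) 1) :
    √(α + β * t) * |f t| ≤ 4 * ∫ y, √(α + β * y) * |f y| ∂unitMeasure
      + 2 * ∫ y, √(α + β * y) * |f' y| ∂unitMeasure := by
  obtain ⟨p, hp, hF⟩ := flowsTo_affine α β h
  refine weighted_sup_of_flowsTo (w := fun t => √(α + β * t)) (by fun_prop)
    (fun _ _ => Real.sqrt_nonneg _) hf hf' hp (fun t ht t' ht' y hy => ?_) ht
  have hy1 : y ∈ Icc (0 : ℝ) 1 := ordConnected_Icc.uIcc_subset ht (hp ht') hy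
  have h1 := hF t ht t' ht' y hy
  have h2 := h y hy1
  rw [Real.sqrt_le_left (by positivity), mul_pow, Real.sq_sqrt h2]
  simp only at h1
  linarith

/-- One-dimensional Hardy inequality with an affine weight. -/
theorem hardy_affine {α β : ℝ} (h : ∀ t ∈ Icc (0 : ℝ) 1, 0 ≤ α + β * t)
    {f f' : ℝ → ℝ} (hf : ∀ t, HasDerivAt f (f' t) t) (hf' : Continuous f') :
    |β| * |∫ y, f y ∂unitMeasure| ≤ 8 * ∫ y, (α + β * y) * |f y| ∂unitMeasure
      + 5 * ∫ y, (α + β * y) * |f' y| ∂unitMeasure := by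
  have hfc : Continuous f := continuous_iff_continuousAt.2 fun x => (hf x).continuousAt
  -- The slope `β` is the derivative of the weight, so the unweighted integral of `f` is a boundary
  -- term minus a weighted integral of `f'`. Bounding both endpoint values by `weighted_sup` gives
  -- `8 = 4 + 4` and `5 = 2 + 2 + 1`.
  have e1 : ∫ y in (0 : ℝ)..1, (β * f y + (α + β * y) * f' y)
      = (α + β * 1) * f 1 - (α + β * 0) * f 0 := by
    refine intervalIntegral.integral_eq_sub_of_hasDerivAt
      (f := fun y => (α + β * y) * f y) (fun y _ => ?_) ?_
    · have : HasDerivAt (fun y => α + β * y) β y := by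
        simpa using ((hasDerivAt_id y).const_mul β).const_add α
      exact this.mul (hf y)
    · exact Continuous.intervalIntegrable (by fun_prop) _ _
  rw [intervalIntegral.integral_of_le zero_le_one, ← integral_Icc_eq_integral_Ioc,
    integral_add (integrable_unit (by fun_prop)) (integrable_unit (by fun_prop)),
    integral_const_mul] at e1
  have e2 : |∫ y in Icc (0 : ℝ) 1, (α + β * y) * f' y| ≤
      ∫ y, (α + β * y) * |f' y| ∂unitMeasure := by
    refine abs_integral_le_integral_abs.trans (le_of_eq ?_)
    refine setIntegral_congr_fun measurableSet_Icc fun y hy => ?_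
    simp only [abs_mul, abs_of_nonneg (h y hy)]
  have s0 := weighted_sup h hf hf' (t := 0) (by simp)
  have s1 := weighted_sup h hf hf' (t := 1) (by simp)
  rw [← abs_mul]
  have e3 : β * ∫ y, f y ∂unitMeasure = (α + β * 1) * f 1 - (α + β * 0) * f 0
      - ∫ y in Icc (0 : ℝ) 1, (α + β * y) * f' y := by linarith
  rw [e3]
  have a0 : |(α + β * 0) * f 0| = (α + β * 0) * |f 0| := by
    rw [abs_mul, abs_of_nonneg (h 0 (by simp))]
  have a1 : |(α + β * 1) * f 1| = (α + β * 1) * |f 1| := by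
    rw [abs_mul, abs_of_nonneg (h 1 (by simp))]
  have t1 := abs_sub ((α + β * 1) * f 1 - (α + β * 0) * f 0)
    (∫ y in Icc (0 : ℝ) 1, (α + β * y) * f' y)
  have t2 := abs_sub ((α + β * 1) * f 1) ((α + β * 0) * f 0)
  linarith

theorem sq_integral_mul_le {X : Type*} [MeasurableSpace X] {μ : Measure X} {f g : X → ℝ}
    (hf : MemLp f 2 μ) (hg : MemLp g 2 μ) :
    (∫ x, f x * g x ∂μ) ^ 2 ≤ (∫ x, f x ^ 2 ∂μ) * ∫ x, g x ^ 2 ∂μ := by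
  have e : ∀ {f g : X → ℝ} (hf : MemLp f 2 μ) (hg : MemLp g 2 μ),
      inner ℝ (hf.toLp f) (hg.toLp g) = ∫ x, f x * g x ∂μ := by
    intro f g hf hg
    rw [MeasureTheory.L2.inner_def]
    refine integral_congr_ae ?_
    filter_upwards [hf.coeFn_toLp, hg.coeFn_toLp] with x h1 h2
    rw [h1, h2, real_inner_comm]
    rfl
  have := real_inner_mul_inner_self_le (hf.toLp f) (hg.toLp g)
  rw [e hf hg, e hf hf, e hg hg] at this
  simpa only [pow_two] using this

/-- Lebesgue measure on the unit square. -/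
abbrev squareMeasure : Measure (ℝ × ℝ) := unitMeasure.prod unitMeasure

theorem squareMeasure_eq :
    squareMeasure = volume.restrict (Icc (0 : ℝ) 1 ×ˢ Icc (0 : ℝ) 1) := by
  rw [squareMeasure, unitMeasure, Measure.prod_restrict]
  rfl

theorem ae_square {P : ℝ × ℝ → Prop} (h : ∀ s ∈ Icc (0 : ℝ) 1, ∀ t ∈ Icc (0 : ℝ) 1, P (s, t)) :
    ∀ᵐ x ∂squareMeasure, P x := by
  rw [squareMeasure_eq]
  refine (ae_restrict_iff' (measurableSet_Icc.prod measurableSet_Icc)).2 (.of_forall ?_)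
  rintro ⟨s, t⟩ ⟨hs, ht⟩
  exact h s hs t ht

theorem memLp_square {f : ℝ × ℝ → ℝ} (hf : Continuous f) (p : ENNReal) :
    MemLp f p squareMeasure := by
  rw [squareMeasure_eq]
  have hc : IsCompact (Icc (0 : ℝ) 1 ×ˢ Icc (0 : ℝ) 1) := isCompact_Icc.prod isCompact_Icc
  obtain ⟨C, hC⟩ := hc.exists_bound_of_continuousOn hf.continuousOn
  have : IsFiniteMeasure (volume.restrict (Icc (0 : ℝ) 1 ×ˢ Icc (0 : ℝ) 1)) :=
    ⟨by simpa using hc.measure_lt_top⟩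
  exact MemLp.of_bound hf.aestronglyMeasurable C
    ((ae_restrict_iff' (measurableSet_Icc.prod measurableSet_Icc)).2 (.of_forall hC))

theorem integrable_square {f : ℝ × ℝ → ℝ} (hf : Continuous f) : Integrable f squareMeasure :=
  memLp_one_iff_integrable.1 (memLp_square hf 1)

theorem integral_mul_le_sqrt {f g : ℝ × ℝ → ℝ} (hf : Continuous f) (hg : Continuous g) {a b : ℝ}
    (ha : ∫ x, f x ^ 2 ∂squareMeasure ≤ a ^ 2) (hb : ∫ x, g x ^ 2 ∂squareMeasure ≤ b ^ 2)
    (ha0 : 0 ≤ a) (hb0 : 0 ≤ b) : ∫ x, f x * g x ∂squareMeasure ≤ a * b := by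
  refine (abs_le_of_sq_le_sq' (b := a * b) ?_ (by positivity)).2
  refine (sq_integral_mul_le (memLp_square hf 2) (memLp_square hg 2)).trans ?_
  rw [mul_pow]
  exact mul_le_mul ha hb (integral_nonneg fun _ => sq_nonneg _) (sq_nonneg _)

/-- If `F²` is bounded by the product of the integrals of `a` along the vertical and of `b` along
the horizontal lines, then it is integrable with the corresponding bound. -/
theorem integral_le_of_slices {F a b : ℝ × ℝ → ℝ} (hF : Continuous F) (ha : Continuous a)
    (hb : Continuous b)
    (h : ∀ s ∈ Icc (0 : ℝ) 1, ∀ t ∈ Icc (0 : ℝ) 1,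
      F (s, t) ≤ (∫ y, a (s, y) ∂unitMeasure) * ∫ y, b (y, t) ∂unitMeasure) :
    ∫ x, F x ∂squareMeasure ≤ (∫ x, a x ∂squareMeasure) * ∫ x, b x ∂squareMeasure := by
  have i1 := (integrable_square ha).integral_prod_left
  have i2 := (integrable_square hb).integral_prod_right
  rw [integral_prod _ (integrable_square ha), integral_prod_symm _ (integrable_square hb),
    ← integral_prod_mul]
  exact integral_mono_ae (integrable_square hF) (i1.mul_prod i2) (ae_square h)

/-- Critical Sobolev inequality on the unit square with a nonnegative affine weight. -/
theorem weighted_sobolev_square {α β γ : ℝ}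
    (h : ∀ s ∈ Icc (0 : ℝ) 1, ∀ t ∈ Icc (0 : ℝ) 1, 0 ≤ α + β * s + γ * t) (hβ : β ≠ 0)
    {u us ut : ℝ × ℝ → ℝ} (hu : Continuous u) (hus : Continuous us) (hut : Continuous ut)
    (hs : ∀ s t, HasDerivAt (fun s => u (s, t)) (us (s, t)) s)
    (ht : ∀ s t, HasDerivAt (fun t => u (s, t)) (ut (s, t)) t) :
    ∫ x, (α + β * x.1 + γ * x.2) * u x ^ 6 ∂squareMeasure ≤
      (2800 / |β|) ^ 2 * (∫ x, (α + β * x.1 + γ * x.2) * (u x ^ 2 + us x ^ 2 + ut x ^ 2)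
        ∂squareMeasure) ^ 3 := by
  set ρ : ℝ × ℝ → ℝ := fun x => α + β * x.1 + γ * x.2 with hρ
  have hρc : Continuous ρ := by fun_prop
  set w : ℝ × ℝ → ℝ := fun x => √(ρ x) with hw
  have hwc : Continuous w := by fun_prop
  have hw2 : ∀ s ∈ Icc (0 : ℝ) 1, ∀ t ∈ Icc (0 : ℝ) 1, w (s, t) ^ 2 = ρ (s, t) :=
    fun s hs t ht => Real.sq_sqrt (h s hs t ht)
  set E := ∫ x, ρ x * (u x ^ 2 + us x ^ 2 + ut x ^ 2) ∂squareMeasure with hE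
  set X6 := ∫ x, ρ x * u x ^ 6 ∂squareMeasure with hX6
  set X4 := ∫ x, u x ^ 4 ∂squareMeasure with hX4
  have hE0 : 0 ≤ E := integral_nonneg_of_ae (ae_square fun s hs t ht => by
    have := h s hs t ht
    simp only [Pi.zero_apply, hρ]
    positivity)
  have hX60 : 0 ≤ X6 := integral_nonneg_of_ae (ae_square fun s hs t ht => by
    have := h s hs t ht
    simp only [Pi.zero_apply, hρ]
    positivity)
  have hX40 : 0 ≤ X4 := integral_nonneg fun _ => by positivity
  set D := √E with hD
  have hD0 : 0 ≤ D := Real.sqrt_nonneg _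
  have hD2 : D ^ 2 = E := Real.sq_sqrt hE0
  have bd : ∀ v : ℝ × ℝ → ℝ, Continuous v → (∀ x, v x ^ 2 ≤ u x ^ 2 + us x ^ 2 + ut x ^ 2) →
      ∫ x, (w x * |v x|) ^ 2 ∂squareMeasure ≤ D ^ 2 := by
    intro v hv hle
    rw [hD2]
    refine integral_mono_ae (integrable_square (by fun_prop)) (integrable_square (by fun_prop))
      (ae_square fun s hs t ht => ?_)
    simp only [mul_pow, sq_abs, hw2 s hs t ht]
    exact mul_le_mul_of_nonneg_left (hle _) (h s hs t ht)
  have bu := bd u hu fun x => by nlinarith [sq_nonneg (us x), sq_nonneg (ut x)]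
  have bs := bd us hus fun x => by nlinarith [sq_nonneg (u x), sq_nonneg (ut x)]
  have bt := bd ut hut fun x => by nlinarith [sq_nonneg (us x), sq_nonneg (u x)]
  have q4 : ∫ x, (u x ^ 2) ^ 2 ∂squareMeasure ≤ √X4 ^ 2 := by
    rw [Real.sq_sqrt hX40, hX4]
    exact le_of_eq (integral_congr_ae (.of_forall fun x => by ring))
  have q6 : ∫ x, (w x * |u x| ^ 3) ^ 2 ∂squareMeasure ≤ √X6 ^ 2 := by
    rw [Real.sq_sqrt hX60, hX6]
    refine integral_mono_ae (integrable_square (by fun_prop)) (integrable_square (by fun_prop))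
      (ae_square fun s hs t ht => le_of_eq ?_)
    simp only [mul_pow, hw2 s hs t ht, ← pow_mul]
    rw [(by decide : Even (3 * 2)).pow_abs]
  have slice : ∀ v : ℝ × ℝ → ℝ, Continuous v →
      ∫ x, (w x * |v x|) ^ 2 ∂squareMeasure ≤ D ^ 2 →
      ∫ x, (4 * (u x ^ 2 * (w x * |u x|)) + 6 * (u x ^ 2 * (w x * |v x|))) ∂squareMeasure
        ≤ 10 * (√X4 * D) := by
    intro v hv hb
    rw [integral_add (integrable_square (by fun_prop)) (integrable_square (by fun_prop)),
      integral_const_mul, integral_const_mul]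
    have k1 := integral_mul_le_sqrt (f := fun x => u x ^ 2) (g := fun x => w x * |u x|)
      (by fun_prop) (by fun_prop) q4 bu (Real.sqrt_nonneg _) hD0
    have k2 := integral_mul_le_sqrt (f := fun x => u x ^ 2) (g := fun x => w x * |v x|)
      (by fun_prop) (by fun_prop) q4 hb (Real.sqrt_nonneg _) hD0
    linarith
  -- Gagliardo–Nirenberg: `w |u|³` is bounded by an integral along the vertical line and by one
  -- along the horizontal line. The product of the bounds separates under the double integral, and
  -- Cauchy–Schwarz against the unweighted `u²` bounds each factor by `10 √X4 D`.
  have S : X6 ≤ 100 * X4 * D ^ 2 := by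
    have k : X6 ≤ _ := integral_le_of_slices (F := fun x => ρ x * u x ^ 6)
      (a := fun x => 4 * (u x ^ 2 * (w x * |u x|)) + 6 * (u x ^ 2 * (w x * |ut x|)))
      (b := fun x => 4 * (u x ^ 2 * (w x * |u x|)) + 6 * (u x ^ 2 * (w x * |us x|)))
      (by fun_prop) (by fun_prop) (by fun_prop) ?_
    · refine k.trans ((mul_le_mul (slice ut hut bt) (slice us hus bs) ?_ (by positivity)).trans ?_)
      · exact integral_nonneg fun x => by positivity
      · have := Real.sq_sqrt hX40
        nlinarith
    · intro s hs' t ht'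
      have p1 : w (s, t) * |u (s, t)| ^ 3 ≤ ∫ y, (4 * (u (s, y) ^ 2 * (w (s, y) * |u (s, y)|)) +
          6 * (u (s, y) ^ 2 * (w (s, y) * |ut (s, y)|))) ∂unitMeasure := by
        have := weighted_sup_sqrt (α := α + β * s) (β := γ) (fun t ht => h s hs' t ht)
          (f := fun t => u (s, t) ^ 3) (f' := fun t => 3 * u (s, t) ^ 2 * ut (s, t))
          (fun t => by simpa using (ht s t).fun_pow 3) (by fun_prop) ht'
        rw [abs_pow] at this
        refine this.trans (le_of_eq ?_)
        rw [integral_add (integrable_unit (by fun_prop)) (integrable_unit (by fun_prop)),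
          ← integral_const_mul, ← integral_const_mul]
        congr 1 <;> refine integral_congr_ae (.of_forall fun y => ?_)
        · simp only [hw, hρ, abs_pow, ← sq_abs (u (s, y))]
          ring
        · simp only [hw, hρ, abs_mul, abs_pow, sq_abs, Nat.abs_ofNat]
          ring
      have p2 : w (s, t) * |u (s, t)| ^ 3 ≤ ∫ y, (4 * (u (y, t) ^ 2 * (w (y, t) * |u (y, t)|)) +
          6 * (u (y, t) ^ 2 * (w (y, t) * |us (y, t)|))) ∂unitMeasure := by
        have := weighted_sup_sqrt (α := α + γ * t) (β := β)
          (fun s hs => by have := h s hs t ht'; linarith)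
          (f := fun s => u (s, t) ^ 3) (f' := fun s => 3 * u (s, t) ^ 2 * us (s, t))
          (fun s => by simpa using (hs s t).fun_pow 3) (by fun_prop) hs'
        rw [abs_pow, add_right_comm] at this
        refine this.trans (le_of_eq ?_)
        rw [integral_add (integrable_unit (by fun_prop)) (integrable_unit (by fun_prop)),
          ← integral_const_mul, ← integral_const_mul]
        congr 1 <;> refine integral_congr_ae (.of_forall fun y => ?_)
        · simp only [hw, hρ, abs_pow, ← sq_abs (u (y, t)), add_right_comm α (γ * t)]
          ring
        · simp only [hw, hρ, abs_mul, abs_pow, sq_abs, Nat.abs_ofNat,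
            add_right_comm α (γ * t)]
          ring
      have p0 : 0 ≤ w (s, t) * |u (s, t)| ^ 3 := by positivity
      calc ρ (s, t) * u (s, t) ^ 6
          = (w (s, t) * |u (s, t)| ^ 3) * (w (s, t) * |u (s, t)| ^ 3) := by
            rw [← hw2 s hs' t ht', ← (by decide : Even 6).pow_abs]; ring
        _ ≤ _ := mul_le_mul p1 p2 p0 (p0.trans p1)
  -- Hardy's inequality for `u⁴` on horizontal lines restores the weight in the integral left over
  -- by `S`; this is where a nonzero slope `β` is needed. Here `20 = 5 * 4`, the `4` from
  -- differentiating `u⁴`, and `28 = 8 + 20`.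
  have H : |β| * X4 ≤ 28 * (√X6 * D) := by
    have k1 := integral_mul_le_sqrt (f := fun x => w x * |u x| ^ 3) (g := fun x => w x * |u x|)
      (by fun_prop) (by fun_prop) q6 bu (Real.sqrt_nonneg _) hD0
    have k2 := integral_mul_le_sqrt (f := fun x => w x * |u x| ^ 3) (g := fun x => w x * |us x|)
      (by fun_prop) (by fun_prop) q6 bs (Real.sqrt_nonneg _) hD0
    have k3 : |β| * X4 ≤ ∫ x, (8 * (ρ x * u x ^ 4) + 20 * (ρ x * (|u x| ^ 3 * |us x|)))
        ∂squareMeasure := by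
      rw [hX4, ← integral_const_mul, integral_prod_symm _ (integrable_square (by fun_prop)),
        integral_prod_symm _ (integrable_square (by fun_prop))]
      refine integral_mono_ae
        (integrable_square (f := fun x => |β| * u x ^ 4) (by fun_prop)).integral_prod_right
        (integrable_square (f := fun x => 8 * (ρ x * u x ^ 4) + 20 * (ρ x * (|u x| ^ 3 * |us x|)))
          (by fun_prop)).integral_prod_right ?_
      refine (ae_restrict_iff' measurableSet_Icc).2 (.of_forall fun t ht' => ?_)
      have := hardy_affine (α := α + γ * t) (β := β)
        (fun s hs => by have := h s hs t ht'; linarith)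
        (f := fun s => u (s, t) ^ 4) (f' := fun s => 4 * u (s, t) ^ 3 * us (s, t))
        (fun s => by simpa using (hs s t).fun_pow 4) (by fun_prop)
      dsimp only
      rw [integral_const_mul]
      rw [abs_of_nonneg (integral_nonneg fun _ => by positivity)] at this
      refine this.trans (le_of_eq ?_)
      rw [integral_add (integrable_unit (by fun_prop)) (integrable_unit (by fun_prop)),
        integral_const_mul, integral_const_mul]
      congr 1
      · congr 1
        refine integral_congr_ae (.of_forall fun y => ?_)
        simp only [hρ, add_right_comm α (γ * t), abs_pow, (by decide : Even 4).pow_abs]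
      · rw [← integral_const_mul, ← integral_const_mul]
        refine integral_congr_ae (.of_forall fun y => ?_)
        simp only [hρ, add_right_comm α (γ * t), abs_mul, abs_pow, Nat.abs_ofNat]
        ring
    rw [integral_add (integrable_square (by fun_prop)) (integrable_square (by fun_prop)),
      integral_const_mul, integral_const_mul] at k3
    have e1 : ∫ x, ρ x * u x ^ 4 ∂squareMeasure
        = ∫ x, w x * |u x| ^ 3 * (w x * |u x|) ∂squareMeasure := by
      refine integral_congr_ae (ae_square fun s hs t ht => ?_)
      simp only [← hw2 s hs t ht, ← (by decide : Even 4).pow_abs (u (s, t))]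
      ring
    have e2 : ∫ x, ρ x * (|u x| ^ 3 * |us x|) ∂squareMeasure
        = ∫ x, w x * |u x| ^ 3 * (w x * |us x|) ∂squareMeasure := by
      refine integral_congr_ae (ae_square fun s hs t ht => ?_)
      simp only [← hw2 s hs t ht]
      ring
    linarith
  have hβ0 : 0 < |β| := abs_pos.2 hβ
  -- The two estimates close up: `X6` is bounded by its own square root times `D³`, and one factor
  -- cancels.
  have hx : √X6 * √X6 ≤ √X6 * (2800 / |β| * D ^ 3) := by
    rw [Real.mul_self_sqrt hX60]
    have : X4 ≤ 28 * (√X6 * D) / |β| := by rw [le_div_iff₀ hβ0]; linarith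
    calc X6 ≤ 100 * X4 * D ^ 2 := S
      _ ≤ 100 * (28 * (√X6 * D) / |β|) * D ^ 2 := by gcongr
      _ = _ := by ring
  have hx2 : √X6 ≤ 2800 / |β| * D ^ 3 := by
    rcases (Real.sqrt_nonneg X6).eq_or_lt with h0 | h0
    · rw [← h0]; positivity
    · exact le_of_mul_le_mul_left hx h0
  calc X6 = √X6 ^ 2 := (Real.sq_sqrt hX60).symm
    _ ≤ (2800 / |β| * D ^ 3) ^ 2 := by gcongr
    _ = (2800 / |β|) ^ 2 * E ^ 3 := by rw [← hD2]; ring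

/-! ## Parallelograms in the meridian plane -/

/-- The affine parametrisation of the parallelogram with corner `a` and sides `d`, `e`. -/
def cellMap (a d e : Plane) (x : ℝ × ℝ) : Plane := a + x.1 • d + x.2 • e

/-- The closed parallelogram with corner `a` and sides `d`, `e`. -/
def cell (a d e : Plane) : Set Plane := cellMap a d e '' (Icc (0 : ℝ) 1 ×ˢ Icc (0 : ℝ) 1)

theorem continuous_cellMap (a d e : Plane) : Continuous (cellMap a d e) := by
  unfold cellMap
  fun_prop

theorem isCompact_cell (a d e : Plane) : IsCompact (cell a d e) :=
  (isCompact_Icc.prod isCompact_Icc).image (continuous_cellMap a d e)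

/-- The parametrisation is a linear isomorphism followed by a translation, so it carries Lebesgue
measure to a Haar measure, which is a multiple of Lebesgue measure by uniqueness. The factor never
needs to be computed. -/
theorem exists_map_cellMap (a : Plane) {d e : Plane} (h : LinearIndependent ℝ ![d, e]) :
    MeasurableEmbedding (cellMap a d e) ∧ ∃ c : ENNReal, c ≠ 0 ∧ c ≠ ⊤ ∧
      (volume : Measure (ℝ × ℝ)).map (cellMap a d e) = c • (volume : Measure Plane) := by
  set f : ℝ × ℝ →ₗ[ℝ] Plane :=
    (LinearMap.fst ℝ ℝ ℝ).smulRight d + (LinearMap.snd ℝ ℝ ℝ).smulRight e with hf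
  have hinj : Function.Injective f := by
    rw [injective_iff_map_eq_zero]
    rintro ⟨s, t⟩ hst
    have := LinearIndependent.pair_iff.1 h s t (by simpa [hf] using hst)
    simp [this.1, this.2]
  set L := (LinearMap.linearEquivOfInjective f hinj (by simp)).toContinuousLinearEquiv with hL
  have hLf : ∀ x, L x = x.1 • d + x.2 • e := fun x => rfl
  have hcomp : cellMap a d e = (fun y => a + y) ∘ L := by
    funext x
    simp only [cellMap, Function.comp_apply, hLf, add_assoc]
  constructor
  · rw [hcomp]
    exact (Homeomorph.addLeft a).measurableEmbedding.comp L.toHomeomorph.measurableEmbedding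
  · have : ((volume : Measure (ℝ × ℝ)).map L).IsAddHaarMeasure :=
      ContinuousLinearEquiv.isAddHaarMeasure_map L volume
    have h2 := Measure.isAddLeftInvariant_eq_smul
      ((volume : Measure (ℝ × ℝ)).map L) (volume : Measure Plane)
    refine ⟨Measure.addHaarScalarFactor ((volume : Measure (ℝ × ℝ)).map L)
      (volume : Measure Plane), ?_, ENNReal.coe_ne_top, ?_⟩
    · exact_mod_cast (Measure.addHaarScalarFactor_pos_of_isAddHaarMeasure _ _).ne'
    rw [hcomp, ← ENNReal.smul_def, ← Measure.map_map (measurable_const_add a) L.continuous.measurable,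
      map_add_left_eq_self]
    exact h2

/-- Change of variables on a parallelogram. -/
theorem exists_integral_cell (a : Plane) {d e : Plane} (h : LinearIndependent ℝ ![d, e]) :
    ∃ c : ℝ, 0 < c ∧ ∀ g : Plane → ℝ,
      ∫ x in cell a d e, g x = c * ∫ x, g (cellMap a d e x) ∂squareMeasure := by
  obtain ⟨hm, c, h0, h1, h2⟩ := exists_map_cellMap a h
  refine ⟨(c⁻¹).toReal, ENNReal.toReal_pos (by simpa using h1) (by simpa using h0), fun g => ?_⟩
  have e1 : (volume : Measure Plane) = c⁻¹ • (volume : Measure (ℝ × ℝ)).map (cellMap a d e) := by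
    rw [h2, smul_smul, ENNReal.inv_mul_cancel h0 h1, one_smul]
  rw [e1, Measure.restrict_smul, integral_smul_measure, hm.setIntegral_map, cell,
    preimage_image_eq _ hm.injective, squareMeasure_eq, smul_eq_mul]

theorem integral_axi {E : Type*} [NormedAddCommGroup E] [NormedSpace ℝ E] {ϑ : Set Plane}
    (h : ∀ᵐ x ∂volume.restrict ϑ, 0 ≤ x 0) (g : Plane → E) :
    ∫ x, g x ∂axi ϑ = ∫ x in ϑ, x 0 • g x := by
  have hm : Measurable fun x : Plane => Real.toNNReal (x 0) := by fun_prop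
  refine (integral_withDensity_eq_integral_smul (μ := volume.restrict ϑ) hm g).trans ?_
  refine integral_congr_ae ?_
  filter_upwards [h] with x hx
  rw [NNReal.smul_def, Real.coe_toNNReal _ hx]

theorem ae_nonneg_cell {a d e : Plane} (h : ∀ x ∈ cell a d e, 0 ≤ x 0) :
    ∀ᵐ x ∂volume.restrict (cell a d e), 0 ≤ x 0 :=
  (ae_restrict_iff' (isCompact_cell a d e).measurableSet).2 (.of_forall h)

theorem cellMap_mem {a d e : Plane} {s t : ℝ} (hs : s ∈ Icc (0 : ℝ) 1) (ht : t ∈ Icc (0 : ℝ) 1) :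
    cellMap a d e (s, t) ∈ cell a d e :=
  mem_image_of_mem _ ⟨hs, ht⟩

theorem fderiv_apply_eq {φ : Plane → ℝ} (x d : Plane) :
    fderiv ℝ φ x d = d 0 * partialDeriv 0 φ x + d 1 * partialDeriv 1 φ x := by
  have : d = d 0 • EuclideanSpace.single (0 : Fin 2) (1 : ℝ) +
      d 1 • EuclideanSpace.single (1 : Fin 2) (1 : ℝ) := by
    ext i
    fin_cases i <;> simp
  conv_lhs => rw [this, map_add, map_smul, map_smul]
  rfl

theorem sq_fderiv_apply_le {φ : Plane → ℝ} (x d : Plane) :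
    fderiv ℝ φ x d ^ 2 ≤ ((d 0) ^ 2 + (d 1) ^ 2) *
      (partialDeriv 0 φ x ^ 2 + partialDeriv 1 φ x ^ 2) := by
  rw [fderiv_apply_eq]
  nlinarith [sq_nonneg (d 0 * partialDeriv 1 φ x - d 1 * partialDeriv 0 φ x)]

/-- The density `φ² + |∇φ|²`. -/
def energyDensity (φ : Plane → ℝ) (x : Plane) : ℝ :=
  φ x ^ 2 + partialDeriv 0 φ x ^ 2 + partialDeriv 1 φ x ^ 2

theorem continuous_partialDeriv {φ : Plane → ℝ} (hφ : ContDiff ℝ 1 φ) (i : Fin 2) :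
    Continuous (partialDeriv i φ) := by
  have := hφ.continuous_fderiv (by simp)
  unfold partialDeriv
  fun_prop

theorem continuous_energyDensity {φ : Plane → ℝ} (hφ : ContDiff ℝ 1 φ) :
    Continuous (energyDensity φ) := by
  have h0 := continuous_partialDeriv hφ 0
  have h1 := continuous_partialDeriv hφ 1
  have := hφ.continuous
  unfold energyDensity
  fun_prop

theorem energyDensity_nonneg (φ : Plane → ℝ) (x : Plane) : 0 ≤ energyDensity φ x := by
  unfold energyDensity
  positivity

theorem hasDerivAt_cellMap_fst {φ : Plane → ℝ} (hφ : ContDiff ℝ 1 φ) (a d e : Plane) (s t : ℝ) :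
    HasDerivAt (fun s => φ (cellMap a d e (s, t))) (fderiv ℝ φ (cellMap a d e (s, t)) d) s := by
  have h1 : HasDerivAt (fun s : ℝ => cellMap a d e (s, t)) d s := by
    have := (((hasDerivAt_id s).smul_const d).const_add a).add_const (t • e)
    simpa [cellMap] using this
  exact ((hφ.differentiable (by simp)) _).hasFDerivAt.comp_hasDerivAt s h1

theorem hasDerivAt_cellMap_snd {φ : Plane → ℝ} (hφ : ContDiff ℝ 1 φ) (a d e : Plane) (s t : ℝ) :
    HasDerivAt (fun t => φ (cellMap a d e (s, t))) (fderiv ℝ φ (cellMap a d e (s, t)) e) t := by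
  have h1 : HasDerivAt (fun t : ℝ => cellMap a d e (s, t)) e t := by
    have := (((hasDerivAt_id t).smul_const e).const_add (a + s • d))
    simpa [cellMap] using this
  exact ((hφ.differentiable (by simp)) _).hasFDerivAt.comp_hasDerivAt t h1

theorem continuous_fderiv_cellMap {φ : Plane → ℝ} (hφ : ContDiff ℝ 1 φ) (a d e v : Plane) :
    Continuous fun x => fderiv ℝ φ (cellMap a d e x) v :=
  ((hφ.continuous_fderiv (by simp)).comp (continuous_cellMap a d e)).clm_apply continuous_const

theorem cellMap_apply_zero (a d e : Plane) (x : ℝ × ℝ) :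
    cellMap a d e x 0 = a 0 + d 0 * x.1 + e 0 * x.2 := by
  simp [cellMap, mul_comm]

theorem energy_cellMap_le {φ : Plane → ℝ} (a d e : Plane) (x : ℝ × ℝ) :
    φ (cellMap a d e x) ^ 2 + fderiv ℝ φ (cellMap a d e x) d ^ 2
      + fderiv ℝ φ (cellMap a d e x) e ^ 2 ≤
    (1 + (d 0 ^ 2 + d 1 ^ 2) + (e 0 ^ 2 + e 1 ^ 2)) * energyDensity φ (cellMap a d e x) := by
  have h1 := sq_fderiv_apply_le (φ := φ) (cellMap a d e x) d
  have h2 := sq_fderiv_apply_le (φ := φ) (cellMap a d e x) e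
  unfold energyDensity
  set p := φ (cellMap a d e x) ^ 2
  set q := partialDeriv 0 φ (cellMap a d e x) ^ 2 + partialDeriv 1 φ (cellMap a d e x) ^ 2
    with hq
  have hp0 : 0 ≤ p := sq_nonneg _
  have hq0 : 0 ≤ q := by positivity
  have : 0 ≤ (d 0 ^ 2 + d 1 ^ 2 + (e 0 ^ 2 + e 1 ^ 2)) * p := by positivity
  nlinarith

theorem cell_swap (a d e : Plane) : cell a e d = cell a d e := by
  unfold cell cellMap
  ext x
  constructor
  · rintro ⟨⟨s, t⟩, ⟨hs, ht⟩, rfl⟩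
    exact ⟨(t, s), ⟨ht, hs⟩, by simp only; abel⟩
  · rintro ⟨⟨s, t⟩, ⟨hs, ht⟩, rfl⟩
    exact ⟨(t, s), ⟨ht, hs⟩, by simp only; abel⟩

/-- Pulled back to the unit square, the weight `r` is affine with slope `d 0` in the first variable,
so a side that is not parallel to the axis makes the inequality on the square applicable. -/
theorem exists_sobolev_cell_of_ne {a d e : Plane} (h : LinearIndependent ℝ ![d, e])
    (hr : ∀ x ∈ cell a d e, 0 ≤ x 0) (hd : d 0 ≠ 0) :
    ∃ C : ℝ, 0 ≤ C ∧ ∀ φ : Plane → ℝ, ContDiff ℝ 1 φ →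
      ∫ x, φ x ^ 6 ∂axi (cell a d e) ≤ C * (∫ x, energyDensity φ x ∂axi (cell a d e)) ^ 3 := by
  obtain ⟨c, hc, hint⟩ := exists_integral_cell a h
  set M := 1 + (d 0 ^ 2 + d 1 ^ 2) + (e 0 ^ 2 + e 1 ^ 2) with hM
  have hM0 : 0 ≤ M := by positivity
  refine ⟨(2800 / |d 0|) ^ 2 * M ^ 3 * (c⁻¹) ^ 2, by positivity, fun φ hφ => ?_⟩
  have hpos : ∀ s ∈ Icc (0 : ℝ) 1, ∀ t ∈ Icc (0 : ℝ) 1, 0 ≤ a 0 + d 0 * s + e 0 * t :=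
    fun s hs t ht => by
      have := hr _ (cellMap_mem hs ht)
      rwa [cellMap_apply_zero] at this
  have key := weighted_sobolev_square hpos hd (hφ.continuous.comp (continuous_cellMap a d e))
    (continuous_fderiv_cellMap hφ a d e d) (continuous_fderiv_cellMap hφ a d e e)
    (hasDerivAt_cellMap_fst hφ a d e) (hasDerivAt_cellMap_snd hφ a d e)
  have hφc := hφ.continuous
  have hcm := continuous_cellMap a d e
  have hen := (continuous_energyDensity hφ).comp hcm
  have e1 : ∫ x, (a 0 + d 0 * x.1 + e 0 * x.2) * ((φ ∘ cellMap a d e) x ^ 2 +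
      fderiv ℝ φ (cellMap a d e x) d ^ 2 + fderiv ℝ φ (cellMap a d e x) e ^ 2) ∂squareMeasure
      ≤ M * ∫ x, (a 0 + d 0 * x.1 + e 0 * x.2) * energyDensity φ (cellMap a d e x)
        ∂squareMeasure := by
    rw [← integral_const_mul]
    have c1 := continuous_fderiv_cellMap hφ a d e d
    have c2 := continuous_fderiv_cellMap hφ a d e e
    refine integral_mono_ae (integrable_square (by fun_prop))
      (integrable_square (Continuous.mul continuous_const
        (Continuous.mul (by fun_prop) hen))) (ae_square fun s hs t ht => ?_)
    have := energy_cellMap_le (φ := φ) a d e (s, t)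
    have h0 := hpos s hs t ht
    calc _ ≤ (a 0 + d 0 * s + e 0 * t) * (M * energyDensity φ (cellMap a d e (s, t))) :=
          mul_le_mul_of_nonneg_left this h0
      _ = _ := by ring
  rw [integral_axi (ae_nonneg_cell hr), integral_axi (ae_nonneg_cell hr)]
  simp only [smul_eq_mul]
  rw [hint, hint]
  simp only [cellMap_apply_zero]
  set I := ∫ x, (a 0 + d 0 * x.1 + e 0 * x.2) * energyDensity φ (cellMap a d e x) ∂squareMeasure
  have e0 : 0 ≤ ∫ x, (a 0 + d 0 * x.1 + e 0 * x.2) * ((φ ∘ cellMap a d e) x ^ 2 +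
      fderiv ℝ φ (cellMap a d e x) d ^ 2 + fderiv ℝ φ (cellMap a d e x) e ^ 2)
      ∂squareMeasure := integral_nonneg_of_ae (ae_square fun s hs t ht => by
    have := hpos s hs t ht
    simp only [Pi.zero_apply]
    positivity)
  calc c * ∫ x, (a 0 + d 0 * x.1 + e 0 * x.2) * φ (cellMap a d e x) ^ 6 ∂squareMeasure
      ≤ c * ((2800 / |d 0|) ^ 2 * (M * I) ^ 3) := by
        gcongr
        exact key.trans (by gcongr)
    _ = (2800 / |d 0|) ^ 2 * M ^ 3 * (c⁻¹) ^ 2 * (c * I) ^ 3 := by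
        field_simp

/-- Critical Sobolev inequality `H¹₁ ⊆ L⁶₁` on a parallelogram in the closed half-plane. -/
theorem exists_sobolev_cell {a d e : Plane} (h : LinearIndependent ℝ ![d, e])
    (hr : ∀ x ∈ cell a d e, 0 ≤ x 0) :
    ∃ C : ℝ, 0 ≤ C ∧ ∀ φ : Plane → ℝ, ContDiff ℝ 1 φ →
      ∫ x, φ x ^ 6 ∂axi (cell a d e) ≤ C * (∫ x, energyDensity φ x ∂axi (cell a d e)) ^ 3 := by
  -- Two independent sides cannot both be parallel to the axis; if `d` is, the sides exchange their
  -- roles.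
  by_cases hd : d 0 = 0
  · have he : e 0 ≠ 0 := by
      intro he
      have h1 := LinearIndependent.pair_iff.1 h (e 1) (-d 1) (by
        ext i
        fin_cases i <;> simp [hd, he, mul_comm])
      have h2 := LinearIndependent.pair_iff.1 h 1 0 (by
        ext i
        fin_cases i
        · simp [hd]
        · simpa using h1.2)
      simp at h2
    rw [← cell_swap] at hr ⊢
    exact exists_sobolev_cell_of_ne (LinearIndependent.pair_symm_iff.1 h) hr he
  · exact exists_sobolev_cell_of_ne h hr hd

/-- Trace inequality on the side `{a + s d}` of a parallelogram in the closed half-plane. -/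
theorem exists_trace_cell {a d e : Plane} (h : LinearIndependent ℝ ![d, e])
    (hr : ∀ x ∈ cell a d e, 0 ≤ x 0) :
    ∃ C : ℝ, 0 ≤ C ∧ ∀ φ : Plane → ℝ, ContDiff ℝ 1 φ →
      ∫ s, (cellMap a d e (s, 0) 0) * φ (cellMap a d e (s, 0)) ^ 2 ∂unitMeasure
        ≤ C * ∫ x, energyDensity φ x ∂axi (cell a d e) := by
  obtain ⟨c, hc, hint⟩ := exists_integral_cell a h
  set M := 1 + (d 0 ^ 2 + d 1 ^ 2) + (e 0 ^ 2 + e 1 ^ 2) with hM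
  have hM0 : 0 ≤ M := by positivity
  refine ⟨6 * M * c⁻¹, by positivity, fun φ hφ => ?_⟩
  have hpos : ∀ s ∈ Icc (0 : ℝ) 1, ∀ t ∈ Icc (0 : ℝ) 1, 0 ≤ a 0 + d 0 * s + e 0 * t :=
    fun s hs t ht => by
      have := hr _ (cellMap_mem hs ht)
      rwa [cellMap_apply_zero] at this
  have hcm := continuous_cellMap a d e
  have hen := (continuous_energyDensity hφ).comp hcm
  have hφc := hφ.continuous.comp hcm
  have hd2 := continuous_fderiv_cellMap hφ a d e e
  have i1 : Continuous fun x : ℝ × ℝ => (a 0 + d 0 * x.1 + e 0 * x.2) *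
      energyDensity φ (cellMap a d e x) := Continuous.mul (by fun_prop) hen
  have c1 : ∀ s, Continuous fun t : ℝ => fderiv ℝ φ (cellMap a d e (s, t)) e :=
    fun s => hd2.comp (by fun_prop)
  have c2 : ∀ s, Continuous fun t : ℝ => φ (cellMap a d e (s, t)) :=
    fun s => hφc.comp (by fun_prop)
  have c3 : ∀ s, Continuous fun t : ℝ => energyDensity φ (cellMap a d e (s, t)) :=
    fun s => hen.comp (by fun_prop)
  have c4 : Continuous fun s : ℝ => φ (cellMap a d e (s, 0)) := hφc.comp (by fun_prop)
  rw [integral_axi (ae_nonneg_cell hr)]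
  simp only [smul_eq_mul]
  rw [hint, ← mul_assoc, mul_assoc (6 * M), inv_mul_cancel₀ hc.ne', mul_one,
    integral_prod _ (integrable_square (by simpa only [cellMap_apply_zero] using i1)),
    ← integral_const_mul]
  simp only [cellMap_apply_zero]
  refine integral_mono_ae (integrable_unit (by fun_prop))
    ((integrable_square i1).integral_prod_left.const_mul _) ?_
  refine (ae_restrict_iff' measurableSet_Icc).2 (.of_forall fun s hs => ?_)
  -- The value of `r φ²` at the foot `t = 0` of each transversal segment is bounded by integrals
  -- along that segment; integrating in `s` gives the trace inequality.
  have := weighted_sup (α := a 0 + d 0 * s) (β := e 0) (fun t ht => hpos s hs t ht)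
    (f := fun t => φ (cellMap a d e (s, t)) ^ 2)
    (f' := fun t => 2 * φ (cellMap a d e (s, t)) * fderiv ℝ φ (cellMap a d e (s, t)) e)
    (fun t => by simpa using (hasDerivAt_cellMap_snd hφ a d e s t).fun_pow 2)
    (by have := c1 s; have := c2 s; fun_prop) (t := 0) (by simp)
  simp only [abs_pow, sq_abs] at this
  refine this.trans ?_
  have b1 := c1 s
  have b2 := c2 s
  have b3 := c3 s
  beta_reduce
  rw [← integral_const_mul, ← integral_const_mul, ← integral_const_mul,
    ← integral_add (integrable_unit (by fun_prop)) (integrable_unit (by fun_prop))]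
  refine integral_mono_ae (integrable_unit (by fun_prop)) (integrable_unit (by fun_prop)) ?_
  refine (ae_restrict_iff' measurableSet_Icc).2 (.of_forall fun t ht => ?_)
  have h1 := energy_cellMap_le (φ := φ) a d e (s, t)
  have h2 := hpos s hs t ht
  set p := φ (cellMap a d e (s, t))
  set q := fderiv ℝ φ (cellMap a d e (s, t)) e
  have h3 : |2 * p * q| ≤ p ^ 2 + q ^ 2 := by
    rw [abs_le]
    constructor <;> nlinarith [sq_nonneg (p + q), sq_nonneg (p - q)]
  have h4 : 4 * p ^ 2 + 2 * |2 * p * q| ≤ 6 * M * energyDensity φ (cellMap a d e (s, t)) := by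
    nlinarith [sq_nonneg (fderiv ℝ φ (cellMap a d e (s, t)) d), sq_nonneg q]
  calc _ = (a 0 + d 0 * s + e 0 * t) * (4 * p ^ 2 + 2 * |2 * p * q|) := by ring
    _ ≤ (a 0 + d 0 * s + e 0 * t) * (6 * M * energyDensity φ (cellMap a d e (s, t))) :=
      mul_le_mul_of_nonneg_left h4 h2
    _ = _ := by ring

/-! ## Decomposition of polygonal sets into parallelograms -/

section Triangle

variable (b : AffineBasis (Fin 3) ℝ Plane)

theorem triangle_eq_coord {i j k : Fin 3} (hij : i ≠ j) (hik : i ≠ k) (hjk : j ≠ k) (x : Plane) :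
    b.coord i x + b.coord j x + b.coord k x = 1 ∧
    x = b i + b.coord j x • (b j - b i) + b.coord k x • (b k - b i) := by
  have hu : (Finset.univ : Finset (Fin 3)) = {i, j, k} := by
    ext l
    simp only [Finset.mem_univ, Finset.mem_insert, Finset.mem_singleton, true_iff]
    omega
  have h1 := b.sum_coord_apply_eq_one x
  have h2 := b.linear_combination_coord_eq_self x
  rw [hu, Finset.sum_insert (by simp [hij, hik]), Finset.sum_insert (by simp [hjk]),
    Finset.sum_singleton] at h1 h2
  refine ⟨by linarith, ?_⟩
  have h3 : b.coord i x = 1 - b.coord j x - b.coord k x := by linarith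
  conv_lhs => rw [← h2, h3]
  module

theorem coord_eq_of_triangle {i j k : Fin 3} (hij : i ≠ j) (hik : i ≠ k) (hjk : j ≠ k)
    (s t : ℝ) :
    b.coord i (b i + s • (b j - b i) + t • (b k - b i)) = 1 - s - t ∧
    b.coord j (b i + s • (b j - b i) + t • (b k - b i)) = s ∧
    b.coord k (b i + s • (b j - b i) + t • (b k - b i)) = t := by
  have key : ∀ l, b.coord l (b i + s • (b j - b i) + t • (b k - b i))
      = b.coord l (b i) + s * (b.coord l (b j) - b.coord l (b i))
        + t * (b.coord l (b k) - b.coord l (b i)) := by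
    intro l
    have hl : ∀ x : Plane, b.coord l x = (b.coord l).linear x + b.coord l 0 := by
      intro x
      have := (b.coord l).map_vadd 0 x
      simpa using this
    rw [hl (_ + _), hl (b i), hl (b j), hl (b k)]
    simp only [map_add, map_smul, map_sub, smul_eq_mul]
    ring
  refine ⟨?_, ?_, ?_⟩ <;> rw [key] <;>
    simp [hij, hik, hjk, hij.symm, hik.symm, hjk.symm]
  ring

theorem linearIndependent_triangle {i j k : Fin 3} (hij : i ≠ j) (hik : i ≠ k) (hjk : j ≠ k) :
    LinearIndependent ℝ ![(1 / 2 : ℝ) • (b j - b i), (1 / 2 : ℝ) • (b k - b i)] := by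
  rw [LinearIndependent.pair_iff]
  intro s t hst
  have h := coord_eq_of_triangle b hij hik hjk (s * (1 / 2)) (t * (1 / 2))
  have e : b i + (s * (1 / 2)) • (b j - b i) + (t * (1 / 2)) • (b k - b i) = b i := by
    rw [mul_smul, mul_smul, add_assoc, hst, add_zero]
  rw [e] at h
  have h1 := h.2.1
  have h2 := h.2.2
  simp [hij.symm, hik.symm] at h1 h2
  exact ⟨by linarith, by linarith⟩

/-- In the parallelogram spanned by the two half sides at a vertex, the barycentric coordinates of
the other two vertices run through `[0, 1/2]`, which leaves the third one nonnegative. The three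
such parallelograms overlap but cover the triangle. -/
theorem cell_subset_triangle {i j k : Fin 3} (hij : i ≠ j) (hik : i ≠ k) (hjk : j ≠ k) :
    cell (b i) ((1 / 2 : ℝ) • (b j - b i)) ((1 / 2 : ℝ) • (b k - b i)) ⊆
      convexHull ℝ (range b) := by
  rintro x ⟨⟨s, t⟩, ⟨hs, ht⟩, rfl⟩
  have h := coord_eq_of_triangle b hij hik hjk (s * (1 / 2)) (t * (1 / 2))
  rw [b.convexHull_eq_nonneg_coord]
  intro l
  simp only [cellMap, smul_smul] at h ⊢
  simp only [mem_Icc] at hs ht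
  have hl : l = i ∨ l = j ∨ l = k := by omega
  rcases hl with rfl | rfl | rfl
  · rw [h.1]; linarith
  · rw [h.2.1]; linarith
  · rw [h.2.2]; linarith

theorem mem_cell_triangle {i j k : Fin 3} (hij : i ≠ j) (hik : i ≠ k) (hjk : j ≠ k) {x : Plane}
    (hx : x ∈ convexHull ℝ (range b)) (h1 : b.coord j x ≤ 1 / 2) (h2 : b.coord k x ≤ 1 / 2) :
    cellMap (b i) ((1 / 2 : ℝ) • (b j - b i)) ((1 / 2 : ℝ) • (b k - b i))
      (2 * b.coord j x, 2 * b.coord k x) = x ∧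
    2 * b.coord j x ∈ Icc (0 : ℝ) 1 ∧ 2 * b.coord k x ∈ Icc (0 : ℝ) 1 := by
  rw [b.convexHull_eq_nonneg_coord] at hx
  have p1 := hx j
  have p2 := hx k
  refine ⟨?_, ⟨by linarith, by linarith⟩, ⟨by linarith, by linarith⟩⟩
  conv_rhs => rw [(triangle_eq_coord b hij hik hjk x).2]
  simp only [cellMap, smul_smul]
  congr 3 <;> ring_nf

end Triangle

/-- A polygonal set is, up to a null set, a finite union of parallelograms, and its boundary is
covered by sides of these. -/
theorem IsPolygonal.exists_cells {U : Set Plane} (h : IsPolygonal U) :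
    ∃ (ι : Type) (_ : Fintype ι) (a d e : ι → Plane),
      (∀ i, LinearIndependent ℝ ![d i, e i]) ∧
      (∀ i, cell (a i) (d i) (e i) ⊆ closure U) ∧
      (∀ i, volume (cell (a i) (d i) (e i) \ U) = 0) ∧
      U ⊆ ⋃ i, cell (a i) (d i) (e i) ∧
      frontier U ⊆ ⋃ i, (fun s : ℝ => cellMap (a i) (d i) (e i) (s, 0)) '' Icc 0 1 := by
  obtain ⟨n, p, hp, hU⟩ := h
  have hspan : ∀ i, affineSpan ℝ (range (p i)) = ⊤ := fun i =>
    (hp i).affineSpan_eq_top_iff_card_eq_finrank_add_one.2 (by simp)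
  set b : Fin n → AffineBasis (Fin 3) ℝ Plane := fun i => ⟨p i, hp i, hspan i⟩ with hb
  have hbp : ∀ i, (b i : Fin 3 → Plane) = p i := fun i => rfl
  set F : Set Plane := ⋃ i, convexHull ℝ (range (p i)) with hF
  have hcl : ∀ i, IsClosed (convexHull ℝ (range (p i))) := fun i =>
    (Set.finite_range (p i)).isClosed_convexHull ℝ
  have hFc : IsClosed F := isClosed_iUnion_of_finite hcl
  have hint : ∀ i, interior (convexHull ℝ (range (p i))) ⊆ U := fun i => by
    rw [hU]
    exact interior_mono (subset_iUnion (fun i => convexHull ℝ (range (p i))) i)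
  have hsub : ∀ i, convexHull ℝ (range (p i)) ⊆ closure U := fun i => by
    have h1 : (interior (convexHull ℝ (range (p i)))).Nonempty :=
      interior_convexHull_nonempty_iff_affineSpan_eq_top.2 (hspan i)
    have h2 := (convex_convexHull ℝ (range (p i))).closure_interior_eq_closure_of_nonempty_interior
      h1
    calc convexHull ℝ (range (p i)) ⊆ closure (convexHull ℝ (range (p i))) := subset_closure
      _ = closure (interior (convexHull ℝ (range (p i)))) := h2.symm
      _ ⊆ closure U := closure_mono (hint i)
  have hnull : ∀ i, volume (convexHull ℝ (range (p i)) \ U) = 0 := fun i => by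
    refine measure_mono_null ?_ ((convex_convexHull ℝ (range (p i))).addHaar_frontier volume)
    rw [(hcl i).frontier_eq]
    exact sdiff_subset_sdiff_right (hint i)
  -- Nonnegative coordinates with sum one cannot contain two that exceed `1/2`, so one of the two
  -- indices other than `k` can be taken as `l`.
  have hcoord : ∀ i x (k : Fin 3), x ∈ convexHull ℝ (range (p i)) →
      ∃ j l : Fin 3, k ≠ j ∧ k ≠ l ∧ j ≠ l ∧ (b i).coord l x ≤ 1 / 2 := by
    intro i x k hx
    have hx' : x ∈ convexHull ℝ (range (b i)) := hx
    rw [(b i).convexHull_eq_nonneg_coord] at hx'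
    obtain ⟨j, l, h1, h2, h3⟩ : ∃ j l : Fin 3, k ≠ j ∧ k ≠ l ∧ j ≠ l := by
      fin_cases k
      · exact ⟨1, 2, by decide, by decide, by decide⟩
      · exact ⟨0, 2, by decide, by decide, by decide⟩
      · exact ⟨0, 1, by decide, by decide, by decide⟩
    have hs := (triangle_eq_coord (b i) h1 h2 h3 x).1
    by_cases hl : (b i).coord l x ≤ 1 / 2
    · exact ⟨j, l, h1, h2, h3, hl⟩
    · refine ⟨l, j, h2, h1, h3.symm, ?_⟩
      have := hx' k
      push Not at hl
      linarith
  -- A cell is indexed by a triangle, a vertex and an ordering of the other two vertices: the order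
  -- decides which side at the vertex is the first one, so every half edge occurs as a distinguished
  -- side.
  let ι := {q : Fin n × Fin 3 × Fin 3 × Fin 3 //
    q.2.1 ≠ q.2.2.1 ∧ q.2.1 ≠ q.2.2.2 ∧ q.2.2.1 ≠ q.2.2.2}
  have hcell : ∀ q : ι, cell (b q.1.1 q.1.2.1)
      ((1 / 2 : ℝ) • (b q.1.1 q.1.2.2.1 - b q.1.1 q.1.2.1))
      ((1 / 2 : ℝ) • (b q.1.1 q.1.2.2.2 - b q.1.1 q.1.2.1)) ⊆
      convexHull ℝ (range (p q.1.1)) := fun q =>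
    cell_subset_triangle (b q.1.1) q.2.1 q.2.2.1 q.2.2.2
  refine ⟨ι, inferInstance, fun q => b q.1.1 q.1.2.1,
    fun q => (1 / 2 : ℝ) • (b q.1.1 q.1.2.2.1 - b q.1.1 q.1.2.1),
    fun q => (1 / 2 : ℝ) • (b q.1.1 q.1.2.2.2 - b q.1.1 q.1.2.1), ?_, ?_, ?_, ?_, ?_⟩
  · exact fun q => linearIndependent_triangle (b q.1.1) q.2.1 q.2.2.1 q.2.2.2
  · exact fun q => (hcell q).trans (hsub _)
  · exact fun q => measure_mono_null (sdiff_subset_sdiff_left (hcell q)) (hnull _)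
  · intro x hx
    rw [hU] at hx
    obtain ⟨i, hi⟩ := mem_iUnion.1 (interior_subset hx)
    have hx' : x ∈ convexHull ℝ (range (b i)) := hi
    have hx'' := hx'
    rw [(b i).convexHull_eq_nonneg_coord] at hx''
    -- The cell is taken at a vertex whose coordinate is at least `1/2`; if there is none, every
    -- vertex serves.
    obtain ⟨k, hk⟩ : ∃ k, 1 / 2 ≤ (b i).coord k x ∨ ∀ l, (b i).coord l x ≤ 1 / 2 := by
      by_cases hk : ∃ k, 1 / 2 ≤ (b i).coord k x
      · exact ⟨hk.choose, .inl hk.choose_spec⟩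
      · push Not at hk
        exact ⟨0, .inr fun l => (hk l).le⟩
    obtain ⟨j, l, h1, h2, h3, h4⟩ := hcoord i x k hi
    have hj : (b i).coord j x ≤ 1 / 2 := by
      rcases hk with hk | hk
      · have := (triangle_eq_coord (b i) h1 h2 h3 x).1
        have := hx'' l
        linarith
      · exact hk j
    obtain ⟨e1, e2, e3⟩ := mem_cell_triangle (b i) h1 h2 h3 hx' hj h4
    exact mem_iUnion.2 ⟨⟨(i, k, j, l), h1, h2, h3⟩, _, ⟨e2, e3⟩, e1⟩
  · intro x hx
    have hxF : x ∈ F := by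
      have : closure U ⊆ F := by
        rw [hU]
        exact closure_minimal interior_subset hFc
      exact this hx.1
    obtain ⟨i, hi⟩ := mem_iUnion.1 hxF
    have hx' : x ∈ convexHull ℝ (range (b i)) := hi
    have hx'' := hx'
    rw [(b i).convexHull_eq_nonneg_coord] at hx''
    -- A boundary point of `U` is interior to no triangle, so one of its coordinates in a triangle
    -- containing it vanishes. It then lies on an edge, in the half adjacent to one of the two
    -- endpoints.
    have hni : x ∉ interior (convexHull ℝ (range (b i))) := by
      intro hxi
      have hUo : IsOpen U := by rw [hU]; exact isOpen_interior
      exact (hUo.frontier_eq ▸ hx).2 (hint i hxi)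
    rw [(b i).interior_convexHull] at hni
    simp only [mem_ofPred_eq, not_forall, not_lt] at hni
    obtain ⟨k, hk⟩ := hni
    have hk0 : (b i).coord k x = 0 := le_antisymm hk (hx'' k)
    obtain ⟨j, l, h1, h2, h3, h4⟩ := hcoord i x k hi
    obtain ⟨e1, e2, e3⟩ := mem_cell_triangle (b i) (i := j) (j := l) (k := k) h3 h1.symm h2.symm
      hx' h4 (by rw [hk0]; norm_num)
    refine mem_iUnion.2 ⟨⟨(i, j, l, k), h3, h1.symm, h2.symm⟩, _, e2, ?_⟩
    simpa only [hk0, mul_zero] using e1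

/-! ## Weak derivatives and continuously differentiable functions -/

instance isLocallyFiniteMeasure_axi (ϑ : Set Plane) : IsLocallyFiniteMeasure (axi ϑ) := by
  unfold axi
  have : Continuous fun x : Plane => Real.toNNReal (x 0) := by fun_prop
  exact IsLocallyFiniteMeasure.withDensity_coe this

theorem ae_mem_axi {ϑ : Set Plane} (h : MeasurableSet ϑ) : ∀ᵐ x ∂axi ϑ, x ∈ ϑ := by
  rw [ae_axi_iff]
  filter_upwards [ae_restrict_mem h] with x hx _ using hx

theorem ae_pos_axi (ϑ : Set Plane) : ∀ᵐ x ∂axi ϑ, 0 < x 0 := by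
  rw [ae_axi_iff]
  exact .of_forall fun x hx => hx

theorem isFiniteMeasure_axi {ϑ : Set Plane} (h : MeasurableSet ϑ) (hb : Bornology.IsBounded ϑ) :
    IsFiniteMeasure (axi ϑ) := by
  constructor
  have h1 : axi ϑ univ ≤ axi ϑ ϑ := measure_mono_ae ((ae_mem_axi h).mono fun x hx _ => hx)
  exact (h1.trans (measure_mono subset_closure)).trans_lt hb.isCompact_closure.measure_lt_top

theorem memLp_axi_of_continuous {E : Type*} [NormedAddCommGroup E] [SecondCountableTopology E]
    [MeasurableSpace E] [BorelSpace E] {ϑ : Set Plane} (h : MeasurableSet ϑ)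
    (hb : Bornology.IsBounded ϑ) {f : Plane → E} (hf : Continuous f) (p : ENNReal) :
    MemLp f p (axi ϑ) := by
  have := isFiniteMeasure_axi h hb
  obtain ⟨C, hC⟩ := hb.isCompact_closure.exists_bound_of_continuousOn hf.continuousOn
  refine MemLp.of_bound hf.aestronglyMeasurable C ?_
  filter_upwards [ae_mem_axi h] with x hx using hC x (subset_closure hx)

theorem norm_sq_Lp {X 𝕜 : Type*} [RCLike 𝕜] [MeasurableSpace X] {μ : Measure X} (f : Lp 𝕜 2 μ) :
    ‖f‖ ^ 2 = ∫ x, ‖f x‖ ^ 2 ∂μ := by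
  have h := inner_self_eq_norm_sq_to_K (𝕜 := 𝕜) f
  rw [MeasureTheory.L2.inner_def] at h
  have e : ∫ x, inner 𝕜 (f x) (f x) ∂μ = ((∫ x, ‖f x‖ ^ 2 ∂μ : ℝ) : 𝕜) := by
    rw [← integral_ofReal]
    refine integral_congr_ae (.of_forall fun x => ?_)
    simp only [inner_self_eq_norm_sq_to_K, RCLike.ofReal_pow]
  rw [e] at h
  exact_mod_cast h.symm

theorem H1.norm_sq {𝕜 : Type} [RCLike 𝕜] {ϑ : Set Plane} (u : H1 𝕜 ϑ) :
    ‖u‖ ^ 2 = ‖H1.fn u‖ ^ 2 + ‖H1.dr u‖ ^ 2 + ‖H1.dz u‖ ^ 2 := by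
  rw [Submodule.coe_norm, PiLp.norm_sq_eq_of_L2, Fin.sum_univ_three]
  rfl

/-- Near a point of the open set the weight stays above half its value there, so Lebesgue measure is
locally dominated by a multiple of `axi ϑ`. -/
theorem locallyIntegrableOn_of_L2 {𝕜 : Type} [RCLike 𝕜] {ϑ : Set Plane} (ho : IsOpen ϑ)
    (hp : ϑ ⊆ {x | 0 < x 0}) (f : L2 𝕜 ϑ) : LocallyIntegrableOn f ϑ volume := by
  intro x hx
  have hx0 : 0 < x 0 := hp hx
  have hopen : IsOpen (ϑ ∩ {y : Plane | x 0 / 2 < y 0}) :=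
    ho.inter (isOpen_lt continuous_const (by fun_prop))
  obtain ⟨ε, hε, hb⟩ := Metric.isOpen_iff.1 hopen x ⟨hx, by simp only [mem_ofPred_eq]; linarith⟩
  refine ⟨Metric.ball x ε, mem_nhdsWithin_of_mem_nhds (Metric.ball_mem_nhds x hε), ?_⟩
  have hle : volume.restrict (Metric.ball x ε) ≤ (ENNReal.ofReal (x 0 / 2))⁻¹ • axi ϑ := by
    refine Measure.le_iff.2 fun s hs => ?_
    unfold axi
    rw [Measure.smul_apply, withDensity_apply _ hs, smul_eq_mul,
      Measure.restrict_restrict hs, Measure.restrict_apply hs, ← one_mul (volume _),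
      ← ENNReal.inv_mul_cancel (a := ENNReal.ofReal (x 0 / 2)) (by simpa using hx0)
        ENNReal.ofReal_ne_top, mul_assoc]
    gcongr
    calc ENNReal.ofReal (x 0 / 2) * volume (s ∩ Metric.ball x ε)
        = ∫⁻ _ in s ∩ Metric.ball x ε, ENNReal.ofReal (x 0 / 2) := by simp
      _ ≤ ∫⁻ y in s ∩ Metric.ball x ε, ENNReal.ofReal (y 0) := by
          refine setLIntegral_mono' (hs.inter measurableSet_ball) fun y hy => ?_
          exact ENNReal.ofReal_le_ofReal (hb hy.2).2.le
      _ ≤ _ := lintegral_mono_set (inter_subset_inter_right _ fun y hy => (hb hy).1)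
  have hm : MemLp f 2 (volume.restrict (Metric.ball x ε)) :=
    ((Lp.memLp f).smul_measure (by simpa using hx0)).mono_measure hle
  have : IsFiniteMeasure (volume.restrict (Metric.ball x ε)) :=
    ⟨by rw [Measure.restrict_apply_univ]; exact measure_ball_lt_top⟩
  exact hm.integrable one_le_two

/-- The fundamental lemma of the calculus of variations, applied to the difference of the two
candidates. -/
theorem IsWeakPartial.unique {𝕜 : Type} [RCLike 𝕜] {ϑ : Set Plane} (ho : IsOpen ϑ)
    (hp : ϑ ⊆ {x | 0 < x 0}) {i : Fin 2} {u g g' : L2 𝕜 ϑ} (h : IsWeakPartial i ϑ u g)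
    (h' : IsWeakPartial i ϑ u g') : g = g' := by
  have key : ∀ᵐ x ∂(volume : Measure Plane), x ∈ ϑ → (g - g') x = 0 := by
    refine ho.ae_eq_zero_of_integral_contDiff_smul_eq_zero
      (locallyIntegrableOn_of_L2 ho hp _) fun φ h1 h2 h3 => ?_
    have ht : IsTest ϑ φ := ⟨h1, h2, fun x hx => ⟨h3 hx, hp (h3 hx)⟩⟩
    obtain ⟨p, hp'⟩ := ht.pairing 𝕜
    have e : ∫ x in ϑ, φ x • (g - g') x = 0 := by
      rw [hp', inner_sub_right, ← hp', ← hp', sub_eq_zero]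
      have := (h φ ht).symm.trans (h' φ ht)
      exact neg_injective this
    rw [← e]
    refine (setIntegral_eq_integral_of_forall_compl_eq_zero fun x hx => ?_).symm
    rw [image_eq_zero_of_notMem_tsupport fun hh => hx (h3 hh), zero_smul]
  rw [← sub_eq_zero]
  refine Lp.ext ?_
  filter_upwards [Lp.coeFn_zero 𝕜 2 (axi ϑ), ae_axi_iff.2
    (((ae_restrict_iff' ho.measurableSet).2 key).mono fun x hx _ => hx)] with x h1 h2
  rw [h1, h2]
  rfl

/-- Since elements of `H1` are recorded as triples, this is what allows approximants known only
through their values to be replaced by `H1.ofContDiff`, whose derivatives are the classical ones. -/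
theorem H1.ext_fn {𝕜 : Type} [RCLike 𝕜] {ϑ : Set Plane} (ho : IsOpen ϑ) (hp : ϑ ⊆ {x | 0 < x 0})
    {u v : H1 𝕜 ϑ} (h : H1.fn u = H1.fn v) : u = v := by
  have h0 : u.1 0 = v.1 0 := h
  refine Subtype.ext (PiLp.ext fun i => ?_)
  fin_cases i
  · exact h0
  · exact IsWeakPartial.unique ho hp u.2.1 (h0 ▸ v.2.1)
  · exact IsWeakPartial.unique ho hp u.2.2 (h0 ▸ v.2.2)

theorem isWeakPartial_of_contDiff {𝕜 : Type} [RCLike 𝕜] {ϑ : Set Plane} {φ : Plane → 𝕜}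
    (hφ : ContDiff ℝ 1 φ) (i : Fin 2) {u g : Plane → 𝕜} (hu : u =ᵐ[axi ϑ] φ)
    (hg : g =ᵐ[axi ϑ] fun x => fderiv ℝ φ x (EuclideanSpace.single i 1)) :
    IsWeakPartial i ϑ u g := by
  intro ψ hψ
  have hsub : tsupport (partialDeriv i ψ) ⊆ tsupport ψ := by
    refine (closure_mono ?_).trans (tsupport_fderiv_subset ℝ (f := ψ))
    intro x hx h
    exact hx (by simp [partialDeriv, h])
  have tr : ∀ {χ : Plane → ℝ} {f f' : Plane → 𝕜}, tsupport χ ⊆ tsupport ψ →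
      f =ᵐ[axi ϑ] f' → ∫ x in ϑ, χ x • f x = ∫ x, χ x • f' x := by
    intro χ f f' hχ hf
    have e1 : ∫ x in ϑ, χ x • f x = ∫ x in ϑ, χ x • f' x := by
      refine integral_congr_ae ?_
      filter_upwards [ae_axi_iff.1 hf] with x hx
      by_cases hp : 0 < x 0
      · rw [hx hp]
      · have : χ x = 0 := image_eq_zero_of_notMem_tsupport fun hh =>
          hp (hψ.support (hχ hh)).2
        simp [this]
    rw [e1]
    refine setIntegral_eq_integral_of_forall_compl_eq_zero fun x hx => ?_
    have : χ x = 0 := image_eq_zero_of_notMem_tsupport fun hh => hx (hψ.support (hχ hh)).1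
    simp [this]
  rw [tr hsub hu, tr subset_rfl hg]
  have hψ1 : ContDiff ℝ 1 ψ := hψ.smooth.of_le (by simp)
  have cd : Continuous fun x => fderiv ℝ φ x (EuclideanSpace.single i 1) :=
    (hφ.continuous_fderiv (by simp)).clm_apply continuous_const
  have cp : Continuous (partialDeriv i ψ) := continuous_partialDeriv hψ1 i
  have sp : HasCompactSupport (partialDeriv i ψ) :=
    hψ.compact.of_isClosed_subset (isClosed_tsupport _) hsub
  have key := integral_smul_fderiv_eq_neg_fderiv_smul_of_integrable (𝕜 := ℝ) (μ := volume)
    (f := ψ) (g := φ) (v := EuclideanSpace.single i 1)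
    ((cp.smul hφ.continuous).integrable_of_hasCompactSupport sp.smul_right)
    ((hψ1.continuous.smul cd).integrable_of_hasCompactSupport hψ.compact.smul_right)
    ((hψ1.continuous.smul hφ.continuous).integrable_of_hasCompactSupport hψ.compact.smul_right)
    (fun x _ => hψ1.differentiable (by simp) x) (fun x _ => hφ.differentiable (by simp) x)
  rw [key, neg_neg]
  rfl

/-- The element of `H¹₁(ϑ)` given by a continuously differentiable function. -/
def H1.ofContDiff {𝕜 : Type} [RCLike 𝕜] {ϑ : Set Plane} (hm : MeasurableSet ϑ)
    (hb : Bornology.IsBounded ϑ) {φ : Plane → 𝕜} (hφ : ContDiff ℝ 1 φ) : H1 𝕜 ϑ :=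
  have cd : ∀ i : Fin 2, Continuous fun x => fderiv ℝ φ x (EuclideanSpace.single i 1) := fun _ =>
    (hφ.continuous_fderiv (by simp)).clm_apply continuous_const
  ⟨WithLp.toLp 2 ![(memLp_axi_of_continuous hm hb hφ.continuous 2).toLp φ,
    (memLp_axi_of_continuous hm hb (cd 0) 2).toLp _,
    (memLp_axi_of_continuous hm hb (cd 1) 2).toLp _],
    isWeakPartial_of_contDiff hφ 0
      (MemLp.coeFn_toLp (memLp_axi_of_continuous hm hb hφ.continuous 2))
      (MemLp.coeFn_toLp (memLp_axi_of_continuous hm hb (cd 0) 2)),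
    isWeakPartial_of_contDiff hφ 1
      (MemLp.coeFn_toLp (memLp_axi_of_continuous hm hb hφ.continuous 2))
      (MemLp.coeFn_toLp (memLp_axi_of_continuous hm hb (cd 1) 2))⟩

section ofContDiff

variable {𝕜 : Type} [RCLike 𝕜] {ϑ : Set Plane} (hm : MeasurableSet ϑ)
    (hb : Bornology.IsBounded ϑ) {φ : Plane → 𝕜} (hφ : ContDiff ℝ 1 φ)

theorem H1.fn_ofContDiff : H1.fn (H1.ofContDiff hm hb hφ) =ᵐ[axi ϑ] φ :=
  MemLp.coeFn_toLp (memLp_axi_of_continuous hm hb hφ.continuous 2)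

theorem H1.dr_ofContDiff : H1.dr (H1.ofContDiff hm hb hφ) =ᵐ[axi ϑ]
    fun x => fderiv ℝ φ x (EuclideanSpace.single 0 1) :=
  MemLp.coeFn_toLp (memLp_axi_of_continuous hm hb
    ((hφ.continuous_fderiv (by simp)).clm_apply continuous_const) 2)

theorem H1.dz_ofContDiff : H1.dz (H1.ofContDiff hm hb hφ) =ᵐ[axi ϑ]
    fun x => fderiv ℝ φ x (EuclideanSpace.single 1 1) :=
  MemLp.coeFn_toLp (memLp_axi_of_continuous hm hb
    ((hφ.continuous_fderiv (by simp)).clm_apply continuous_const) 2)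

include hm hb in
theorem H1.eq_ofContDiff (ho : IsOpen ϑ) (hp : ϑ ⊆ {x | 0 < x 0}) {u : H1 𝕜 ϑ}
    (hu : H1.fn u =ᵐ[axi ϑ] φ) : u = H1.ofContDiff hm hb hφ :=
  H1.ext_fn ho hp (Lp.ext (hu.trans (H1.fn_ofContDiff hm hb hφ).symm))

end ofContDiff

theorem partialDeriv_re {φ : Plane → ℂ} (hφ : ContDiff ℝ 1 φ) (i : Fin 2) (x : Plane) :
    partialDeriv i (fun x => (φ x).re) x = (fderiv ℝ φ x (EuclideanSpace.single i 1)).re := by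
  have h := Complex.reCLM.hasFDerivAt.comp x (hφ.differentiable (by simp) x).hasFDerivAt
  have h2 : HasFDerivAt (fun x => (φ x).re) (Complex.reCLM.comp (fderiv ℝ φ x)) x := h
  rw [partialDeriv, h2.fderiv]
  rfl

theorem partialDeriv_im {φ : Plane → ℂ} (hφ : ContDiff ℝ 1 φ) (i : Fin 2) (x : Plane) :
    partialDeriv i (fun x => (φ x).im) x = (fderiv ℝ φ x (EuclideanSpace.single i 1)).im := by
  have h := Complex.imCLM.hasFDerivAt.comp x (hφ.differentiable (by simp) x).hasFDerivAt
  have h2 : HasFDerivAt (fun x => (φ x).im) (Complex.imCLM.comp (fderiv ℝ φ x)) x := h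
  rw [partialDeriv, h2.fderiv]
  rfl

theorem integrable_energyDensity {ϑ : Set Plane} (hm : MeasurableSet ϑ)
    (hb : Bornology.IsBounded ϑ) {φ : Plane → ℝ} (hφ : ContDiff ℝ 1 φ) :
    Integrable (energyDensity φ) (axi ϑ) :=
  memLp_one_iff_integrable.1 (memLp_axi_of_continuous hm hb (continuous_energyDensity hφ) 1)

theorem H1.norm_sq_ofContDiff {ϑ : Set Plane} (hm : MeasurableSet ϑ)
    (hb : Bornology.IsBounded ϑ) {φ : Plane → ℝ} (hφ : ContDiff ℝ 1 φ) :
    ‖H1.ofContDiff hm hb hφ‖ ^ 2 = ∫ x, energyDensity φ x ∂axi ϑ := by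
  have c0 := continuous_partialDeriv hφ 0
  have c1 := continuous_partialDeriv hφ 1
  have hc := hφ.continuous
  have int : ∀ {f : Plane → ℝ}, Continuous f → Integrable f (axi ϑ) := fun hf =>
    memLp_one_iff_integrable.1 (memLp_axi_of_continuous hm hb hf 1)
  unfold energyDensity
  rw [integral_add (int (by fun_prop)) (int (by fun_prop)),
    integral_add (int (by fun_prop)) (int (by fun_prop)), H1.norm_sq, norm_sq_Lp, norm_sq_Lp,
    norm_sq_Lp]
  congr 1
  · congr 1
    · refine integral_congr_ae ?_
      filter_upwards [H1.fn_ofContDiff hm hb hφ] with x hx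
      rw [hx, Real.norm_eq_abs, sq_abs]
    · refine integral_congr_ae ?_
      filter_upwards [H1.dr_ofContDiff hm hb hφ] with x hx
      rw [hx, Real.norm_eq_abs, sq_abs]
      rfl
  · refine integral_congr_ae ?_
    filter_upwards [H1.dz_ofContDiff hm hb hφ] with x hx
    rw [hx, Real.norm_eq_abs, sq_abs]
    rfl

theorem H1.norm_sq_ofContDiff_complex {ϑ : Set Plane} (hm : MeasurableSet ϑ)
    (hb : Bornology.IsBounded ϑ) {φ : Plane → ℂ} (hφ : ContDiff ℝ 1 φ) :
    ‖H1.ofContDiff hm hb hφ‖ ^ 2 = ∫ x, energyDensity (fun x => (φ x).re) x ∂axi ϑ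
      + ∫ x, energyDensity (fun x => (φ x).im) x ∂axi ϑ := by
  have hre : ContDiff ℝ 1 fun x => (φ x).re := Complex.reCLM.contDiff.comp hφ
  have him : ContDiff ℝ 1 fun x => (φ x).im := Complex.imCLM.contDiff.comp hφ
  have c0 : ∀ i : Fin 2, Continuous fun x => fderiv ℝ φ x (EuclideanSpace.single i 1) := fun _ =>
    (hφ.continuous_fderiv (by simp)).clm_apply continuous_const
  have d0 := c0 0
  have d1 := c0 1
  have hc := hφ.continuous
  have int : ∀ {f : Plane → ℝ}, Continuous f → Integrable f (axi ϑ) := fun hf =>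
    memLp_one_iff_integrable.1 (memLp_axi_of_continuous hm hb hf 1)
  have e : ∀ {f g : Plane → ℂ}, f =ᵐ[axi ϑ] g → ∫ x, ‖f x‖ ^ 2 ∂axi ϑ = ∫ x, ‖g x‖ ^ 2 ∂axi ϑ :=
    fun h => integral_congr_ae (h.mono fun x hx => by simp only [hx])
  rw [← integral_add (integrable_energyDensity hm hb hre) (integrable_energyDensity hm hb him),
    H1.norm_sq, norm_sq_Lp, norm_sq_Lp, norm_sq_Lp, e (H1.fn_ofContDiff hm hb hφ),
    e (H1.dr_ofContDiff hm hb hφ), e (H1.dz_ofContDiff hm hb hφ),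
    ← integral_add (int (by fun_prop)) (int (by fun_prop)),
    ← integral_add (int (by fun_prop)) (int (by fun_prop))]
  refine integral_congr_ae (.of_forall fun x => ?_)
  simp only [energyDensity, partialDeriv_re hφ, partialDeriv_im hφ, Complex.sq_norm,
    Complex.normSq_apply]
  ring

/-! ## Embedding and trace theorems on polygonal sets -/

theorem axi_le_of_null {s U : Set Plane} (h : volume (s \ U) = 0) : axi s ≤ axi U := by
  have hs : s ≤ᵐ[volume] U := by
    rw [ae_le_set]
    exact h
  refine Measure.le_iff.2 fun t ht => ?_
  unfold axi
  rw [withDensity_apply _ ht, withDensity_apply _ ht]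
  exact lintegral_mono' (Measure.restrict_mono_measure (Measure.restrict_mono' hs le_rfl) t) le_rfl

theorem axi_le_sum {ι : Type} [Countable ι] {U : Set Plane} {s : ι → Set Plane}
    (h : U ⊆ ⋃ i, s i) : axi U ≤ Measure.sum fun i => axi (s i) := by
  refine (axi_mono h).trans (Measure.le_iff.2 fun t ht => ?_)
  rw [Measure.sum_apply _ ht]
  unfold axi
  simp only [withDensity_apply _ ht, Measure.restrict_restrict ht, inter_iUnion]
  exact lintegral_iUnion_le _ _

theorem nonneg_of_mem_closure {U : Set Plane} (hp : U ⊆ {x | 0 < x 0}) {x : Plane}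
    (hx : x ∈ closure U) : 0 ≤ x 0 := by
  have : IsClosed {x : Plane | 0 ≤ x 0} := isClosed_le continuous_const (by fun_prop)
  refine closure_minimal (t := {x : Plane | 0 ≤ x 0}) (fun y hy => ?_) this hx
  have h1 : 0 < y 0 := hp hy
  exact by simpa only [mem_ofPred_eq] using h1.le

theorem IsPolygonal.isOpen {U : Set Plane} (h : IsPolygonal U) : IsOpen U := by
  obtain ⟨n, p, -, rfl⟩ := h
  exact isOpen_interior

/-- Elements of `H¹₁(ϑ)` that are limits of functions in `C¹(ℝ²)`. -/
def H1.Approximable {𝕜 : Type} [RCLike 𝕜] {ϑ : Set Plane}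
    (u : H1 𝕜 ϑ) : Prop :=
  ∃ (φ : ℕ → Plane → 𝕜) (V : ℕ → H1 𝕜 ϑ), (∀ n, ContDiff ℝ 1 (φ n)) ∧
    (∀ n, H1.fn (V n) =ᵐ[axi ϑ] φ n) ∧ Tendsto V atTop (𝓝 u)

section Sobolev

variable {U : Set Plane} (h : IsPolygonal U) (hp : U ⊆ {x | 0 < x 0})
  (hb : Bornology.IsBounded U)

include h hp hb

/-- The parallelograms cover `U` and each is contained in it up to a null set, so their inequalities
can be added; overlaps only enlarge the constant. -/
theorem exists_sobolev : ∃ C : ℝ, 0 ≤ C ∧ ∀ φ : Plane → ℝ, ContDiff ℝ 1 φ →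
    ∫ x, φ x ^ 6 ∂axi U ≤ C * (∫ x, energyDensity φ x ∂axi U) ^ 3 := by
  obtain ⟨ι, _, a, d, e, hli, hcl, hnull, hcov, -⟩ := h.exists_cells
  have hr : ∀ i, ∀ x ∈ cell (a i) (d i) (e i), 0 ≤ x 0 := fun i x hx =>
    nonneg_of_mem_closure hp (hcl i hx)
  choose C hC0 hC using fun i => exists_sobolev_cell (hli i) (hr i)
  refine ⟨∑ i, C i, Finset.sum_nonneg fun i _ => hC0 i, fun φ hφ => ?_⟩
  have hm := h.isOpen.measurableSet
  have int6 : ∀ i, Integrable (fun x => φ x ^ 6) (axi (cell (a i) (d i) (e i))) := fun i =>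
    memLp_one_iff_integrable.1 (memLp_axi_of_continuous (isCompact_cell _ _ _).measurableSet
      (isCompact_cell _ _ _).isBounded (hφ.continuous.pow 6) 1)
  have hsum : Integrable (fun x => φ x ^ 6)
      (Measure.sum fun i => axi (cell (a i) (d i) (e i))) := by
    rw [Measure.sum_fintype]
    exact integrable_finsetSum_measure.2 fun i _ => int6 i
  calc ∫ x, φ x ^ 6 ∂axi U
      ≤ ∫ x, φ x ^ 6 ∂(Measure.sum fun i => axi (cell (a i) (d i) (e i))) :=
        integral_mono_measure (axi_le_sum hcov)
          (.of_forall fun x => (by decide : Even 6).pow_nonneg _) hsum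
    _ = ∑ i, ∫ x, φ x ^ 6 ∂axi (cell (a i) (d i) (e i)) := by
        rw [Measure.sum_fintype, integral_finsetSum_measure fun i _ => int6 i]
    _ ≤ ∑ i, C i * (∫ x, energyDensity φ x ∂axi U) ^ 3 := by
        refine Finset.sum_le_sum fun i _ => (hC i φ hφ).trans ?_
        refine mul_le_mul_of_nonneg_left (pow_le_pow_left₀
          (integral_nonneg fun x => energyDensity_nonneg φ x) ?_ 3) (hC0 i)
        exact integral_mono_measure (axi_le_of_null (hnull i))
          (.of_forall fun x => energyDensity_nonneg φ x) (integrable_energyDensity hm hb hφ)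
    _ = _ := by rw [Finset.sum_mul]

-- The bound passes from `C¹` functions to their limits by Fatou's lemma along an almost everywhere
-- convergent subsequence.
omit h in
theorem eLpNorm_six_le_of_contDiff (ho : IsOpen U) {𝕜 : Type} [RCLike 𝕜] {C : ℝ} (hC0 : 0 ≤ C)
    (hC : ∀ (φ : Plane → 𝕜) (hφ : ContDiff ℝ 1 φ),
      ∫ x, ‖φ x‖ ^ 6 ∂axi U ≤ C * ‖H1.ofContDiff ho.measurableSet hb hφ‖ ^ 6)
    {u : H1 𝕜 U} (hu : H1.Approximable u) :
    eLpNorm (H1.fn u) 6 (axi U) ≤ ENNReal.ofReal (C ^ (6⁻¹ : ℝ) * ‖u‖) := by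
  obtain ⟨φ, V, h1, h2, h3⟩ := hu
  have bd : ∀ n, eLpNorm (H1.fn (V n)) 6 (axi U) ≤ ENNReal.ofReal (C ^ (6⁻¹ : ℝ) * ‖V n‖) := by
    intro n
    rw [eLpNorm_congr_ae (h2 n), MemLp.eLpNorm_eq_integral_rpow_norm (by simp) (by simp)
      (memLp_axi_of_continuous ho.measurableSet hb (h1 n).continuous 6)]
    refine ENNReal.ofReal_le_ofReal ?_
    have e1 := hC (φ n) (h1 n)
    rw [← H1.eq_ofContDiff ho.measurableSet hb (h1 n) ho hp (h2 n)] at e1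
    have e2 : ∫ x, ‖φ n x‖ ^ (ENNReal.toReal 6) ∂axi U = ∫ x, ‖φ n x‖ ^ 6 ∂axi U := by
      refine integral_congr_ae (.of_forall fun x => ?_)
      simp only [ENNReal.toReal_ofNat]
      exact_mod_cast Real.rpow_natCast ‖φ n x‖ 6
    rw [e2, ENNReal.toReal_ofNat]
    calc (∫ x, ‖φ n x‖ ^ 6 ∂axi U) ^ (6⁻¹ : ℝ) ≤ (C * ‖V n‖ ^ 6) ^ (6⁻¹ : ℝ) :=
          Real.rpow_le_rpow (integral_nonneg fun x => by positivity) e1 (by norm_num)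
      _ = C ^ (6⁻¹ : ℝ) * ‖V n‖ := by
          rw [Real.mul_rpow hC0 (by positivity)]
          congr 1
          have := Real.pow_rpow_inv_natCast (norm_nonneg (V n)) (n := 6) (by norm_num)
          exact_mod_cast this
  have h4 : Tendsto (fun n => H1.fn (V n)) atTop (𝓝 (H1.fn u)) := by
    have hc : Continuous fun v : H1 𝕜 U => H1.fn v := by
      unfold H1.fn
      fun_prop
    exact (hc.tendsto u).comp h3
  obtain ⟨ns, hns, hae⟩ := (tendstoInMeasure_of_tendsto_Lp h4).exists_seq_tendsto_ae
  have h5 : Tendsto (fun k => ENNReal.ofReal (C ^ (6⁻¹ : ℝ) * ‖V (ns k)‖)) atTop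
      (𝓝 (ENNReal.ofReal (C ^ (6⁻¹ : ℝ) * ‖u‖))) :=
    ENNReal.tendsto_ofReal (((h3.comp hns.tendsto_atTop).norm).const_mul _)
  calc eLpNorm (H1.fn u) 6 (axi U)
      ≤ liminf (fun k => eLpNorm (H1.fn (V (ns k))) 6 (axi U)) atTop :=
        Lp.eLpNorm_lim_le_liminf_eLpNorm (fun k => Lp.aestronglyMeasurable _) _ hae
    _ ≤ liminf (fun k => ENNReal.ofReal (C ^ (6⁻¹ : ℝ) * ‖V (ns k)‖)) atTop :=
        liminf_le_liminf (.of_forall fun k => bd _)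
    _ = _ := h5.liminf_eq

theorem exists_embedding_real : ∃ K : ℝ, 0 ≤ K ∧ ∀ u : H1 ℝ U, H1.Approximable u →
    eLpNorm (H1.fn u) 6 (axi U) ≤ ENNReal.ofReal (K * ‖u‖) := by
  obtain ⟨C, hC0, hC⟩ := exists_sobolev h hp hb
  refine ⟨C ^ (6⁻¹ : ℝ), by positivity, fun u hu =>
    eLpNorm_six_le_of_contDiff hp hb h.isOpen hC0 (fun φ hφ => ?_) hu⟩
  have := hC φ hφ
  rw [← H1.norm_sq_ofContDiff h.isOpen.measurableSet hb hφ, ← pow_mul] at this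
  simpa only [Real.norm_eq_abs, (by decide : Even 6).pow_abs] using this

theorem exists_embedding_complex : ∃ K : ℝ, 0 ≤ K ∧ ∀ u : H1 ℂ U, H1.Approximable u →
    eLpNorm (H1.fn u) 6 (axi U) ≤ ENNReal.ofReal (K * ‖u‖) := by
  obtain ⟨C, hC0, hC⟩ := exists_sobolev h hp hb
  -- The `4` comes from `(a + b)³ ≤ 4 (a³ + b³)` for the squares of the real and the imaginary part.
  refine ⟨(4 * C) ^ (6⁻¹ : ℝ), by positivity, fun u hu =>
    eLpNorm_six_le_of_contDiff hp hb h.isOpen (C := 4 * C) (by positivity) (fun φ hφ => ?_) hu⟩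
  have hre : ContDiff ℝ 1 fun x => (φ x).re := Complex.reCLM.contDiff.comp hφ
  have him : ContDiff ℝ 1 fun x => (φ x).im := Complex.imCLM.contDiff.comp hφ
  have h1 := hC _ hre
  have h2 := hC _ him
  have int : ∀ {f : Plane → ℝ}, Continuous f → Integrable f (axi U) := fun hf =>
    memLp_one_iff_integrable.1 (memLp_axi_of_continuous h.isOpen.measurableSet hb hf 1)
  have cre := hre.continuous
  have cim := him.continuous
  have h3 : ∫ x, ‖φ x‖ ^ 6 ∂axi U ≤
      4 * (∫ x, (φ x).re ^ 6 ∂axi U + ∫ x, (φ x).im ^ 6 ∂axi U) := by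
    rw [← integral_add (int (by fun_prop)) (int (by fun_prop)), ← integral_const_mul]
    refine integral_mono (int (by have := hφ.continuous; fun_prop)) (int (by fun_prop))
      fun x => ?_
    have e : ‖φ x‖ ^ 6 = ((φ x).re ^ 2 + (φ x).im ^ 2) ^ 3 := by
      rw [show (6 : ℕ) = 2 * 3 from rfl, pow_mul, Complex.sq_norm, Complex.normSq_apply]
      ring
    simp only
    rw [e]
    have := add_pow_le (sq_nonneg (φ x).re) (sq_nonneg (φ x).im) 3
    calc _ ≤ _ := this
      _ = _ := by ring
  have e := H1.norm_sq_ofContDiff_complex h.isOpen.measurableSet hb hφ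
  rw [show (6 : ℕ) = 2 * 3 from rfl, pow_mul, e]
  set p := ∫ x, energyDensity (fun x => (φ x).re) x ∂axi U
  set q := ∫ x, energyDensity (fun x => (φ x).im) x ∂axi U
  have p0 : 0 ≤ p := integral_nonneg fun x => energyDensity_nonneg _ x
  have q0 : 0 ≤ q := integral_nonneg fun x => energyDensity_nonneg _ x
  have h4 : p ^ 3 + q ^ 3 ≤ (p + q) ^ 3 := by
    have : 0 ≤ p * q * (p + q) := by positivity
    nlinarith
  calc ∫ x, ‖φ x‖ ^ 6 ∂axi U ≤ 4 * (C * p ^ 3 + C * q ^ 3) := by linarith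
    _ = 4 * C * (p ^ 3 + q ^ 3) := by ring
    _ ≤ 4 * C * (p + q) ^ 3 := by gcongr

-- The edge is the image of the unit interval under a map with Lipschitz constant `‖d‖`, and a
-- Lipschitz map enlarges one-dimensional Hausdorff measure at most by its constant. An inequality
-- is enough for trace bounds.
omit h hp hb in
theorem exists_restrict_hausdorff_edge_le (a d e : Plane) : ∃ K : NNReal,
    (Measure.hausdorffMeasure 1 : Measure Plane).restrict
      ((fun s : ℝ => cellMap a d e (s, 0)) '' Icc 0 1) ≤
    K • unitMeasure.map (fun s : ℝ => cellMap a d e (s, 0)) := by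
  have hlip : LipschitzWith ‖d‖₊ (fun s : ℝ => cellMap a d e (s, 0)) := by
    refine LipschitzWith.of_dist_le_mul fun s t => ?_
    simp only [cellMap, zero_smul, add_zero, dist_eq_norm, add_sub_add_left_eq_sub, ← sub_smul,
      norm_smul, coe_nnnorm]
    rw [mul_comm]
  refine ⟨‖d‖₊, Measure.le_iff.2 fun t ht => ?_⟩
  rw [Measure.restrict_apply ht, Measure.smul_apply,
    Measure.map_apply hlip.continuous.measurable ht,
    Measure.restrict_apply (hlip.continuous.measurable ht), inter_comm,
    ← image_inter_preimage]
  refine (hlip.lipschitzOnWith.hausdorffMeasure_image_le zero_le_one).trans (le_of_eq ?_)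
  rw [hausdorffMeasure_real, ENNReal.rpow_one, inter_comm]
  rfl

/-- The boundary is covered by sides of the parallelograms, and the trace inequalities there add up.
With the lower integral no integrability on the boundary has to be known beforehand; the case `φ =
1` shows afterwards that the boundary has finite measure. -/
theorem exists_trace_contDiff : ∃ C : ℝ, 0 ≤ C ∧ ∀ φ : Plane → ℝ, ContDiff ℝ 1 φ →
    ∫⁻ x, ENNReal.ofReal (φ x ^ 2) ∂axiCurve (frontier U) ≤
      ENNReal.ofReal (C * ∫ x, energyDensity φ x ∂axi U) := by
  obtain ⟨ι, _, a, d, e, hli, hcl, hnull, -, hfr⟩ := h.exists_cells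
  have hr : ∀ i, ∀ x ∈ cell (a i) (d i) (e i), 0 ≤ x 0 := fun i x hx =>
    nonneg_of_mem_closure hp (hcl i hx)
  choose C hC0 hC using fun i => exists_trace_cell (hli i) (hr i)
  choose K hK using fun i => exists_restrict_hausdorff_edge_le (a i) (d i) (e i)
  refine ⟨∑ i, K i * C i, Finset.sum_nonneg fun i _ => mul_nonneg (K i).2 (hC0 i),
    fun φ hφ => ?_⟩
  have hm := h.isOpen.measurableSet
  have hφc := hφ.continuous
  set E := ∫ x, energyDensity φ x ∂axi U
  have hE : 0 ≤ E := integral_nonneg fun x => energyDensity_nonneg φ x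
  have edge : ∀ i, ∫⁻ x in (fun s : ℝ => cellMap (a i) (d i) (e i) (s, 0)) '' Icc 0 1,
      ENNReal.ofReal (x 0) * ENNReal.ofReal (φ x ^ 2) ∂Measure.hausdorffMeasure 1 ≤
      ENNReal.ofReal (K i * C i * E) := by
    intro i
    have hc : Continuous fun s : ℝ => cellMap (a i) (d i) (e i) (s, 0) :=
      (continuous_cellMap _ _ _).comp (by fun_prop)
    refine (lintegral_mono' (hK i) le_rfl).trans ?_
    rw [lintegral_smul_measure, lintegral_map (by fun_prop) hc.measurable, mul_assoc,
      ENNReal.ofReal_mul (p := (K i : ℝ)) (K i).2]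
    have e1 : (K i : ENNReal) = ENNReal.ofReal (K i : ℝ) := by simp
    rw [ENNReal.smul_def, smul_eq_mul, e1]
    gcongr
    have e2 : ∫⁻ s, ENNReal.ofReal (cellMap (a i) (d i) (e i) (s, 0) 0) *
        ENNReal.ofReal (φ (cellMap (a i) (d i) (e i) (s, 0)) ^ 2) ∂unitMeasure
        = ∫⁻ s, ENNReal.ofReal (cellMap (a i) (d i) (e i) (s, 0) 0 *
          φ (cellMap (a i) (d i) (e i) (s, 0)) ^ 2) ∂unitMeasure := by
      refine setLIntegral_congr_fun measurableSet_Icc fun s hs => ?_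
      exact (ENNReal.ofReal_mul (hr i _ (cellMap_mem hs (by simp)))).symm
    rw [e2, ← ofReal_integral_eq_lintegral_ofReal]
    · refine ENNReal.ofReal_le_ofReal ((hC i φ hφ).trans ?_)
      refine mul_le_mul_of_nonneg_left ?_ (hC0 i)
      exact integral_mono_measure (axi_le_of_null (hnull i))
          (.of_forall fun x => energyDensity_nonneg φ x) (integrable_energyDensity hm hb hφ)
    · exact integrable_unit (by fun_prop)
    · refine (ae_restrict_iff' measurableSet_Icc).2 (.of_forall fun s hs => ?_)
      exact mul_nonneg (hr i _ (cellMap_mem hs (by simp))) (sq_nonneg _)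
  unfold axiCurve
  rw [lintegral_withDensity_eq_lintegral_mul _ (by fun_prop) (by fun_prop)]
  calc ∫⁻ x in frontier U, ENNReal.ofReal (x 0) * ENNReal.ofReal (φ x ^ 2)
        ∂Measure.hausdorffMeasure 1
      ≤ ∫⁻ x in ⋃ i, (fun s : ℝ => cellMap (a i) (d i) (e i) (s, 0)) '' Icc 0 1,
        ENNReal.ofReal (x 0) * ENNReal.ofReal (φ x ^ 2) ∂Measure.hausdorffMeasure 1 :=
        lintegral_mono_set hfr
    _ ≤ ∑' i, ∫⁻ x in (fun s : ℝ => cellMap (a i) (d i) (e i) (s, 0)) '' Icc 0 1,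
        ENNReal.ofReal (x 0) * ENNReal.ofReal (φ x ^ 2) ∂Measure.hausdorffMeasure 1 :=
        lintegral_iUnion_le _ _
    _ ≤ ∑' i, ENNReal.ofReal (K i * C i * E) := ENNReal.tsum_le_tsum edge
    _ = _ := by
        rw [tsum_fintype, ← ENNReal.ofReal_sum_of_nonneg, Finset.sum_mul]
        exact fun i _ => mul_nonneg (mul_nonneg (K i).2 (hC0 i)) hE

omit h hp hb in
theorem axiCurve_mono {S S' : Set Plane} (hS : S ⊆ S') : axiCurve S ≤ axiCurve S' :=
  Measure.le_iff.2 fun t ht => by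
    unfold axiCurve
    rw [withDensity_apply _ ht, withDensity_apply _ ht]
    exact lintegral_mono' (Measure.restrict_mono_measure
      (Measure.restrict_mono hS le_rfl) t) le_rfl

theorem isFiniteMeasure_axiCurve {S : Set Plane} (hS : S ⊆ frontier U) :
    IsFiniteMeasure (axiCurve S) := by
  obtain ⟨C, hC0, hC⟩ := exists_trace_contDiff h hp hb
  constructor
  have := hC (fun _ => 1) contDiff_const
  simp only [one_pow, ENNReal.ofReal_one, lintegral_const, one_mul] at this
  exact ((axiCurve_mono hS) univ).trans_lt (this.trans_lt ENNReal.ofReal_lt_top)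

/-- The trace operator is bounded. -/
theorem exists_trace_bound : ∃ C : ℝ, 0 ≤ C ∧ ∀ S ⊆ frontier U, ∀ (u : H1 ℝ U) (g : L2Curve ℝ S),
    IsTrace S u g → ‖g‖ ≤ C * ‖u‖ := by
  obtain ⟨C, hC0, hC⟩ := exists_trace_contDiff h hp hb
  refine ⟨√C, Real.sqrt_nonneg _, fun S hS u g hg => ?_⟩
  obtain ⟨φ, V, g', h1, h2, h3, h4, h5⟩ := hg
  have hm := h.isOpen.measurableSet
  have bd : ∀ n, ‖g' n‖ ≤ √C * ‖V n‖ := by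
    intro n
    refine abs_le_of_sq_le_sq' (b := √C * ‖V n‖) ?_ (by positivity) |>.2
    rw [mul_pow, Real.sq_sqrt hC0, norm_sq_Lp, H1.eq_ofContDiff hm hb (h1 n) h.isOpen hp (h2 n),
      H1.norm_sq_ofContDiff]
    have e1 : ∫ x, ‖g' n x‖ ^ 2 ∂axiCurve S = ∫ x, φ n x ^ 2 ∂axiCurve S := by
      refine integral_congr_ae ?_
      filter_upwards [h3 n] with x hx
      rw [hx, Real.norm_eq_abs, sq_abs]
    rw [e1, integral_eq_lintegral_of_nonneg_ae (.of_forall fun x => sq_nonneg _)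
      ((h1 n).continuous.pow 2).aestronglyMeasurable]
    refine ENNReal.toReal_le_of_le_ofReal (mul_nonneg hC0 (integral_nonneg fun x =>
      energyDensity_nonneg _ x)) ?_
    exact (lintegral_mono' (axiCurve_mono hS) le_rfl).trans (hC _ (h1 n))
  exact le_of_tendsto_of_tendsto h5.norm (h4.norm.const_mul _) (.of_forall bd)

end Sobolev

/-! ## Traces of finite element functions -/

/-- Convolution with a bump supported in the ball of radius `ε`. By the last clause the gradient is
exact wherever `F` is affine on a slightly larger ball, so for piecewise linear functions the
gradients converge pointwise almost everywhere without any differentiability theorem for Lipschitz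
functions. -/
theorem exists_mollification {F : Plane → ℝ} {K : NNReal} (hF : LipschitzWith K F) {ε : ℝ}
    (hε : 0 < ε) : ∃ φ : Plane → ℝ, ContDiff ℝ 1 φ ∧ LipschitzWith K φ ∧
      (∀ x, |φ x - F x| ≤ K * ε) ∧
      ∀ (x : Plane) (L : Plane →L[ℝ] ℝ) (c : ℝ),
        (∀ y ∈ Metric.ball x (2 * ε), F y = L y + c) → fderiv ℝ φ x = L := by
  let ρ : ContDiffBump (0 : Plane) := ⟨ε / 2, ε, by positivity, by linarith⟩
  set w : Plane → ℝ := ρ.normed volume with hw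
  have wc : Continuous w := ρ.continuous_normed
  have ws : HasCompactSupport w := ρ.hasCompactSupport_normed
  have w0 : ∀ x, 0 ≤ w x := fun x => ρ.nonneg_normed x
  have w1 : ∫ x, w x = 1 := ρ.integral_normed
  set φ : Plane → ℝ := convolution w F (ContinuousLinearMap.lsmul ℝ ℝ) volume with hφ
  have hval : ∀ x, φ x = ∫ t, w t * F (x - t) := fun x => rfl
  have int : ∀ {g : Plane → ℝ}, Continuous g → Integrable (fun t => w t * g t) := fun hg =>
    (wc.mul hg).integrable_of_hasCompactSupport ws.mul_right
  have intF : ∀ x, Integrable fun t => w t * F (x - t) := fun x =>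
    int (hF.continuous.comp (by fun_prop))
  refine ⟨φ, ?_, ?_, fun x => ?_, fun x L c hx => ?_⟩
  · exact ws.contDiff_convolution_left _ ρ.contDiff_normed hF.continuous.locallyIntegrable
  · refine LipschitzWith.of_dist_le_mul fun x y => ?_
    rw [hval, hval, Real.dist_eq, ← integral_sub (intF x) (intF y)]
    calc |∫ t, (w t * F (x - t) - w t * F (y - t))|
        ≤ ∫ t, w t * (K * dist x y) := by
          refine (abs_integral_le_integral_abs).trans (integral_mono
            ((intF x).sub (intF y)).abs (int continuous_const) fun t => ?_)
          simp only [← mul_sub, abs_mul, abs_of_nonneg (w0 t)]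
          refine mul_le_mul_of_nonneg_left ?_ (w0 t)
          have := hF.dist_le_mul (x - t) (y - t)
          rwa [dist_sub_right, Real.dist_eq] at this
      _ = K * dist x y := by rw [integral_mul_const, w1, one_mul]
  · have := ρ.dist_normed_convolution_le (μ := volume) (g := F) (x₀ := x) (ε := K * ε)
      hF.continuous.aestronglyMeasurable fun y hy => by
        have h1 := hF.dist_le_mul y x
        have h2 : dist y x ≤ ε := (Metric.mem_ball.1 hy).le
        exact h1.trans (by gcongr)
    rwa [Real.dist_eq] at this
  -- Averaging an affine function over translates changes only its constant term.
  · have hev : φ =ᶠ[𝓝 x] fun y => L y + (c - ∫ t, w t * L t) := by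
      filter_upwards [Metric.ball_mem_nhds x hε] with y hy
      have e : ∀ t, w t * F (y - t) = w t * (L y + c) - w t * L t := by
        intro t
        by_cases ht : w t = 0
        · simp [ht]
        · have ht' : t ∈ Metric.ball (0 : Plane) ε := by
            have : t ∈ Function.support (ρ.normed volume) := ht
            rwa [ρ.support_normed_eq] at this
          have hyt : y - t ∈ Metric.ball x (2 * ε) := by
            rw [mem_ball_zero_iff] at ht'
            rw [mem_ball_iff_norm] at hy ⊢
            calc ‖y - t - x‖ = ‖(y - x) - t‖ := by congr 1; abel
              _ ≤ ‖y - x‖ + ‖t‖ := norm_sub_le _ _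
              _ < 2 * ε := by linarith
          rw [hx _ hyt, map_sub]
          ring
      rw [hval]
      simp only [e]
      rw [integral_sub (int continuous_const) (int L.continuous), integral_mul_const, w1]
      ring
    rw [hev.fderiv_eq, fderiv_add_const]
    exact L.fderiv

/-- The function `F` is affine in a neighbourhood of `x`. -/
def LocallyAffineAt (F : Plane → ℝ) (x : Plane) : Prop :=
  ∃ (L : Plane →L[ℝ] ℝ) (c : ℝ), ∀ᶠ y in 𝓝 x, F y = L y + c

theorem tendsto_L2_of_bounded {𝕜 : Type} [RCLike 𝕜] {ϑ : Set Plane} (hm : MeasurableSet ϑ)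
    (hb : Bornology.IsBounded ϑ) {f : ℕ → L2 𝕜 ϑ} {g : L2 𝕜 ϑ} {C : ℝ}
    (hC : ∀ n, ∀ᵐ x ∂axi ϑ, ‖f n x - g x‖ ≤ C)
    (h : ∀ᵐ x ∂axi ϑ, Tendsto (fun n => f n x) atTop (𝓝 (g x))) : Tendsto f atTop (𝓝 g) := by
  have := isFiniteMeasure_axi hm hb
  rw [tendsto_iff_norm_sub_tendsto_zero]
  have key : Tendsto (fun n => ∫ x, ‖f n x - g x‖ ^ 2 ∂axi ϑ) atTop (𝓝 (∫ _, 0 ∂axi ϑ)) := by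
    refine tendsto_integral_of_dominated_convergence (fun _ => C ^ 2) (fun n => ?_)
      (integrable_const _) (fun n => ?_) ?_
    · exact ((Lp.aestronglyMeasurable _).sub (Lp.aestronglyMeasurable _)).norm.pow 2
    · filter_upwards [hC n] with x hx
      rw [Real.norm_eq_abs, abs_of_nonneg (by positivity)]
      gcongr
    · filter_upwards [h] with x hx
      have := ((hx.sub_const (g x)).norm).pow 2
      simpa using this
  rw [integral_zero] at key
  have e : ∀ n, ‖f n - g‖ = √(∫ x, ‖f n x - g x‖ ^ 2 ∂axi ϑ) := by
    intro n
    rw [← Real.sqrt_sq (norm_nonneg (f n - g)), norm_sq_Lp]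
    congr 1
    refine integral_congr_ae ?_
    filter_upwards [Lp.coeFn_sub (f n) g] with x hx
    rw [hx]
    rfl
  simp only [e]
  simpa using key.sqrt

theorem tendsto_H1 {𝕜 : Type} [RCLike 𝕜] {ϑ : Set Plane} {ι : Type*} {l : Filter ι}
    {V : ι → H1 𝕜 ϑ} {u : H1 𝕜 ϑ} (h0 : Tendsto (fun n => H1.fn (V n)) l (𝓝 (H1.fn u)))
    (h1 : Tendsto (fun n => H1.dr (V n)) l (𝓝 (H1.dr u)))
    (h2 : Tendsto (fun n => H1.dz (V n)) l (𝓝 (H1.dz u))) : Tendsto V l (𝓝 u) := by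
  rw [tendsto_subtype_rng, (PiLp.homeomorph 2 (fun _ : Fin 3 => L2 𝕜 ϑ)).isInducing.tendsto_nhds_iff,
    tendsto_pi_nhds]
  intro i
  fin_cases i
  · exact h0
  · exact h1
  · exact h2

theorem IsWeakPartial.of_tendsto {𝕜 : Type} [RCLike 𝕜] {ϑ : Set Plane} {i : Fin 2}
    {u g : ℕ → L2 𝕜 ϑ} {u₀ g₀ : L2 𝕜 ϑ} (h : ∀ n, IsWeakPartial i ϑ (u n) (g n))
    (hu : Tendsto u atTop (𝓝 u₀)) (hg : Tendsto g atTop (𝓝 g₀)) : IsWeakPartial i ϑ u₀ g₀ := by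
  obtain ⟨S, hc, hS⟩ := isWeakPartial_iff (𝕜 := 𝕜) i ϑ
  rw [hS]
  exact hc.mem_of_tendsto (hu.prodMk_nhds hg) (.of_forall fun n => (hS _ _).1 (h n))

theorem isBounded_frontier {U : Set Plane} (hb : Bornology.IsBounded U) :
    Bornology.IsBounded (frontier U) :=
  hb.closure.subset frontier_subset_closure

/-- The mollifications of `F` at scale `1 / (n + 1)` are the required `C¹` approximants. Their
gradients are bounded by `K` and converge almost everywhere, hence in `L²₁` on the bounded set `U`;
on the boundary, which has finite measure, the convergence is uniform. -/
theorem exists_trace_of_lipschitz {U : Set Plane} (h : IsPolygonal U) (hp : U ⊆ {x | 0 < x 0})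
    (hb : Bornology.IsBounded U) {F : Plane → ℝ} {K : NNReal} (hF : LipschitzWith K F)
    (haff : ∀ᵐ x ∂axi U, LocallyAffineAt F x) {u : H1 ℝ U} (hu : H1.fn u =ᵐ[axi U] F)
    {S : Set Plane} (hS : S ⊆ frontier U) (hSm : MeasurableSet S) :
    ∃ γ : L2Curve ℝ S, IsTrace S u γ := by
  have hm := h.isOpen.measurableSet
  have fin := isFiniteMeasure_axiCurve h hp hb hS
  have fin' := isFiniteMeasure_axi hm hb
  have hε : ∀ n : ℕ, (0 : ℝ) < 1 / (n + 1) := fun n => by positivity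
  have hε0 := tendsto_one_div_add_atTop_nhds_zero_nat (𝕜 := ℝ)
  choose φ h1 h2 h3 h4 using fun n : ℕ => exists_mollification hF (hε n)
  have hconv : ∀ x, Tendsto (fun n => φ n x) atTop (𝓝 (F x)) := by
    intro x
    rw [tendsto_iff_dist_tendsto_zero]
    refine squeeze_zero (fun _ => dist_nonneg) (fun n => h3 n x) ?_
    simpa using hε0.const_mul (K : ℝ)
  have hder : ∀ᵐ x ∂axi U, ∀ i : Fin 2, Tendsto (fun n => fderiv ℝ (φ n) x
      (EuclideanSpace.single i 1)) atTop (𝓝 (fderiv ℝ F x (EuclideanSpace.single i 1))) := by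
    filter_upwards [haff] with x hx i
    obtain ⟨L, c, hL⟩ := hx
    obtain ⟨δ, hδ, hball⟩ := Metric.eventually_nhds_iff_ball.1 hL
    have eF : fderiv ℝ F x = L := by
      have : F =ᶠ[𝓝 x] fun y => L y + c := hL
      rw [this.fderiv_eq, fderiv_add_const]
      exact L.fderiv
    refine tendsto_const_nhds.congr' ?_
    have hlt : ∀ᶠ n : ℕ in atTop, 1 / ((n : ℝ) + 1) < δ / 2 :=
      hε0.eventually (gt_mem_nhds (by positivity))
    filter_upwards [hlt] with n hn
    rw [h4 n x L c fun y hy => hball y (Metric.ball_subset_ball (by linarith) hy), eF]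
  have dbd : ∀ {f : Plane → ℝ}, LipschitzWith K f → ∀ x (i : Fin 2),
      ‖fderiv ℝ f x (EuclideanSpace.single i 1)‖ ≤ K := fun hf x i => by
    refine ((fderiv ℝ _ x).le_opNorm _).trans ?_
    simpa using norm_fderiv_le_of_lipschitz ℝ hf (x₀ := x)
  have memG : ∀ i : Fin 2, MemLp (fun x => fderiv ℝ F x (EuclideanSpace.single i 1)) 2 (axi U) :=
    fun i => MemLp.of_bound (measurable_fderiv_apply_const ℝ F _).aestronglyMeasurable K
      (.of_forall fun x => dbd hF x i)
  set V : ℕ → H1 ℝ U := fun n => H1.ofContDiff hm hb (h1 n) with hV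
  have t0 : Tendsto (fun n => H1.fn (V n)) atTop (𝓝 (H1.fn u)) := by
    refine tendsto_L2_of_bounded hm hb (C := K) (fun n => ?_) ?_
    · filter_upwards [H1.fn_ofContDiff hm hb (h1 n), hu] with x e1 e2
      rw [e1, e2]
      refine (h3 n x).trans (mul_le_of_le_one_right K.2 ?_)
      rw [div_le_one (by positivity)]
      linarith [(Nat.cast_nonneg n : (0 : ℝ) ≤ n)]
    · filter_upwards [ae_all_iff.2 fun n => H1.fn_ofContDiff hm hb (h1 n), hu] with x e1 e2
      simp only [hV, e1, e2]
      exact hconv x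
  have t1 : Tendsto (fun n => H1.dr (V n)) atTop (𝓝 ((memG 0).toLp _)) := by
    refine tendsto_L2_of_bounded hm hb (C := K + K) (fun n => ?_) ?_
    · filter_upwards [H1.dr_ofContDiff hm hb (h1 n), (memG 0).coeFn_toLp] with x e1 e2
      rw [e1, e2]
      exact (norm_sub_le _ _).trans (add_le_add (dbd (h2 n) x 0) (dbd hF x 0))
    · filter_upwards [ae_all_iff.2 fun n => H1.dr_ofContDiff hm hb (h1 n),
        (memG 0).coeFn_toLp, hder] with x e1 e2 e3
      simp only [hV, e1, e2]
      exact e3 0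
  have t2 : Tendsto (fun n => H1.dz (V n)) atTop (𝓝 ((memG 1).toLp _)) := by
    refine tendsto_L2_of_bounded hm hb (C := K + K) (fun n => ?_) ?_
    · filter_upwards [H1.dz_ofContDiff hm hb (h1 n), (memG 1).coeFn_toLp] with x e1 e2
      rw [e1, e2]
      exact (norm_sub_le _ _).trans (add_le_add (dbd (h2 n) x 1) (dbd hF x 1))
    · filter_upwards [ae_all_iff.2 fun n => H1.dz_ofContDiff hm hb (h1 n),
        (memG 1).coeFn_toLp, hder] with x e1 e2 e3
      simp only [hV, e1, e2]
      exact e3 1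
  -- The limit of the classical derivatives is a weak derivative of `u` because that relation is
  -- closed, and so it is the one stored in `u`.
  have g1 : (memG 0).toLp _ = H1.dr u := IsWeakPartial.unique h.isOpen hp
    (IsWeakPartial.of_tendsto (fun n => (V n).2.1) t0 t1) u.2.1
  have g2 : (memG 1).toLp _ = H1.dz u := IsWeakPartial.unique h.isOpen hp
    (IsWeakPartial.of_tendsto (fun n => (V n).2.2) t0 t2) u.2.2
  rw [g1] at t1
  rw [g2] at t2
  have memS : ∀ {f : Plane → ℝ}, Continuous f → MemLp f 2 (axiCurve S) := by
    intro f hf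
    obtain ⟨C, hC⟩ := (isBounded_frontier hb).isCompact_closure.exists_bound_of_continuousOn
      hf.continuousOn
    refine MemLp.of_bound hf.aestronglyMeasurable C ?_
    have : ∀ᵐ x ∂axiCurve S, x ∈ S :=
      (withDensity_absolutelyContinuous _ _) (ae_restrict_mem hSm)
    filter_upwards [this] with x hx using hC x (subset_closure (hS hx))
  refine ⟨(memS hF.continuous).toLp F, φ, V, fun n => (memS (h1 n).continuous).toLp (φ n), h1,
    fun n => H1.fn_ofContDiff hm hb (h1 n), fun n => MemLp.coeFn_toLp _, tendsto_H1 t0 t1 t2, ?_⟩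
  rw [tendsto_iff_norm_sub_tendsto_zero]
  refine squeeze_zero (fun _ => norm_nonneg _) (fun n => Lp.norm_le_of_ae_bound
    (C := K * (1 / (n + 1))) (by positivity) ?_) (by
      simpa using (hε0.const_mul (K : ℝ)).const_mul
        (measureUnivNNReal (axiCurve S) ^ (ENNReal.toReal 2)⁻¹ : ℝ))
  filter_upwards [Lp.coeFn_sub ((memS (h1 n).continuous).toLp (φ n))
    ((memS hF.continuous).toLp F), (memS (h1 n).continuous).coeFn_toLp,
    (memS hF.continuous).coeFn_toLp] with x e1 e2 e3
  rw [e1, Pi.sub_apply, e2, e3]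
  exact h3 n x

/-! ## Lipschitz extension of finite element functions -/

theorem eqOn_convexHull_of_affine {a a' : Plane →ᵃ[ℝ] ℝ} {s : Set Plane} (h : EqOn a a' s) :
    EqOn a a' (convexHull ℝ s) := by
  have hc : Convex ℝ ((a - a') ⁻¹' {0}) := (convex_singleton 0).affine_preimage (a - a')
  have hs : s ⊆ (a - a') ⁻¹' {0} := fun x hx => by simp [h hx]
  intro x hx
  have := convexHull_min hs hc hx
  simpa [sub_eq_zero] using this

/-- A function on `[0, 1]` which is Lipschitz with constant `M` near each point, as seen from that
point, changes by at most `M`. -/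
theorem abs_sub_le_of_locally {g : ℝ → ℝ} {M : ℝ}
    (h : ∀ t ∈ Icc (0 : ℝ) 1, ∀ᶠ s in 𝓝[Icc 0 1] t, |g s - g t| ≤ M * |s - t|) :
    |g 1 - g 0| ≤ M := by
  have hc : ContinuousOn g (Icc 0 1) := by
    intro t ht
    rw [ContinuousWithinAt, tendsto_iff_dist_tendsto_zero]
    refine squeeze_zero' (.of_forall fun _ => dist_nonneg) (h t ht) ?_
    have : Tendsto (fun s : ℝ => M * |s - t|) (𝓝 t) (𝓝 (M * |t - t|)) :=
      Continuous.tendsto (by fun_prop) t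
    simp only [sub_self, abs_zero, mul_zero] at this
    exact this.mono_left nhdsWithin_le_nhds
  -- Continuous induction: the set of good times is closed in the interval and extends to the right
  -- of each of its points.
  have key : Icc (0 : ℝ) 1 ⊆ {t | |g t - g 0| ≤ M * t} := by
    refine IsClosed.Icc_subset_of_forall_mem_nhdsWithin ?_ (by simp) ?_
    · have hcont : ContinuousOn (fun t => |g t - g 0| - M * t) (Icc 0 1) := by fun_prop
      have := hcont.preimage_isClosed_of_isClosed isClosed_Icc (isClosed_Iic (a := (0 : ℝ)))
      convert! this using 1
      ext t
      simp [and_comm]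
    · rintro t ⟨ht, ht0, ht1⟩
      replace ht : |g t - g 0| ≤ M * t := ht
      have h1 : ∀ᶠ s in 𝓝[>] t, |g s - g t| ≤ M * |s - t| :=
        (h t ⟨ht0, ht1.le⟩).filter_mono (nhdsWithin_le_of_mem (by
          filter_upwards [Ioc_mem_nhdsGT ht1] with s hs using ⟨ht0.trans hs.1.le, hs.2⟩))
      filter_upwards [h1, self_mem_nhdsWithin] with s hs hst
      rw [abs_of_pos (show 0 < s - t from sub_pos.2 hst)] at hs
      calc |g s - g 0| ≤ |g s - g t| + |g t - g 0| := abs_sub_le _ _ _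
        _ ≤ M * (s - t) + M * t := add_le_add hs ht
        _ = M * s := by ring
  simpa using key (right_mem_Icc.2 zero_le_one)

theorem exists_affine_interpolation {K : Finset Plane} (hK : AffineIndependent ℝ ((↑) : K → Plane))
    (hc : K.card = 3) (f : Plane → ℝ) : ∃ a : Plane →ᵃ[ℝ] ℝ, ∀ p ∈ K, a p = f p := by
  have hspan : affineSpan ℝ (range ((↑) : K → Plane)) = ⊤ :=
    hK.affineSpan_eq_top_iff_card_eq_finrank_add_one.2 (by simp [hc])
  set b : AffineBasis K ℝ Plane := ⟨(↑), hK, hspan⟩ with hb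
  refine ⟨∑ q : K, f q • b.coord q, fun p hp => ?_⟩
  have e : ∀ (s : Finset K) (x : Plane), (∑ q ∈ s, f q • b.coord q) x
      = ∑ q ∈ s, f q * b.coord q x := by
    classical
    intro s x
    induction s using Finset.induction_on with
    | empty => simp
    | insert q s hq ih => rw [Finset.sum_insert hq, Finset.sum_insert hq, AffineMap.coe_add,
        Pi.add_apply, ih]; rfl
  rw [e, Finset.sum_eq_single ⟨p, hp⟩]
  · have : b.coord ⟨p, hp⟩ (b ⟨p, hp⟩) = 1 := b.coord_apply_eq _
    have hb' : b ⟨p, hp⟩ = p := rfl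
    rw [hb'] at this
    rw [this, mul_one]
  · intro q _ hq
    have : b.coord q (b ⟨p, hp⟩) = 0 := b.coord_apply_ne hq
    have hb' : b ⟨p, hp⟩ = p := rfl
    rw [hb'] at this
    rw [this, mul_zero]
  · simp

theorem isOpen_rectangle (R L : ℝ) : IsOpen (rectangle R L) := by
  have : rectangle R L = {x : Plane | 0 < x 0} ∩ {x | x 0 < R} ∩ {x | 0 < x 1} ∩ {x | x 1 < L} := by
    ext x
    simp [rectangle, and_assoc]
  rw [this]
  refine (((isOpen_lt ?_ ?_).inter (isOpen_lt ?_ ?_)).inter (isOpen_lt ?_ ?_)).inter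
    (isOpen_lt ?_ ?_) <;> fun_prop

theorem convex_rectangle (R L : ℝ) : Convex ℝ (rectangle R L) := by
  intro x hx y hy a b ha hb hab
  obtain ⟨h1, h2, h3, h4⟩ := hx
  obtain ⟨k1, k2, k3, k4⟩ := hy
  have hb' : b = 1 - a := by linarith
  subst hb'
  simp only [rectangle, mem_ofPred_eq, PiLp.add_apply, PiLp.smul_apply, smul_eq_mul]
  rcases ha.eq_or_lt with rfl | ha'
  · simp only [zero_mul, sub_zero, one_mul, zero_add]
    exact ⟨k1, k2, k3, k4⟩
  · refine ⟨?_, ?_, ?_, ?_⟩ <;> nlinarith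

theorem rectangle_subset_pos (R L : ℝ) : rectangle R L ⊆ {x | 0 < x 0} := fun _ hx => hx.1

theorem isBounded_rectangle (R L : ℝ) : Bornology.IsBounded (rectangle R L) := by
  refine (Metric.isBounded_iff_subset_closedBall 0).2 ⟨√(R ^ 2 + L ^ 2), fun x hx => ?_⟩
  obtain ⟨h1, h2, h3, h4⟩ := hx
  rw [mem_closedBall_zero_iff, EuclideanSpace.norm_eq]
  refine Real.sqrt_le_sqrt ?_
  rw [Fin.sum_univ_two, Real.norm_eq_abs, Real.norm_eq_abs, sq_abs, sq_abs]
  nlinarith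

namespace IsMesh

variable {m : ℕ} {G : Configuration m} {𝒦 : Geometry.SimplicialComplex ℝ Plane} (h : IsMesh G 𝒦)

include h

/-- A face without exactly three vertices does not span the plane and is a null set; so is the
boundary of each convex face. There are finitely many faces, so their union is negligible. -/
theorem ae_mem_interior : ∀ᵐ x : Plane, x ∈ G.dom → ∃ K ∈ 𝒦.faces, K.card = 3 ∧
    x ∈ interior (convexHull ℝ (K : Set Plane)) := by
  have h1 : ∀ᵐ x : Plane, ∀ K ∈ 𝒦.faces, K.card ≠ 3 → x ∉ convexHull ℝ (K : Set Plane) := by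
    rw [ae_ball_iff h.finite.countable]
    intro K hK
    by_cases hc : K.card = 3
    · simp [hc]
    · have : affineSpan ℝ (K : Set Plane) ≠ ⊤ := by
        intro htop
        have hr : range ((↑) : K → Plane) = (K : Set Plane) := by simp
        have := ((𝒦.indep hK).affineSpan_eq_top_iff_card_eq_finrank_add_one).1
          (by rw [hr]; exact htop)
        simp at this
        exact hc this
      have h0 := measure_mono_null (convexHull_subset_affineSpan (𝕜 := ℝ) (K : Set Plane))
        (Measure.addHaar_affineSubspace volume _ this)
      filter_upwards [measure_eq_zero_iff_ae_notMem.1 h0] with x hx _ using hx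
  have h2 : ∀ᵐ x : Plane, ∀ K ∈ 𝒦.faces, x ∉ frontier (convexHull ℝ (K : Set Plane)) := by
    rw [ae_ball_iff h.finite.countable]
    intro K _
    exact measure_eq_zero_iff_ae_notMem.1 ((convex_convexHull ℝ _).addHaar_frontier volume)
  filter_upwards [h1, h2] with x h1 h2 hx
  have hs : x ∈ 𝒦.space := by
    rw [h.space_eq]
    exact subset_closure hx
  obtain ⟨K, hK, hxK⟩ := Geometry.SimplicialComplex.mem_space_iff.1 hs
  have hc : K.card = 3 := by
    by_contra hc
    exact h1 K hK hc hxK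
  refine ⟨K, hK, hc, ?_⟩
  by_contra hni
  exact h2 K hK ⟨subset_closure hxK, hni⟩

/-- The part of the rectangle missed by the finitely many closed triangles is open and null, hence
empty. -/
theorem exists_triangle {x : Plane} (hx : x ∈ G.dom) : ∃ K ∈ 𝒦.faces, K.card = 3 ∧
    x ∈ convexHull ℝ (K : Set Plane) := by
  set T : Set Plane := ⋃ K ∈ {K ∈ 𝒦.faces | K.card = 3}, convexHull ℝ (K : Set Plane) with hT
  have hfin : {K ∈ 𝒦.faces | K.card = 3}.Finite := h.finite.subset fun K hK => hK.1
  have hcl : IsClosed T := hfin.isClosed_biUnion fun K _ => K.finite_toSet.isClosed_convexHull ℝ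
  have ho : IsOpen (G.dom \ T) := (isOpen_rectangle _ _).sdiff hcl
  have h0 : volume (G.dom \ T) = 0 := by
    rw [measure_eq_zero_iff_ae_notMem]
    filter_upwards [h.ae_mem_interior] with x hx hxT
    obtain ⟨K, hK, hc, hxK⟩ := hx hxT.1
    exact hxT.2 (mem_biUnion (show K ∈ {K ∈ 𝒦.faces | K.card = 3} from ⟨hK, hc⟩)
      (interior_subset hxK))
  have hemp := (ho.measure_eq_zero_iff volume).1 h0
  have hxT : x ∈ T := by
    by_contra hn
    exact (hemp ▸ (⟨hx, hn⟩ : x ∈ G.dom \ T) : x ∈ (∅ : Set Plane))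
  obtain ⟨K, hK, hxK⟩ := mem_iUnion₂.1 hxT
  exact ⟨K, hK.1, hK.2, hxK⟩

/-- The open workpiece is disjoint from the coils and the air, hence from their closures, so a
triangle that meets it can only be resolved by the workpiece. -/
theorem subset_of_mem_workpiece {K : Finset Plane} (hK : K ∈ 𝒦.faces) (hc : K.card = 3)
    {x : Plane} (hx : x ∈ G.workpiece) (hxK : x ∈ convexHull ℝ (K : Set Plane)) :
    convexHull ℝ (K : Set Plane) ⊆ closure G.workpiece := by
  have ho := G.workpiece_polygonal.isOpen
  rcases h.resolves K hK hc with h1 | ⟨k, h1⟩ | h1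
  · exact h1
  · exact absurd (h1 hxK) (disjoint_left.1 ((G.workpiece_disjoint k).closure_right ho) hx)
  · have hd : Disjoint G.workpiece G.air := by
      refine disjoint_left.2 fun y hy hy' => hy'.2 (subset_closure ?_)
      exact Or.inl hy
    exact absurd (h1 hxK) (disjoint_left.1 (hd.closure_right ho) hx)

/-- A continuous piecewise linear function on the workpiece extends to a Lipschitz function which
is locally affine almost everywhere. -/
theorem exists_lipschitz_extension {f : Plane → ℝ}
    (hf : ∀ K ∈ 𝒦.faces, K.card = 3 → convexHull ℝ (K : Set Plane) ⊆ closure G.workpiece →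
      ∃ a : Plane →ᵃ[ℝ] ℝ, EqOn f a (convexHull ℝ (K : Set Plane))) :
    ∃ (F : Plane → ℝ) (C : NNReal), LipschitzWith C F ∧ EqOn F f G.workpiece ∧
      ∀ᵐ x : Plane, x ∈ G.dom → LocallyAffineAt F x := by
  classical
  set 𝒯 := {K : Finset Plane | K ∈ 𝒦.faces ∧ K.card = 3} with h𝒯
  have hfin : 𝒯.Finite := h.finite.subset fun K hK => hK.1
  -- The nodal values of `f` are interpolated on every triangle of the rectangle, not only on those
  -- of the workpiece. Off the workpiece these values are arbitrary, but the interpolant is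
  -- piecewise linear and continuous on a convex set, which the workpiece need not be.
  have hex : ∀ K : Finset Plane, ∃ a : Plane →ᵃ[ℝ] ℝ, K ∈ 𝒯 → ∀ p ∈ K, a p = f p := by
    intro K
    by_cases hK : K ∈ 𝒯
    · obtain ⟨a, ha⟩ := exists_affine_interpolation (𝒦.indep hK.1) hK.2 f
      exact ⟨a, fun _ => ha⟩
    · exact ⟨0, fun h => absurd h hK⟩
  choose a ha using hex
  -- By conformity two triangles meet in the hull of their common vertices, where both interpolants
  -- are determined by the same nodal values.
  have compat : ∀ K ∈ 𝒯, ∀ K' ∈ 𝒯, ∀ x, x ∈ convexHull ℝ (K : Set Plane) →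
      x ∈ convexHull ℝ (K' : Set Plane) → a K x = a K' x := by
    intro K hK K' hK' x hx hx'
    have hxx := 𝒦.inter_subset_convexHull hK.1 hK'.1 ⟨hx, hx'⟩
    refine eqOn_convexHull_of_affine (fun p hp => ?_) hxx
    rw [ha K hK p hp.1, ha K' hK' p hp.2]
  set F₀ : Plane → ℝ := fun x => if hx : ∃ K ∈ 𝒯, x ∈ convexHull ℝ (K : Set Plane) then
    a hx.choose x else 0 with hF₀
  have hF₀e : ∀ K ∈ 𝒯, ∀ x ∈ convexHull ℝ (K : Set Plane), F₀ x = a K x := by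
    intro K hK x hx
    have hx' : ∃ K ∈ 𝒯, x ∈ convexHull ℝ (K : Set Plane) := ⟨K, hK, hx⟩
    simp only [hF₀, dif_pos hx']
    exact compat _ hx'.choose_spec.1 K hK x hx'.choose_spec.2 hx
  have hlin : ∀ K (x y : Plane), a K x - a K y =
      LinearMap.toContinuousLinearMap (a K).linear (x - y) := by
    intro K x y
    have := (a K).linearMap_vsub x y
    simpa using this.symm
  obtain ⟨B, hB⟩ : ∃ B : ℝ, ∀ K ∈ 𝒯, ‖LinearMap.toContinuousLinearMap (a K).linear‖ ≤ B := by
    obtain ⟨B, hB⟩ := (hfin.image fun K => ‖LinearMap.toContinuousLinearMap (a K).linear‖).bddAbove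
    exact ⟨B, fun K hK => hB (mem_image_of_mem _ hK)⟩
  set C : NNReal := Real.toNNReal B with hC
  have hloc : ∀ K ∈ 𝒯, ∀ x ∈ convexHull ℝ (K : Set Plane), ∀ y ∈ convexHull ℝ (K : Set Plane),
      |F₀ x - F₀ y| ≤ C * ‖x - y‖ := by
    intro K hK x hx y hy
    rw [hF₀e K hK x hx, hF₀e K hK y hy, hlin]
    exact ((LinearMap.toContinuousLinearMap (a K).linear).le_opNorm (x - y)).trans
      (mul_le_mul_of_nonneg_right ((hB K hK).trans (Real.le_coe_toNNReal B)) (norm_nonneg _))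
  -- The segment between two points stays in the convex rectangle, and along it the Lipschitz bounds
  -- of the individual triangles are joined by `abs_sub_le_of_locally`.
  have hlip : LipschitzOnWith C F₀ G.dom := by
    refine LipschitzOnWith.of_dist_le_mul fun x hx y hy => ?_
    set γ : ℝ → Plane := fun t => y + t • (x - y) with hγ
    have hγc : Continuous γ := by fun_prop
    have hγd : ∀ s t, γ s - γ t = (s - t) • (x - y) := by
      intro s t
      simp only [hγ, sub_smul]
      abel
    have hγm : ∀ t ∈ Icc (0 : ℝ) 1, γ t ∈ G.dom := by
      intro t ht
      have := (convex_rectangle G.R G.L) hy hx (sub_nonneg.2 ht.2) ht.1 (by ring)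
      have e : γ t = (1 - t) • y + t • x := by simp only [hγ]; module
      rw [e]
      exact this
    have key := abs_sub_le_of_locally (g := F₀ ∘ γ) (M := C * ‖x - y‖) fun t ht => by
      -- Finitely many closed triangles miss `γ t`, so nearby points avoid them too; whichever
      -- triangle contains such a point therefore also contains `γ t`.
      have hev : ∀ᶠ s in 𝓝 t, ∀ K ∈ 𝒯, γ t ∉ convexHull ℝ (K : Set Plane) →
          γ s ∉ convexHull ℝ (K : Set Plane) := by
        rw [eventually_all_finite hfin]
        intro K hK
        by_cases hn : γ t ∈ convexHull ℝ (K : Set Plane)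
        · simp [hn]
        · have hcl : IsClosed (convexHull ℝ (K : Set Plane)) :=
            K.finite_toSet.isClosed_convexHull ℝ
          filter_upwards [hγc.continuousAt.eventually (hcl.isOpen_compl.mem_nhds hn)] with s hs _
            using hs
      filter_upwards [nhdsWithin_le_nhds hev, self_mem_nhdsWithin] with s hs hsI
      obtain ⟨K, hK, hKc, hsK⟩ := h.exists_triangle (hγm s hsI)
      have htK : γ t ∈ convexHull ℝ (K : Set Plane) := by
        by_contra hn
        exact hs K ⟨hK, hKc⟩ hn hsK
      refine (hloc K ⟨hK, hKc⟩ _ hsK _ htK).trans (le_of_eq ?_)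
      rw [hγd, norm_smul, Real.norm_eq_abs]
      ring
    have e1 : γ 1 = x := by simp [hγ]
    have e0 : γ 0 = y := by simp [hγ]
    rw [Function.comp_apply, Function.comp_apply, e1, e0] at key
    rwa [Real.dist_eq, dist_eq_norm]
  obtain ⟨F, hF, hFF⟩ := hlip.extend_real
  refine ⟨F, C, hF, fun x hx => ?_, ?_⟩
  · obtain ⟨K, hK, hc, hxK⟩ := h.exists_triangle (G.workpiece_subset hx)
    rw [← hFF (G.workpiece_subset hx), hF₀e K ⟨hK, hc⟩ x hxK]
    obtain ⟨a', ha'⟩ := hf K hK hc (h.subset_of_mem_workpiece hK hc hx hxK)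
    rw [ha' hxK]
    refine eqOn_convexHull_of_affine (fun p hp => ?_) hxK
    rw [ha K ⟨hK, hc⟩ p hp, ha' (subset_convexHull ℝ _ hp)]
  · filter_upwards [h.ae_mem_interior] with x hx hxd
    obtain ⟨K, hK, hc, hxK⟩ := hx hxd
    refine ⟨LinearMap.toContinuousLinearMap (a K).linear, a K 0, ?_⟩
    filter_upwards [isOpen_interior.mem_nhds hxK, (isOpen_rectangle G.R G.L).mem_nhds hxd]
      with y hy hyd
    rw [← hFF hyd, hF₀e K ⟨hK, hc⟩ y (interior_subset hy)]
    have := hlin K y 0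
    rw [sub_zero] at this
    linarith

end IsMesh

theorem Configuration.workpiece_pos {m : ℕ} (G : Configuration m) :
    G.workpiece ⊆ {x | 0 < x 0} :=
  G.workpiece_subset.trans (rectangle_subset_pos _ _)

theorem Configuration.isBounded_workpiece {m : ℕ} (G : Configuration m) :
    Bornology.IsBounded G.workpiece :=
  (isBounded_rectangle _ _).subset G.workpiece_subset

theorem Configuration.outer_subset {m : ℕ} (G : Configuration m) :
    G.outer ⊆ frontier G.workpiece := inter_subset_left

theorem Configuration.measurableSet_outer {m : ℕ} (G : Configuration m) :
    MeasurableSet G.outer :=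
  isClosed_frontier.measurableSet.inter
    (isOpen_ne_fun (by fun_prop) continuous_const).measurableSet

/-- Finite element functions on the workpiece have traces. -/
theorem exists_trace_of_mem_meshX {m : ℕ} {G : Configuration m}
    {𝒦 : Geometry.SimplicialComplex ℝ Plane} (h : IsMesh G 𝒦) {W : H1 ℝ G.workpiece}
    (hW : W ∈ meshX G 𝒦) : ∃ γ : L2Curve ℝ G.outer, IsTrace G.outer W γ := by
  obtain ⟨f, -, hf, hWf⟩ := hW
  obtain ⟨F, C, hF, hFf, haff⟩ := h.exists_lipschitz_extension hf
  have hm := G.workpiece_polygonal.isOpen.measurableSet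
  refine exists_trace_of_lipschitz G.workpiece_polygonal G.workpiece_pos G.isBounded_workpiece hF
    ?_ (u := W) ?_ G.outer_subset G.measurableSet_outer
  · rw [ae_axi_iff, ae_restrict_iff' hm]
    filter_upwards [haff] with x hx hxm _ using hx (G.workpiece_subset hxm)
  · filter_upwards [hWf, ae_mem_axi hm] with x hx hxm
    rw [hx, hFf hxm]

theorem sub_mem_meshX {m : ℕ} {G : Configuration m} {𝒦 : Geometry.SimplicialComplex ℝ Plane}
    {W W' : H1 ℝ G.workpiece} (hW : W ∈ meshX G 𝒦) (hW' : W' ∈ meshX G 𝒦) :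
    W - W' ∈ meshX G 𝒦 := by
  obtain ⟨f, hc, ha, he⟩ := hW
  obtain ⟨f', hc', ha', he'⟩ := hW'
  refine ⟨fun x => f x - f' x, hc.sub hc', fun K hK h3 hs => ?_, ?_⟩
  · obtain ⟨a, h1⟩ := ha K hK h3 hs
    obtain ⟨a', h1'⟩ := ha' K hK h3 hs
    exact ⟨a - a', fun x hx => by simp [h1 hx, h1' hx]⟩
  · have : H1.fn (W - W') = H1.fn W - H1.fn W' := rfl
    rw [this]
    filter_upwards [Lp.coeFn_sub (H1.fn W) (H1.fn W'), he, he'] with x e1 e2 e3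
    rw [e1, Pi.sub_apply, e2, e3]

theorem sub_mem_meshY {m : ℕ} {G : Configuration m} {𝒦 : Geometry.SimplicialComplex ℝ Plane}
    {Z Z' : HTilde0 G.dom} (hZ : Z ∈ meshY G 𝒦) (hZ' : Z' ∈ meshY G 𝒦) :
    Z - Z' ∈ meshY G 𝒦 := by
  obtain ⟨f, hc, ha, hb, he⟩ := hZ
  obtain ⟨f', hc', ha', hb', he'⟩ := hZ'
  refine ⟨fun x => f x - f' x, hc.sub hc', fun K hK h3 => ?_, fun x hx => ?_, ?_⟩
  · obtain ⟨a, h1⟩ := ha K hK h3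
    obtain ⟨a', h1'⟩ := ha' K hK h3
    exact ⟨a - a', fun x hx => by simp [h1 hx, h1' hx]⟩
  · simp [hb x hx, hb' x hx]
  · have : HTilde0.fn (Z - Z') = HTilde0.fn Z - HTilde0.fn Z' := rfl
    rw [this]
    filter_upwards [Lp.coeFn_sub (HTilde0.fn Z) (HTilde0.fn Z'), he, he'] with x e1 e2 e3
    rw [e1, Pi.sub_apply, e2, e3]

/-! ## Weak time derivatives -/

section Time

variable {X : Type*} [NormedAddCommGroup X] [NormedSpace ℝ X] [CompleteSpace X]

/-- Fubini on the triangle `s < t`: the inner integral of `φ'` from `s` to `τ` is `-φ s`, since `φ`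
vanishes at `τ`. -/
theorem integral_deriv_smul_primitive {τ : ℝ} {g : ℝ → X}
    (hg : Integrable g (volume.restrict (Ioo 0 τ))) {φ : ℝ → ℝ} (hφ : ContDiff ℝ 1 φ)
    (hs : tsupport φ ⊆ Ioo 0 τ) :
    ∫ t in Ioo 0 τ, deriv φ t • (∫ s in Ioo 0 t, g s) = - ∫ t in Ioo 0 τ, φ t • g t := by
  have hφ' : Continuous (deriv φ) := hφ.continuous_deriv le_rfl
  set μ := volume.restrict (Ioo 0 τ) with hμ
  have hint : Integrable (Function.uncurry fun t s : ℝ => deriv φ t • (Ioi s).indicator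
      (fun _ => g s) t) (μ.prod μ) := by
    obtain ⟨C, hC⟩ := isCompact_Icc.exists_bound_of_continuousOn (s := Icc 0 τ) hφ'.continuousOn
    have h1 : Integrable (fun x : ℝ × ℝ => deriv φ x.1 • g x.2) (μ.prod μ) := by
      have : Integrable (deriv φ) μ := (hφ'.continuousOn.integrableOn_compact
        (isCompact_Icc (a := 0) (b := τ))).mono_set Ioo_subset_Icc_self
      exact this.smul_prod hg
    have h2 : (Function.uncurry fun t s : ℝ => deriv φ t • (Ioi s).indicator (fun _ => g s) t)
        = {x : ℝ × ℝ | x.2 < x.1}.indicator fun x => deriv φ x.1 • g x.2 := by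
      funext x
      obtain ⟨t, s⟩ := x
      by_cases hst : s < t <;> simp [Function.uncurry, hst]
    rw [h2]
    exact h1.indicator (measurableSet_lt measurable_snd measurable_fst)
  have hswap := integral_integral_swap hint
  have e1 : ∀ t ∈ Ioo 0 τ, ∫ s, deriv φ t • (Ioi s).indicator (fun _ => g s) t ∂μ
      = deriv φ t • ∫ s in Ioo 0 t, g s := by
    intro t ht
    rw [integral_smul]
    congr 1
    have : ∀ s, (Ioi s).indicator (fun _ => g s) t = (Iio t).indicator g s := fun s => by
      by_cases h : s < t <;> simp [h]
    simp only [this]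
    rw [integral_indicator measurableSet_Iio, hμ, Measure.restrict_restrict measurableSet_Iio]
    congr 2
    ext s
    simp only [mem_inter_iff, mem_Iio, mem_Ioo]
    exact ⟨fun h => ⟨h.2.1, h.1⟩, fun h => ⟨h.2, h.1, h.2.trans ht.2⟩⟩
  have e2 : ∀ s ∈ Ioo 0 τ, ∫ t, deriv φ t • (Ioi s).indicator (fun _ => g s) t ∂μ
      = - (φ s • g s) := by
    intro s hs'
    have : ∀ t, deriv φ t • (Ioi s).indicator (fun _ => g s) t
        = (Ioi s).indicator (deriv φ) t • g s := fun t => by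
      by_cases h : s < t <;> simp [h]
    simp only [this]
    rw [integral_smul_const, integral_indicator measurableSet_Ioi, hμ,
      Measure.restrict_restrict measurableSet_Ioi]
    have e3 : Ioi s ∩ Ioo 0 τ = Ioo s τ := by
      ext t
      simp only [mem_inter_iff, mem_Ioi, mem_Ioo]
      exact ⟨fun h => ⟨h.1, h.2.2⟩, fun h => ⟨h.1, hs'.1.trans h.1, h.2⟩⟩
    have hτ : φ τ = 0 := image_eq_zero_of_notMem_tsupport fun h => (hs h).2.false
    rw [e3, ← integral_Ioc_eq_integral_Ioo, ← intervalIntegral.integral_of_le hs'.2.le,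
      intervalIntegral.integral_deriv_eq_sub (fun x _ => hφ.differentiable (by simp) x)
        (hφ'.intervalIntegrable _ _), hτ, zero_sub, neg_smul]
  rw [← setIntegral_congr_fun measurableSet_Ioo e1, hswap,
    setIntegral_congr_fun measurableSet_Ioo e2, integral_neg]

/-- The lemma of du Bois-Reymond. -/
theorem ae_eq_const_of_integral_deriv_smul {τ : ℝ} (hτ : 0 < τ) {h : ℝ → X}
    (hh : Integrable h (volume.restrict (Ioo 0 τ)))
    (hz : ∀ φ : ℝ → ℝ, ContDiff ℝ (⊤ : ℕ∞) φ → HasCompactSupport φ → tsupport φ ⊆ Ioo 0 τ →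
      ∫ t in Ioo 0 τ, deriv φ t • h t = 0) :
    ∃ c : X, ∀ᵐ t ∂volume.restrict (Ioo 0 τ), h t = c := by
  let ρ : ContDiffBump (τ / 2) := ⟨τ / 8, τ / 4, by positivity, by linarith⟩
  set ψ₀ : ℝ → ℝ := ρ.normed volume with hψ₀
  have s0 : tsupport ψ₀ ⊆ Ioo 0 τ := by
    rw [hψ₀, ρ.tsupport_normed_eq, Real.closedBall_eq_Icc]
    intro x hx
    have h1 := hx.1
    have h2 := hx.2
    simp only [ρ] at h1 h2
    exact ⟨by linarith, by linarith⟩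
  have c0 : HasCompactSupport ψ₀ := ρ.hasCompactSupport_normed
  have d0 : ContDiff ℝ (⊤ : ℕ∞) ψ₀ := ρ.contDiff_normed
  have hi : ∀ {ψ : ℝ → ℝ}, Continuous ψ → Integrable (fun t => ψ t • h t)
      (volume.restrict (Ioo 0 τ)) := by
    intro ψ hψ
    obtain ⟨C, hC⟩ := isCompact_Icc.exists_bound_of_continuousOn (s := Icc 0 τ) hψ.continuousOn
    exact hh.bdd_smul C hψ.aestronglyMeasurable
      ((ae_restrict_iff' measurableSet_Ioo).2 (.of_forall fun t ht =>
        hC t (Ioo_subset_Icc_self ht)))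
  -- The constant is the mean of `h` against a fixed bump of integral one. Any test function minus
  -- its integral times this bump has mean zero, hence is the derivative of a test function, and
  -- such derivatives annihilate `h`.
  refine ⟨∫ t in Ioo 0 τ, ψ₀ t • h t, ?_⟩
  set c := ∫ t in Ioo 0 τ, ψ₀ t • h t with hc
  rw [ae_restrict_iff' measurableSet_Ioo]
  have key : ∀ᵐ t : ℝ, t ∈ Ioo 0 τ → h t - c = 0 := by
    refine isOpen_Ioo.ae_eq_zero_of_integral_contDiff_smul_eq_zero (f := fun t => h t - c) ?_
      fun ψ d1 c1 s1 => ?_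
    · exact (IntegrableOn.locallyIntegrableOn (hh.sub (integrable_const c)))
    · set I := ∫ t, ψ t with hI
      set χ : ℝ → ℝ := fun t => ψ t - I * ψ₀ t with hχ
      have dχ : ContDiff ℝ (⊤ : ℕ∞) χ := d1.sub (contDiff_const.mul d0)
      obtain ⟨a, b, hab, hsub⟩ : ∃ a b : ℝ, Icc a b ⊆ Ioo 0 τ ∧ ∀ t, t ∉ Icc a b → χ t = 0 := by
        have hK : IsCompact (insert (τ / 2) (tsupport ψ ∪ tsupport ψ₀)) :=
          (c1.isCompact.union c0.isCompact).insert _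
        have hne : (insert (τ / 2) (tsupport ψ ∪ tsupport ψ₀)).Nonempty := insert_nonempty _ _
        have hKs : insert (τ / 2) (tsupport ψ ∪ tsupport ψ₀) ⊆ Ioo 0 τ :=
          insert_subset ⟨by linarith, by linarith⟩ (union_subset s1 s0)
        refine ⟨sInf (insert (τ / 2) (tsupport ψ ∪ tsupport ψ₀)),
          sSup (insert (τ / 2) (tsupport ψ ∪ tsupport ψ₀)), ?_, fun t ht => ?_⟩
        · exact fun t ht => ⟨(hKs (hK.sInf_mem hne)).1.trans_le ht.1,
            ht.2.trans_lt (hKs (hK.sSup_mem hne)).2⟩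
        · have hn : t ∉ insert (τ / 2) (tsupport ψ ∪ tsupport ψ₀) := fun hm =>
            ht ⟨csInf_le hK.bddBelow hm, le_csSup hK.bddAbove hm⟩
          simp only [mem_insert_iff, mem_union, not_or] at hn
          simp only [hχ, image_eq_zero_of_notMem_tsupport hn.2.1,
            image_eq_zero_of_notMem_tsupport hn.2.2, mul_zero, sub_zero]
      have iψ : Integrable ψ := d1.continuous.integrable_of_hasCompactSupport c1
      have iψ₀ : Integrable ψ₀ := d0.continuous.integrable_of_hasCompactSupport c0
      have hχ0 : ∫ t, χ t = 0 := by
        rw [integral_sub iψ (iψ₀.const_mul I), integral_const_mul, ρ.integral_normed, mul_one,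
          ← hI, sub_self]
      set φ : ℝ → ℝ := fun t => ∫ s in (0 : ℝ)..t, χ s with hφ
      have hder : ∀ t, HasDerivAt φ (χ t) t := fun t =>
        intervalIntegral.integral_hasDerivAt_right (dχ.continuous.intervalIntegrable _ _)
          (dχ.continuous.stronglyMeasurableAtFilter _ _) dχ.continuous.continuousAt
      have hderiv : deriv φ = χ := funext fun t => (hder t).deriv
      have dφ : ContDiff ℝ (⊤ : ℕ∞) φ := by
        rw [contDiff_infty_iff_deriv]
        exact ⟨fun t => (hder t).differentiableAt, by rw [hderiv]; exact dχ⟩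
      -- To the left of `[a, b]` the integrand vanishes; to the right the primitive has collected
      -- the whole integral of `χ`, which is zero.
      have hφ0 : ∀ t, t ∉ Icc a b → φ t = 0 := by
        intro t ht
        rw [mem_Icc, not_and_or, not_le, not_le] at ht
        have zl : ∀ t ≤ 0, χ t = 0 := fun t ht => hsub t fun hm => (hab hm).1.not_ge ht
        rcases ht with ht | ht
        · rw [hφ]
          refine intervalIntegral.integral_zero_ae (.of_forall fun s hs => ?_)
          rcases le_total 0 t with h0 | h0
          · rw [uIoc_of_le h0] at hs
            exact hsub s fun hm => (hs.2.trans_lt ht).not_ge hm.1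
          · rw [uIoc_of_ge h0] at hs
            exact zl s hs.2
        · have h0 : χ =ᵐ[volume] (Ioc 0 t).indicator χ ∨ t ≤ 0 := by
            by_cases ht0 : t ≤ 0
            · exact .inr ht0
            · refine .inl (.of_forall fun s => ?_)
              by_cases hs : s ∈ Ioc 0 t
              · simp [hs]
              · rw [indicator_of_notMem hs]
                by_cases hs0 : s ≤ 0
                · exact zl s hs0
                · refine hsub s fun hm => hs ⟨not_le.1 hs0, (hm.2.trans_lt ht).le⟩
          rcases h0 with h0 | h0
          · by_cases ht0 : t ≤ 0
            · rw [hφ]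
              refine intervalIntegral.integral_zero_ae (.of_forall fun s hs => ?_)
              rw [uIoc_of_ge ht0] at hs
              exact zl s hs.2
            · rw [hφ]
              simp only
              rw [intervalIntegral.integral_of_le (not_le.1 ht0).le,
                ← integral_indicator measurableSet_Ioc, ← integral_congr_ae h0, hχ0]
          · rw [hφ]
            refine intervalIntegral.integral_zero_ae (.of_forall fun s hs => ?_)
            rw [uIoc_of_ge h0] at hs
            exact zl s hs.2
      have hts : tsupport φ ⊆ Icc a b :=
        closure_minimal (fun t ht => by_contra fun hn => ht (hφ0 t hn)) isClosed_Icc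
      have hcs : HasCompactSupport φ :=
        isCompact_Icc.of_isClosed_subset (isClosed_tsupport φ) hts
      have hzero := hz φ dφ hcs (hts.trans hab)
      rw [hderiv] at hzero
      have e1 : ∫ t in Ioo 0 τ, ψ t • h t = I • c := by
        have : ∫ t in Ioo 0 τ, χ t • h t
            = ∫ t in Ioo 0 τ, (ψ t • h t - I • (ψ₀ t • h t)) := by
          refine integral_congr_ae (.of_forall fun t => ?_)
          simp only [hχ, sub_smul, mul_smul]
        have i2 : Integrable (fun t => I • (ψ₀ t • h t)) (volume.restrict (Ioo 0 τ)) :=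
          (hi d0.continuous).smul I
        rw [this, integral_sub (hi d1.continuous) i2, integral_smul,
          sub_eq_zero] at hzero
        exact hzero
      have e2 : ∫ t in Ioo 0 τ, ψ t • c = I • c := by
        rw [integral_smul_const]
        congr 1
        refine setIntegral_eq_integral_of_forall_compl_eq_zero fun t ht => ?_
        exact image_eq_zero_of_notMem_tsupport fun hm => ht (s1 hm)
      have e3 : ∫ t, ψ t • (h t - c) = ∫ t in Ioo 0 τ, ψ t • (h t - c) := by
        refine (setIntegral_eq_integral_of_forall_compl_eq_zero fun t ht => ?_).symm
        rw [image_eq_zero_of_notMem_tsupport fun hm => ht (s1 hm), zero_smul]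
      rw [e3]
      simp only [smul_sub]
      rw [integral_sub (hi d1.continuous) ?_, e1, e2, sub_self]
      exact iψ.integrableOn.smul_const c
  filter_upwards [key] with t ht htm using sub_eq_zero.1 (ht htm)

omit [NormedSpace ℝ X] [CompleteSpace X] in
theorem MemL2Time.integrable {τ : ℝ} {g : ℝ → X} (h : MemL2Time τ g) :
    Integrable g (volume.restrict (Ioo 0 τ)) := by
  have : IsFiniteMeasure (volume.restrict (Ioo 0 τ)) := ⟨by simp⟩
  exact MemLp.integrable one_le_two h

omit [NormedSpace ℝ X] [CompleteSpace X] in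
theorem MemL2Time.intervalIntegrable {τ : ℝ} {g : ℝ → X} (h : MemL2Time τ g) {s t : ℝ}
    (hs : s ∈ Icc 0 τ) (ht : t ∈ Icc 0 τ) : IntervalIntegrable g volume s t := by
  have h1 : IntegrableOn g (Icc 0 τ) := (integrableOn_Icc_iff_integrableOn_Ioo (by simp) (by simp)).2 h.integrable
  have : IntervalIntegrable g volume 0 τ :=
    (intervalIntegrable_iff_integrableOn_Icc_of_le (hs.1.trans hs.2)).2 h1
  refine this.mono_set ?_
  rw [uIcc_of_le (hs.1.trans hs.2)]
  exact ordConnected_Icc.uIcc_subset hs ht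

/-- A function in `H¹(0, τ; X)` has an absolutely continuous representative. -/
theorem MemH1Time.exists_representative {τ : ℝ} (hτ : 0 < τ) {g g' : ℝ → X}
    (h : MemH1Time τ g g') : ∃ d : ℝ → X, ContinuousOn d (Icc 0 τ) ∧
      (∀ᵐ t ∂volume.restrict (Ioo 0 τ), g t = d t) ∧
      ∀ s ∈ Icc 0 τ, ∀ t ∈ Icc 0 τ, d t - d s = ∫ x in s..t, g' x := by
  have i1 := h.mem.integrable
  have i2 := h.deriv_mem.integrable
  have hτm : (0 : ℝ) ∈ Icc 0 τ := ⟨le_rfl, hτ.le⟩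
  have hcont : ContinuousOn (fun t => ∫ s in (0 : ℝ)..t, g' s) (Icc 0 τ) := by
    have := intervalIntegral.continuousOn_primitive_interval (μ := volume) (f := g') (a := 0)
      (b := τ) (by rw [uIcc_of_le hτ.le]; exact (integrableOn_Icc_iff_integrableOn_Ioo (by simp) (by simp)).2 i2)
    rwa [uIcc_of_le hτ.le] at this
  have hprim : ∀ t ∈ Icc 0 τ, ∫ s in Ioo 0 t, g' s = ∫ s in (0 : ℝ)..t, g' s := fun t ht => by
    rw [intervalIntegral.integral_of_le ht.1, integral_Ioc_eq_integral_Ioo]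
  have hGi : Integrable (fun t => ∫ s in Ioo 0 t, g' s) (volume.restrict (Ioo 0 τ)) := by
    have : IntegrableOn (fun t => ∫ s in (0 : ℝ)..t, g' s) (Ioo 0 τ) volume :=
      (hcont.integrableOn_compact isCompact_Icc).mono_set Ioo_subset_Icc_self
    refine Integrable.congr (f := fun t => ∫ s in (0 : ℝ)..t, g' s) this ?_
    exact (ae_restrict_iff' measurableSet_Ioo).2 (.of_forall fun t ht =>
      (hprim t (Ioo_subset_Icc_self ht)).symm)
  -- `g` minus the primitive of `g'` has zero weak derivative, so it is constant.
  obtain ⟨c, hc⟩ := ae_eq_const_of_integral_deriv_smul hτ (i1.sub hGi) fun φ d c1 s1 => by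
    have hd : Continuous (deriv φ) := d.continuous_deriv (by simp)
    have bd : ∀ {f : ℝ → X}, Integrable f (volume.restrict (Ioo 0 τ)) →
        Integrable (fun t => deriv φ t • f t) (volume.restrict (Ioo 0 τ)) := by
      intro f hf
      obtain ⟨C, hC⟩ := isCompact_Icc.exists_bound_of_continuousOn (s := Icc 0 τ) hd.continuousOn
      exact hf.bdd_smul C hd.aestronglyMeasurable
        ((ae_restrict_iff' measurableSet_Ioo).2 (.of_forall fun t ht =>
          hC t (Ioo_subset_Icc_self ht)))
    simp only [Pi.sub_apply, smul_sub]
    rw [integral_sub (bd i1) (bd hGi), h.weak φ d c1 s1,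
      integral_deriv_smul_primitive i2 (d.of_le (by simp)) s1, sub_self]
  refine ⟨fun t => c + ∫ s in (0 : ℝ)..t, g' s, continuousOn_const.add hcont, ?_, ?_⟩
  · filter_upwards [hc, ae_restrict_mem measurableSet_Ioo] with t ht htm
    rw [← hprim t (Ioo_subset_Icc_self htm), ← ht]
    simp
  · intro s hs t ht
    rw [add_sub_add_left_eq_sub, intervalIntegral.integral_interval_sub_left
      (h.deriv_mem.intervalIntegrable hτm ht) (h.deriv_mem.intervalIntegrable hτm hs)]

omit [NormedSpace ℝ X] [CompleteSpace X] in
theorem eqOn_Icc_of_ae {τ : ℝ} (hτ : 0 < τ) {f g : ℝ → X} (hf : ContinuousOn f (Icc 0 τ))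
    (hg : ContinuousOn g (Icc 0 τ)) (h : ∀ᵐ t ∂volume.restrict (Ioo 0 τ), f t = g t) :
    EqOn f g (Icc 0 τ) := by
  have h1 : EqOn f g (Ioo 0 τ) := Measure.eqOn_open_of_ae_eq (μ := volume) h isOpen_Ioo
    (hf.mono Ioo_subset_Icc_self) (hg.mono Ioo_subset_Icc_self)
  refine h1.of_subset_closure hf hg Ioo_subset_Icc_self ?_
  rw [closure_Ioo hτ.ne]

/-- The fundamental theorem of calculus in `H¹(0, τ; X)`. -/
theorem MemH1Time.sub_eq_integral {τ : ℝ} (hτ : 0 < τ) {g g' : ℝ → X} (h : MemH1Time τ g g')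
    (hg : ContinuousOn g (Icc 0 τ)) {s t : ℝ} (hs : s ∈ Icc 0 τ) (ht : t ∈ Icc 0 τ) :
    g t - g s = ∫ x in s..t, g' x := by
  obtain ⟨d, h1, h2, h3⟩ := h.exists_representative hτ
  have e := eqOn_Icc_of_ae hτ hg h1 h2
  rw [e hs, e ht, h3 s hs t ht]

omit [CompleteSpace X] in
theorem norm_sq_integral_le {τ : ℝ} {f : ℝ → X} (hf : MemL2Time τ f) {s t : ℝ} (hs : 0 ≤ s)
    (hst : s ≤ t) (ht : t ≤ τ) :
    ‖∫ x in s..t, f x‖ ^ 2 ≤ (t - s) * ∫ x in s..t, ‖f x‖ ^ 2 := by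
  have hm : MemLp f 2 (volume.restrict (Ioc s t)) := by
    have : MemLp f 2 (volume.restrict (Ioc 0 τ)) := by
      rw [← restrict_Ioo_eq_restrict_Ioc]
      exact hf
    exact this.mono_measure (Measure.restrict_mono (Ioc_subset_Ioc hs ht) le_rfl)
  have hfin : IsFiniteMeasure (volume.restrict (Ioc s t)) := ⟨by simp⟩
  have h1 := sq_integral_mul_le (memLp_const (1 : ℝ)) hm.norm
  simp only [one_mul, one_pow, integral_const, smul_eq_mul, mul_one, MeasurableSet.univ,
    measureReal_restrict_apply, univ_inter, Real.volume_real_Ioc, max_eq_left (sub_nonneg.2 hst)]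
    at h1
  rw [intervalIntegral.integral_of_le hst, intervalIntegral.integral_of_le hst]
  refine le_trans ?_ h1
  exact pow_le_pow_left₀ (norm_nonneg _) (norm_integral_le_integral_norm _) 2

end Time

/-! ## Coercivity of the curl -/

/-- On each line parallel to the `r`-axis the integral is the nonnegative value at `r = R` minus the
zero value on the axis. -/
theorem integral_partialDeriv_rectangle_nonneg {R L : ℝ} (hR : 0 < R) (hL : 0 < L)
    {ψ : Plane → ℝ} (hψ : ContDiff ℝ 1 ψ) (h0 : ∀ x : Plane, x 0 = 0 → ψ x = 0)
    (h1 : ∀ x : Plane, x 0 = R → 0 ≤ ψ x) :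
    0 ≤ ∫ x in rectangle R L, partialDeriv 0 ψ x := by
  set d : Plane := EuclideanSpace.single 0 R with hd
  set e : Plane := EuclideanSpace.single 1 L with he
  have hli : LinearIndependent ℝ ![d, e] := by
    rw [LinearIndependent.pair_iff]
    intro s t hst
    have a0 := congrArg (fun x : Plane => x 0) hst
    have a1 := congrArg (fun x : Plane => x 1) hst
    simp [hd, he, hR.ne', hL.ne'] at a0 a1
    exact ⟨a0, a1⟩
  have c0 : ∀ x, cellMap 0 d e x 0 = x.1 * R := fun x => by simp [cellMap, hd, he]
  have c1 : ∀ x, cellMap 0 d e x 1 = x.2 * L := fun x => by simp [cellMap, hd, he]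
  obtain ⟨c, hc, hcell⟩ := exists_integral_cell 0 hli
  have hsub : rectangle R L ⊆ cell 0 d e := by
    rintro x ⟨x1, x2, x3, x4⟩
    refine ⟨(x 0 / R, x 1 / L), ⟨⟨by positivity, by rw [div_le_one hR]; exact x2.le⟩,
      ⟨by positivity, by rw [div_le_one hL]; exact x4.le⟩⟩, ?_⟩
    ext i
    fin_cases i
    · exact (c0 _).trans (div_mul_cancel₀ _ hR.ne')
    · exact (c1 _).trans (div_mul_cancel₀ _ hL.ne')
  have hmr : MeasurableSet (rectangle R L) := (isOpen_rectangle R L).measurableSet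
  rw [← inter_eq_self_of_subset_right hsub, ← setIntegral_indicator hmr, hcell]
  refine mul_nonneg hc.le ?_
  have hin : ∀ᵐ x ∂squareMeasure, x.1 ∈ Ioo (0 : ℝ) 1 ∧ x.2 ∈ Ioo (0 : ℝ) 1 := by
    have hu : ∀ᵐ s ∂unitMeasure, s ∈ Ioo (0 : ℝ) 1 := by
      rw [unitMeasure, ← restrict_Ioo_eq_restrict_Icc]
      exact ae_restrict_mem measurableSet_Ioo
    exact (Measure.quasiMeasurePreserving_fst.ae hu).and (Measure.quasiMeasurePreserving_snd.ae hu)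
  have e1 : ∫ x, (rectangle R L).indicator (fun x => partialDeriv 0 ψ x) (cellMap 0 d e x)
      ∂squareMeasure = ∫ x, fderiv ℝ ψ (cellMap 0 d e x) (EuclideanSpace.single 0 1)
      ∂squareMeasure := by
    refine integral_congr_ae ?_
    filter_upwards [hin] with x hx
    rw [indicator_of_mem]
    · rfl
    · refine ⟨?_, ?_, ?_, ?_⟩
      · rw [c0]; exact mul_pos hx.1.1 hR
      · rw [c0]; exact mul_lt_of_lt_one_left hR hx.1.2
      · rw [c1]; exact mul_pos hx.2.1 hL
      · rw [c1]; exact mul_lt_of_lt_one_left hL hx.2.2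
  rw [e1]
  have hi := integrable_square (continuous_fderiv_cellMap hψ 0 d e (EuclideanSpace.single 0 1))
  rw [integral_prod_symm _ hi]
  refine integral_nonneg fun t => ?_
  simp only [Pi.zero_apply]
  have hds : ∀ s, HasDerivAt (fun s => R⁻¹ * ψ (cellMap 0 d e (s, t)))
      (fderiv ℝ ψ (cellMap 0 d e (s, t)) (EuclideanSpace.single 0 1)) s := fun s => by
    have h := (hasDerivAt_cellMap_fst hψ 0 d e s t).const_mul R⁻¹
    have hde : d = R • EuclideanSpace.single (0 : Fin 2) (1 : ℝ) := by
      ext i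
      fin_cases i <;> simp [hd]
    nth_rw 3 [hde] at h
    rwa [map_smul, smul_eq_mul, inv_mul_cancel_left₀ hR.ne'] at h
  have hcont : Continuous fun s => fderiv ℝ ψ (cellMap 0 d e (s, t)) (EuclideanSpace.single 0 1) :=
    (continuous_fderiv_cellMap hψ 0 d e (EuclideanSpace.single 0 1)).comp (by fun_prop)
  rw [unitMeasure, integral_Icc_eq_integral_Ioc, ← intervalIntegral.integral_of_le zero_le_one,
    intervalIntegral.integral_eq_sub_of_hasDerivAt (fun s _ => hds s)
      (hcont.intervalIntegrable _ _), h0 (cellMap 0 d e (0, t)) (by rw [c0]; simp), mul_zero, sub_zero]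
  exact mul_nonneg (inv_nonneg.2 hR.le) (h1 _ (by rw [c0]; simp))

/-- Times `r`, the integrand is `∂_r` of `r² / (r² + ε²) |φ|²`. The factor forces the value zero on
the axis, where a `C¹` approximant need not vanish; without it the integral would be that of `∂_r
|φ|²`. -/
theorem integral_regularized_nonneg {R L : ℝ} (hR : 0 < R) (hL : 0 < L)
    {φ : Plane → ℂ} (hφ : ContDiff ℝ 1 φ) {ε : ℝ} (hε : 0 < ε) :
    0 ≤ ∫ x, (2 * (x 0 / (x 0 ^ 2 + ε ^ 2)) * inner ℝ (φ x) (fderiv ℝ φ x (EuclideanSpace.single 0 1))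
      + 2 * ε ^ 2 / (x 0 ^ 2 + ε ^ 2) ^ 2 * ‖φ x‖ ^ 2) ∂axi (rectangle R L) := by
  have hpos : ∀ x : Plane, x 0 ^ 2 + ε ^ 2 ≠ 0 := fun x => by positivity
  set ψ : Plane → ℝ := fun x => x 0 ^ 2 / (x 0 ^ 2 + ε ^ 2) * ‖φ x‖ ^ 2 with hψ
  have dψ : ContDiff ℝ 1 ψ := by
    have h0 : ContDiff ℝ 1 fun x : Plane => x 0 := by fun_prop
    exact ((h0.pow 2).div ((h0.pow 2).add contDiff_const) hpos).mul (hφ.norm_sq ℝ)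
  have key := integral_partialDeriv_rectangle_nonneg hR hL dψ
    (fun x hx => by simp [hψ, hx]) (fun x _ => by simp only [hψ]; positivity)
  have hmr : MeasurableSet (rectangle R L) := (isOpen_rectangle R L).measurableSet
  rw [integral_axi ((ae_restrict_iff' hmr).2 (.of_forall fun x hx => hx.1.le))]
  refine key.trans_eq (setIntegral_congr_fun hmr fun x hx => ?_)
  have l1 : HasDerivAt (fun t : ℝ => x + t • EuclideanSpace.single (0 : Fin 2) (1 : ℝ))
      (EuclideanSpace.single 0 1) 0 := by
    simpa using ((hasDerivAt_id (0 : ℝ)).smul_const (EuclideanSpace.single (0 : Fin 2) (1 : ℝ))).const_add x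
  have l2 : HasDerivAt (fun t : ℝ => φ (x + t • EuclideanSpace.single (0 : Fin 2) (1 : ℝ)))
      (fderiv ℝ φ x (EuclideanSpace.single 0 1)) 0 := by
    have h := (hφ.differentiable (by simp) (x + (0 : ℝ) • EuclideanSpace.single (0 : Fin 2) (1 : ℝ))).hasFDerivAt
    have := h.comp_hasDerivAt (0 : ℝ) l1
    simpa [Function.comp_def] using this
  have l3 : HasDerivAt (fun t : ℝ => ψ (x + t • EuclideanSpace.single (0 : Fin 2) (1 : ℝ)))
      (partialDeriv 0 ψ x) 0 := by
    have h := (dψ.differentiable (by simp) (x + (0 : ℝ) • EuclideanSpace.single (0 : Fin 2) (1 : ℝ))).hasFDerivAt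
    have := h.comp_hasDerivAt (0 : ℝ) l1
    simpa [partialDeriv, Function.comp_def] using this
  have l4 : HasDerivAt (fun t : ℝ => (x 0 + t) ^ 2) (2 * x 0) 0 := by
    simpa using ((hasDerivAt_id (0 : ℝ)).const_add (x 0)).fun_pow 2
  have l5 := (l4.div (l4.add_const (ε ^ 2)) (by simpa using hpos x)).mul l2.norm_sq
  have e : (fun t : ℝ => ψ (x + t • EuclideanSpace.single (0 : Fin 2) (1 : ℝ)))
      = (fun t => (x 0 + t) ^ 2) / (fun t => (x 0 + t) ^ 2 + ε ^ 2)
        * fun t : ℝ => ‖φ (x + t • EuclideanSpace.single (0 : Fin 2) (1 : ℝ))‖ ^ 2 := by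
    funext t
    simp [hψ]
  rw [← e] at l5
  rw [l3.unique l5]
  have hx0 := hpos x
  simp only [Pi.div_apply, add_zero, zero_smul, smul_eq_mul]
  field_simp
  ring

theorem exists_mul_clm (E : Type*) [NormedAddCommGroup E] [NormedSpace ℝ E] {X : Type*}
    [MeasurableSpace X] {μ : Measure X} {m : X → ℝ}
    (hm : AEStronglyMeasurable m μ) (C : ℝ) (hC : ∀ᵐ x ∂μ, |m x| ≤ C) :
    ∃ M : Lp E 2 μ →L[ℝ] Lp E 2 μ, ∀ u, M u =ᵐ[μ] fun x => m x • u x := by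
  have h := memLp_top_of_bound hm C hC
  refine ⟨(ContinuousLinearMap.lsmul ℝ ℝ (E := E)).holderL μ ⊤ 2 2 (h.toLp m), fun u => ?_⟩
  refine (ContinuousLinearMap.coeFn_holder _ _ _).trans ?_
  filter_upwards [h.coeFn_toLp] with x hx
  rw [hx]
  rfl

theorem H1.tendsto_components {𝕜 : Type} [RCLike 𝕜] {ϑ : Set Plane} {U : ℕ → H1 𝕜 ϑ} {u : H1 𝕜 ϑ}
    (h : Tendsto U atTop (𝓝 u)) : Tendsto (fun n => H1.fn (U n)) atTop (𝓝 (H1.fn u)) ∧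
      Tendsto (fun n => H1.dr (U n)) atTop (𝓝 (H1.dr u)) ∧
      Tendsto (fun n => H1.dz (U n)) atTop (𝓝 (H1.dz u)) := by
  have hc : ∀ i : Fin 3, Continuous fun v : H1 𝕜 ϑ => v.1 i := fun i => by fun_prop
  exact ⟨((hc 0).tendsto u).comp h, ((hc 1).tendsto u).comp h, ((hc 2).tendsto u).comp h⟩

theorem restrictL2_self {𝕜 : Type} [RCLike 𝕜] {ϑ : Set Plane} (u : L2 𝕜 ϑ) :
    restrictL2 subset_rfl u = u :=
  Lp.ext (restrictL2_ae subset_rfl u)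

theorem tendsto_integral_mul_of_bounded {X : Type*} [MeasurableSpace X] {μ : Measure X} {C c : ℝ}
    {p : X → ℝ} (hp : Integrable p μ) {α : ℕ → X → ℝ} (hm : ∀ k, AEStronglyMeasurable (α k) μ)
    (hb : ∀ k x, |α k x| ≤ C) (hl : ∀ᵐ x ∂μ, Tendsto (fun k => α k x) atTop (𝓝 c)) :
    (∀ k, Integrable (fun x => α k x * p x) μ) ∧
      Tendsto (fun k => ∫ x, α k x * p x ∂μ) atTop (𝓝 (∫ x, c * p x ∂μ)) := by
  refine ⟨fun k => hp.bdd_mul (c := C) (hm k) (.of_forall (hb k)), ?_⟩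
  refine tendsto_integral_of_dominated_convergence (fun x => C * ‖p x‖)
    (fun k => (hm k).mul hp.aestronglyMeasurable) (hp.norm.const_mul C)
    (fun k => .of_forall fun x => ?_) ?_
  · rw [norm_mul]
    exact mul_le_mul_of_nonneg_right (hb k x) (norm_nonneg _)
  · filter_upwards [hl] with x hx using hx.mul_const _

section Cross

variable {R L : ℝ} (hR : 0 < R) (hL : 0 < L)

-- For fixed `ε` both coefficients are bounded, so the expression is continuous in `H¹₁` and the
-- sign survives the limit of the approximants.
include hR hL in
theorem integral_regularized_nonneg_of_approximable {u : H1 ℂ (rectangle R L)}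
    (hu : H1.Approximable u) {ε : ℝ} (hε : 0 < ε) :
    0 ≤ ∫ x, (2 * (x 0 / (x 0 ^ 2 + ε ^ 2)) * inner ℝ (H1.fn u x) (H1.dr u x)
      + 2 * ε ^ 2 / (x 0 ^ 2 + ε ^ 2) ^ 2 * ‖H1.fn u x‖ ^ 2) ∂axi (rectangle R L) := by
  have hpos : ∀ x : Plane, x 0 ^ 2 + ε ^ 2 ≠ 0 := fun x => by positivity
  have hx0 : Continuous fun x : Plane => x 0 := by fun_prop
  obtain ⟨M₁, hM₁⟩ := exists_mul_clm ℂ (μ := axi (rectangle R L))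
    (m := fun x : Plane => 2 * (x 0 / (x 0 ^ 2 + ε ^ 2)))
    (Continuous.aestronglyMeasurable (by fun_prop (disch := exact hpos _))) (1 / ε) (by
      filter_upwards [ae_pos_axi (rectangle R L)] with x hx
      rw [abs_of_nonneg (by positivity), ← mul_div_assoc, div_le_div_iff₀ (by positivity) hε]
      nlinarith [sq_nonneg (x 0 - ε)])
  obtain ⟨M₂, hM₂⟩ := exists_mul_clm ℂ (μ := axi (rectangle R L))
    (m := fun x : Plane => 2 * ε ^ 2 / (x 0 ^ 2 + ε ^ 2) ^ 2)
    (Continuous.aestronglyMeasurable (continuous_const.div (by fun_prop)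
      fun x => pow_ne_zero 2 (hpos x))) (2 / ε ^ 2) (.of_forall fun x => by
      rw [abs_of_nonneg (by positivity), div_le_div_iff₀ (by positivity) (by positivity)]
      nlinarith [sq_nonneg (x 0), sq_nonneg (x 0 * ε), sq_nonneg (x 0 ^ 2)])
  have key : ∀ f g : L2 ℂ (rectangle R L), inner ℝ f (M₁ g) + inner ℝ f (M₂ f)
      = ∫ x, (2 * (x 0 / (x 0 ^ 2 + ε ^ 2)) * inner ℝ (f x) (g x)
      + 2 * ε ^ 2 / (x 0 ^ 2 + ε ^ 2) ^ 2 * ‖f x‖ ^ 2) ∂axi (rectangle R L) := by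
    intro f g
    rw [L2.inner_def, L2.inner_def, ← integral_add (L2.integrable_inner _ _)
      (L2.integrable_inner _ _)]
    refine integral_congr_ae ?_
    filter_upwards [hM₁ g, hM₂ f] with x h1 h2
    rw [h1, h2, real_inner_smul_right, real_inner_smul_right, real_inner_self_eq_norm_sq]
  rw [← key]
  obtain ⟨φ, V, h1, h2, h3⟩ := hu
  obtain ⟨t1, t2, -⟩ := H1.tendsto_components h3
  have ht := (t1.inner (𝕜 := ℝ) ((M₁.continuous.tendsto _).comp t2)).add
    (t1.inner (𝕜 := ℝ) ((M₂.continuous.tendsto _).comp t1))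
  refine ge_of_tendsto' ht fun n => ?_
  simp only [Function.comp_apply]
  rw [key]
  have hm := (isOpen_rectangle R L).measurableSet
  have e := H1.eq_ofContDiff hm (isBounded_rectangle R L) (h1 n) (isOpen_rectangle R L)
    (rectangle_subset_pos R L) (h2 n)
  refine (integral_regularized_nonneg hR hL (h1 n) hε).trans_eq (integral_congr_ae ?_)
  filter_upwards [h2 n, H1.dr_ofContDiff hm (isBounded_rectangle R L) (h1 n)] with x hx1 hx2
  rw [hx1, e, hx2]

-- Let `ε → 0`. Writing `Z` as `r` times `Z/r`, the coefficients become `r² / (r² + ε²)` and `ε² r²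
-- / (r² + ε²)²`; both are at most one and tend to one and zero. Dominated convergence applies
-- because `Z/r` is itself in `L²₁`.
include hR hL in
theorem integral_inner_div_nonneg {Z : HTilde (rectangle R L)}
    (hZ : H1.Approximable (HTilde.restrict subset_rfl Z)) : 0 ≤ inner ℝ (Z.1 3) (Z.1 1) := by
  set μ := axi (rectangle R L) with hμ
  have e0 : H1.fn (HTilde.restrict subset_rfl Z) = Z.1 0 := restrictL2_self _
  have e1 : H1.dr (HTilde.restrict subset_rfl Z) = Z.1 1 := restrictL2_self _
  have hi1 : Integrable (fun x => (inner ℝ (Z.1 3 x) (Z.1 1 x) : ℝ)) μ := L2.integrable_inner _ _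
  have hi2 : Integrable (fun x => ‖Z.1 3 x‖ ^ 2) μ := by
    simpa only [real_inner_self_eq_norm_sq] using L2.integrable_inner (𝕜 := ℝ) (Z.1 3) (Z.1 3)
  have hx0 : Continuous fun x : Plane => x 0 := by fun_prop
  set ε : ℕ → ℝ := fun k => 1 / ((k : ℝ) + 1) with hε
  have ε0 : ∀ k, 0 < ε k := fun k => by positivity
  have tε : Tendsto ε atTop (𝓝 0) := tendsto_one_div_add_atTop_nhds_zero_nat
  have hpos : ∀ k (x : Plane), 0 < x 0 ^ 2 + ε k ^ 2 := fun k x => by have := ε0 k; positivity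
  obtain ⟨j1, l1⟩ := tendsto_integral_mul_of_bounded (C := 1) (c := 1) hi1
    (α := fun k x => x 0 ^ 2 / (x 0 ^ 2 + ε k ^ 2))
    (fun k => Continuous.aestronglyMeasurable ((hx0.pow 2).div ((hx0.pow 2).add continuous_const)
      fun x => (hpos k x).ne'))
    (fun k x => by
      rw [abs_of_nonneg (div_nonneg (sq_nonneg _) (hpos k x).le), div_le_one (hpos k x)]
      nlinarith [sq_nonneg (ε k)])
    (by
      filter_upwards [ae_pos_axi (rectangle R L)] with x hp
      have hne : x 0 ^ 2 + (0 : ℝ) ^ 2 ≠ 0 := by positivity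
      have := (tendsto_const_nhds (x := x 0 ^ 2)).div ((tε.pow 2).const_add (x 0 ^ 2)) hne
      rwa [zero_pow two_ne_zero, add_zero, div_self (by positivity)] at this)
  obtain ⟨j2, l2⟩ := tendsto_integral_mul_of_bounded (C := 1) (c := 0) hi2
    (α := fun k x => ε k ^ 2 * x 0 ^ 2 / (x 0 ^ 2 + ε k ^ 2) ^ 2)
    (fun k => Continuous.aestronglyMeasurable ((continuous_const.mul (hx0.pow 2)).div
      (((hx0.pow 2).add continuous_const).pow 2) fun x => pow_ne_zero 2 (hpos k x).ne'))
    (fun k x => by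
      rw [abs_of_nonneg (by have := hpos k x; positivity), div_le_one (pow_pos (hpos k x) 2)]
      nlinarith [sq_nonneg (x 0 ^ 2), sq_nonneg (ε k ^ 2), mul_nonneg (sq_nonneg (x 0)) (sq_nonneg (ε k))])
    (by
      filter_upwards [ae_pos_axi (rectangle R L)] with x hp
      have hne : x 0 ^ 2 + (0 : ℝ) ^ 2 ≠ 0 := by positivity
      have := ((tε.pow 2).mul_const (x 0 ^ 2)).div (((tε.pow 2).const_add (x 0 ^ 2)).pow 2)
        (pow_ne_zero 2 hne)
      rwa [zero_pow two_ne_zero, zero_mul, zero_div] at this)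
  have hnn : ∀ k : ℕ, 0 ≤ (∫ x, x 0 ^ 2 / (x 0 ^ 2 + ε k ^ 2) * inner ℝ (Z.1 3 x) (Z.1 1 x) ∂μ)
      + ∫ x, ε k ^ 2 * x 0 ^ 2 / (x 0 ^ 2 + ε k ^ 2) ^ 2 * ‖Z.1 3 x‖ ^ 2 ∂μ := by
    intro k
    have h := integral_regularized_nonneg_of_approximable hR hL hZ (ε0 k)
    rw [e0, e1] at h
    have h2 : ∫ x, (2 * (x 0 / (x 0 ^ 2 + ε k ^ 2)) * inner ℝ (Z.1 0 x) (Z.1 1 x)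
        + 2 * ε k ^ 2 / (x 0 ^ 2 + ε k ^ 2) ^ 2 * ‖Z.1 0 x‖ ^ 2) ∂μ
        = 2 * ∫ x, (x 0 ^ 2 / (x 0 ^ 2 + ε k ^ 2) * inner ℝ (Z.1 3 x) (Z.1 1 x)
        + ε k ^ 2 * x 0 ^ 2 / (x 0 ^ 2 + ε k ^ 2) ^ 2 * ‖Z.1 3 x‖ ^ 2) ∂μ := by
      rw [← integral_const_mul]
      refine integral_congr_ae ?_
      filter_upwards [Z.2.2.2, ae_pos_axi (rectangle R L)] with x hx hp
      have : (Z.1 0) x = x 0 • (Z.1 3) x := by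
        rw [hx, Complex.real_smul, mul_div_cancel₀]
        exact_mod_cast hp.ne'
      rw [this, real_inner_smul_left, norm_smul, Real.norm_of_nonneg hp.le]
      ring
    rw [h2, integral_add (j1 k) (j2 k)] at h
    linarith
  have h := ge_of_tendsto' (l1.add l2) hnn
  simp only [one_mul, zero_mul, integral_zero, add_zero] at h
  rwa [L2.inner_def]

include hR hL in
/-- The curl is bounded below on functions with zero trace. -/
theorem HTilde0.norm_sq_le (Z : HTilde0 (rectangle R L)) :
    ‖Z‖ ^ 2 ≤ (1 + R ^ 2) * (‖Z.1.1 1 + Z.1.1 3‖ ^ 2 + ‖HTilde0.dz Z‖ ^ 2) := by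
  have hZ : H1.Approximable (HTilde.restrict subset_rfl Z.1) := by
    obtain ⟨φ, U, -, h1, h2, -, h3, -⟩ := Z.2
    exact ⟨φ, U, h1, h2, h3⟩
  have hn := integral_inner_div_nonneg hR hL hZ
  have h0 : ‖Z.1.1 0‖ ≤ R * ‖Z.1.1 3‖ := by
    refine Lp.norm_le_mul_norm_of_ae_le_mul ?_
    filter_upwards [Z.1.2.2.2, ae_pos_axi (rectangle R L),
      ae_mem_axi (isOpen_rectangle R L).measurableSet] with x hx hp hm
    rw [hx, norm_div, Complex.norm_real, Real.norm_of_nonneg hp.le, mul_div_assoc',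
      le_div_iff₀ hp, mul_comm]
    exact mul_le_mul_of_nonneg_right hm.2.1.le (norm_nonneg _)
  have e : ‖Z‖ ^ 2 = ‖Z.1.1 0‖ ^ 2 + ‖Z.1.1 1‖ ^ 2 + ‖Z.1.1 2‖ ^ 2 + ‖Z.1.1 3‖ ^ 2 := by
    rw [Submodule.coe_norm, Submodule.coe_norm, PiLp.norm_sq_eq_of_L2, Fin.sum_univ_four]
  -- The cross term is nonnegative by `hn`, so the axial curl controls `∂_r Z` and `Z/r` separately;
  -- `|Z| ≤ R |Z/r|` then supplies the `L²₁` norm of `Z` and the factor `1 + R²`.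
  have e2 := norm_add_sq_real (Z.1.1 1) (Z.1.1 3)
  rw [real_inner_comm] at e2
  have h0' : ‖Z.1.1 0‖ ^ 2 ≤ R ^ 2 * ‖Z.1.1 3‖ ^ 2 := by
    rw [← mul_pow]
    exact pow_le_pow_left₀ (norm_nonneg _) h0 2
  have e3 : HTilde0.dz Z = Z.1.1 2 := rfl
  rw [e, e2, e3]
  nlinarith [sq_nonneg R, sq_nonneg ‖Z.1.1 1‖, sq_nonneg ‖Z.1.1 2‖, sq_nonneg ‖Z.1.1 3‖,
    mul_nonneg (sq_nonneg R) (sq_nonneg ‖Z.1.1 1‖), mul_nonneg (sq_nonneg R) (sq_nonneg ‖Z.1.1 2‖),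
    mul_nonneg (sq_nonneg R) hn]

end Cross

/-! ## The magnetic operator -/

section Monotone

variable {E : Type*} [NormedAddCommGroup E] [InnerProductSpace ℝ E] {ν : ℝ → ℝ}
  {νmin ν₀ ξ ϱ : ℝ}

/-- Split off the moduli: with `s = ‖a‖ ‖b‖ - ⟨a, b⟩ ≥ 0` the inner product equals `(ν‖a‖ ‖a‖ - ν‖b‖
‖b‖)(‖a‖ - ‖b‖) + (ν‖a‖ + ν‖b‖) s`, while `‖a - b‖² = (‖a‖ - ‖b‖)² + 2 s`. Monotonicity serves the
first part, the lower bound of `ν` the second. -/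
theorem inner_sub_ge_of_monotone (hb : ∀ p, 0 ≤ p → νmin ≤ ν p)
    (hm : ∀ p q, 0 ≤ p → 0 ≤ q → ϱ * |p - q| ^ 2 ≤ (ν p * p - ν q * q) * (p - q)) (a b : E) :
    min ϱ νmin * ‖a - b‖ ^ 2 ≤ inner ℝ (a - b) (ν ‖a‖ • a - ν ‖b‖ • b) := by
  have h1 := hm ‖a‖ ‖b‖ (norm_nonneg a) (norm_nonneg b)
  have h2 : inner ℝ (a - b) (ν ‖a‖ • a - ν ‖b‖ • b)
      = ν ‖a‖ * ‖a‖ ^ 2 + ν ‖b‖ * ‖b‖ ^ 2 - (ν ‖a‖ + ν ‖b‖) * inner ℝ a b := by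
    simp only [inner_sub_left, inner_sub_right, real_inner_smul_right, real_inner_self_eq_norm_sq,
      real_inner_comm a b]
    ring
  have h3 := norm_sub_sq_real a b
  have h4 : inner ℝ a b ≤ ‖a‖ * ‖b‖ := real_inner_le_norm a b
  rw [sq_abs] at h1
  rw [h2, h3]
  have h5 := min_le_left ϱ νmin
  have h6 := min_le_right ϱ νmin
  have h7 := hb ‖a‖ (norm_nonneg a)
  have h8 := hb ‖b‖ (norm_nonneg b)
  nlinarith [mul_nonneg (sub_nonneg.2 h5) (sq_nonneg (‖a‖ - ‖b‖)),
    mul_nonneg (sub_nonneg.2 (h6.trans h7)) (sub_nonneg.2 h4),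
    mul_nonneg (sub_nonneg.2 (h6.trans h8)) (sub_nonneg.2 h4)]

/-- In `ν‖a‖ (a - b) + (ν‖a‖ - ν‖b‖) b` the second term has norm `|(ν‖a‖ - ν‖b‖) ‖b‖|`, which is a
difference of `p ↦ ν(p) p` up to `ν‖a‖ (‖a‖ - ‖b‖)`. No continuity of `ν` itself is required. -/
theorem norm_sub_le_of_lipschitz (hb : ∀ p, 0 ≤ p → 0 ≤ ν p ∧ ν p ≤ ν₀)
    (hl : ∀ p q, 0 ≤ p → 0 ≤ q → |ν p * p - ν q * q| ≤ ξ * |p - q|) (hξ : 0 ≤ ξ) (a b : E) :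
    ‖ν ‖a‖ • a - ν ‖b‖ • b‖ ≤ (ξ + 2 * ν₀) * ‖a - b‖ := by
  obtain ⟨h1, h2⟩ := hb ‖a‖ (norm_nonneg a)
  have h3 := hl ‖a‖ ‖b‖ (norm_nonneg a) (norm_nonneg b)
  have h4 := abs_norm_sub_norm_le a b
  have e : ν ‖a‖ • a - ν ‖b‖ • b = ν ‖a‖ • (a - b) + (ν ‖a‖ - ν ‖b‖) • b := by
    simp only [smul_sub, sub_smul]
    abel
  have h5 : ‖(ν ‖a‖ - ν ‖b‖) • b‖ ≤ (ξ + ν₀) * ‖a - b‖ := by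
    rw [norm_smul, ← abs_norm b, Real.norm_eq_abs, ← abs_mul, abs_norm]
    have : (ν ‖a‖ - ν ‖b‖) * ‖b‖
        = (ν ‖a‖ * ‖a‖ - ν ‖b‖ * ‖b‖) - ν ‖a‖ * (‖a‖ - ‖b‖) := by ring
    rw [this]
    refine (abs_sub _ _).trans ?_
    rw [abs_mul, abs_of_nonneg h1]
    nlinarith [mul_le_mul_of_nonneg_left h4 hξ, mul_le_mul h2 h4 (abs_nonneg _) (h1.trans h2)]
  rw [e]
  refine (norm_add_le _ _).trans ?_
  rw [norm_smul, Real.norm_of_nonneg h1]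
  nlinarith [mul_le_mul_of_nonneg_right h2 (norm_nonneg (a - b))]

end Monotone

theorem integral_norm_mul_norm_le {X E F : Type*} [MeasurableSpace X] {μ : Measure X}
    [NormedAddCommGroup E] [NormedAddCommGroup F] {f : X → E} {g : X → F}
    (hf : MemLp f 2 μ) (hg : MemLp g 2 μ) :
    ∫ x, ‖f x‖ * ‖g x‖ ∂μ ≤ √(∫ x, ‖f x‖ ^ 2 ∂μ) * √(∫ x, ‖g x‖ ^ 2 ∂μ) := by
  rw [← Real.sqrt_mul (integral_nonneg fun _ => sq_nonneg _)]
  exact Real.le_sqrt_of_sq_le (sq_integral_mul_le hf.norm hg.norm)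

namespace HTilde0

variable {ϑ : Set Plane}

/-- The vector `curl (Z e_θ)`. -/
def curlVec (Z : HTilde0 ϑ) (x : Plane) : EuclideanSpace ℂ (Fin 2) := !₂[curlR Z x, curlZ Z x]

theorem curlZ_ae (Z : HTilde0 ϑ) : curlZ Z =ᵐ[axi ϑ] (Z.1.1 1 + Z.1.1 3 : L2 ℂ ϑ) := by
  filter_upwards [Z.1.2.2.2, Lp.coeFn_add (Z.1.1 1) (Z.1.1 3)] with x h1 h2
  rw [h2, Pi.add_apply, h1]
  rfl

theorem curlR_ae (Z : HTilde0 ϑ) : curlR Z =ᵐ[axi ϑ] (-(Z.1.1 2) : L2 ℂ ϑ) :=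
  (Lp.coeFn_neg _).symm

theorem norm_curlVec (Z : HTilde0 ϑ) (x : Plane) : ‖curlVec Z x‖ = curlNorm Z x := by
  rw [EuclideanSpace.norm_eq, Fin.sum_univ_two]
  rfl

theorem norm_sq_curlVec (Z : HTilde0 ϑ) (x : Plane) :
    ‖curlVec Z x‖ ^ 2 = ‖curlR Z x‖ ^ 2 + ‖curlZ Z x‖ ^ 2 := by
  rw [EuclideanSpace.norm_sq_eq, Fin.sum_univ_two]
  rfl

theorem memLp_curlR (Z : HTilde0 ϑ) : MemLp (curlR Z) 2 (axi ϑ) :=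
  (memLp_congr_ae (curlR_ae Z)).2 (Lp.memLp _)

theorem memLp_curlZ (Z : HTilde0 ϑ) : MemLp (curlZ Z) 2 (axi ϑ) :=
  (memLp_congr_ae (curlZ_ae Z)).2 (Lp.memLp _)

theorem memLp_curlVec (Z : HTilde0 ϑ) : MemLp (curlVec Z) 2 (axi ϑ) := by
  have hm : AEStronglyMeasurable (curlVec Z) (axi ϑ) := by
    have h := (memLp_curlR Z).aestronglyMeasurable
    have h' := (memLp_curlZ Z).aestronglyMeasurable
    have hp : AEStronglyMeasurable (fun x => (curlR Z x, curlZ Z x)) (axi ϑ) := h.prodMk h'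
    have hc : Continuous fun p : ℂ × ℂ => (!₂[p.1, p.2] : EuclideanSpace ℂ (Fin 2)) := by
      fun_prop
    exact hc.comp_aestronglyMeasurable hp
  rw [memLp_two_iff_integrable_sq_norm hm]
  simp only [norm_sq_curlVec]
  exact (memLp_curlR Z).norm.integrable_sq.add (memLp_curlZ Z).norm.integrable_sq

theorem integral_norm_sq_curlVec (Z : HTilde0 ϑ) :
    ∫ x, ‖curlVec Z x‖ ^ 2 ∂axi ϑ = ‖dz Z‖ ^ 2 + ‖Z.1.1 1 + Z.1.1 3‖ ^ 2 := by
  simp only [norm_sq_curlVec]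
  rw [integral_add (memLp_curlR Z).norm.integrable_sq (memLp_curlZ Z).norm.integrable_sq,
    norm_sq_Lp, norm_sq_Lp]
  congr 1
  · refine integral_congr_ae (.of_forall fun x => ?_)
    simp [curlR]
  · refine integral_congr_ae ?_
    filter_upwards [curlZ_ae Z] with x hx
    rw [hx]

theorem norm_sq_eq (Z : HTilde0 ϑ) :
    ‖Z‖ ^ 2 = ‖Z.1.1 0‖ ^ 2 + ‖Z.1.1 1‖ ^ 2 + ‖Z.1.1 2‖ ^ 2 + ‖Z.1.1 3‖ ^ 2 := by
  rw [Submodule.coe_norm, Submodule.coe_norm, PiLp.norm_sq_eq_of_L2, Fin.sum_univ_four]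

theorem sqrt_integral_norm_sq_curlVec_le (Z : HTilde0 ϑ) :
    √(∫ x, ‖curlVec Z x‖ ^ 2 ∂axi ϑ) ≤ 2 * ‖Z‖ := by
  refine Real.sqrt_le_iff.2 ⟨by positivity, ?_⟩
  have e : dz Z = Z.1.1 2 := rfl
  have h := norm_add_le (Z.1.1 1) (Z.1.1 3)
  rw [integral_norm_sq_curlVec, mul_pow, norm_sq_eq, e]
  nlinarith [norm_nonneg (Z.1.1 1 + Z.1.1 3), sq_nonneg (‖Z.1.1 1‖ - ‖Z.1.1 3‖),
    sq_nonneg ‖Z.1.1 0‖, sq_nonneg ‖Z.1.1 2‖]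

theorem curlVec_sub (A B : HTilde0 ϑ) :
    curlVec (A - B) =ᵐ[axi ϑ] fun x => curlVec A x - curlVec B x := by
  filter_upwards [curlR_ae A, curlR_ae B, curlR_ae (A - B), curlZ_ae A, curlZ_ae B,
    curlZ_ae (A - B), Lp.coeFn_sub (-(A.1.1 2)) (-(B.1.1 2)),
    Lp.coeFn_sub (A.1.1 1 + A.1.1 3) (B.1.1 1 + B.1.1 3)] with x h1 h2 h3 h4 h5 h6 h7 h8
  have e1 : (-((A - B).1.1 2) : L2 ℂ ϑ) = -(A.1.1 2) - -(B.1.1 2) := by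
    have : (A - B).1.1 2 = A.1.1 2 - B.1.1 2 := rfl
    rw [this]; abel
  have e2 : ((A - B).1.1 1 + (A - B).1.1 3 : L2 ℂ ϑ) = (A.1.1 1 + A.1.1 3) - (B.1.1 1 + B.1.1 3) := by
    have h : (A - B).1.1 1 = A.1.1 1 - B.1.1 1 := rfl
    have h' : (A - B).1.1 3 = A.1.1 3 - B.1.1 3 := rfl
    rw [h, h']; abel
  rw [e1, h7, Pi.sub_apply, ← h1, ← h2] at h3
  rw [e2, h8, Pi.sub_apply, ← h4, ← h5] at h6
  ext i
  fin_cases i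
  · exact h3
  · exact h6

end HTilde0

namespace Coefficients

variable {m : ℕ} {G : Configuration m} (D : Coefficients G)

/-- Only `p ↦ ν_C(p) p` is known to be continuous; dividing by `p` for `p > 0` shows that `ν_C` is
measurable. The truncation is there because the assumptions concern `p ≥ 0` only. -/
theorem measurable_ν_aux : Measurable fun p : ℝ => D.νC (max p 0) := by
  obtain ⟨ξ, hξ, hl⟩ := D.ν_lipschitz
  have hc : Continuous fun p : ℝ => D.νC (max p 0) * max p 0 := by
    refine continuous_iff_continuousAt.2 fun p => Metric.continuousAt_iff.2 fun ε hε =>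
      ⟨ε / ξ, by positivity, fun {q} hq => ?_⟩
    rw [Real.dist_eq] at hq ⊢
    refine (hl _ _ (le_max_right _ _) (le_max_right _ _)).trans_lt ?_
    rw [lt_div_iff₀ hξ] at hq
    have := abs_max_sub_max_le_abs q p 0
    nlinarith
  have e : (fun p : ℝ => D.νC (max p 0)) = fun p => if 0 < p then
      D.νC (max p 0) * max p 0 / p else D.νC 0 := by
    funext p
    split_ifs with h
    · rw [max_eq_left h.le, mul_div_cancel_right₀ _ h.ne']
    · rw [max_eq_right (not_lt.1 h)]
  rw [e]
  exact Measurable.ite measurableSet_Ioi (hc.measurable.div measurable_id) measurable_const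

theorem isOpen_conductor : IsOpen G.conductor :=
  G.workpiece_polygonal.isOpen.union (isOpen_iUnion G.coil_open)

open Classical in
theorem aestronglyMeasurable_ν {μ : Measure Plane} {f : Plane → ℝ}
    (hf : AEStronglyMeasurable f μ) (h0 : ∀ x, 0 ≤ f x) :
    AEStronglyMeasurable (fun x => D.ν x (f x)) μ := by
  have e : (fun x => D.ν x (f x)) = G.conductor.piecewise (fun x => D.νC (max (f x) 0))
      fun _ => D.ν₀ := by
    funext x
    by_cases hx : x ∈ G.conductor
    · rw [piecewise_eq_of_mem _ _ _ hx, ν, if_pos hx, max_eq_left (h0 x)]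
    · rw [piecewise_eq_of_notMem _ _ _ hx, ν, if_neg hx]
  rw [e]
  refine AEStronglyMeasurable.piecewise (isOpen_conductor (G := G)).measurableSet ?_ ?_
  · exact ((D.measurable_ν_aux.comp_aemeasurable hf.aemeasurable).aestronglyMeasurable).restrict
  · exact aestronglyMeasurable_const

theorem ν_properties : ∃ νmin ξ ϱ : ℝ, 0 < νmin ∧ 0 < ξ ∧ 0 < ϱ ∧ 0 < D.ν₀ ∧ ∀ x,
    (∀ p, 0 ≤ p → νmin ≤ D.ν x p ∧ D.ν x p ≤ D.ν₀) ∧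
    (∀ p q, 0 ≤ p → 0 ≤ q → |D.ν x p * p - D.ν x q * q| ≤ ξ * |p - q|) ∧
    (∀ p q, 0 ≤ p → 0 ≤ q → ϱ * |p - q| ^ 2 ≤ (D.ν x p * p - D.ν x q * q) * (p - q)) := by
  obtain ⟨νmin, h0, hb⟩ := D.ν_bounds
  obtain ⟨ξ, hξ, hl⟩ := D.ν_lipschitz
  obtain ⟨ϱ, hϱ, hm⟩ := D.ν_monotone
  have hmin : νmin ≤ D.ν₀ := (hb 0 le_rfl).1.trans (hb 0 le_rfl).2
  have hpos : 0 < D.ν₀ := h0.trans_le hmin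
  refine ⟨νmin, max ξ D.ν₀, min ϱ D.ν₀, h0, lt_max_of_lt_left hξ, lt_min hϱ hpos, hpos,
    fun x => ?_⟩
  by_cases hx : x ∈ G.conductor
  · have e : D.ν x = D.νC := by
      funext p
      rw [ν, if_pos hx]
    rw [e]
    exact ⟨hb, fun p q hp hq => (hl p q hp hq).trans
        (mul_le_mul_of_nonneg_right (le_max_left _ _) (abs_nonneg _)),
      fun p q hp hq => (mul_le_mul_of_nonneg_right (min_le_left _ _) (by positivity)).trans
        (hm p q hp hq)⟩
  · have e : D.ν x = fun _ => D.ν₀ := by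
      funext p
      rw [ν, if_neg hx]
    rw [e]
    refine ⟨fun _ _ => ⟨hmin, le_rfl⟩, fun p q _ _ => ?_, fun p q _ _ => ?_⟩
    · rw [← mul_sub, abs_mul, abs_of_pos hpos]
      exact mul_le_mul_of_nonneg_right (le_max_right _ _) (abs_nonneg _)
    · rw [← mul_sub, mul_assoc, ← sq, sq_abs]
      exact mul_le_mul_of_nonneg_right (min_le_right _ _) (sq_nonneg _)

/-- The field `ν(|curl A|) curl A`. -/
def flux (A : HTilde0 G.dom) (x : Plane) : EuclideanSpace ℂ (Fin 2) :=
  D.ν x ‖HTilde0.curlVec A x‖ • HTilde0.curlVec A x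

theorem memLp_flux (A : HTilde0 G.dom) : MemLp (D.flux A) 2 (axi G.dom) := by
  obtain ⟨νmin, _, _, h0, _, _, _, h⟩ := D.ν_properties
  have hA := HTilde0.memLp_curlVec A
  refine MemLp.of_le_mul (c := D.ν₀) hA
    ((D.aestronglyMeasurable_ν hA.aestronglyMeasurable.norm fun _ => norm_nonneg _).smul
      hA.aestronglyMeasurable) (.of_forall fun x => ?_)
  obtain ⟨h1, h2⟩ := (h x).1 ‖HTilde0.curlVec A x‖ (norm_nonneg _)
  rw [flux, norm_smul, Real.norm_of_nonneg (h0.le.trans h1)]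
  exact mul_le_mul_of_nonneg_right h2 (norm_nonneg _)

theorem magnetic_eq (A Z : HTilde0 G.dom) :
    D.magnetic A Z = ∫ x, inner ℂ (HTilde0.curlVec Z x) (D.flux A x) ∂axi G.dom := by
  refine integral_congr_ae (.of_forall fun x => ?_)
  simp only [flux, HTilde0.norm_curlVec, PiLp.inner_apply, Fin.sum_univ_two, RCLike.inner_apply,
    PiLp.smul_apply, Complex.real_smul]
  simp only [HTilde0.curlVec, PiLp.toLp_apply, Matrix.cons_val_zero, Matrix.cons_val_one]
  ring

theorem integrable_inner_flux (A Z : HTilde0 G.dom) :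
    Integrable (fun x => inner ℂ (HTilde0.curlVec Z x) (D.flux A x)) (axi G.dom) :=
  ((HTilde0.memLp_curlVec Z).norm.integrable_mul (D.memLp_flux A).norm).mono'
    ((HTilde0.memLp_curlVec Z).aestronglyMeasurable.inner (D.memLp_flux A).aestronglyMeasurable)
    (.of_forall fun _ => norm_inner_le_norm _ _)

/-- Pointwise strong monotonicity bounds the real part below by the `L²₁` norm of the curl of `A -
B`, and `HTilde0.norm_sq_le` turns that into the full norm. -/
theorem exists_magnetic_coercive : ∃ c : ℝ, 0 < c ∧ ∀ A B : HTilde0 G.dom,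
    c * ‖A - B‖ ^ 2 ≤ (D.magnetic A (A - B) - D.magnetic B (A - B)).re := by
  obtain ⟨νmin, ξ, ϱ, h0, -, hϱ, -, h⟩ := D.ν_properties
  have hc : 0 < min ϱ νmin := lt_min hϱ h0
  refine ⟨min ϱ νmin / (1 + G.R ^ 2), by positivity, fun A B => ?_⟩
  rw [magnetic_eq, magnetic_eq,
    ← integral_sub (D.integrable_inner_flux A _) (D.integrable_inner_flux B _)]
  have hi := (D.integrable_inner_flux A (A - B)).sub (D.integrable_inner_flux B (A - B))
  have hre := (Complex.reCLM.integral_comp_comm hi)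
  simp only [Complex.reCLM_apply, Pi.sub_apply] at hre
  rw [← hre]
  have hn : ‖A - B‖ ^ 2 ≤ (1 + G.R ^ 2) * (‖(A - B).1.1 1 + (A - B).1.1 3‖ ^ 2
      + ‖HTilde0.dz (A - B)‖ ^ 2) := HTilde0.norm_sq_le G.R_pos G.L_pos (A - B)
  have hcv := HTilde0.integral_norm_sq_curlVec (A - B)
  rw [add_comm (‖_‖ ^ 2) (‖_‖ ^ 2), ← hcv] at hn
  calc _ ≤ min ϱ νmin * ∫ x, ‖HTilde0.curlVec (A - B) x‖ ^ 2 ∂axi G.dom := by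
        rw [div_mul_eq_mul_div, div_le_iff₀ (by positivity), mul_assoc]
        refine mul_le_mul_of_nonneg_left (hn.trans_eq (mul_comm _ _)) hc.le
    _ = ∫ x, min ϱ νmin * ‖HTilde0.curlVec (A - B) x‖ ^ 2 ∂axi G.dom :=
        (integral_const_mul _ _).symm
    _ ≤ _ := by
        refine integral_mono_ae ?_ hi.re ?_
        · exact (HTilde0.memLp_curlVec (A - B)).norm.integrable_sq.const_mul _
        · filter_upwards [HTilde0.curlVec_sub A B] with x hx
          simp only [hx]
          have := inner_sub_ge_of_monotone (fun p hp => ((h x).1 p hp).1) (h x).2.2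
            (HTilde0.curlVec A x) (HTilde0.curlVec B x)
          refine this.trans_eq ?_
          rw [← inner_sub_right, PiLp.inner_apply, PiLp.inner_apply, Complex.re_sum]
          exact Finset.sum_congr rfl fun i _ => real_inner_eq_re_inner ℂ _ _

theorem exists_magnetic_lipschitz : ∃ K : ℝ, 0 ≤ K ∧ ∀ A B Z : HTilde0 G.dom,
    ‖D.magnetic A Z - D.magnetic B Z‖ ≤ K * ‖A - B‖ * ‖Z‖ := by
  obtain ⟨νmin, ξ, ϱ, h0, hξ, hϱ, hpos, h⟩ := D.ν_properties
  refine ⟨4 * (ξ + 2 * D.ν₀), by positivity, fun A B Z => ?_⟩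
  rw [magnetic_eq, magnetic_eq,
    ← integral_sub (D.integrable_inner_flux A _) (D.integrable_inner_flux B _)]
  have hZ := HTilde0.memLp_curlVec Z
  have hAB := HTilde0.memLp_curlVec (A - B)
  calc _ ≤ ∫ x, ‖inner ℂ (HTilde0.curlVec Z x) (D.flux A x)
        - inner ℂ (HTilde0.curlVec Z x) (D.flux B x)‖ ∂axi G.dom := norm_integral_le_integral_norm _
    _ ≤ ∫ x, (ξ + 2 * D.ν₀) * (‖HTilde0.curlVec Z x‖ * ‖HTilde0.curlVec (A - B) x‖)
        ∂axi G.dom := by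
        refine integral_mono_ae ((D.integrable_inner_flux A Z).sub
          (D.integrable_inner_flux B Z)).norm ((hZ.norm.integrable_mul hAB.norm).const_mul _) ?_
        filter_upwards [HTilde0.curlVec_sub A B] with x hx
        rw [← inner_sub_right, hx]
        refine (norm_inner_le_norm _ _).trans ?_
        have := norm_sub_le_of_lipschitz (fun p hp => ⟨h0.le.trans ((h x).1 p hp).1,
          ((h x).1 p hp).2⟩) (h x).2.1 hξ.le (HTilde0.curlVec A x) (HTilde0.curlVec B x)
        rw [mul_left_comm]
        exact mul_le_mul_of_nonneg_left this (norm_nonneg _)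
    _ ≤ (ξ + 2 * D.ν₀) * ((2 * ‖Z‖) * (2 * ‖A - B‖)) := by
        rw [integral_const_mul]
        refine mul_le_mul_of_nonneg_left ((integral_norm_mul_norm_le hZ hAB).trans ?_)
          (by positivity)
        exact mul_le_mul (HTilde0.sqrt_integral_norm_sq_curlVec_le Z)
          (HTilde0.sqrt_integral_norm_sq_curlVec_le _) (Real.sqrt_nonneg _) (by positivity)
    _ = _ := by ring

theorem magnetic_zero (Z : HTilde0 G.dom) : D.magnetic 0 Z = 0 := by
  rw [magnetic_eq]
  refine integral_eq_zero_of_ae ?_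
  filter_upwards [HTilde0.curlVec_sub (0 : HTilde0 G.dom) 0] with x hx
  rw [sub_self, sub_self] at hx
  simp [flux, hx]

end Coefficients

/-! ## Hölder's inequality with the exponents 2, 6, 6, 6 -/

section Holder

variable {X : Type*} [MeasurableSpace X] {μ : Measure X}

theorem holderTriple_six_six : ENNReal.HolderTriple 6 6 3 := ⟨by
  rw [← ENNReal.toReal_eq_toReal_iff' (by simp) (by simp), ENNReal.toReal_add (by simp) (by simp)]
  norm_num⟩

theorem holderTriple_six_three : ENNReal.HolderTriple 6 3 2 := ⟨by
  rw [← ENNReal.toReal_eq_toReal_iff' (by simp) (by simp), ENNReal.toReal_add (by simp) (by simp)]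
  norm_num⟩

/-- The exponents balance exactly, `1/2 + 3 · 1/6 = 1`: one factor is an error measured in `L²`, the
other three come from the critical embedding or are the constant one. -/
theorem integrable_and_integral_abs_le {f g₁ g₂ g₃ : X → ℝ} {a b₁ b₂ b₃ : ℝ}
    (hf : AEStronglyMeasurable f μ) (h₁ : AEStronglyMeasurable g₁ μ)
    (h₂ : AEStronglyMeasurable g₂ μ) (h₃ : AEStronglyMeasurable g₃ μ)
    (ha : 0 ≤ a) (hb₁ : 0 ≤ b₁) (hb₂ : 0 ≤ b₂) (hb₃ : 0 ≤ b₃)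
    (nf : eLpNorm f 2 μ ≤ ENNReal.ofReal a) (n₁ : eLpNorm g₁ 6 μ ≤ ENNReal.ofReal b₁)
    (n₂ : eLpNorm g₂ 6 μ ≤ ENNReal.ofReal b₂) (n₃ : eLpNorm g₃ 6 μ ≤ ENNReal.ofReal b₃) :
    Integrable (fun x => f x * (g₁ x * (g₂ x * g₃ x))) μ ∧
      ∫ x, |f x * (g₁ x * (g₂ x * g₃ x))| ∂μ ≤ a * (b₁ * (b₂ * b₃)) := by
  have := holderTriple_six_six
  have := holderTriple_six_three
  have e1 : eLpNorm (g₂ • g₃) 3 μ ≤ ENNReal.ofReal (b₂ * b₃) := by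
    rw [ENNReal.ofReal_mul hb₂]
    exact (eLpNorm_smul_le_mul_eLpNorm h₃ h₂).trans (mul_le_mul' n₂ n₃)
  have e2 : eLpNorm (g₁ • (g₂ • g₃)) 2 μ ≤ ENNReal.ofReal (b₁ * (b₂ * b₃)) := by
    rw [ENNReal.ofReal_mul hb₁]
    exact (eLpNorm_smul_le_mul_eLpNorm (h₂.smul h₃) h₁).trans (mul_le_mul' n₁ e1)
  have e3 : eLpNorm (f • (g₁ • (g₂ • g₃))) 1 μ ≤ ENNReal.ofReal (a * (b₁ * (b₂ * b₃))) := by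
    rw [ENNReal.ofReal_mul ha]
    exact (eLpNorm_smul_le_mul_eLpNorm (h₁.smul (h₂.smul h₃)) hf).trans (mul_le_mul' nf e2)
  have hm : AEStronglyMeasurable (f • (g₁ • (g₂ • g₃))) μ := hf.smul (h₁.smul (h₂.smul h₃))
  have hi : Integrable (f • (g₁ • (g₂ • g₃))) μ :=
    memLp_one_iff_integrable.1 ⟨hm, e3.trans_lt ENNReal.ofReal_lt_top⟩
  refine ⟨hi, ?_⟩
  rw [eLpNorm_one_eq_lintegral_enorm] at e3
  exact (integral_norm_eq_lintegral_enorm hm).trans_le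
    (ENNReal.toReal_le_of_le_ofReal (by positivity) e3)

end Holder

/-- For a simple function the composition is a finite sum of measurable pieces; continuity in the
second variable passes to the limit along simple approximations of `S`. -/
theorem aemeasurable_caratheodory {X : Type*} [MeasurableSpace X] {μ : Measure X}
    {σ : X → ℝ → ℝ} (hm : ∀ u, AEMeasurable (fun x => σ x u) μ) (hc : ∀ᵐ x ∂μ, Continuous (σ x))
    {S : X → ℝ} (hS : StronglyMeasurable S) : AEMeasurable (fun x => σ x (S x)) μ := by
  have h1 : ∀ f : SimpleFunc X ℝ, AEMeasurable (fun x => σ x (f x)) μ := by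
    intro f
    have e : (fun x => σ x (f x)) = fun x => ∑ u ∈ f.range, (f ⁻¹' {u}).indicator (fun x => σ x u) x := by
      funext x
      rw [Finset.sum_eq_single (f x)]
      · simp
      · intro u _ hu
        exact indicator_of_notMem (fun h => hu h.symm) _
      · intro h
        exact absurd (f.mem_range_self x) h
    rw [e]
    exact Finset.aemeasurable_fun_sum _ fun u _ => (hm u).indicator (f.measurableSet_fiber u)
  refine aemeasurable_of_tendsto_metrizable_ae atTop (fun n => h1 (hS.approx n)) ?_
  filter_upwards [hc] with x hx
  exact (hx.tendsto _).comp (hS.tendsto_approx x)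

/-! ## Restriction to subdomains -/

theorem norm_restrictL2_le {𝕜 : Type} [RCLike 𝕜] {ϑ' ϑ : Set Plane} (h : ϑ' ⊆ ϑ) (u : L2 𝕜 ϑ) :
    ‖restrictL2 h u‖ ≤ ‖u‖ := by
  rw [Lp.norm_def, Lp.norm_def, eLpNorm_congr_ae (restrictL2_ae h u)]
  exact ENNReal.toReal_mono (Lp.eLpNorm_ne_top u) (eLpNorm_mono_measure _ (axi_mono h))

theorem continuous_restrictL2 {𝕜 : Type} [RCLike 𝕜] {ϑ' ϑ : Set Plane} (h : ϑ' ⊆ ϑ) :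
    Continuous (restrictL2 (𝕜 := 𝕜) h) :=
  AddMonoidHomClass.continuous_of_bound (restrictL2 h) 1 fun u => by
    rw [one_mul]; exact norm_restrictL2_le h u

theorem HTilde.norm_restrict_le {ϑ' ϑ : Set Plane} (h : ϑ' ⊆ ϑ) (Z : HTilde0 ϑ) :
    ‖HTilde.restrict h Z.1‖ ≤ ‖Z‖ := by
  refine (sq_le_sq₀ (norm_nonneg _) (norm_nonneg _)).1 ?_
  refine le_trans ?_ (HTilde0.norm_sq_eq Z).ge
  rw [H1.norm_sq]
  have h0 : ‖H1.fn (HTilde.restrict h Z.1)‖ ≤ ‖Z.1.1 0‖ := norm_restrictL2_le h _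
  have h1 : ‖H1.dr (HTilde.restrict h Z.1)‖ ≤ ‖Z.1.1 1‖ := norm_restrictL2_le h _
  have h2 : ‖H1.dz (HTilde.restrict h Z.1)‖ ≤ ‖Z.1.1 2‖ := norm_restrictL2_le h _
  have h0' := pow_le_pow_left₀ (norm_nonneg _) h0 2
  have h1' := pow_le_pow_left₀ (norm_nonneg _) h1 2
  have h2' := pow_le_pow_left₀ (norm_nonneg _) h2 2
  linarith [sq_nonneg ‖Z.1.1 3‖]

theorem HTilde.approximable_restrict {ϑ' ϑ : Set Plane} (h : ϑ' ⊆ ϑ) (ho' : IsOpen ϑ')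
    (ho : IsOpen ϑ) (hb : Bornology.IsBounded ϑ) (hp : ϑ ⊆ {x | 0 < x 0}) (Z : HTilde0 ϑ) :
    H1.Approximable (HTilde.restrict h Z.1) := by
  obtain ⟨φ, U, -, h1, h2, -, h3, -⟩ := Z.2
  have hb' := hb.subset h
  have hm' := ho'.measurableSet
  have hm := ho.measurableSet
  refine ⟨φ, fun n => H1.ofContDiff hm' hb' (h1 n), h1, fun n => H1.fn_ofContDiff hm' hb' (h1 n), ?_⟩
  obtain ⟨t0, t1, t2⟩ := H1.tendsto_components h3
  have e := fun n => H1.eq_ofContDiff hm hb (h1 n) ho hp (h2 n)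
  have r : ∀ w : L2 ℂ ϑ, restrictL2 h (restrictL2 subset_rfl w) = restrictL2 h w := fun w => by
    rw [restrictL2_self]
  refine tendsto_H1 ?_ ?_ ?_
  · have := ((continuous_restrictL2 h).tendsto _).comp t0
    rw [show H1.fn (HTilde.restrict h Z.1) = restrictL2 h (H1.fn (HTilde.restrict subset_rfl Z.1))
      from (r _).symm]
    refine this.congr fun n => ?_
    refine Lp.ext ((restrictL2_ae h _).trans ?_)
    have e2 : H1.fn (U n) =ᵐ[axi ϑ'] φ n := ae_mono (axi_mono h) (h2 n)
    exact e2.trans (H1.fn_ofContDiff hm' hb' (h1 n)).symm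
  · have := ((continuous_restrictL2 h).tendsto _).comp t1
    rw [show H1.dr (HTilde.restrict h Z.1) = restrictL2 h (H1.dr (HTilde.restrict subset_rfl Z.1))
      from (r _).symm]
    refine this.congr fun n => ?_
    refine Lp.ext ((restrictL2_ae h _).trans ?_)
    dsimp only
    rw [e n]
    have e2 : H1.dr (H1.ofContDiff hm hb (h1 n)) =ᵐ[axi ϑ'] _ :=
      ae_mono (axi_mono h) (H1.dr_ofContDiff hm hb (h1 n))
    exact e2.trans
      (H1.dr_ofContDiff hm' hb' (h1 n)).symm
  · have := ((continuous_restrictL2 h).tendsto _).comp t2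
    rw [show H1.dz (HTilde.restrict h Z.1) = restrictL2 h (H1.dz (HTilde.restrict subset_rfl Z.1))
      from (r _).symm]
    refine this.congr fun n => ?_
    refine Lp.ext ((restrictL2_ae h _).trans ?_)
    dsimp only
    rw [e n]
    have e2 : H1.dz (H1.ofContDiff hm hb (h1 n)) =ᵐ[axi ϑ'] _ :=
      ae_mono (axi_mono h) (H1.dz_ofContDiff hm hb (h1 n))
    exact e2.trans
      (H1.dz_ofContDiff hm' hb' (h1 n)).symm

theorem axi_restrict {ϑ' ϑ : Set Plane} (h : ϑ' ⊆ ϑ) (hm : MeasurableSet ϑ') :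
    (axi ϑ).restrict ϑ' = axi ϑ' := by
  unfold axi
  rw [restrict_withDensity hm, Measure.restrict_restrict hm, inter_eq_self_of_subset_left h]

theorem axi_absolutelyContinuous {ϑ' ϑ : Set Plane} (h : ϑ' ⊆ ϑ) :
    axi ϑ' ≪ volume.restrict ϑ :=
  (withDensity_absolutelyContinuous _ _).trans (Measure.restrict_mono h le_rfl).absolutelyContinuous

namespace Configuration

variable {m : ℕ} (G : Configuration m)

theorem isOpen_dom : IsOpen G.dom := isOpen_rectangle _ _

theorem isBounded_dom : Bornology.IsBounded G.dom := isBounded_rectangle _ _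

theorem dom_pos : G.dom ⊆ {x | 0 < x 0} := rectangle_subset_pos _ _

theorem conductor_subset : G.conductor ⊆ G.dom :=
  union_subset G.workpiece_subset (iUnion_subset G.coil_subset)

/-- One constant for all the `L⁶₁` norms that enter Hölder's inequality, including that of the
function `1`, which fills a slot when there are fewer than three factors. Potentials are measured on
the workpiece only. -/
theorem exists_embedding : ∃ K : ℝ, 0 ≤ K ∧
    (∀ W : H1 ℝ G.workpiece, H1.Approximable W →
      eLpNorm (H1.fn W) 6 (axi G.workpiece) ≤ ENNReal.ofReal (K * ‖W‖)) ∧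
    (∀ A : HTilde0 G.dom, eLpNorm (HTilde0.fn A) 6 (axi G.workpiece)
      ≤ ENNReal.ofReal (K * ‖HTilde.restrict G.workpiece_subset_dom A.1‖)) ∧
    eLpNorm (fun _ => (1 : ℝ)) 6 (axi G.workpiece) ≤ ENNReal.ofReal K := by
  have hb := G.isBounded_workpiece
  have hp := G.workpiece_pos
  have ho := G.workpiece_polygonal.isOpen
  obtain ⟨K₁, h1, hK₁⟩ := exists_embedding_real G.workpiece_polygonal hp hb
  obtain ⟨K₂, h2, hK₂⟩ := exists_embedding_complex G.workpiece_polygonal hp hb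
  have hfin := isFiniteMeasure_axi ho.measurableSet hb
  have hc : MemLp (fun _ : Plane => (1 : ℝ)) 6 (axi G.workpiece) := memLp_const 1
  set K₃ := (eLpNorm (fun _ : Plane => (1 : ℝ)) 6 (axi G.workpiece)).toReal
  have h3 : 0 ≤ K₃ := ENNReal.toReal_nonneg
  refine ⟨K₁ + K₂ + K₃, by positivity, fun W hW => (hK₁ W hW).trans ?_, fun A => ?_, ?_⟩
  · exact ENNReal.ofReal_le_ofReal (mul_le_mul_of_nonneg_right (by linarith) (norm_nonneg _))
  · have h := hK₂ _ (HTilde.approximable_restrict G.workpiece_subset_dom ho G.isOpen_dom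
      G.isBounded_dom G.dom_pos A)
    have e : H1.fn (HTilde.restrict G.workpiece_subset_dom A.1) =ᵐ[axi G.workpiece]
      HTilde0.fn A := restrictL2_ae G.workpiece_subset_dom (HTilde0.fn A)
    rw [eLpNorm_congr_ae e] at h
    exact h.trans (ENNReal.ofReal_le_ofReal
      (mul_le_mul_of_nonneg_right (by linarith) (norm_nonneg _)))
  · rw [← ENNReal.ofReal_toReal hc.eLpNorm_ne_top]
    exact ENNReal.ofReal_le_ofReal (by linarith)

end Configuration

/-! ## The electromagnetic form -/

namespace Coefficients

variable {m : ℕ} {G : Configuration m} (D : Coefficients G)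

theorem aestronglyMeasurable_σ {μ : Measure Plane} (hμ : μ ≪ volume.restrict G.dom)
    (S : L2 ℝ G.workpiece) : AEStronglyMeasurable (fun x => D.σ x (S x)) μ :=
  (aemeasurable_caratheodory (fun u => (D.σ_measurable u).mono_ac hμ)
    (hμ.ae_le D.σ_continuous) (Lp.stronglyMeasurable S)).aestronglyMeasurable

/-- The conductivity is bounded, and Lipschitz in the temperature; off the workpiece it is
independent of the temperature. -/
theorem exists_σ_properties : ∃ s : ℝ, 0 ≤ s ∧
    (∀ᵐ x ∂axi G.conductor, (∀ u, 0 ≤ D.σ x u ∧ D.σ x u ≤ s) ∧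
      ∀ u v, |D.σ x u - D.σ x v| ≤ G.workpiece.indicator (fun _ => s * |u - v|) x) := by
  obtain ⟨lo, hi, h0, hb⟩ := D.σ_bounds
  obtain ⟨σp, hp, hl⟩ := D.σ_lipschitz
  have hs : ∀ k, 0 ≤ D.σcoil k := fun k => (D.σcoil_pos k).le
  have hsum : 0 ≤ ∑ k, D.σcoil k := Finset.sum_nonneg fun k _ => hs k
  have h1 : ∀ᵐ x, x ∈ G.workpiece → ∀ u, lo ≤ D.σ x u ∧ D.σ x u ≤ hi :=
    (ae_restrict_iff' G.workpiece_polygonal.isOpen.measurableSet).1 hb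
  have h2 : ∀ᵐ x, x ∈ G.workpiece → ∀ u v, |D.σ x u - D.σ x v| ≤ σp * |u - v| :=
    (ae_restrict_iff' G.workpiece_polygonal.isOpen.measurableSet).1 hl
  have h3 : ∀ᵐ x, ∀ k, x ∈ G.coil k → ∀ u, D.σ x u = D.σcoil k :=
    ae_all_iff.2 fun k => (ae_restrict_iff' (G.coil_open k).measurableSet).1 (D.σ_coil k)
  have hac : axi G.conductor ≪ volume :=
    (axi_absolutelyContinuous G.conductor_subset).trans Measure.absolutelyContinuous_restrict
  refine ⟨|hi| + ∑ k, D.σcoil k + σp, by positivity, ?_⟩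
  filter_upwards [hac.ae_le h1, hac.ae_le h2, hac.ae_le h3,
    ae_mem_axi (isOpen_conductor (G := G)).measurableSet] with x x1 x2 x3 hx
  rcases hx with hx | hx
  · refine ⟨fun u => ⟨h0.le.trans (x1 hx u).1, ?_⟩, fun u v => ?_⟩
    · linarith [(x1 hx u).2, le_abs_self hi]
    · rw [indicator_of_mem hx]
      exact (x2 hx u v).trans (mul_le_mul_of_nonneg_right (by linarith [abs_nonneg hi])
        (abs_nonneg _))
  · obtain ⟨k, hk⟩ := mem_iUnion.1 hx
    have hn : x ∉ G.workpiece := fun h => disjoint_left.1 (G.workpiece_disjoint k) h hk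
    refine ⟨fun u => ?_, fun u v => ?_⟩
    · rw [x3 k hk]
      exact ⟨hs k, by linarith [abs_nonneg hi,
        Finset.single_le_sum (f := D.σcoil) (fun j _ => hs j) (Finset.mem_univ k)]⟩
    · rw [x3 k hk, x3 k hk, sub_self, abs_zero, indicator_of_notMem hn]

/-- The eddy current term `∫_{Ω_C} σ(·,S) A Z̄ r`. -/
def eddy (S : L2 ℝ G.workpiece) (A Z : HTilde0 G.dom) : ℂ :=
  ∫ x, (D.σ x (S x) : ℂ) * (HTilde0.fn A) x * (starRingEnd ℂ) ((HTilde0.fn Z) x) ∂axi G.conductor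

/-- The left-hand side of the electromagnetic equation. -/
def electricForm (S : L2 ℝ G.workpiece) (A Z : HTilde0 G.dom) : ℂ :=
  Complex.I * D.ω * D.eddy S A Z + D.magnetic A Z

/-- The load of the electromagnetic equation. -/
def load (V : Fin m → ℂ) (Z : HTilde0 G.dom) : ℂ :=
  ∑ k, ∫ x in G.coil k, (D.σcoil k : ℂ) * V k * (starRingEnd ℂ) ((HTilde0.fn Z) x)

theorem eddy_def (S : L2 ℝ G.workpiece) (A Z : HTilde0 G.dom) : D.eddy S A Z =
    ∫ x, (D.σ x (S x) : ℂ) * (HTilde0.fn A) x * (starRingEnd ℂ) ((HTilde0.fn Z) x)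
      ∂axi G.conductor := rfl

theorem electricForm_def (S : L2 ℝ G.workpiece) (A Z : HTilde0 G.dom) :
    D.electricForm S A Z = Complex.I * D.ω * D.eddy S A Z + D.magnetic A Z := rfl

theorem load_def (V : Fin m → ℂ) (Z : HTilde0 G.dom) : D.load V Z =
    ∑ k, ∫ x in G.coil k, (D.σcoil k : ℂ) * V k * (starRingEnd ℂ) ((HTilde0.fn Z) x) := rfl

theorem electricEq_iff (V : Fin m → ℂ) (S : L2 ℝ G.workpiece) (A Z : HTilde0 G.dom) :
    D.ElectricEq V S A Z ↔ D.electricForm S A Z = D.load V Z := Iff.rfl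

attribute [irreducible] eddy electricForm load

theorem memLp_fn_of_subset {ϑ : Set Plane} (h : ϑ ⊆ G.dom) (A : HTilde0 G.dom) :
    MemLp (HTilde0.fn A) 2 (axi ϑ) :=
  (Lp.memLp (HTilde0.fn A)).mono_measure (axi_mono h)

theorem sqrt_integral_norm_sq_fn_le {ϑ : Set Plane} (h : ϑ ⊆ G.dom) (A : HTilde0 G.dom) :
    √(∫ x, ‖HTilde0.fn A x‖ ^ 2 ∂axi ϑ) ≤ ‖A‖ := by
  refine Real.sqrt_le_iff.2 ⟨norm_nonneg _, ?_⟩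
  have h1 : ∫ x, ‖HTilde0.fn A x‖ ^ 2 ∂axi ϑ ≤ ∫ x, ‖HTilde0.fn A x‖ ^ 2 ∂axi G.dom :=
    integral_mono_measure (axi_mono h) (.of_forall fun _ => sq_nonneg _)
      (Lp.memLp (HTilde0.fn A)).norm.integrable_sq
  refine h1.trans ?_
  rw [← norm_sq_Lp]
  refine le_trans ?_ (HTilde0.norm_sq_eq A).ge
  have : HTilde0.fn A = A.1.1 0 := rfl
  rw [this]
  nlinarith [sq_nonneg ‖A.1.1 1‖, sq_nonneg ‖A.1.1 2‖, sq_nonneg ‖A.1.1 3‖]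

theorem aestronglyMeasurable_σ_conductor (S : L2 ℝ G.workpiece) :
    AEStronglyMeasurable (fun x => (D.σ x (S x) : ℂ)) (axi G.conductor) :=
  Complex.continuous_ofReal.comp_aestronglyMeasurable
    (D.aestronglyMeasurable_σ (axi_absolutelyContinuous G.conductor_subset) S)

theorem integrable_fn_mul_conj (A Z : HTilde0 G.dom) :
    Integrable (fun x => HTilde0.fn A x * (starRingEnd ℂ) (HTilde0.fn Z x)) (axi G.conductor) := by
  have hA := memLp_fn_of_subset G.conductor_subset A
  have hZ := memLp_fn_of_subset G.conductor_subset Z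
  exact hA.integrable_mul hZ.star

theorem integrable_eddy (S : L2 ℝ G.workpiece) (A Z : HTilde0 G.dom) :
    Integrable (fun x => (D.σ x (S x) : ℂ) * (HTilde0.fn A) x *
      (starRingEnd ℂ) ((HTilde0.fn Z) x)) (axi G.conductor) := by
  obtain ⟨s, hs, h⟩ := D.exists_σ_properties
  have := (integrable_fn_mul_conj A Z).bdd_mul (c := s) (D.aestronglyMeasurable_σ_conductor S) (by
    filter_upwards [h] with x hx
    rw [Complex.norm_real, Real.norm_of_nonneg (hx.1 _).1]
    exact (hx.1 _).2)
  simpa only [mul_assoc] using this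

theorem norm_I_mul_ω_mul (z : ℂ) : ‖Complex.I * D.ω * z‖ = D.ω * ‖z‖ := by
  rw [norm_mul, norm_mul, Complex.norm_I, one_mul, Complex.norm_real,
    Real.norm_of_nonneg D.ω_pos.le]

theorem eddy_sub (S : L2 ℝ G.workpiece) (A B Z : HTilde0 G.dom) :
    D.eddy S (A - B) Z = D.eddy S A Z - D.eddy S B Z := by
  rw [D.eddy_def S (A - B) Z, D.eddy_def S A Z, D.eddy_def S B Z,
    ← integral_sub (D.integrable_eddy S A Z) (D.integrable_eddy S B Z)]
  refine integral_congr_ae ?_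
  have : HTilde0.fn (A - B) =ᵐ[axi G.conductor] fun x => HTilde0.fn A x - HTilde0.fn B x :=
    ae_mono (axi_mono G.conductor_subset) (Lp.coeFn_sub (HTilde0.fn A) (HTilde0.fn B))
  filter_upwards [this] with x hx
  rw [hx]
  ring

/-- `σ |A|²` is real, so the eddy term contributes nothing to the real part: coercivity rests on the
magnetic operator alone and is uniform in the temperature. -/
theorem re_I_mul_eddy_self (S : L2 ℝ G.workpiece) (A : HTilde0 G.dom) :
    (Complex.I * D.ω * D.eddy S A A).re = 0 := by
  have e : D.eddy S A A = ((∫ x, D.σ x (S x) * ‖HTilde0.fn A x‖ ^ 2 ∂axi G.conductor : ℝ) : ℂ) := by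
    rw [eddy_def, ← integral_complex_ofReal]
    refine integral_congr_ae (.of_forall fun x => ?_)
    simp only [mul_assoc, Complex.mul_conj']
    push_cast
    rfl
  rw [e]
  simp [Complex.mul_re]

theorem exists_electric_coercive : ∃ c : ℝ, 0 < c ∧ ∀ (S : L2 ℝ G.workpiece) (A B : HTilde0 G.dom),
    c * ‖A - B‖ ^ 2 ≤ (D.electricForm S A (A - B) - D.electricForm S B (A - B)).re := by
  obtain ⟨c, hc, h⟩ := D.exists_magnetic_coercive
  refine ⟨c, hc, fun S A B => (h A B).trans_eq ?_⟩
  have e : D.electricForm S A (A - B) - D.electricForm S B (A - B)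
      = Complex.I * D.ω * D.eddy S (A - B) (A - B)
        + (D.magnetic A (A - B) - D.magnetic B (A - B)) := by
    rw [D.eddy_sub S A B, D.electricForm_def S A, D.electricForm_def S B]
    ring
  rw [e, Complex.add_re _ (D.magnetic A (A - B) - D.magnetic B (A - B)), re_I_mul_eddy_self,
    zero_add]

theorem exists_electric_lipschitz : ∃ K : ℝ, 0 ≤ K ∧
    ∀ (S : L2 ℝ G.workpiece) (A B Z : HTilde0 G.dom),
      ‖D.electricForm S A Z - D.electricForm S B Z‖ ≤ K * ‖A - B‖ * ‖Z‖ := by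
  obtain ⟨K, hK, h⟩ := D.exists_magnetic_lipschitz
  obtain ⟨s, hs, hσ⟩ := D.exists_σ_properties
  have hω := D.ω_pos
  refine ⟨D.ω * s + K, by positivity, fun S A B Z => ?_⟩
  have h1 : ‖D.eddy S (A - B) Z‖ ≤ s * (‖A - B‖ * ‖Z‖) := by
    rw [D.eddy_def S (A - B) Z]
    have hA := memLp_fn_of_subset G.conductor_subset (A - B)
    have hZ := memLp_fn_of_subset G.conductor_subset Z
    calc _ ≤ ∫ x, s * (‖HTilde0.fn (A - B) x‖ * ‖HTilde0.fn Z x‖) ∂axi G.conductor := by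
          refine norm_integral_le_of_norm_le ((hA.norm.integrable_mul hZ.norm).const_mul s) ?_
          filter_upwards [hσ] with x hx
          have hn : ∀ (r : ℝ) (a b : ℂ), 0 ≤ r →
              ‖(r : ℂ) * a * (starRingEnd ℂ) b‖ = r * (‖a‖ * ‖b‖) := fun r a b hr => by
            rw [norm_mul, norm_mul, Complex.norm_real, Real.norm_of_nonneg hr, mul_assoc,
              RCLike.norm_conj]
          exact (hn _ _ _ (hx.1 _).1).trans_le
            (mul_le_mul_of_nonneg_right (hx.1 _).2 (by positivity))
      _ ≤ _ := by
          rw [integral_const_mul]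
          refine mul_le_mul_of_nonneg_left ((integral_norm_mul_norm_le hA hZ).trans ?_) hs
          exact mul_le_mul (sqrt_integral_norm_sq_fn_le G.conductor_subset _)
            (sqrt_integral_norm_sq_fn_le G.conductor_subset _) (Real.sqrt_nonneg _) (norm_nonneg _)
  have e : D.electricForm S A Z - D.electricForm S B Z
      = Complex.I * D.ω * D.eddy S (A - B) Z + (D.magnetic A Z - D.magnetic B Z) := by
    rw [D.eddy_sub S A B, D.electricForm_def S A, D.electricForm_def S B]
    ring
  rw [e]
  refine (norm_add_le _ _).trans ?_
  have h3 : ∀ w s a b K : ℝ, w * (s * (a * b)) + K * a * b = (w * s + K) * a * b := by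
    intros; ring
  have h4 := (D.norm_I_mul_ω_mul (D.eddy S (A - B) Z)).trans_le (mul_le_mul_of_nonneg_left h1 hω.le)
  exact (add_le_add h4 (h A B Z)).trans_eq (h3 _ _ _ _ _)

/-- The magnetic parts cancel and `σ` depends on the temperature only in the workpiece. There
Hölder's inequality is applied with `S - S'` in `L²₁` and `A`, `Z` and `1` in `L⁶₁`. -/
theorem exists_electric_temperature : ∃ K : ℝ, 0 ≤ K ∧
    ∀ (S S' : L2 ℝ G.workpiece) (A Z : HTilde0 G.dom),
      ‖D.electricForm S A Z - D.electricForm S' A Z‖ ≤ K * ‖S - S'‖ * ‖A‖ * ‖Z‖ := by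
  obtain ⟨s, hs, hσ⟩ := D.exists_σ_properties
  obtain ⟨K, hK, -, hA, h1⟩ := G.exists_embedding
  have hω := D.ω_pos
  refine ⟨D.ω * (s * K ^ 3), by positivity, fun S S' A Z => ?_⟩
  have hwc : G.workpiece ⊆ G.conductor := subset_union_left
  have hwm := G.workpiece_polygonal.isOpen.measurableSet
  have e : D.electricForm S A Z - D.electricForm S' A Z
      = Complex.I * D.ω * (D.eddy S A Z - D.eddy S' A Z) := by
    rw [D.electricForm_def S, D.electricForm_def S']
    ring
  have hn : ∀ B : HTilde0 G.dom, eLpNorm (fun x => ‖HTilde0.fn B x‖) 6 (axi G.workpiece)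
      ≤ ENNReal.ofReal (K * ‖B‖) := fun B => by
    rw [eLpNorm_norm]
    exact (hA B).trans (ENNReal.ofReal_le_ofReal
      (mul_le_mul_of_nonneg_left (HTilde.norm_restrict_le _ B) hK))
  have hmeas : ∀ B : HTilde0 G.dom,
      AEStronglyMeasurable (fun x => ‖HTilde0.fn B x‖) (axi G.workpiece) := fun B =>
    (memLp_fn_of_subset G.workpiece_subset B).aestronglyMeasurable.norm
  obtain ⟨i1, i2⟩ := integrable_and_integral_abs_le (μ := axi G.workpiece)
    (f := fun x => (S - S') x) (Lp.aestronglyMeasurable (S - S')) (hmeas A) (hmeas Z)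
    aestronglyMeasurable_const (norm_nonneg (S - S')) (by positivity) (by positivity) hK
    (by rw [Lp.norm_def, ENNReal.ofReal_toReal (Lp.eLpNorm_ne_top _)]) (hn A) (hn Z) h1
  have h2 : ‖D.eddy S A Z - D.eddy S' A Z‖ ≤ s * (‖S - S'‖ * (K * ‖A‖ * (K * ‖Z‖ * K))) := by
    rw [D.eddy_def S A Z, D.eddy_def S' A Z, ← integral_sub (D.integrable_eddy S A Z) (D.integrable_eddy S' A Z)]
    have hind : Integrable (G.workpiece.indicator fun x =>
        s * |(S - S') x * (‖HTilde0.fn A x‖ * (‖HTilde0.fn Z x‖ * 1))|) (axi G.conductor) := by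
      rw [integrable_indicator_iff hwm, IntegrableOn, axi_restrict hwc hwm]
      exact i1.abs.const_mul s
    have hSS : ∀ᵐ x ∂axi G.conductor, x ∈ G.workpiece → (S - S') x = S x - S' x := by
      rw [← ae_restrict_iff' hwm, axi_restrict hwc hwm]
      exact Lp.coeFn_sub S S'
    refine (norm_integral_le_of_norm_le hind ?_).trans ?_
    · filter_upwards [hσ, hSS] with x hx hx2
      rw [← sub_mul, ← sub_mul, norm_mul, norm_mul, RCLike.norm_conj, ← Complex.ofReal_sub,
        Complex.norm_real, Real.norm_eq_abs]
      have h3 := hx.2 (S x) (S' x)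
      by_cases hw : x ∈ G.workpiece
      · rw [indicator_of_mem hw] at h3 ⊢
        rw [hx2 hw, mul_one, abs_mul, abs_of_nonneg (a := _ * _) (by positivity), mul_assoc,
          ← mul_assoc s]
        exact mul_le_mul_of_nonneg_right h3 (by positivity)
      · rw [indicator_of_notMem hw] at h3 ⊢
        rw [le_antisymm h3 (abs_nonneg _), zero_mul, zero_mul]
    · rw [integral_indicator hwm, axi_restrict hwc hwm, integral_const_mul]
      exact mul_le_mul_of_nonneg_left i2 hs
  rw [e, norm_I_mul_ω_mul]
  refine (mul_le_mul_of_nonneg_left h2 hω.le).trans_eq ?_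
  ring

/-- The load carries no weight: `Z dr dz = (Z/r) r dr dz`, so it is bounded through the `L²₋₁` part
of the norm. -/
theorem exists_load_bound (V : Fin m → ℂ) : ∃ M : ℝ, 0 ≤ M ∧ ∀ Z, ‖D.load V Z‖ ≤ M * ‖Z‖ := by
  have hfin := isFiniteMeasure_axi G.isOpen_dom.measurableSet G.isBounded_dom
  set B := √(∫ _, ‖(1 : ℝ)‖ ^ 2 ∂axi G.dom) with hB
  refine ⟨∑ k, ‖(D.σcoil k : ℂ) * V k‖ * B, by positivity, fun Z => ?_⟩
  rw [load_def, Finset.sum_mul]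
  refine norm_sum_le_of_le _ fun k _ => ?_
  have hZ3 : HTilde0.fn Z = Z.1.1 0 := rfl
  have e : ∫ x in G.coil k, (D.σcoil k : ℂ) * V k * (starRingEnd ℂ) ((HTilde0.fn Z) x)
      = ∫ x, (D.σcoil k : ℂ) * V k * (starRingEnd ℂ) (Z.1.1 3 x) ∂axi (G.coil k) := by
    have hpos : ∀ᵐ x ∂volume.restrict (G.coil k), 0 < x 0 :=
      (ae_restrict_iff' (G.coil_open k).measurableSet).2
        (.of_forall fun x hx => G.dom_pos (G.coil_subset k hx))
    rw [integral_axi (hpos.mono fun _ h => h.le)]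
    refine integral_congr_ae ?_
    have h := ae_axi_iff.1 (ae_mono (axi_mono (G.coil_subset k)) Z.1.2.2.2)
    filter_upwards [h, hpos] with x hx hp
    rw [hx hp, hZ3, map_div₀, Complex.conj_ofReal, Complex.real_smul, mul_left_comm,
      mul_div_cancel₀ _ (Complex.ofReal_ne_zero.2 hp.ne')]
  rw [e]
  calc _ ≤ ∫ x, ‖(D.σcoil k : ℂ) * V k‖ * ‖Z.1.1 3 x‖ ∂axi (G.coil k) := by
        refine (norm_integral_le_integral_norm _).trans_eq ?_
        refine integral_congr_ae (.of_forall fun x => ?_)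
        simp only [norm_mul, RCLike.norm_conj]
    _ ≤ ‖(D.σcoil k : ℂ) * V k‖ * ∫ x, ‖(1 : ℝ)‖ * ‖Z.1.1 3 x‖ ∂axi G.dom := by
        rw [integral_const_mul]
        refine mul_le_mul_of_nonneg_left ?_ (norm_nonneg _)
        simp only [norm_one, one_mul]
        exact integral_mono_measure (axi_mono (G.coil_subset k)) (.of_forall fun _ => norm_nonneg _)
          ((Lp.memLp (Z.1.1 3)).integrable one_le_two).norm
    _ ≤ _ := by
        rw [mul_assoc]
        refine mul_le_mul_of_nonneg_left ((integral_norm_mul_norm_le (memLp_const (1 : ℝ))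
          (Lp.memLp (Z.1.1 3))).trans ?_) (norm_nonneg _)
        refine mul_le_mul_of_nonneg_left (Real.sqrt_le_iff.2 ⟨norm_nonneg _, ?_⟩)
          (Real.sqrt_nonneg _)
        rw [← norm_sq_Lp]
        refine le_trans ?_ (HTilde0.norm_sq_eq Z).ge
        nlinarith [sq_nonneg ‖Z.1.1 0‖, sq_nonneg ‖Z.1.1 1‖, sq_nonneg ‖Z.1.1 2‖]

theorem electricForm_zero (S : L2 ℝ G.workpiece) (Z : HTilde0 G.dom) :
    D.electricForm S 0 Z = 0 := by
  have h := D.eddy_sub S 0 0 Z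
  rw [sub_self, sub_self] at h
  rw [electricForm_def, h, magnetic_zero, mul_zero, add_zero]

/-- A priori bound for the potential. -/
theorem exists_potential_bound (V : Fin m → ℂ) : ∃ M : ℝ, 0 ≤ M ∧
    ∀ (S : L2 ℝ G.workpiece) (A : HTilde0 G.dom), D.ElectricEq V S A A → ‖A‖ ≤ M := by
  obtain ⟨c, hc, hco⟩ := D.exists_electric_coercive
  obtain ⟨M, hM, hl⟩ := D.exists_load_bound V
  refine ⟨M / c, by positivity, fun S A h => ?_⟩
  have h1 := hco S A 0
  rw [sub_zero, electricForm_zero, sub_zero] at h1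
  have h2 : D.electricForm S A A = D.load V A := (D.electricEq_iff _ _ _ _).1 h
  rw [h2] at h1
  have h3 := (h1.trans (Complex.re_le_norm _)).trans (hl A)
  rw [le_div_iff₀ hc]
  rcases (norm_nonneg A).eq_or_lt with h0 | h0
  · rw [← h0, zero_mul]; exact hM
  · nlinarith

/-- One factor `z` is cancelled from the coercivity estimate. In the application `z` is the distance
of the Galerkin solution to the comparison function, `s` the temperature perturbation, `b` the
approximation error and `n` the norm of the exact potential. -/
theorem le_of_quadratic_estimate {c K K' M z s b n x P Q : ℝ} (hc : 0 < c) (hK : 0 ≤ K)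
    (hK' : 0 ≤ K') (hz : 0 ≤ z) (hs : 0 ≤ s) (hb : 0 ≤ b) (hn : 0 ≤ n)
    (h : c * z ^ 2 ≤ P + Q) (hP : P ≤ K' * s * n * z) (hQ : Q ≤ K * b * z) (hM : n ≤ M)
    (hx : x ≤ z + b) : x ≤ ((K' * M + K) / c + 1) * (s + b) := by
  have hM0 : 0 ≤ M := hn.trans hM
  have h8 : K' * s * n * z ≤ K' * s * M * z := by gcongr
  have h9 : c * z ≤ K' * M * s + K * b := by
    rcases hz.eq_or_lt with hz | hz
    · rw [← hz, mul_zero]; positivity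
    · nlinarith
  have h11 : z ≤ (K' * M + K) / c * (s + b) := by
    rw [div_mul_eq_mul_div, le_div_iff₀ hc]
    nlinarith [mul_nonneg (mul_nonneg hK' hM0) hb, mul_nonneg hK hs]
  linarith

/-- Céa's lemma for the potential, with a perturbed temperature. -/
theorem exists_potential_error (V : Fin m → ℂ) : ∃ C : ℝ, 0 ≤ C ∧
    ∀ (S S' : L2 ℝ G.workpiece) (A A' B : HTilde0 G.dom), D.ElectricEq V S A A →
      D.ElectricEq V S A (A' - B) → D.ElectricEq V S' A' (A' - B) →
      ‖A' - A‖ ≤ C * (‖S' - S‖ + ‖A - B‖) := by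
  obtain ⟨c, hc, hco⟩ := D.exists_electric_coercive
  obtain ⟨K, hK, hl⟩ := D.exists_electric_lipschitz
  obtain ⟨K', hK', ht⟩ := D.exists_electric_temperature
  obtain ⟨M, hM, hb⟩ := D.exists_potential_bound V
  refine ⟨(K' * M + K) / c + 1, by positivity, fun S S' A A' B h0 h1 h2 => ?_⟩
  have h1' : D.electricForm S A (A' - B) = D.load V (A' - B) := (D.electricEq_iff _ _ _ _).1 h1
  have h2' : D.electricForm S' A' (A' - B) = D.load V (A' - B) := (D.electricEq_iff _ _ _ _).1 h2
  have h3 := hco S' A' B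
  -- Both forms tested with `A' - B` equal the same load, so `A'` may be replaced by `A`; what
  -- remains is a temperature perturbation at fixed `A` and the approximation error `A - B`.
  have e : D.electricForm S' A' (A' - B) - D.electricForm S' B (A' - B)
      = -(D.electricForm S' A (A' - B) - D.electricForm S A (A' - B))
        + (D.electricForm S' A (A' - B) - D.electricForm S' B (A' - B)) := by
    linear_combination h2' - h1'
  rw [e] at h3
  have h4 := (h3.trans (Complex.re_le_norm _)).trans (norm_add_le _ _)
  rw [norm_neg] at h4
  have h10 : ‖A' - A‖ ≤ ‖A' - B‖ + ‖A - B‖ :=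
    (norm_sub_le_norm_sub_add_norm_sub A' B A).trans_eq
      (congrArg (‖A' - B‖ + ·) (norm_sub_rev B A))
  exact le_of_quadratic_estimate hc hK hK' (norm_nonneg (A' - B)) (norm_nonneg (S' - S))
    (norm_nonneg (A - B)) (norm_nonneg A) h4 (ht S' S A (A' - B)) (hl S' A B (A' - B)) (hb S A h0) h10

theorem continuous_electricForm (Z : HTilde0 G.dom) :
    Continuous fun p : L2 ℝ G.workpiece × HTilde0 G.dom => D.electricForm p.1 p.2 Z := by
  obtain ⟨K, hK, hl⟩ := D.exists_electric_lipschitz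
  obtain ⟨K', hK', ht⟩ := D.exists_electric_temperature
  refine continuous_iff_continuousAt.2 fun p => ?_
  rw [ContinuousAt, tendsto_iff_norm_sub_tendsto_zero]
  have hlim : Tendsto (fun q : L2 ℝ G.workpiece × HTilde0 G.dom =>
      K * ‖q.2 - p.2‖ * ‖Z‖ + K' * ‖q.1 - p.1‖ * ‖p.2‖ * ‖Z‖) (𝓝 p) (𝓝 0) := by
    have : Continuous fun q : L2 ℝ G.workpiece × HTilde0 G.dom =>
      K * ‖q.2 - p.2‖ * ‖Z‖ + K' * ‖q.1 - p.1‖ * ‖p.2‖ * ‖Z‖ := by fun_prop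
    simpa using this.tendsto p
  refine squeeze_zero (fun _ => norm_nonneg _) (fun q => ?_) hlim
  have e : D.electricForm q.1 q.2 Z - D.electricForm p.1 p.2 Z
      = (D.electricForm q.1 q.2 Z - D.electricForm q.1 p.2 Z)
        + (D.electricForm q.1 p.2 Z - D.electricForm p.1 p.2 Z) := by ring
  rw [e]
  exact (norm_add_le _ _).trans (add_le_add (hl _ _ _ _) (ht _ _ _ _))

/-- Both sides are continuous in time and agree almost everywhere, hence everywhere; the comparison
with the scheme takes place at the time nodes, endpoints included. -/
theorem electricEq_of_ae {τ : ℝ} (hτ : 0 < τ) {V : Fin m → ℂ} {A : ℝ → HTilde0 G.dom}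
    {S : ℝ → L2 ℝ G.workpiece} (hA : ContinuousOn A (Icc 0 τ)) (hS : ContinuousOn S (Icc 0 τ))
    (h : ∀ᵐ t ∂volume.restrict (Ioo 0 τ), ∀ Z, D.ElectricEq V (S t) (A t) Z) {t : ℝ}
    (ht : t ∈ Icc 0 τ) (Z : HTilde0 G.dom) : D.ElectricEq V (S t) (A t) Z := by
  have h1 : ContinuousOn (fun t => D.electricForm (S t) (A t) Z) (Icc 0 τ) :=
    (D.continuous_electricForm Z).comp_continuousOn (hS.prodMk hA)
  exact (D.electricEq_iff _ _ _ _).2 (eqOn_Icc_of_ae hτ h1 (continuousOn_const (c := D.load V Z))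
    (h.mono fun t ht => (D.electricEq_iff _ _ _ _).1 (ht Z)) ht)

end Coefficients

/-! ## Traces -/

section Trace

variable {𝕜 : Type} [RCLike 𝕜] {ϑ S : Set Plane}

theorem IsTrace.sub {u v : H1 𝕜 ϑ} {g h : L2Curve 𝕜 S} (hu : IsTrace S u g)
    (hv : IsTrace S v h) : IsTrace S (u - v) (g - h) := by
  have := hu.add (hv.smul (-1))
  rwa [neg_one_smul, neg_one_smul, ← sub_eq_add_neg, ← sub_eq_add_neg] at this

theorem IsTrace.approximable {u : H1 𝕜 ϑ} {g : L2Curve 𝕜 S} (hu : IsTrace S u g) :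
    H1.Approximable u := by
  obtain ⟨φ, U, -, h1, h2, -, h3, -⟩ := hu
  exact ⟨φ, U, h1, h2, h3⟩

/-- A diagonal sequence of `C¹` approximants, the `k`-th chosen within `1 / (k + 1)` of both `u k`
and its trace. -/
theorem IsTrace.of_tendsto {u : ℕ → H1 𝕜 ϑ} {g : ℕ → L2Curve 𝕜 S} {u₀ : H1 𝕜 ϑ}
    {g₀ : L2Curve 𝕜 S} (h : ∀ k, IsTrace S (u k) (g k)) (hu : Tendsto u atTop (𝓝 u₀))
    (hg : Tendsto g atTop (𝓝 g₀)) : IsTrace S u₀ g₀ := by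
  choose φ U g' h1 h2 h3 h4 h5 using h
  have hex : ∀ k : ℕ, ∃ n, dist (u k) (U k n) < 1 / ((k : ℝ) + 1) ∧
      dist (g k) (g' k n) < 1 / ((k : ℝ) + 1) := by
    intro k
    have hk : (0 : ℝ) < 1 / ((k : ℝ) + 1) := by positivity
    obtain ⟨n, hn1, hn2⟩ := (((Metric.tendsto_nhds.1 (h4 k)) _ hk).and
      ((Metric.tendsto_nhds.1 (h5 k)) _ hk)).exists
    exact ⟨n, by rwa [dist_comm], by rwa [dist_comm]⟩
  choose n hn using hex
  have t0 : Tendsto (fun k : ℕ => 1 / ((k : ℝ) + 1)) atTop (𝓝 0) :=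
    tendsto_one_div_add_atTop_nhds_zero_nat
  exact ⟨fun k => φ k (n k), fun k => U k (n k), fun k => g' k (n k), fun k => h1 k _,
    fun k => h2 k _, fun k => h3 k _,
    hu.congr_dist (squeeze_zero (fun _ => dist_nonneg) (fun k => (hn k).1.le) t0),
    hg.congr_dist (squeeze_zero (fun _ => dist_nonneg) (fun k => (hn k).2.le) t0)⟩

end Trace

theorem integral_mul_eq_inner {X : Type*} [MeasurableSpace X] {μ : Measure X} (f g : Lp ℝ 2 μ) :
    ∫ x, f x * g x ∂μ = inner ℝ f g := by
  rw [L2.inner_def]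
  exact integral_congr_ae (.of_forall fun x => mul_comm _ _)

theorem ae_mem_Icc_closure {τ : ℝ} (hτ : 0 < τ) {P : ℝ → Prop}
    (h : ∀ᵐ t ∂volume.restrict (Ioo 0 τ), P t) :
    Icc 0 τ ⊆ closure (Ioo 0 τ ∩ {t | P t}) := by
  have hd : Dense {t | t ∈ Ioo 0 τ → P t} :=
    Measure.dense_of_ae ((ae_restrict_iff' measurableSet_Ioo).1 h)
  rw [← closure_Ioo hτ.ne]
  refine closure_minimal ?_ isClosed_closure
  refine (hd.open_subset_closure_inter isOpen_Ioo).trans (closure_mono ?_)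
  exact fun t ht => ⟨ht.1, ht.2 ht.1⟩

namespace Configuration

variable {m : ℕ} (G : Configuration m)

theorem exists_trace_bound : ∃ C : ℝ, 0 ≤ C ∧ ∀ (u : H1 ℝ G.workpiece) (g : L2Curve ℝ G.outer),
    IsTrace G.outer u g → ‖g‖ ≤ C * ‖u‖ := by
  obtain ⟨C, hC, h⟩ := InductionHeating.exists_trace_bound G.workpiece_polygonal G.workpiece_pos
    G.isBounded_workpiece
  exact ⟨C, hC, fun u g => h _ G.outer_subset u g⟩

/-- Traces along a continuous path in `H¹₁(Ω₀)`. -/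
theorem exists_continuous_trace {τ : ℝ} (hτ : 0 < τ) {T : ℝ → H1 ℝ G.workpiece}
    (hT : ContinuousOn T (Icc 0 τ))
    (h : ∀ᵐ t ∂volume.restrict (Ioo 0 τ), ∃ γ, IsTrace G.outer (T t) γ) :
    ∃ γ : ℝ → L2Curve ℝ G.outer, ContinuousOn γ (Icc 0 τ) ∧
      ∀ t ∈ Icc 0 τ, IsTrace G.outer (T t) (γ t) := by
  obtain ⟨C, hC, hb⟩ := G.exists_trace_bound
  -- The times at which a trace exists are dense. Along such times tending to `t` the traces form a
  -- Cauchy sequence by the trace bound, and the limit is a trace of `T t`.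
  have hall : ∀ t ∈ Icc 0 τ, ∃ γ, IsTrace G.outer (T t) γ := by
    intro t ht
    obtain ⟨s, hs, hlim⟩ := mem_closure_iff_seq_limit.1 (ae_mem_Icc_closure hτ h ht)
    have hsI : ∀ k, s k ∈ Icc 0 τ := fun k => Ioo_subset_Icc_self (hs k).1
    have hγ : ∀ k, ∃ γ, IsTrace G.outer (T (s k)) γ := fun k => (hs k).2
    choose g hg using hγ
    have hTs : Tendsto (fun k => T (s k)) atTop (𝓝 (T t)) :=
      (hT t ht).tendsto.comp (tendsto_nhdsWithin_iff.2 ⟨hlim, .of_forall hsI⟩)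
    have hc : CauchySeq g := by
      have h1 := hTs.cauchySeq
      rw [Metric.cauchySeq_iff'] at h1 ⊢
      intro ε hε
      obtain ⟨N, hN⟩ := h1 (ε / (C + 1)) (by positivity)
      refine ⟨N, fun n hn => ?_⟩
      have h2 := hN n hn
      rw [dist_eq_norm] at h2 ⊢
      rw [lt_div_iff₀ (by positivity)] at h2
      refine (hb _ _ ((hg n).sub (hg N))).trans_lt ?_
      nlinarith [norm_nonneg (T (s n) - T (s N))]
    obtain ⟨g₀, hg₀⟩ := cauchySeq_tendsto_of_complete hc
    exact ⟨g₀, IsTrace.of_tendsto hg hTs hg₀⟩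
  choose! γ hγ using hall
  refine ⟨γ, fun t ht => ?_, hγ⟩
  rw [ContinuousWithinAt, tendsto_iff_norm_sub_tendsto_zero]
  have h1 := (tendsto_iff_norm_sub_tendsto_zero.1 (hT t ht)).const_mul C
  rw [mul_zero] at h1
  refine squeeze_zero' (.of_forall fun _ => norm_nonneg _) ?_ h1
  filter_upwards [self_mem_nhdsWithin] with s hs
  exact hb _ _ ((hγ s hs).sub (hγ t ht))

end Configuration

/-! ## The heat equation -/

namespace Coefficients

variable {m : ℕ} {G : Configuration m} (D : Coefficients G)

/-- The Joule heat functional. -/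
def joule (S : L2 ℝ G.workpiece) (A : HTilde0 G.dom) (W : H1 ℝ G.workpiece) : ℝ :=
  1 / 2 * (∫ x, D.ω ^ 2 * D.σ x (S x) * ‖(HTilde0.fn A) x‖ ^ 2 * (H1.fn W) x ∂axi G.workpiece)

theorem joule_def (S : L2 ℝ G.workpiece) (A : HTilde0 G.dom) (W : H1 ℝ G.workpiece) :
    D.joule S A W = 1 / 2 * (∫ x, D.ω ^ 2 * D.σ x (S x) * ‖(HTilde0.fn A) x‖ ^ 2 * (H1.fn W) x
      ∂axi G.workpiece) := rfl

/-- `M` and `N` multiply by `κ` and `η`. With them the heat equation is a relation between inner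
products, and its error analysis becomes Hilbert space algebra. The boundary term is used only
through its sign. -/
theorem exists_heat_representation : ∃ (M : L2 ℝ G.workpiece →L[ℝ] L2 ℝ G.workpiece)
    (N : L2Curve ℝ G.outer →L[ℝ] L2Curve ℝ G.outer) (k : ℝ), 0 < k ∧
    (∀ u, k * ‖u‖ ^ 2 ≤ inner ℝ (M u) u) ∧ (∀ g, 0 ≤ inner ℝ (N g) g) ∧
    ∀ dT S A g T W γT γW, D.HeatEq dT S A g T W γT γW ↔
      inner ℝ dT (H1.fn W) + (inner ℝ (M (H1.dr T)) (H1.dr W) + inner ℝ (M (H1.dz T)) (H1.dz W)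
        + inner ℝ (N γT) γW) = D.joule S A W + inner ℝ (N g) γW := by
  obtain ⟨k₀, k₁, hk, hκ⟩ := D.κ_bounds
  obtain ⟨e₀, e₁, he, hη⟩ := D.η_bounds
  have ac1 : axi G.workpiece ≪ volume.restrict G.workpiece := withDensity_absolutelyContinuous _ _
  have ac2 : axiCurve G.outer ≪ (Measure.hausdorffMeasure 1).restrict G.outer :=
    withDensity_absolutelyContinuous _ _
  have hκ' : ∀ᵐ x ∂axi G.workpiece, k₀ ≤ D.κ x ∧ D.κ x ≤ k₁ := ac1.ae_le hκ
  have hη' : ∀ᵐ x ∂axiCurve G.outer, e₀ ≤ D.η x ∧ D.η x ≤ e₁ := ac2.ae_le hη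
  obtain ⟨M, hM⟩ := exists_mul_clm ℝ (D.κ_measurable.mono_ac ac1).aestronglyMeasurable k₁
    (hκ'.mono fun x hx => by rw [abs_of_nonneg (hk.le.trans hx.1)]; exact hx.2)
  obtain ⟨N, hN⟩ := exists_mul_clm ℝ (D.η_measurable.mono_ac ac2).aestronglyMeasurable e₁
    (hη'.mono fun x hx => by rw [abs_of_nonneg (he.le.trans hx.1)]; exact hx.2)
  have eM : ∀ u v, inner ℝ (M u) v = ∫ x, D.κ x * (u x * v x) ∂axi G.workpiece := fun u v => by
    rw [← integral_mul_eq_inner]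
    refine integral_congr_ae ?_
    filter_upwards [hM u] with x hx
    rw [hx, smul_eq_mul, mul_assoc]
  have eN : ∀ u v, inner ℝ (N u) v = ∫ x, D.η x * u x * v x ∂axiCurve G.outer := fun u v => by
    rw [← integral_mul_eq_inner]
    refine integral_congr_ae ?_
    filter_upwards [hN u] with x hx
    rw [hx, smul_eq_mul]
  have iM : ∀ u v : L2 ℝ G.workpiece,
      Integrable (fun x => D.κ x * (u x * v x)) (axi G.workpiece) := fun u v => by
    have := L2.integrable_inner (𝕜 := ℝ) (M u) v
    refine this.congr ?_
    filter_upwards [hM u] with x hx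
    rw [hx]
    simp only [smul_eq_mul, RCLike.inner_apply, conj_trivial]
    ring
  refine ⟨M, N, k₀, hk, fun u => ?_, fun g => ?_, fun dT S A g T W γT γW => ?_⟩
  · rw [eM, norm_sq_Lp, ← integral_const_mul]
    refine integral_mono_ae ((Lp.memLp u).norm.integrable_sq.const_mul k₀) (iM u u) ?_
    filter_upwards [hκ'] with x hx
    rw [Real.norm_eq_abs, sq_abs, sq]
    exact mul_le_mul_of_nonneg_right hx.1 (mul_self_nonneg _)
  · rw [eN]
    refine integral_nonneg_of_ae ?_
    filter_upwards [hη'] with x hx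
    simp only [Pi.zero_apply]
    rw [mul_assoc]
    exact mul_nonneg (he.le.trans hx.1) (mul_self_nonneg _)
  · rw [eN, eN, eM, eM, ← integral_add (iM _ _) (iM _ _), ← integral_mul_eq_inner, joule_def,
      HeatEq, heatForm]
    simp only [mul_add]

/-- Split `σ₁ a² - σ₂ b²` as `(σ₁ - σ₂) a² + σ₂ (a - b)(a + b)`, so that each resulting product has
exactly one error factor, `p` or `e`, and at most three further ones. -/
theorem abs_source_sub_le {ω σ₁ σ₂ s p a b e w : ℝ} (h1 : |σ₁ - σ₂| ≤ s * p) (h2 : 0 ≤ σ₂)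
    (h3 : σ₂ ≤ s) (h4 : |a - b| ≤ e) (ha : 0 ≤ a) (hb : 0 ≤ b) :
    |ω ^ 2 * σ₁ * a ^ 2 * w - ω ^ 2 * σ₂ * b ^ 2 * w|
      ≤ ω ^ 2 * s * (p * (a * (a * |w|)) + e * (a * |w|) + e * (b * |w|)) := by
  have hs := h2.trans h3
  have e1 : ω ^ 2 * σ₁ * a ^ 2 * w - ω ^ 2 * σ₂ * b ^ 2 * w
      = ω ^ 2 * ((σ₁ - σ₂) * a ^ 2 + σ₂ * ((a - b) * (a + b))) * w := by ring
  have e2 : |(σ₁ - σ₂) * a ^ 2 + σ₂ * ((a - b) * (a + b))| ≤ s * p * a ^ 2 + s * (e * (a + b)) := by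
    refine (abs_add_le _ _).trans (add_le_add ?_ ?_)
    · rw [abs_mul, abs_of_nonneg (sq_nonneg a)]
      exact mul_le_mul_of_nonneg_right h1 (sq_nonneg a)
    · rw [abs_mul, abs_mul, abs_of_nonneg h2, abs_of_nonneg (add_nonneg ha hb)]
      exact mul_le_mul h3 (mul_le_mul_of_nonneg_right h4 (add_nonneg ha hb)) (by positivity) hs
  rw [e1, abs_mul, abs_mul, abs_of_nonneg (sq_nonneg ω)]
  calc _ ≤ ω ^ 2 * (s * p * a ^ 2 + s * (e * (a + b))) * |w| := by gcongr
    _ = _ := by ring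

theorem abs_integral_source_sub_le {X : Type*} [MeasurableSpace X] {μ : Measure X}
    {ω s B₁ B₂ B₃ : ℝ} {σ₁ σ₂ p a b e w : X → ℝ} (hs : 0 ≤ s)
    (h : ∀ᵐ x ∂μ, |σ₁ x - σ₂ x| ≤ s * |p x| ∧ 0 ≤ σ₂ x ∧ σ₂ x ≤ s ∧ |a x - b x| ≤ |e x| ∧
      0 ≤ a x ∧ 0 ≤ b x)
    (i1 : Integrable (fun x => p x * (a x * (a x * w x))) μ)
    (b1 : ∫ x, |p x * (a x * (a x * w x))| ∂μ ≤ B₁)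
    (i2 : Integrable (fun x => e x * (a x * (w x * 1))) μ)
    (b2 : ∫ x, |e x * (a x * (w x * 1))| ∂μ ≤ B₂)
    (i3 : Integrable (fun x => e x * (b x * (w x * 1))) μ)
    (b3 : ∫ x, |e x * (b x * (w x * 1))| ∂μ ≤ B₃) :
    |∫ x, (ω ^ 2 * σ₁ x * a x ^ 2 * w x - ω ^ 2 * σ₂ x * b x ^ 2 * w x) ∂μ|
      ≤ ω ^ 2 * s * (B₁ + B₂ + B₃) := by
  have ib := ((i1.abs.add i2.abs).add i3.abs).const_mul (ω ^ 2 * s)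
  rw [← Real.norm_eq_abs]
  refine (norm_integral_le_of_norm_le ib ?_).trans ?_
  · filter_upwards [h] with x ⟨h1, h2, h3, h4, h5, h6⟩
    simp only [Pi.add_apply]
    rw [Real.norm_eq_abs]
    refine (abs_source_sub_le h1 h2 h3 h4 h5 h6).trans_eq ?_
    simp only [abs_mul, abs_of_nonneg h5, abs_of_nonneg h6, mul_one]
  · rw [integral_const_mul, integral_add' (i1.abs.add i2.abs) i3.abs, integral_add' i1.abs i2.abs]
    exact mul_le_mul_of_nonneg_left (add_le_add (add_le_add b1 b2) b3) (by positivity)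

theorem eLpNorm_norm_fn_le {K : ℝ} (hK : 0 ≤ K) (hA : ∀ A : HTilde0 G.dom,
    eLpNorm (HTilde0.fn A) 6 (axi G.workpiece)
      ≤ ENNReal.ofReal (K * ‖HTilde.restrict G.workpiece_subset_dom A.1‖)) (B : HTilde0 G.dom) :
    eLpNorm (fun x => ‖HTilde0.fn B x‖) 6 (axi G.workpiece) ≤ ENNReal.ofReal (K * ‖B‖) := by
  rw [eLpNorm_norm]
  exact (hA B).trans (ENNReal.ofReal_le_ofReal
    (mul_le_mul_of_nonneg_left (HTilde.norm_restrict_le _ B) hK))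

theorem eLpNorm_two_eq {X E : Type*} [MeasurableSpace X] {μ : Measure X} [NormedAddCommGroup E]
    (f : Lp E 2 μ) : eLpNorm (fun x => f x) 2 μ = ENNReal.ofReal ‖f‖ := by
  rw [Lp.norm_def, ENNReal.ofReal_toReal (Lp.eLpNorm_ne_top f)]

theorem aestronglyMeasurable_norm_fn (B : HTilde0 G.dom) :
    AEStronglyMeasurable (fun x => ‖HTilde0.fn B x‖) (axi G.workpiece) :=
  (memLp_fn_of_subset G.workpiece_subset B).aestronglyMeasurable.norm

theorem exists_σ_properties_workpiece : ∃ s : ℝ, 0 ≤ s ∧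
    ∀ᵐ x ∂axi G.workpiece, (∀ u, 0 ≤ D.σ x u ∧ D.σ x u ≤ s) ∧
      ∀ u v, |D.σ x u - D.σ x v| ≤ s * |u - v| := by
  obtain ⟨s, hs, hσ⟩ := D.exists_σ_properties
  refine ⟨s, hs, ?_⟩
  filter_upwards [ae_mono (axi_mono (subset_union_left : G.workpiece ⊆ G.conductor)) hσ,
    ae_mem_axi G.workpiece_polygonal.isOpen.measurableSet] with x hx hm
  exact ⟨hx.1, fun u v => (hx.2 u v).trans_eq (indicator_of_mem hm _)⟩

theorem integrable_joule (S : L2 ℝ G.workpiece) (B : HTilde0 G.dom) (W : H1 ℝ G.workpiece) :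
    Integrable (fun x => D.ω ^ 2 * D.σ x (S x) * ‖(HTilde0.fn B) x‖ ^ 2 * (H1.fn W) x)
      (axi G.workpiece) := by
  obtain ⟨s, hs, hσ⟩ := D.exists_σ_properties_workpiece
  obtain ⟨K, hK, -, hA, h1⟩ := G.exists_embedding
  have pB : 0 ≤ K * ‖B‖ := mul_nonneg hK (norm_nonneg B)
  have i := (integrable_and_integral_abs_le (Lp.aestronglyMeasurable (H1.fn W))
    (aestronglyMeasurable_norm_fn B) (aestronglyMeasurable_norm_fn B) aestronglyMeasurable_const
    (norm_nonneg (H1.fn W)) pB pB hK (eLpNorm_two_eq (H1.fn W)).le (eLpNorm_norm_fn_le hK hA B)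
    (eLpNorm_norm_fn_le hK hA B) h1).1
  have := (i.bdd_mul (c := s) (D.aestronglyMeasurable_σ
    (axi_absolutelyContinuous G.workpiece_subset) S) (by
      filter_upwards [hσ] with x hx
      rw [Real.norm_of_nonneg (hx.1 _).1]
      exact (hx.1 _).2)).const_mul (D.ω ^ 2)
  refine this.congr (.of_forall fun x => ?_)
  simp only
  ring

theorem fn_restrict_sub_ae (A A' : HTilde0 G.dom) :
    ∀ᵐ x ∂axi G.workpiece, H1.fn (HTilde.restrict G.workpiece_subset_dom A.1
      - HTilde.restrict G.workpiece_subset_dom A'.1) x = HTilde0.fn A x - HTilde0.fn A' x := by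
  have e : H1.fn (HTilde.restrict G.workpiece_subset_dom A.1
      - HTilde.restrict G.workpiece_subset_dom A'.1)
      = restrictL2 G.workpiece_subset_dom (HTilde0.fn A)
      - restrictL2 G.workpiece_subset_dom (HTilde0.fn A') := rfl
  rw [e]
  filter_upwards [Lp.coeFn_sub (restrictL2 G.workpiece_subset_dom (HTilde0.fn A))
    (restrictL2 G.workpiece_subset_dom (HTilde0.fn A')),
    restrictL2_ae G.workpiece_subset_dom (HTilde0.fn A),
    restrictL2_ae G.workpiece_subset_dom (HTilde0.fn A')] with x x1 x2 x3
  rw [x1, Pi.sub_apply, x2, x3]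

theorem _root_.InductionHeating.H1.norm_fn_le {𝕜 : Type} [RCLike 𝕜] {ϑ : Set Plane} (u : H1 𝕜 ϑ) :
    ‖H1.fn u‖ ≤ ‖u‖ := by
  have := H1.norm_sq u
  exact (sq_le_sq₀ (norm_nonneg _) (norm_nonneg _)).1
    (by linarith [sq_nonneg ‖H1.dr u‖, sq_nonneg ‖H1.dz u‖])

/-- Hölder's inequality with the temperature or the potential difference in `L²₁` and the rest in
`L⁶₁`. The difference of potentials is taken on the workpiece only, where alone the time regularity
of `A` is assumed. -/
theorem exists_joule_estimate : ∃ K : ℝ, 0 ≤ K ∧ ∀ (S S' : L2 ℝ G.workpiece)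
    (A A' : HTilde0 G.dom) (W : H1 ℝ G.workpiece), H1.Approximable W →
    |D.joule S A W - D.joule S' A' W| ≤ K * (‖S - S'‖ * ‖A‖ ^ 2
      + ‖HTilde.restrict G.workpiece_subset_dom A.1 - HTilde.restrict G.workpiece_subset_dom A'.1‖
        * (‖A‖ + ‖A'‖)) * ‖W‖ := by
  obtain ⟨s, hs, hσ⟩ := D.exists_σ_properties_workpiece
  obtain ⟨K, hK, hW, hA, h1⟩ := G.exists_embedding
  have nA := eLpNorm_norm_fn_le hK hA
  have mA := aestronglyMeasurable_norm_fn (G := G)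
  refine ⟨D.ω ^ 2 * s * K ^ 3, by positivity, fun S S' A A' W hWa => ?_⟩
  have mW := Lp.aestronglyMeasurable (H1.fn W)
  have nW := hW W hWa
  have hdx := fn_restrict_sub_ae A A'
  generalize HTilde.restrict G.workpiece_subset_dom A.1
    - HTilde.restrict G.workpiece_subset_dom A'.1 = d at hdx ⊢
  have nd : eLpNorm (fun x => ‖H1.fn d x‖) 2 (axi G.workpiece) ≤ ENNReal.ofReal ‖d‖ := by
    rw [eLpNorm_norm, eLpNorm_two_eq]
    exact ENNReal.ofReal_le_ofReal (H1.norm_fn_le d)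
  have pA : ∀ B : HTilde0 G.dom, 0 ≤ K * ‖B‖ := fun B => mul_nonneg hK (norm_nonneg B)
  have pW : 0 ≤ K * ‖W‖ := by positivity
  obtain ⟨i1, b1⟩ := integrable_and_integral_abs_le (Lp.aestronglyMeasurable (S - S'))
    (mA A) (mA A) mW (norm_nonneg (S - S')) (pA A) (pA A) pW (eLpNorm_two_eq (S - S')).le
    (nA A) (nA A) nW
  have q : ∀ B : HTilde0 G.dom, Integrable (fun x => ‖H1.fn d x‖ * (‖HTilde0.fn B x‖ *
      (H1.fn W x * 1))) (axi G.workpiece) ∧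
      ∫ x, |‖H1.fn d x‖ * (‖HTilde0.fn B x‖ * (H1.fn W x * 1))| ∂axi G.workpiece
      ≤ ‖d‖ * (K * ‖B‖ * (K * ‖W‖ * K)) := fun B =>
    integrable_and_integral_abs_le (Lp.aestronglyMeasurable (H1.fn d)).norm (mA B) mW
      aestronglyMeasurable_const (norm_nonneg d) (pA B) pW hK nd (nA B) nW h1
  obtain ⟨i2, b2⟩ := q A
  obtain ⟨i3, b3⟩ := q A'
  have hbound : |∫ x, (D.ω ^ 2 * D.σ x (S x) * ‖(HTilde0.fn A) x‖ ^ 2 * (H1.fn W) x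
      - D.ω ^ 2 * D.σ x (S' x) * ‖(HTilde0.fn A') x‖ ^ 2 * (H1.fn W) x) ∂axi G.workpiece|
      ≤ D.ω ^ 2 * s * (‖S - S'‖ * (K * ‖A‖ * (K * ‖A‖ * (K * ‖W‖)))
        + ‖d‖ * (K * ‖A‖ * (K * ‖W‖ * K)) + ‖d‖ * (K * ‖A'‖ * (K * ‖W‖ * K))) := by
    refine abs_integral_source_sub_le hs ?_ i1 b1 i2 b2 i3 b3
    filter_upwards [hσ, hdx, Lp.coeFn_sub S S'] with x hx hdx hS
    rw [hS, hdx]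
    refine ⟨hx.2 _ _, (hx.1 _).1, (hx.1 _).2, ?_, norm_nonneg _, norm_nonneg _⟩
    rw [abs_norm]
    exact abs_norm_sub_norm_le _ _
  rw [joule_def, joule_def, ← mul_sub, ← integral_sub (D.integrable_joule S A W)
    (D.integrable_joule S' A' W), abs_mul, abs_of_pos (by norm_num : (0 : ℝ) < 1 / 2)]
  have hfin : ∀ w p a a' e x δ : ℝ, 0 ≤ x → x ≤ w * (p * (K * a * (K * a * (K * e)))
        + δ * (K * a * (K * e * K)) + δ * (K * a' * (K * e * K))) →
      1 / 2 * x ≤ w * K ^ 3 * (p * a ^ 2 + δ * (a + a')) * e := by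
    intro w p a a' e x δ hx h
    have : w * K ^ 3 * (p * a ^ 2 + δ * (a + a')) * e = w * (p * (K * a * (K * a * (K * e)))
        + δ * (K * a * (K * e * K)) + δ * (K * a' * (K * e * K))) := by ring
    linarith
  exact hfin (D.ω ^ 2 * s) ‖S - S'‖ ‖A‖ ‖A'‖ ‖W‖ _ ‖d‖ (abs_nonneg _) hbound

attribute [irreducible] joule

theorem tendsto_joule {W : H1 ℝ G.workpiece} (hW : H1.Approximable W) {ι : Type*} {l : Filter ι}
    {S : ι → L2 ℝ G.workpiece} {A : ι → HTilde0 G.dom} {S₀ : L2 ℝ G.workpiece} {A₀ : HTilde0 G.dom}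
    (hS : Tendsto S l (𝓝 S₀)) (hA : Tendsto A l (𝓝 A₀)) :
    Tendsto (fun i => D.joule (S i) (A i) W) l (𝓝 (D.joule S₀ A₀ W)) := by
  obtain ⟨K, hK, h⟩ := D.exists_joule_estimate
  have h1 : Tendsto (fun i => ‖S i - S₀‖) l (𝓝 0) := tendsto_iff_norm_sub_tendsto_zero.1 hS
  have h2 : Tendsto (fun i => ‖A i - A₀‖) l (𝓝 0) := tendsto_iff_norm_sub_tendsto_zero.1 hA
  have h3 : Tendsto (fun i => ‖A i‖) l (𝓝 ‖A₀‖) := hA.norm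
  rw [tendsto_iff_norm_sub_tendsto_zero]
  have hlim : Tendsto (fun i => K * (‖S i - S₀‖ * ‖A i‖ ^ 2 + ‖A i - A₀‖ * (‖A i‖ + ‖A₀‖)) * ‖W‖)
      l (𝓝 (K * (0 * ‖A₀‖ ^ 2 + 0 * (‖A₀‖ + ‖A₀‖)) * ‖W‖)) :=
    (((h1.mul (h3.pow 2)).add (h2.mul (h3.add tendsto_const_nhds))).const_mul K).mul_const ‖W‖
  rw [zero_mul, zero_mul, add_zero, mul_zero, zero_mul] at hlim
  refine squeeze_zero (fun _ => norm_nonneg _) (fun i => (h (S i) S₀ (A i) A₀ W hW).trans ?_) hlim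
  have h4 : ‖HTilde.restrict G.workpiece_subset_dom (A i).1
      - HTilde.restrict G.workpiece_subset_dom A₀.1‖ ≤ ‖A i - A₀‖ := by
    rw [← map_sub]
    exact HTilde.norm_restrict_le G.workpiece_subset_dom (A i - A₀)
  have h5 : 0 ≤ ‖A i‖ + ‖A₀‖ := add_nonneg (norm_nonneg _) (norm_nonneg _)
  exact mul_le_mul_of_nonneg_right (mul_le_mul_of_nonneg_left (add_le_add le_rfl
    (mul_le_mul_of_nonneg_right h4 h5)) hK) (norm_nonneg _)

/-- For continuous data the heat equation holds at every time. -/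
theorem exists_heat_equation {τ : ℝ} (hτ : 0 < τ) {V : Fin m → ℂ} {Tc : ℝ → L2Curve ℝ G.outer}
    {T₀ : L2 ℝ G.workpiece} {A : ℝ → HTilde0 G.dom} {T : ℝ → H1 ℝ G.workpiece}
    {Tt d : ℝ → L2 ℝ G.workpiece} (hTc : ContinuousOn Tc (Icc 0 τ))
    (h : D.IsSolution τ V Tc T₀ A T Tt) (hA : ContinuousOn A (Icc 0 τ))
    (hT : ContinuousOn T (Icc 0 τ)) (hd : ContinuousOn d (Icc 0 τ))
    (hTt : ∀ᵐ t ∂volume.restrict (Ioo 0 τ), Tt t = d t) :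
    ∃ γ : ℝ → L2Curve ℝ G.outer, ∀ t ∈ Icc 0 τ, IsTrace G.outer (T t) (γ t) ∧
      ∀ W γW, IsTrace G.outer W γW →
        D.HeatEq (d t) (H1.fn (T t)) (A t) (Tc t) (T t) W (γ t) γW := by
  obtain ⟨γ, hγc, hγ⟩ := G.exists_continuous_trace hτ hT
    (h.heat.mono fun t ht => ⟨ht.choose, ht.choose_spec.1⟩)
  obtain ⟨C, hC, hb⟩ := G.exists_trace_bound
  refine ⟨γ, fun t ht => ⟨hγ t ht, fun W γW hW => ?_⟩⟩
  obtain ⟨M, N, k, -, -, -, hrep⟩ := D.exists_heat_representation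
  rw [hrep]
  have c0 : ContinuousOn (fun t => H1.fn (T t)) (Icc 0 τ) := h.cont
  have cc : ∀ i : Fin 3, Continuous fun v : H1 ℝ G.workpiece => v.1 i := fun i => by fun_prop
  have c1 : ContinuousOn (fun t => H1.dr (T t)) (Icc 0 τ) := (cc 1).comp_continuousOn hT
  have c2 : ContinuousOn (fun t => H1.dz (T t)) (Icc 0 τ) := (cc 2).comp_continuousOn hT
  have cl : ContinuousOn (fun t => inner ℝ (d t) (H1.fn W) + (inner ℝ (M (H1.dr (T t))) (H1.dr W)
      + inner ℝ (M (H1.dz (T t))) (H1.dz W) + inner ℝ (N (γ t)) γW)) (Icc 0 τ) :=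
    (hd.inner continuousOn_const).add ((((M.continuous.comp_continuousOn c1).inner
      continuousOn_const).add ((M.continuous.comp_continuousOn c2).inner continuousOn_const)).add
      ((N.continuous.comp_continuousOn hγc).inner continuousOn_const))
  have cr : ContinuousOn (fun t => D.joule (H1.fn (T t)) (A t) W + inner ℝ (N (Tc t)) γW)
      (Icc 0 τ) := by
    refine ContinuousOn.add (fun s hs => ?_)
      ((N.continuous.comp_continuousOn hTc).inner continuousOn_const)
    exact D.tendsto_joule hW.approximable (c0 s hs) (hA s hs)
  refine eqOn_Icc_of_ae hτ cl cr ?_ ht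
  filter_upwards [h.heat, hTt, ae_restrict_mem measurableSet_Ioo] with s hs hsd hsm
  obtain ⟨γT, hγT, heq⟩ := hs
  -- Traces are unique: by the trace bound the difference of two traces of the same function
  -- vanishes.
  have hu : γT = γ s := by
    have := hb _ _ (hγT.sub (hγ s (Ioo_subset_Icc_self hsm)))
    rw [sub_self, norm_zero, mul_zero] at this
    exact sub_eq_zero.1 (norm_le_zero_iff.1 this)
  have := (hrep _ _ _ _ _ _ _ _).1 (heq W γW hW)
  rwa [hu, hsd] at this

end Coefficients

/-! ## The time grid -/

section Grid

variable {τ : ℝ} {N : ℕ}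

theorem timeStep_pos (hτ : 0 < τ) (hN : 1 ≤ N) : 0 < timeStep τ N :=
  div_pos hτ (by exact_mod_cast hN)

theorem card_mul_timeStep (hN : 1 ≤ N) : N * timeStep τ N = τ := by
  have : (N : ℝ) ≠ 0 := by positivity
  exact mul_div_cancel₀ _ this

theorem timeNode_succ_sub (n : ℕ) : timeNode τ N (n + 1) - timeNode τ N n = timeStep τ N := by
  unfold timeNode
  push_cast
  ring

theorem timeNode_zero : timeNode τ N 0 = 0 := by simp [timeNode]

theorem timeNode_self (hN : 1 ≤ N) : timeNode τ N N = τ := card_mul_timeStep hN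

theorem timeNode_mem (hτ : 0 < τ) (hN : 1 ≤ N) {n : ℕ} (hn : n ≤ N) :
    timeNode τ N n ∈ Icc 0 τ := by
  have h := (timeStep_pos hτ hN).le
  refine ⟨by unfold timeNode; positivity, ?_⟩
  refine le_trans ?_ (card_mul_timeStep (τ := τ) hN).le
  exact mul_le_mul_of_nonneg_right (by exact_mod_cast hn) h

theorem timeNode_le_succ (hτ : 0 < τ) (hN : 1 ≤ N) (n : ℕ) :
    timeNode τ N n ≤ timeNode τ N (n + 1) := by
  have := timeNode_succ_sub (τ := τ) (N := N) n
  linarith [timeStep_pos hτ hN]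

variable {X : Type*} [NormedAddCommGroup X]

/-- The integral of `‖f‖²` over the `n`-th time interval. -/
def slab (τ : ℝ) (N : ℕ) (f : ℝ → X) (n : ℕ) : ℝ :=
  ∫ x in timeNode τ N n..timeNode τ N (n + 1), ‖f x‖ ^ 2

theorem MemL2Time.intervalIntegrable_norm_sq {f : ℝ → X} (hf : MemL2Time τ f) {s t : ℝ}
    (hs : s ∈ Icc 0 τ) (ht : t ∈ Icc 0 τ) :
    IntervalIntegrable (fun x => ‖f x‖ ^ 2) volume s t := by
  have hi : Integrable (fun x => ‖f x‖ ^ 2) (volume.restrict (Ioo 0 τ)) :=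
    (MemLp.norm hf).integrable_sq
  have h1 : IntegrableOn (fun x => ‖f x‖ ^ 2) (Icc 0 τ) :=
    (integrableOn_Icc_iff_integrableOn_Ioo (by simp) (by simp)).2 hi
  have : IntervalIntegrable (fun x => ‖f x‖ ^ 2) volume 0 τ :=
    (intervalIntegrable_iff_integrableOn_Icc_of_le (hs.1.trans hs.2)).2 h1
  refine this.mono_set ?_
  rw [uIcc_of_le (hs.1.trans hs.2)]
  exact ordConnected_Icc.uIcc_subset hs ht

theorem sum_slab (hτ : 0 < τ) (hN : 1 ≤ N) {f : ℝ → X} (hf : MemL2Time τ f) :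
    ∑ n ∈ Finset.range N, slab τ N f n = ∫ t in Ioo 0 τ, ‖f t‖ ^ 2 := by
  unfold slab
  rw [intervalIntegral.sum_integral_adjacent_intervals fun k hk =>
    hf.intervalIntegrable_norm_sq (timeNode_mem hτ hN hk.le) (timeNode_mem hτ hN hk),
    timeNode_zero, timeNode_self hN, intervalIntegral.integral_of_le hτ.le,
    integral_Ioc_eq_integral_Ioo]

variable [NormedSpace ℝ X] [CompleteSpace X]

/-- The fundamental theorem of calculus and Cauchy–Schwarz. The factor `Δt` here and the one in the
time sum of the squared defects make up the `Δt²` of the final estimate. -/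
theorem norm_sq_sub_le_slab (hτ : 0 < τ) (hN : 1 ≤ N) {g g' : ℝ → X} (h : MemH1Time τ g g')
    (hg : ContinuousOn g (Icc 0 τ)) {n : ℕ} (hn : n < N) :
    ‖g (timeNode τ N (n + 1)) - g (timeNode τ N n)‖ ^ 2 ≤ timeStep τ N * slab τ N g' n := by
  rw [h.sub_eq_integral hτ hg (timeNode_mem hτ hN hn.le) (timeNode_mem hτ hN hn),
    ← timeNode_succ_sub n]
  exact norm_sq_integral_le h.deriv_mem (timeNode_mem hτ hN hn.le).1 (timeNode_le_succ hτ hN n)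
    (timeNode_mem hτ hN hn).2

/-- A bounded linear `Q` commutes with the time integral, so the increment of `(I - Q) g` is the
integral of `(I - Q) g'`. -/
theorem norm_sq_sub_map_sub_le_slab (hτ : 0 < τ) (hN : 1 ≤ N) {g g' : ℝ → X}
    (h : MemH1Time τ g g') (hg : ContinuousOn g (Icc 0 τ)) (Q : X →L[ℝ] X) {n : ℕ} (hn : n < N) :
    ‖(g (timeNode τ N (n + 1)) - Q (g (timeNode τ N (n + 1))))
        - (g (timeNode τ N n) - Q (g (timeNode τ N n)))‖ ^ 2
      ≤ timeStep τ N * slab τ N (fun t => g' t - Q (g' t)) n := by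
  have hs := timeNode_mem hτ hN hn.le
  have ht := timeNode_mem hτ hN hn
  have e := h.sub_eq_integral hτ hg hs ht
  have hi := h.deriv_mem.intervalIntegrable hs ht
  have hm : MemL2Time τ fun t => g' t - Q (g' t) := MemLp.sub h.deriv_mem (Q.comp_memLp' h.deriv_mem)
  have e2 : (g (timeNode τ N (n + 1)) - Q (g (timeNode τ N (n + 1))))
        - (g (timeNode τ N n) - Q (g (timeNode τ N n)))
      = ∫ x in timeNode τ N n..timeNode τ N (n + 1), (g' x - Q (g' x)) := by
    have hq : MemL2Time τ fun t => Q (g' t) := Q.comp_memLp' h.deriv_mem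
    rw [intervalIntegral.integral_sub hi (hq.intervalIntegrable hs ht),
      Q.intervalIntegral_comp_comm hi, ← e, map_sub]
    abel
  rw [e2, ← timeNode_succ_sub n]
  exact norm_sq_integral_le hm hs.1 (timeNode_le_succ hτ hN n) ht.2

/-- Consistency of the backward difference quotient. -/
theorem norm_sq_consistency_le (hτ : 0 < τ) (hN : 1 ≤ N) {g g' g'' d : ℝ → X}
    (h : MemH1Time τ g g') (h' : MemH1Time τ g' g'') (hg : ContinuousOn g (Icc 0 τ))
    (hd : ContinuousOn d (Icc 0 τ)) (hae : ∀ᵐ t ∂volume.restrict (Ioo 0 τ), g' t = d t)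
    (hint : ∀ s ∈ Icc 0 τ, ∀ t ∈ Icc 0 τ, d t - d s = ∫ x in s..t, g'' x) {n : ℕ} (hn : n < N) :
    ‖d (timeNode τ N (n + 1)) - (timeStep τ N)⁻¹ • (g (timeNode τ N (n + 1)) - g (timeNode τ N n))‖ ^ 2
      ≤ timeStep τ N * slab τ N g'' n := by
  have hs := timeNode_mem hτ hN hn.le
  have ht := timeNode_mem hτ hN hn
  have hst := timeNode_le_succ hτ hN n
  have hΔ := timeStep_pos hτ hN
  have hsub := timeNode_succ_sub (τ := τ) (N := N) n
  unfold slab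
  set s := timeNode τ N n
  set t := timeNode τ N (n + 1)
  set Δ := timeStep τ N
  have hIcc : Icc s t ⊆ Icc 0 τ := Icc_subset_Icc hs.1 ht.2
  have hi : IntervalIntegrable d volume s t :=
    (hd.mono (by rw [uIcc_of_le hst]; exact hIcc)).intervalIntegrable
  have e : g t - g s = ∫ x in s..t, d x := by
    rw [h.sub_eq_integral hτ hg hs ht]
    refine intervalIntegral.integral_congr_ae ?_
    have hae' : ∀ᵐ x ∂volume.restrict (Ioc 0 τ), g' x = d x := by
      rwa [← restrict_Ioo_eq_restrict_Ioc]
    filter_upwards [(ae_restrict_iff' measurableSet_Ioc).1 hae'] with x hx hxm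
    rw [uIoc_of_le hst] at hxm
    exact hx (Ioc_subset_Ioc hs.1 ht.2 hxm)
  -- The difference quotient is the mean of the continuous derivative `d` over the step, so the
  -- defect is the mean of `d t - d x`, and each of these is an integral of `g''`.
  have e2 : d t - Δ⁻¹ • (g t - g s) = Δ⁻¹ • ∫ x in s..t, (d t - d x) := by
    rw [intervalIntegral.integral_sub intervalIntegrable_const hi, intervalIntegral.integral_const,
      hsub, ← e, smul_sub Δ⁻¹ (Δ • d t), smul_smul, inv_mul_cancel₀ hΔ.ne', one_smul]
  have hB : 0 ≤ ∫ x in s..t, ‖g'' x‖ ^ 2 :=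
    intervalIntegral.integral_nonneg hst fun _ _ => sq_nonneg _
  have hle : ∀ x ∈ Ioc s t, ‖d t - d x‖ ≤ √(Δ * ∫ x in s..t, ‖g'' x‖ ^ 2) := by
    intro x hx
    have hx' : x ∈ Icc 0 τ := hIcc (Ioc_subset_Icc_self hx)
    refine Real.le_sqrt_of_sq_le ?_
    rw [hint x hx' t ht]
    refine (norm_sq_integral_le h'.deriv_mem hx'.1 hx.2 ht.2).trans ?_
    refine mul_le_mul (by linarith [hx.1]) ?_
      (intervalIntegral.integral_nonneg hx.2 fun _ _ => sq_nonneg _) hΔ.le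
    exact intervalIntegral.integral_mono_interval hx.1.le hx.2 le_rfl
      (.of_forall fun _ => sq_nonneg _) (h'.deriv_mem.intervalIntegrable_norm_sq hs ht)
  have hn := intervalIntegral.norm_integral_le_of_norm_le_const (a := s) (b := t)
    (by rw [uIoc_of_le hst]; exact hle)
  rw [hsub, abs_of_pos hΔ] at hn
  have hfin : ‖d t - Δ⁻¹ • (g t - g s)‖ ≤ √(Δ * ∫ x in s..t, ‖g'' x‖ ^ 2) := by
    rw [e2, norm_smul, norm_inv, Real.norm_of_nonneg hΔ.le, inv_mul_le_iff₀ hΔ, mul_comm]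
    exact hn
  calc _ ≤ √(Δ * ∫ x in s..t, ‖g'' x‖ ^ 2) ^ 2 := pow_le_pow_left₀ (norm_nonneg _) hfin 2
    _ = _ := Real.sq_sqrt (mul_nonneg hΔ.le hB)

end Grid

/-! ## Discrete Gronwall inequality -/

/-- Each step multiplies the old value by at most `1 + 2θ + 2β` and adds at most `2 e n`; the sum of
the `g j` is carried along because the growth factor is at least one. -/
theorem discrete_gronwall {N : ℕ} {a g e : ℕ → ℝ} {θ ρ β : ℝ} (ha : ∀ n, 0 ≤ a n)
    (hg : ∀ n, 0 ≤ g n) (he : ∀ n, 0 ≤ e n) (hθ : 0 ≤ θ) (hθ' : θ ≤ 1 / 2) (hρ : 0 ≤ ρ)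
    (hβ : 0 ≤ β) (h0 : a 0 = 0)
    (h : ∀ n < N, a (n + 1) + ρ * g (n + 1) ≤ a n + θ * a (n + 1) + β * a n + e n) :
    ∀ n ≤ N, a n + ρ * ∑ j ∈ Finset.Icc 1 n, g j
      ≤ (1 + (2 * θ + 2 * β)) ^ n * (2 * ∑ j ∈ Finset.range n, e j) := by
  intro n
  induction n with
  | zero => intro _; simp [h0]
  | succ n ih =>
    intro hn
    have h1 := ih (Nat.le_of_succ_le hn)
    have h2 := h n hn
    have hq : 1 ≤ (1 + (2 * θ + 2 * β)) ^ (n + 1) := one_le_pow₀ (by linarith)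
    have hS : 0 ≤ ρ * ∑ j ∈ Finset.Icc 1 n, g j := mul_nonneg hρ (Finset.sum_nonneg fun j _ => hg j)
    -- The implicit term is absorbed on the left. For `θ ≤ 1/2` one has `(1 + 2θ)(1 - θ) ≥ 1`, so
    -- dividing by `1 - θ` costs at most a factor `1 + 2θ ≤ 2`.
    have h3 : a (n + 1) + ρ * g (n + 1) ≤ (1 + (2 * θ + 2 * β)) * a n + 2 * e n := by
      have h4 : (1 - θ) * (a (n + 1) + ρ * g (n + 1)) ≤ (1 + β) * a n + e n := by
        nlinarith [mul_nonneg hθ (mul_nonneg hρ (hg (n + 1)))]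
      have h5 : 0 ≤ a (n + 1) + ρ * g (n + 1) := add_nonneg (ha _) (mul_nonneg hρ (hg _))
      have h6 : a (n + 1) + ρ * g (n + 1) ≤ (1 + 2 * θ) * ((1 + β) * a n + e n) := by
        refine le_trans ?_ (mul_le_mul_of_nonneg_left h4 (by linarith))
        rw [← mul_assoc]
        refine le_mul_of_one_le_left h5 ?_
        nlinarith
      have h7 : 2 * θ * β * a n ≤ β * a n := by
        have := mul_nonneg hβ (ha n)
        nlinarith
      nlinarith [mul_nonneg hθ (he n), he n]
    rw [Finset.sum_Icc_succ_top (Nat.le_add_left 1 n), Finset.sum_range_succ, mul_add, mul_add,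
      mul_add, pow_succ]
    have h8 := mul_le_mul_of_nonneg_left h1 (show 0 ≤ 1 + (2 * θ + 2 * β) by linarith)
    have h9 : ρ * ∑ j ∈ Finset.Icc 1 n, g j
        ≤ (1 + (2 * θ + 2 * β)) * (ρ * ∑ j ∈ Finset.Icc 1 n, g j) :=
      le_mul_of_one_le_left hS (by linarith)
    have h10 : 2 * e n ≤ (1 + (2 * θ + 2 * β)) ^ (n + 1) * (2 * e n) :=
      le_mul_of_one_le_left (by linarith [he n]) hq
    rw [pow_succ] at h10
    nlinarith

theorem pow_le_exp_of_mul_le {b T : ℝ} (hb : 0 ≤ b) {n : ℕ} (h : n * b ≤ T) :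
    (1 + b) ^ n ≤ Real.exp T := by
  calc (1 + b) ^ n ≤ Real.exp b ^ n := by
        refine pow_le_pow_left₀ (by linarith) ?_ n
        linarith [Real.add_one_le_exp b]
    _ = Real.exp (n * b) := (Real.exp_nat_mul b n).symm
    _ ≤ _ := Real.exp_le_exp.2 h

/-! ## The error equation of one time step -/

theorem half_sub_le_inner_sub {X : Type*} [NormedAddCommGroup X] [InnerProductSpace ℝ X] (x y : X) :
    (‖y‖ ^ 2 - ‖x‖ ^ 2) / 2 ≤ inner ℝ (y - x) y := by
  have h := norm_sub_sq_real y x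
  rw [inner_sub_left, real_inner_self_eq_norm_sq, real_inner_comm]
  linarith [sq_nonneg ‖y - x‖]

theorem inner_map_le {X : Type*} [NormedAddCommGroup X] [InnerProductSpace ℝ X] (M : X →L[ℝ] X)
    (x y : X) : inner ℝ (M x) y ≤ ‖M‖ * (‖x‖ * ‖y‖) := by
  refine (real_inner_le_norm _ _).trans ?_
  rw [← mul_assoc]
  exact mul_le_mul_of_nonneg_right (M.le_opNorm x) (norm_nonneg y)

/-- The exact equation is subtracted from the discrete one, and a comparison function is added and
subtracted. The letters `S`, `U`, `Q` mark exact, discrete and comparison quantities, `r` and `z`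
the two derivatives, `γ` the traces; unprimed functions belong to the old time level. -/
theorem error_identity {X Y : Type*} [NormedAddCommGroup X] [InnerProductSpace ℝ X]
    [NormedAddCommGroup Y] [InnerProductSpace ℝ Y] (M : X →L[ℝ] X) (N : Y →L[ℝ] Y) {c j j' : ℝ}
    {d' s s' u u' q q' w r rS rU rQ z zS zU zQ : X} {g g' γ γS γU γQ : Y}
    (h' : inner ℝ d' w + (inner ℝ (M rS) r + inner ℝ (M zS) z + inner ℝ (N γS) γ)
      = j' + inner ℝ (N g') γ)
    (h : inner ℝ (c • (u' - u)) w + (inner ℝ (M rU) r + inner ℝ (M zU) z + inner ℝ (N γU) γ)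
      = j + inner ℝ (N g) γ) :
    c * inner ℝ ((u' - q') - (u - q)) w
      + (inner ℝ (M (rU - rQ)) r + inner ℝ (M (zU - zQ)) z + inner ℝ (N (γU - γQ)) γ)
    = (j - j') + inner ℝ (N (g - g')) γ + inner ℝ (d' - c • (s' - s)) w
      + c * inner ℝ ((s' - q') - (s - q)) w
      + (inner ℝ (M (rS - rQ)) r + inner ℝ (M (zS - zQ)) z + inner ℝ (N (γS - γQ)) γ) := by
  simp only [map_sub, inner_sub_left, real_inner_smul_left] at h h' ⊢
  linear_combination h - h'

/-- The identity is tested with the discrete error `U' - Q'` itself. Coercivity of `M` covers only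
the derivatives, so the `L²` part of `k e²` reappears on the right, to be handled by Gronwall. -/
theorem error_estimate {X Y : Type*} [NormedAddCommGroup X] [InnerProductSpace ℝ X]
    [NormedAddCommGroup Y] [InnerProductSpace ℝ Y] {M : X →L[ℝ] X} {N : Y →L[ℝ] Y}
    {Δ j j' k e p C J F : ℝ} {d' s s' u u' q q' rS rU rQ zS zU zQ : X} {g g' γS γU γQ : Y}
    (hM : ∀ x, k * ‖x‖ ^ 2 ≤ inner ℝ (M x) x) (hN : ∀ y, 0 ≤ inner ℝ (N y) y)
    (hΔ : 0 < Δ) (he : 0 ≤ e) (hp : 0 ≤ p) (hC : 0 ≤ C) (hJ : 0 ≤ J) (hF : 0 ≤ F)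
    (hsq : e ^ 2 = ‖u' - q'‖ ^ 2 + ‖rU - rQ‖ ^ 2 + ‖zU - zQ‖ ^ 2)
    (pr : ‖rS - rQ‖ ≤ p) (pz : ‖zS - zQ‖ ≤ p) (hγ : ‖γU - γQ‖ ≤ C * e) (pγ : ‖γS - γQ‖ ≤ C * p)
    (hj : j - j' ≤ J * F * e)
    (h' : inner ℝ d' (u' - q') + (inner ℝ (M rS) (rU - rQ) + inner ℝ (M zS) (zU - zQ)
      + inner ℝ (N γS) (γU - γQ)) = j' + inner ℝ (N g') (γU - γQ))
    (h : inner ℝ (Δ⁻¹ • (u' - u)) (u' - q') + (inner ℝ (M rU) (rU - rQ)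
      + inner ℝ (M zU) (zU - zQ) + inner ℝ (N γU) (γU - γQ)) = j + inner ℝ (N g) (γU - γQ)) :
    (‖u' - q'‖ ^ 2 - ‖u - q‖ ^ 2) / (2 * Δ) + k * e ^ 2
      ≤ k * ‖u' - q'‖ ^ 2 + (J + ‖N‖ * C + 1 + (2 * ‖M‖ + ‖N‖ * C ^ 2)) * e *
        (F + ‖g - g'‖ + ‖d' - Δ⁻¹ • (s' - s)‖ + Δ⁻¹ * ‖(s' - q') - (s - q)‖ + p) := by
  have key := error_identity M N (c := Δ⁻¹) (s := s) (s' := s') (q := q)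
    (q' := q') (rQ := rQ) (zQ := zQ) (γQ := γQ) h' h
  have hMn := norm_nonneg M
  have hNn := norm_nonneg N
  have hw : ‖u' - q'‖ ≤ e := (sq_le_sq₀ (norm_nonneg _) he).1
    (by linarith [sq_nonneg ‖rU - rQ‖, sq_nonneg ‖zU - zQ‖])
  have hr : ‖rU - rQ‖ ≤ e := (sq_le_sq₀ (norm_nonneg _) he).1
    (by linarith [sq_nonneg ‖u' - q'‖, sq_nonneg ‖zU - zQ‖])
  have hz : ‖zU - zQ‖ ≤ e := (sq_le_sq₀ (norm_nonneg _) he).1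
    (by linarith [sq_nonneg ‖rU - rQ‖, sq_nonneg ‖u' - q'‖])
  have i1 : (‖u' - q'‖ ^ 2 - ‖u - q‖ ^ 2) / (2 * Δ)
      ≤ Δ⁻¹ * inner ℝ ((u' - q') - (u - q)) (u' - q') := by
    refine le_trans (le_of_eq ?_) (mul_le_mul_of_nonneg_left
      (half_sub_le_inner_sub (u - q) (u' - q')) (inv_nonneg.2 hΔ.le))
    field_simp
  have i2 := hM (rU - rQ)
  have i3 := hM (zU - zQ)
  have i4 := hN (γU - γQ)
  have R1 : inner ℝ (M (rS - rQ)) (rU - rQ) ≤ ‖M‖ * (p * e) :=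
    (inner_map_le M _ _).trans (by gcongr)
  have R2 : inner ℝ (M (zS - zQ)) (zU - zQ) ≤ ‖M‖ * (p * e) :=
    (inner_map_le M _ _).trans (by gcongr)
  have R3 : inner ℝ (N (γS - γQ)) (γU - γQ) ≤ ‖N‖ * ((C * p) * (C * e)) :=
    (inner_map_le N _ _).trans (by gcongr)
  have R4 : inner ℝ (N (g - g')) (γU - γQ) ≤ ‖N‖ * (‖g - g'‖ * (C * e)) :=
    (inner_map_le N _ _).trans (by gcongr)
  have R5 : inner ℝ (d' - Δ⁻¹ • (s' - s)) (u' - q') ≤ ‖d' - Δ⁻¹ • (s' - s)‖ * e :=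
    (real_inner_le_norm _ _).trans (by gcongr)
  have R6 : Δ⁻¹ * inner ℝ ((s' - q') - (s - q)) (u' - q')
      ≤ Δ⁻¹ * (‖(s' - q') - (s - q)‖ * e) :=
    mul_le_mul_of_nonneg_left ((real_inner_le_norm _ _).trans (by gcongr)) (inv_nonneg.2 hΔ.le)
  have p1 := norm_nonneg (g - g')
  have p2 := norm_nonneg (d' - Δ⁻¹ • (s' - s))
  have p3 := mul_nonneg (inv_nonneg.2 hΔ.le) (norm_nonneg ((s' - q') - (s - q)))
  rw [← mul_assoc] at R6
  generalize ‖M‖ = cM at *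
  generalize ‖N‖ = cN at *
  generalize ‖g - g'‖ = x1 at *
  generalize ‖d' - Δ⁻¹ • (s' - s)‖ = x2 at *
  generalize Δ⁻¹ * ‖(s' - q') - (s - q)‖ = x3 at *
  have n1 : 0 ≤ cN * C := mul_nonneg hNn hC
  have n2 : 0 ≤ 2 * cM + cN * C ^ 2 := by positivity
  have K1 : J * F ≤ (J + cN * C + 1 + (2 * cM + cN * C ^ 2)) * F :=
    mul_le_mul_of_nonneg_right (by linarith) hF
  have K2 : cN * C * x1 ≤ (J + cN * C + 1 + (2 * cM + cN * C ^ 2)) * x1 :=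
    mul_le_mul_of_nonneg_right (by linarith) p1
  have K3 : 1 * x2 ≤ (J + cN * C + 1 + (2 * cM + cN * C ^ 2)) * x2 :=
    mul_le_mul_of_nonneg_right (by linarith) p2
  have K4 : 1 * x3 ≤ (J + cN * C + 1 + (2 * cM + cN * C ^ 2)) * x3 :=
    mul_le_mul_of_nonneg_right (by linarith) p3
  have K5 : (2 * cM + cN * C ^ 2) * p ≤ (J + cN * C + 1 + (2 * cM + cN * C ^ 2)) * p :=
    mul_le_mul_of_nonneg_right (by linarith) hp
  have T := mul_le_mul_of_nonneg_right
    (add_le_add (add_le_add (add_le_add (add_le_add K1 K2) K3) K4) K5) he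
  generalize J + cN * C + 1 + (2 * cM + cN * C ^ 2) = K at *
  rw [hsq]
  linarith

theorem H1.norm_dr_le {𝕜 : Type} [RCLike 𝕜] {ϑ : Set Plane} (u : H1 𝕜 ϑ) : ‖H1.dr u‖ ≤ ‖u‖ :=
  (sq_le_sq₀ (norm_nonneg _) (norm_nonneg _)).1
    (by linarith [H1.norm_sq u, sq_nonneg ‖H1.fn u‖, sq_nonneg ‖H1.dz u‖])

theorem H1.norm_dz_le {𝕜 : Type} [RCLike 𝕜] {ϑ : Set Plane} (u : H1 𝕜 ϑ) : ‖H1.dz u‖ ≤ ‖u‖ :=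
  (sq_le_sq₀ (norm_nonneg _) (norm_nonneg _)).1
    (by linarith [H1.norm_sq u, sq_nonneg ‖H1.fn u‖, sq_nonneg ‖H1.dr u‖])

namespace Coefficients

variable {m : ℕ} {G : Configuration m} (D : Coefficients G)

/-- Stability of the error equation: `S, S'` are the exact temperatures at two consecutive times,
`U, U'` the discrete ones and `Q, Q'` arbitrary comparison functions. -/
theorem exists_heat_error_step : ∃ k K : ℝ, 0 < k ∧ 0 ≤ K ∧
    ∀ (Δ : ℝ) (S S' U U' Q Q' : H1 ℝ G.workpiece) (A' Ah : HTilde0 G.dom)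
      (g g' γS γU γQ : L2Curve ℝ G.outer) (d' : L2 ℝ G.workpiece), 0 < Δ →
      IsTrace G.outer S' γS → IsTrace G.outer U' γU → IsTrace G.outer Q' γQ →
      D.HeatEq d' (H1.fn S') A' g' S' (U' - Q') γS (γU - γQ) →
      D.HeatEq (Δ⁻¹ • (H1.fn U' - H1.fn U)) (H1.fn U) Ah g U' (U' - Q') γU (γU - γQ) →
      (‖H1.fn U' - H1.fn Q'‖ ^ 2 - ‖H1.fn U - H1.fn Q‖ ^ 2) / (2 * Δ) + k * ‖U' - Q'‖ ^ 2
        ≤ k * ‖H1.fn U' - H1.fn Q'‖ ^ 2 + K * ‖U' - Q'‖ *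
          (‖H1.fn U - H1.fn S'‖ * ‖Ah‖ ^ 2
            + ‖HTilde.restrict G.workpiece_subset_dom Ah.1
              - HTilde.restrict G.workpiece_subset_dom A'.1‖ * (‖Ah‖ + ‖A'‖)
            + ‖g - g'‖ + ‖d' - Δ⁻¹ • (H1.fn S' - H1.fn S)‖
            + Δ⁻¹ * ‖(H1.fn S' - H1.fn Q') - (H1.fn S - H1.fn Q)‖ + ‖S' - Q'‖) := by
  obtain ⟨M, N, k, hk, hM, hN, hrep⟩ := D.exists_heat_representation
  obtain ⟨J, hJ, hj⟩ := D.exists_joule_estimate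
  obtain ⟨C, hC, hc⟩ := G.exists_trace_bound
  refine ⟨k, J + ‖N‖ * C + 1 + (2 * ‖M‖ + ‖N‖ * C ^ 2), hk, by positivity, ?_⟩
  intro Δ S S' U U' Q Q' A' Ah g g' γS γU γQ d' hΔ tS tU tQ e1 e2
  rw [hrep] at e1 e2
  have tE := tU.sub tQ
  have hJ' := (le_abs_self _).trans
    (hj (H1.fn U) (H1.fn S') Ah A' (U' - Q') tE.approximable)
  have hX1 : 0 ≤ ‖H1.fn U - H1.fn S'‖ * ‖Ah‖ ^ 2 := mul_nonneg (norm_nonneg _) (sq_nonneg _)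
  have hX2 : 0 ≤ ‖HTilde.restrict G.workpiece_subset_dom Ah.1
    - HTilde.restrict G.workpiece_subset_dom A'.1‖ * (‖Ah‖ + ‖A'‖) :=
    mul_nonneg (norm_nonneg _) (add_nonneg (norm_nonneg _) (norm_nonneg _))
  generalize ‖HTilde.restrict G.workpiece_subset_dom Ah.1
    - HTilde.restrict G.workpiece_subset_dom A'.1‖ * (‖Ah‖ + ‖A'‖) = X2 at hJ' hX2 ⊢
  generalize ‖H1.fn U - H1.fn S'‖ * ‖Ah‖ ^ 2 = X1 at hJ' hX1 ⊢
  exact error_estimate hM hN hΔ (norm_nonneg (U' - Q')) (norm_nonneg (S' - Q')) hC hJ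
    (add_nonneg hX1 hX2) (H1.norm_sq (U' - Q')) (H1.norm_dr_le (S' - Q'))
    (H1.norm_dz_le (S' - Q')) (hc _ _ tE) (hc _ _ (tS.sub tQ)) hJ' e1 e2

end Coefficients

/-! ## The error of the scheme -/

/-- Since `x' ≤ e`, the coercivity constant `k` may be lowered to any `μ`, which reduces the
implicit term as well. Young's inequality then absorbs `K e (x + δ)` into half of `μ e²`. -/
theorem young_step {Δ k μ K x x' e δ : ℝ} (hΔ : 0 < Δ) (hμ : 0 < μ) (hμk : μ ≤ k)
    (hx : 0 ≤ x') (hxe : x' ≤ e)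
    (h : (x' ^ 2 - x ^ 2) / (2 * Δ) + k * e ^ 2 ≤ k * x' ^ 2 + K * e * (x + δ)) :
    x' ^ 2 + Δ * μ * e ^ 2 ≤ x ^ 2 + 2 * (Δ * μ) * x' ^ 2 + 2 * (Δ * (K ^ 2 / μ)) * x ^ 2
      + 2 * (Δ * (K ^ 2 / μ)) * δ ^ 2 := by
  have hsq : x' ^ 2 ≤ e ^ 2 := pow_le_pow_left₀ hx hxe 2
  have h1 : μ * (e ^ 2 - x' ^ 2) ≤ k * (e ^ 2 - x' ^ 2) :=
    mul_le_mul_of_nonneg_right hμk (by linarith)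
  have h2 : K * e * (x + δ) ≤ μ / 2 * e ^ 2 + K ^ 2 / μ * (x ^ 2 + δ ^ 2) := by
    have h3 : 0 ≤ μ / 2 * (e - K / μ * (x + δ)) ^ 2 := by positivity
    have h4 : 0 ≤ K ^ 2 / μ / 2 * (x - δ) ^ 2 := by positivity
    have h5 : μ / 2 * (e - K / μ * (x + δ)) ^ 2 + K ^ 2 / μ / 2 * (x - δ) ^ 2
        = μ / 2 * e ^ 2 + K ^ 2 / μ * (x ^ 2 + δ ^ 2) - K * e * (x + δ) := by
      field_simp
      ring
    linarith
  have h6 : (x' ^ 2 - x ^ 2) / (2 * Δ) ≤ μ * x' ^ 2 - μ / 2 * e ^ 2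
      + K ^ 2 / μ * (x ^ 2 + δ ^ 2) := by linarith
  rw [div_le_iff₀ (by positivity)] at h6
  linarith

theorem exists_gronwall_constant {τ k : ℝ} (K : ℝ) (hτ : 0 < τ) (hk : 0 < k) :
    ∃ c : ℝ, 0 ≤ c ∧ ∀ (N : ℕ), 1 ≤ N → ∀ x e δ : ℕ → ℝ, (∀ n, 0 ≤ x n) →
      (∀ n, x n ≤ e n) → x 0 = 0 →
      (∀ n < N, (x (n + 1) ^ 2 - x n ^ 2) / (2 * timeStep τ N) + k * e (n + 1) ^ 2
        ≤ k * x (n + 1) ^ 2 + K * e (n + 1) * (x n + δ n)) →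
      ∀ n ≤ N, x n ^ 2 + timeStep τ N * ∑ j ∈ Finset.Icc 1 n, e j ^ 2
        ≤ c * (timeStep τ N * ∑ j ∈ Finset.range N, δ j ^ 2) := by
  -- As `Δ ≤ τ`, this choice gives `2 Δ μ ≤ 1/4`, so the implicit term is small enough for Gronwall
  -- with any number of time steps.
  set μ := min k (1 / (8 * τ)) with hμdef
  have hμ : 0 < μ := lt_min hk (by positivity)
  have hμτ : τ * μ ≤ 1 / 8 := by
    have := mul_le_mul_of_nonneg_left (min_le_right k (1 / (8 * τ))) hτ.le
    refine this.trans_eq ?_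
    field_simp
  -- The exponential bounds the Gronwall power, whose increment is `4 Δ (μ + K² / μ)`; the factor `1
  -- + 1 / μ` removes the weight `μ` from the sum on the left.
  refine ⟨(1 + 1 / μ) * (Real.exp (4 * (τ * (μ + K ^ 2 / μ))) * (4 * (K ^ 2 / μ))), by positivity, ?_⟩
  intro N hN x e δ hx hxe h0 h n hn
  have hΔ := timeStep_pos hτ hN
  have hNΔ := card_mul_timeStep (τ := τ) hN
  generalize timeStep τ N = Δ at *
  have hΔτ : Δ ≤ τ := by
    rw [← hNΔ]
    exact le_mul_of_one_le_left hΔ.le (by exact_mod_cast hN)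
  have hθ : 2 * (Δ * μ) ≤ 1 / 2 := by
    have := mul_le_mul_of_nonneg_right hΔτ hμ.le
    linarith
  have g := discrete_gronwall (N := N) (a := fun n => x n ^ 2) (g := fun n => e n ^ 2)
    (e := fun n => 2 * (Δ * (K ^ 2 / μ)) * δ n ^ 2) (θ := 2 * (Δ * μ)) (ρ := Δ * μ)
    (β := 2 * (Δ * (K ^ 2 / μ))) (fun _ => sq_nonneg _) (fun _ => sq_nonneg _)
    (fun _ => by positivity) (by positivity) hθ (by positivity) (by positivity) (by simp [h0])
    (fun n hn => young_step hΔ hμ (min_le_left _ _) (hx _) (hxe _) (h n hn)) n hn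
  have hp : (1 + (2 * (2 * (Δ * μ)) + 2 * (2 * (Δ * (K ^ 2 / μ))))) ^ n
      ≤ Real.exp (4 * (τ * (μ + K ^ 2 / μ))) := by
    refine pow_le_exp_of_mul_le (by positivity) ?_
    have h1 : (n : ℝ) * Δ ≤ τ := by
      rw [← hNΔ]
      exact mul_le_mul_of_nonneg_right (by exact_mod_cast hn) hΔ.le
    have h2 := mul_le_mul_of_nonneg_right h1 (show 0 ≤ 4 * (μ + K ^ 2 / μ) by positivity)
    linarith
  have hs : ∑ j ∈ Finset.range n, δ j ^ 2 ≤ ∑ j ∈ Finset.range N, δ j ^ 2 :=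
    Finset.sum_le_sum_of_subset_of_nonneg (Finset.range_mono hn) fun _ _ _ => sq_nonneg _
  have hs0 : 0 ≤ ∑ j ∈ Finset.range n, δ j ^ 2 := Finset.sum_nonneg fun _ _ => sq_nonneg _
  have he0 : 0 ≤ ∑ j ∈ Finset.Icc 1 n, e j ^ 2 := Finset.sum_nonneg fun _ _ => sq_nonneg _
  rw [← Finset.mul_sum] at g
  generalize ∑ j ∈ Finset.range n, δ j ^ 2 = s at *
  generalize ∑ j ∈ Finset.range N, δ j ^ 2 = s' at *
  generalize ∑ j ∈ Finset.Icc 1 n, e j ^ 2 = b at *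
  have g2 : x n ^ 2 + Δ * μ * b
      ≤ Real.exp (4 * (τ * (μ + K ^ 2 / μ))) * (4 * (K ^ 2 / μ)) * (Δ * s') := by
    refine g.trans ((mul_le_mul hp (c := 2 * (2 * (Δ * (K ^ 2 / μ)) * s))
      (d := 4 * (Δ * (K ^ 2 / μ)) * s') ?_ (by positivity) (Real.exp_nonneg _)).trans_eq (by ring))
    have := mul_le_mul_of_nonneg_left hs (show 0 ≤ 4 * (Δ * (K ^ 2 / μ)) by positivity)
    linarith
  rw [mul_assoc]
  refine le_trans ?_ (mul_le_mul_of_nonneg_left g2 (by positivity))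
  have e1 : (1 + 1 / μ) * (x n ^ 2 + Δ * μ * b)
      = x n ^ 2 + Δ * b + (Δ * μ * b + x n ^ 2 / μ) := by
    field_simp
    ring
  rw [e1]
  have : 0 ≤ Δ * μ * b + x n ^ 2 / μ := by positivity
  linarith

theorem sq_sum_le_eight (a b c d e f g h : ℝ) : (a + b + c + d + e + f + g + h) ^ 2
    ≤ 8 * (a ^ 2 + b ^ 2 + c ^ 2 + d ^ 2 + e ^ 2 + f ^ 2 + g ^ 2 + h ^ 2) := by
  have h1 : ∀ u v : ℝ, (u + v) ^ 2 ≤ 2 * (u ^ 2 + v ^ 2) := fun u v => by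
    linarith [sq_nonneg (u - v), add_sq u v, sub_sq u v]
  have e1 : a + b + c + d + e + f + g + h = ((a + b) + (c + d)) + ((e + f) + (g + h)) := by ring
  rw [e1]
  linarith [h1 ((a + b) + (c + d)) ((e + f) + (g + h)), h1 (a + b) (c + d), h1 (e + f) (g + h),
    h1 a b, h1 c d, h1 e f, h1 g h]

/-- `v` and `w` stand for the temperature and potential differences in the Joule source. Their
bounds leave `x`, the discrete error at the old time, which is what Gronwall acts on; all the rest
is data for the defect. -/
theorem source_le {x p s q r y₁ y₂ y₃ p' M C v w na na' : ℝ} (hM : 0 ≤ M) (hC : 0 ≤ C)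
    (hx : 0 ≤ x) (hp : 0 ≤ p) (hs : 0 ≤ s) (hq : 0 ≤ q) (hr : 0 ≤ r) (h1 : 0 ≤ y₁) (h2 : 0 ≤ y₂)
    (h3 : 0 ≤ y₃) (hp' : 0 ≤ p') (hna : 0 ≤ na) (hna' : 0 ≤ na') (ha : na ≤ M) (ha' : na' ≤ M)
    (hv : v ≤ x + p + s) (hw : w ≤ C * (x + p + q) + r) :
    v * na ^ 2 + w * (na + na') + y₁ + y₂ + y₃ + p'
      ≤ (M ^ 2 + 2 * M * C + 2 * M + 1) * (x + (p + s + q + r + y₁ + y₂ + y₃ + p')) := by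
  have a1 : v * na ^ 2 ≤ (x + p + s) * M ^ 2 :=
    mul_le_mul hv (pow_le_pow_left₀ hna ha 2) (by positivity) (by positivity)
  have a2 : w * (na + na') ≤ (C * (x + p + q) + r) * (2 * M) :=
    mul_le_mul hw (by linarith) (by positivity) (by positivity)
  have b1 : 0 ≤ M ^ 2 * (q + r + y₁ + y₂ + y₃ + p') := by positivity
  have b2 : 0 ≤ 2 * M * C * (s + r + y₁ + y₂ + y₃ + p') := by positivity
  have b3 : 0 ≤ 2 * M * (x + p + s + q + y₁ + y₂ + y₃ + p') := by positivity
  linarith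

namespace Coefficients

variable {m : ℕ} {G : Configuration m} (D : Coefficients G)

-- The discrete source uses the old time level and the exact one the new, so both differences are
-- split at the exact solution of the old level. The potential error there is eliminated by Céa's
-- lemma in favour of the temperature error, and all potentials share one a priori bound.
set_option maxHeartbeats 1000000 in
theorem exists_coupled_error_step (V : Fin m → ℂ) : ∃ k K : ℝ, 0 < k ∧
    ∀ (Δ : ℝ) (S S' U U' Q Q' : H1 ℝ G.workpiece) (A A' Ah B : HTilde0 G.dom)
      (g g' γS γU γQ : L2Curve ℝ G.outer) (d' : L2 ℝ G.workpiece), 0 < Δ →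
      IsTrace G.outer S' γS → IsTrace G.outer U' γU → IsTrace G.outer Q' γQ →
      D.ElectricEq V (H1.fn S) A A → D.ElectricEq V (H1.fn S') A' A' →
      D.ElectricEq V (H1.fn U) Ah Ah →
      D.ElectricEq V (H1.fn S) A (Ah - B) → D.ElectricEq V (H1.fn U) Ah (Ah - B) →
      D.HeatEq d' (H1.fn S') A' g' S' (U' - Q') γS (γU - γQ) →
      D.HeatEq (Δ⁻¹ • (H1.fn U' - H1.fn U)) (H1.fn U) Ah g U' (U' - Q') γU (γU - γQ) →
      (‖H1.fn U' - H1.fn Q'‖ ^ 2 - ‖H1.fn U - H1.fn Q‖ ^ 2) / (2 * Δ) + k * ‖U' - Q'‖ ^ 2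
        ≤ k * ‖H1.fn U' - H1.fn Q'‖ ^ 2 + K * ‖U' - Q'‖ * (‖H1.fn U - H1.fn Q‖ +
          (‖S - Q‖ + ‖H1.fn S' - H1.fn S‖ + ‖A - B‖
            + ‖HTilde.restrict G.workpiece_subset_dom A'.1
              - HTilde.restrict G.workpiece_subset_dom A.1‖
            + ‖g' - g‖ + ‖d' - Δ⁻¹ • (H1.fn S' - H1.fn S)‖
            + Δ⁻¹ * ‖(H1.fn S' - H1.fn Q') - (H1.fn S - H1.fn Q)‖ + ‖S' - Q'‖)) := by
  obtain ⟨k, K, hk, hK, hstep⟩ := D.exists_heat_error_step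
  obtain ⟨M, hM, hb⟩ := D.exists_potential_bound V
  obtain ⟨C, hC, hpot⟩ := D.exists_potential_error V
  refine ⟨k, K * (M ^ 2 + 2 * M * C + 2 * M + 1), hk, ?_⟩
  intro Δ S S' U U' Q Q' A A' Ah B g g' γS γU γQ d' hΔ tS tU tQ eA eA' eAh e1 e2 h1 h2
  refine (hstep Δ S S' U U' Q Q' A' Ah g g' γS γU γQ d' hΔ tS tU tQ h1 h2).trans
    (add_le_add le_rfl ?_)
  have hUS : ‖H1.fn U - H1.fn S‖ ≤ ‖H1.fn U - H1.fn Q‖ + ‖S - Q‖ := by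
    have h3 := norm_sub_le_norm_sub_add_norm_sub (H1.fn U) (H1.fn Q) (H1.fn S)
    have h4 : ‖H1.fn Q - H1.fn S‖ ≤ ‖S - Q‖ := by
      rw [norm_sub_rev]
      exact H1.norm_fn_le (S - Q)
    exact h3.trans (add_le_add le_rfl h4)
  have hv : ‖H1.fn U - H1.fn S'‖ ≤ ‖H1.fn U - H1.fn Q‖ + ‖S - Q‖ + ‖H1.fn S' - H1.fn S‖ := by
    have h3 := norm_sub_le_norm_sub_add_norm_sub (H1.fn U) (H1.fn S) (H1.fn S')
    rw [norm_sub_rev (H1.fn S) (H1.fn S')] at h3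
    exact h3.trans (add_le_add hUS le_rfl)
  have hw : ‖HTilde.restrict G.workpiece_subset_dom Ah.1
      - HTilde.restrict G.workpiece_subset_dom A'.1‖
      ≤ C * (‖H1.fn U - H1.fn Q‖ + ‖S - Q‖ + ‖A - B‖)
        + ‖HTilde.restrict G.workpiece_subset_dom A'.1
              - HTilde.restrict G.workpiece_subset_dom A.1‖ := by
    have h3 := hpot (H1.fn S) (H1.fn U) A Ah B eA e1 e2
    have h4 : ‖HTilde.restrict G.workpiece_subset_dom Ah.1
      - HTilde.restrict G.workpiece_subset_dom A.1‖ ≤ ‖Ah - A‖ := by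
      rw [← map_sub]
      exact HTilde.norm_restrict_le G.workpiece_subset_dom (Ah - A)
    have h5 := mul_le_mul_of_nonneg_left (add_le_add hUS (le_refl ‖A - B‖)) hC
    have h6 := norm_sub_le_norm_sub_add_norm_sub (HTilde.restrict G.workpiece_subset_dom Ah.1)
      (HTilde.restrict G.workpiece_subset_dom A.1) (HTilde.restrict G.workpiece_subset_dom A'.1)
    rw [norm_sub_rev (HTilde.restrict G.workpiece_subset_dom A.1)] at h6
    exact h6.trans (add_le_add (h4.trans (h3.trans h5)) le_rfl)
  have h0 := source_le (y₁ := ‖g' - g‖) (y₂ := ‖d' - Δ⁻¹ • (H1.fn S' - H1.fn S)‖)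
    (y₃ := Δ⁻¹ * ‖(H1.fn S' - H1.fn Q') - (H1.fn S - H1.fn Q)‖) (p' := ‖S' - Q'‖) hM hC
    (norm_nonneg (H1.fn U - H1.fn Q)) (norm_nonneg (S - Q)) (norm_nonneg (H1.fn S' - H1.fn S))
    (norm_nonneg (A - B)) (norm_nonneg (HTilde.restrict G.workpiece_subset_dom A'.1
              - HTilde.restrict G.workpiece_subset_dom A.1)) (norm_nonneg _) (norm_nonneg _)
    (mul_nonneg (inv_nonneg.2 hΔ.le) (norm_nonneg _)) (norm_nonneg _)
    (norm_nonneg Ah) (norm_nonneg A') (hb _ Ah eAh) (hb _ A' eA')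
    hv hw
  rw [norm_sub_rev g' g] at h0 ⊢
  refine (mul_le_mul_of_nonneg_left h0 (mul_nonneg hK (norm_nonneg (U' - Q')))).trans_eq ?_
  generalize ‖U' - Q'‖ = e
  generalize M ^ 2 + 2 * M * C + 2 * M + 1 = L
  rw [← mul_assoc, mul_right_comm K e L]

end Coefficients

/-- Projection errors `p`, `q` are bounded at each node and sum to multiples of `N Δ = τ`. The
increments and the consistency error gain a factor `Δ²`. The term with `Δ⁻¹` loses it, which is why
`(I - Q_h) ∂_t T` enters the estimate without a power of `Δt`. -/
theorem sum_defect_le {τ Δ PT PA : ℝ} {N : ℕ} (hΔ : 0 < Δ) (hN : N * Δ = τ)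
    {p q s r y w z a₁ a₂ a₃ a₄ a₅ : ℕ → ℝ} (hp : ∀ n ≤ N, p n ^ 2 ≤ PT)
    (hq : ∀ n ≤ N, q n ^ 2 ≤ PA) (h1 : ∀ n < N, s n ^ 2 ≤ Δ * a₁ n)
    (h2 : ∀ n < N, r n ^ 2 ≤ Δ * a₂ n) (h3 : ∀ n < N, y n ^ 2 ≤ Δ * a₃ n)
    (h4 : ∀ n < N, w n ^ 2 ≤ Δ * a₄ n) (h5 : ∀ n < N, z n ^ 2 ≤ Δ * a₅ n) :
    Δ * ∑ n ∈ Finset.range N,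
      (p n + s n + q n + r n + y n + w n + Δ⁻¹ * z n + p (n + 1)) ^ 2
    ≤ 8 * (2 * τ * PT + τ * PA + Δ ^ 2 * (∑ n ∈ Finset.range N, a₁ n
      + ∑ n ∈ Finset.range N, a₂ n + ∑ n ∈ Finset.range N, a₃ n + ∑ n ∈ Finset.range N, a₄ n)
      + ∑ n ∈ Finset.range N, a₅ n) := by
  have hterm : ∀ n ∈ Finset.range N,
      Δ * (p n + s n + q n + r n + y n + w n + Δ⁻¹ * z n + p (n + 1)) ^ 2
        ≤ 8 * ((Δ * (2 * PT + PA) + Δ ^ 2 * (a₁ n + a₂ n + a₃ n + a₄ n)) + a₅ n) := by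
    intro n hn
    have hn := Finset.mem_range.1 hn
    have hz : Δ * (Δ⁻¹ * z n) ^ 2 ≤ a₅ n := by
      have : Δ * (Δ⁻¹ * z n) ^ 2 = Δ⁻¹ * z n ^ 2 := by field_simp
      rw [this, inv_mul_le_iff₀ hΔ]
      exact h5 n hn
    have e := mul_le_mul_of_nonneg_left
      (sq_sum_le_eight (p n) (s n) (q n) (r n) (y n) (w n) (Δ⁻¹ * z n) (p (n + 1))) hΔ.le
    have t1 := mul_le_mul_of_nonneg_left (hp n hn.le) hΔ.le
    have t2 := mul_le_mul_of_nonneg_left (hp (n + 1) hn) hΔ.le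
    have t3 := mul_le_mul_of_nonneg_left (hq n hn.le) hΔ.le
    have t4 := mul_le_mul_of_nonneg_left (h1 n hn) hΔ.le
    have t5 := mul_le_mul_of_nonneg_left (h2 n hn) hΔ.le
    have t6 := mul_le_mul_of_nonneg_left (h3 n hn) hΔ.le
    have t7 := mul_le_mul_of_nonneg_left (h4 n hn) hΔ.le
    linarith
  rw [Finset.mul_sum]
  refine (Finset.sum_le_sum hterm).trans_eq ?_
  simp only [Finset.sum_add_distrib, ← Finset.mul_sum, Finset.sum_const, Finset.card_range,
    nsmul_eq_mul, ← hN]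
  ring

/-- `H1.fn` as a bounded operator. -/
def H1.fnL (ϑ : Set Plane) : H1 ℝ ϑ →L[ℝ] L2 ℝ ϑ :=
  (PiLp.proj 2 (fun _ : Fin 3 => L2 ℝ ϑ) 0).comp (H1 ℝ ϑ).subtypeL

theorem HTilde.continuous_restrict {ϑ' ϑ : Set Plane} (h : ϑ' ⊆ ϑ) :
    Continuous fun Z : HTilde0 ϑ => HTilde.restrict h Z.1 :=
  (((HTilde.restrict h).comp (HTilde0 ϑ).subtype).mkContinuous 1 fun Z => by
    rw [one_mul]
    exact HTilde.norm_restrict_le h Z).continuous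

namespace Coefficients

variable {m : ℕ} {G : Configuration m} (D : Coefficients G)

-- The one-step estimate is fed into Gronwall's lemma and the defects are summed over the time
-- slabs, which reassemble to integrals over the whole interval.
set_option maxHeartbeats 2000000 in
theorem exists_temperature_error (V : Fin m → ℂ) {τ : ℝ} (hτ : 0 < τ) : ∃ c : ℝ, 0 ≤ c ∧
    ∀ (Tc Tc' : ℝ → L2Curve ℝ G.outer) (T₀ : L2 ℝ G.workpiece)
      (A : ℝ → HTilde0 G.dom) (T : ℝ → H1 ℝ G.workpiece)
      (Tt Ttt : ℝ → L2 ℝ G.workpiece) (At : ℝ → H1 ℂ G.workpiece),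
      ContinuousOn Tc (Icc 0 τ) → MemH1Time τ Tc Tc' →
      D.IsSolution τ V Tc T₀ A T Tt →
      ContinuousOn A (Icc 0 τ) → ContinuousOn T (Icc 0 τ) →
      MemH1Time τ (fun t => HTilde.restrict G.workpiece_subset_dom (A t).1) At →
      MemH2Time τ (fun t => H1.fn (T t)) Tt Ttt →
    ∀ (𝒦 : Geometry.SimplicialComplex ℝ Plane), IsMesh G 𝒦 →
    ∀ (Qh : L2 ℝ G.workpiece →L[ℝ] H1 ℝ G.workpiece), (∀ W, Qh W ∈ meshX G 𝒦) →
    ∀ (N : ℕ), 1 ≤ N → ∀ (Ah B : ℕ → HTilde0 G.dom) (Th : ℕ → H1 ℝ G.workpiece),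
      (∀ n, B n ∈ meshY G 𝒦) →
      IsDiscreteSolution D τ V Tc 𝒦 N (Qh (H1.fn (T 0))) Ah Th →
    ∀ PA PT : ℝ, (∀ n ≤ N, ‖A (timeNode τ N n) - B n‖ ^ 2 ≤ PA) →
      (∀ n ≤ N, ‖T (timeNode τ N n) - Qh (H1.fn (T (timeNode τ N n)))‖ ^ 2 ≤ PT) →
    ∀ n ≤ N,
      ‖H1.fn (Th n) - H1.fn (Qh (H1.fn (T (timeNode τ N n))))‖ ^ 2
        + timeStep τ N * ∑ j ∈ Finset.Icc 1 n,
          ‖Th j - Qh (H1.fn (T (timeNode τ N j)))‖ ^ 2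
      ≤ c * (2 * τ * PT + τ * PA + timeStep τ N ^ 2 *
        ((∫ t in Ioo 0 τ, ‖Tt t‖ ^ 2) + (∫ t in Ioo 0 τ, ‖At t‖ ^ 2)
          + (∫ t in Ioo 0 τ, ‖Tc' t‖ ^ 2) + ∫ t in Ioo 0 τ, ‖Ttt t‖ ^ 2)
        + ∫ t in Ioo 0 τ, ‖Tt t - H1.fn (Qh (Tt t))‖ ^ 2) := by
  obtain ⟨k, K, hk, hstep⟩ := D.exists_coupled_error_step V
  obtain ⟨c, hc, hgr⟩ := exists_gronwall_constant K hτ hk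
  refine ⟨c * 8, by positivity, ?_⟩
  intro Tc Tc' T₀ A T Tt Ttt At hTcc hTc hsol hA hT hAt hTt 𝒦 h𝒦 Qh hQh N hN Ah B Th hB hdisc
    PA PT hPA hPT
  -- The heat equation is evaluated at the nodes, so `∂_t T` is replaced by its continuous
  -- representative.
  obtain ⟨d, hd, hTd, hdint⟩ := hTt.2.exists_representative hτ
  obtain ⟨γ, hγ⟩ := D.exists_heat_equation hτ hTcc hsol hA hT hd hTd
  have hel := fun {t : ℝ} (ht : t ∈ Icc 0 τ) Z =>
    D.electricEq_of_ae hτ hA hsol.cont hsol.electric ht Z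
  -- The comparison functions need traces so that `T_h - Q_h T` is admissible both in the discrete
  -- and in the continuous heat equation.
  choose γQ hγQ using fun n => exists_trace_of_mem_meshX h𝒦 (hQh (H1.fn (T (timeNode τ N n))))
  have hΔ := timeStep_pos hτ hN
  have hfn : ContinuousOn (fun t => H1.fn (T t)) (Icc 0 τ) := hsol.cont
  have hdef := sum_defect_le (PT := PT) (PA := PA) hΔ (card_mul_timeStep (τ := τ) hN)
    (p := fun n => ‖T (timeNode τ N n) - Qh (H1.fn (T (timeNode τ N n)))‖)
    (q := fun n => ‖A (timeNode τ N n) - B n‖) hPT hPA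
    (fun n hn => norm_sq_sub_le_slab hτ hN hTt.1 hfn hn)
    (fun n hn => norm_sq_sub_le_slab hτ hN hAt
      ((HTilde.continuous_restrict G.workpiece_subset_dom).comp_continuousOn hA) hn)
    (fun n hn => norm_sq_sub_le_slab hτ hN hTc hTcc hn)
    (fun n hn => norm_sq_consistency_le hτ hN hTt.1 hTt.2 hfn hd hTd hdint hn)
    (fun n hn => norm_sq_sub_map_sub_le_slab hτ hN hTt.1 hfn ((H1.fnL G.workpiece).comp Qh) hn)
  have hmem : MemL2Time τ fun t => Tt t - (H1.fnL G.workpiece).comp Qh (Tt t) :=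
    MemLp.sub hTt.2.mem (((H1.fnL G.workpiece).comp Qh).comp_memLp' hTt.2.mem)
  rw [sum_slab hτ hN hTt.1.deriv_mem, sum_slab hτ hN hAt.deriv_mem, sum_slab hτ hN hTc.deriv_mem,
    sum_slab hτ hN hTt.2.deriv_mem, sum_slab hτ hN hmem] at hdef
  intro n hn
  rw [mul_assoc]
  refine le_trans ?_ (mul_le_mul_of_nonneg_left hdef hc)
  refine hgr N hN (fun n => ‖H1.fn (Th n) - H1.fn (Qh (H1.fn (T (timeNode τ N n))))‖)
    (fun n => ‖Th n - Qh (H1.fn (T (timeNode τ N n)))‖) _ (fun n => norm_nonneg _)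
    (fun n => H1.norm_fn_le (Th n - Qh (H1.fn (T (timeNode τ N n))))) ?_ ?_ n hn
  -- The scheme starts from `Q_h T(0)`, so the discrete error vanishes at the first node.
  · simp only [timeNode_zero, hdisc.initial, sub_self, norm_zero]
  · intro n hn
    obtain ⟨γU, hγU, hU⟩ := hdisc.heat n hn
    have hs := timeNode_mem hτ hN hn.le
    have ht := timeNode_mem hτ hN hn
    have hE := sub_mem_meshX (hdisc.memX (n + 1) hn) (hQh (H1.fn (T (timeNode τ N (n + 1)))))
    have htr := hγU.sub (hγQ (n + 1))
    exact hstep (timeStep τ N) (T (timeNode τ N n)) (T (timeNode τ N (n + 1))) (Th n) (Th (n + 1))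
      (Qh (H1.fn (T (timeNode τ N n)))) (Qh (H1.fn (T (timeNode τ N (n + 1)))))
      (A (timeNode τ N n)) (A (timeNode τ N (n + 1))) (Ah n) (B n)
      (Tc (timeNode τ N n)) (Tc (timeNode τ N (n + 1))) (γ (timeNode τ N (n + 1))) γU (γQ (n + 1))
      (d (timeNode τ N (n + 1))) hΔ (hγ _ ht).1 hγU (hγQ (n + 1)) (hel hs _) (hel ht _)
      (hdisc.electric n hn.le _ (hdisc.memY n hn.le)) (hel hs _)
      (hdisc.electric n hn.le _ (sub_mem_meshY (hdisc.memY n hn.le) (hB n)))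
      ((hγ _ ht).2 _ _ htr) (hU _ hE _ htr)

end Coefficients

theorem norm_sq_sub_le_two {X : Type*} [SeminormedAddCommGroup X] (x y z : X) :
    ‖x - z‖ ^ 2 ≤ 2 * ‖x - y‖ ^ 2 + 2 * ‖z - y‖ ^ 2 := by
  have h := norm_sub_le_norm_sub_add_norm_sub x y z
  rw [norm_sub_rev y z] at h
  have h2 := pow_le_pow_left₀ (norm_nonneg _) h 2
  linarith [sq_nonneg (‖x - y‖ - ‖z - y‖), add_sq ‖x - y‖ ‖z - y‖, sub_sq ‖x - y‖ ‖z - y‖]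

namespace Coefficients

variable {m : ℕ} {G : Configuration m} (D : Coefficients G)

theorem exists_potential_error_sq (V : Fin m → ℂ) : ∃ C : ℝ, 0 ≤ C ∧
    ∀ (S S' : L2 ℝ G.workpiece) (A A' B : HTilde0 G.dom) (a b : ℝ), D.ElectricEq V S A A →
      D.ElectricEq V S A (A' - B) → D.ElectricEq V S' A' (A' - B) → ‖S' - S‖ ^ 2 ≤ a →
      ‖A - B‖ ^ 2 ≤ b → ‖A' - A‖ ^ 2 ≤ C * (a + b) := by
  obtain ⟨C, hC, h⟩ := D.exists_potential_error V
  refine ⟨2 * C ^ 2, by positivity, fun S S' A A' B a b h1 h2 h3 ha hb => ?_⟩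
  have h4 := pow_le_pow_left₀ (norm_nonneg (A' - A)) (h S S' A A' B h1 h2 h3) 2
  refine h4.trans ?_
  generalize ‖A - B‖ = y at *
  generalize ‖S' - S‖ = x at *
  rw [mul_pow]
  have h5 : (x + y) ^ 2 ≤ 2 * (a + b) := by linarith [sq_nonneg (x - y), add_sq x y, sub_sq x y]
  have := mul_le_mul_of_nonneg_left h5 (sq_nonneg C)
  linarith

end Coefficients

theorem integral_norm_sq_add_le {τ : ℝ} {X : Type*} [NormedAddCommGroup X] {f g h : ℝ → X}
    (hf : MemL2Time τ f) (hg : MemL2Time τ g) (hh : MemL2Time τ h) :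
    (∫ t in Ioo 0 τ, ‖g t‖ ^ 2) + ∫ t in Ioo 0 τ, ‖h t‖ ^ 2
      ≤ ∫ t in Ioo 0 τ, (‖f t‖ ^ 2 + ‖g t‖ ^ 2 + ‖h t‖ ^ 2) := by
  have hf := (MemLp.norm hf).integrable_sq
  have hg := (MemLp.norm hg).integrable_sq
  have hh := (MemLp.norm hh).integrable_sq
  rw [integral_add (f := fun t => ‖f t‖ ^ 2 + ‖g t‖ ^ 2) (hf.add hg) hh, integral_add hf hg]
  have : 0 ≤ ∫ t in Ioo 0 τ, ‖f t‖ ^ 2 := integral_nonneg fun _ => sq_nonneg _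
  linarith

theorem defect_bound_le {τ Δ PA PT I₁ ITc IT It Itt IA : ℝ} (hτ : 0 < τ) (hPA : 0 ≤ PA) (hPT : 0 ≤ PT)
    (h1 : 0 ≤ I₁) (hTc : 0 ≤ ITc) (hIT : 0 ≤ IT) (hA : 0 ≤ IA) (h : It + Itt ≤ IT) :
    2 * τ * PT + τ * PA + Δ ^ 2 * (It + IA + ITc + Itt) + I₁
      ≤ (2 * τ + 1) * (PA + PT + I₁ + Δ ^ 2 * (ITc + IT + IA)) := by
  have h2 : Δ ^ 2 * (It + IA + ITc + Itt) ≤ Δ ^ 2 * (ITc + IT + IA) :=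
    mul_le_mul_of_nonneg_left (by linarith) (sq_nonneg Δ)
  have h3 : 0 ≤ 2 * τ * (I₁ + Δ ^ 2 * (ITc + IT + IA)) := by positivity
  have h4 : 0 ≤ τ * PA := by positivity
  linarith

end

end InductionHeating

/-! ### The error estimate for the fully discrete scheme -/

set_option maxHeartbeats 2000000 in
theorem mainTheorem3 {m : ℕ} (G : Configuration m) (D : Coefficients G)
    (V : Fin m → ℂ) (τ : ℝ) (hτ : 0 < τ) :
    ∃ C : ℝ, 0 < C ∧
      ∀ (Tc Tc' : ℝ → L2Curve ℝ G.outer) (T₀ : H1 ℝ G.workpiece)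
        (A : ℝ → HTilde0 G.dom) (T : ℝ → H1 ℝ G.workpiece)
        (Tt Ttt : ℝ → L2 ℝ G.workpiece) (At : ℝ → H1 ℂ G.workpiece),
        ContinuousOn Tc (Icc 0 τ) → MemH1Time τ Tc Tc' →
        D.IsSolution τ V Tc (H1.fn T₀) A T Tt →
        ContinuousOn A (Icc 0 τ) → ContinuousOn T (Icc 0 τ) →
        MemH1Time τ (fun t => HTilde.restrict G.workpiece_subset_dom (A t).1) At →
        MemH2Time τ (fun t => H1.fn (T t)) Tt Ttt →
      ∀ (𝒦 : Geometry.SimplicialComplex ℝ Plane), IsMesh G 𝒦 →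
      ∀ (Ih : HTilde0 G.dom → HTilde0 G.dom), (∀ Z, Ih Z ∈ meshY G 𝒦) →
      ∀ (Qh : L2 ℝ G.workpiece →L[ℝ] H1 ℝ G.workpiece), (∀ W, Qh W ∈ meshX G 𝒦) →
      ∀ (N : ℕ) (hN : 1 ≤ N) (Ah : ℕ → HTilde0 G.dom) (Th : ℕ → H1 ℝ G.workpiece),
        IsDiscreteSolution D τ V Tc 𝒦 N (Qh (H1.fn (T 0))) Ah Th →
        (Finset.Icc 1 N).sup' (Finset.nonempty_Icc.2 hN)
            (fun n => ‖(H1.fn (Th n)) - (H1.fn (T (timeNode τ N n)))‖ ^ 2)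
          + timeStep τ N * ∑ n ∈ Finset.Icc 1 N, ‖Th n - T (timeNode τ N n)‖ ^ 2
          + (Finset.Icc 0 N).sup' (Finset.nonempty_Icc.2 (Nat.zero_le N))
            (fun n => ‖Ah n - A (timeNode τ N n)‖ ^ 2)
        ≤ C *
          ((Finset.Icc 0 N).sup' (Finset.nonempty_Icc.2 (Nat.zero_le N))
              (fun n => ‖A (timeNode τ N n) - Ih (A (timeNode τ N n))‖ ^ 2)
            + (Finset.Icc 0 N).sup' (Finset.nonempty_Icc.2 (Nat.zero_le N))
              (fun n => ‖T (timeNode τ N n) - Qh (H1.fn (T (timeNode τ N n)))‖ ^ 2)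
            + (∫ t in Ioo 0 τ, ‖Tt t - (H1.fn (Qh (Tt t)))‖ ^ 2)
            + timeStep τ N ^ 2 *
              ((∫ t in Ioo 0 τ, ‖Tc' t‖ ^ 2)
                + (∫ t in Ioo 0 τ, (‖H1.fn (T t)‖ ^ 2 + ‖Tt t‖ ^ 2 + ‖Ttt t‖ ^ 2))
                + ∫ t in Ioo 0 τ, ‖At t‖ ^ 2)) := by
  obtain ⟨c, hc, herr⟩ := D.exists_temperature_error V hτ
  obtain ⟨C, hC, hpot⟩ := D.exists_potential_error_sq V
  -- The three summands belong to the `L²₁` error of the temperature, its summed `H¹₁` error and the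
  -- error of the potential. The factor `2 τ + 1` is that of `defect_bound_le`.
  refine ⟨(2 * (c * (2 * τ + 1)) + 2) + (2 * (c * (2 * τ + 1)) + 2 * τ)
    + C * ((2 * (c * (2 * τ + 1)) + 2) + 1), by positivity, ?_⟩
  intro Tc Tc' T₀ A T Tt Ttt At hTcc hTc hsol hA hT hAt hTt 𝒦 h𝒦 Ih hIh Qh hQh N hN Ah Th hdisc
  have hPA : ∀ n ≤ N, ‖A (timeNode τ N n) - Ih (A (timeNode τ N n))‖ ^ 2
      ≤ (Finset.Icc 0 N).sup' (Finset.nonempty_Icc.2 (Nat.zero_le N))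
        (fun n => ‖A (timeNode τ N n) - Ih (A (timeNode τ N n))‖ ^ 2) := fun n hn =>
    Finset.le_sup' (fun n => ‖A (timeNode τ N n) - Ih (A (timeNode τ N n))‖ ^ 2)
      (Finset.mem_Icc.2 ⟨Nat.zero_le n, hn⟩)
  have hPT : ∀ n ≤ N, ‖T (timeNode τ N n) - Qh (H1.fn (T (timeNode τ N n)))‖ ^ 2
      ≤ (Finset.Icc 0 N).sup' (Finset.nonempty_Icc.2 (Nat.zero_le N))
        (fun n => ‖T (timeNode τ N n) - Qh (H1.fn (T (timeNode τ N n)))‖ ^ 2) := fun n hn =>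
    Finset.le_sup' (fun n => ‖T (timeNode τ N n) - Qh (H1.fn (T (timeNode τ N n)))‖ ^ 2)
      (Finset.mem_Icc.2 ⟨Nat.zero_le n, hn⟩)
  generalize (Finset.Icc 0 N).sup' (Finset.nonempty_Icc.2 (Nat.zero_le N))
    (fun n => ‖A (timeNode τ N n) - Ih (A (timeNode τ N n))‖ ^ 2) = PA at hPA ⊢
  generalize (Finset.Icc 0 N).sup' (Finset.nonempty_Icc.2 (Nat.zero_le N))
    (fun n => ‖T (timeNode τ N n) - Qh (H1.fn (T (timeNode τ N n)))‖ ^ 2) = PT at hPT ⊢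
  have herr := herr Tc Tc' (H1.fn T₀) A T Tt Ttt At hTcc hTc hsol hA hT hAt hTt 𝒦 h𝒦 Qh hQh N hN Ah
    (fun n => Ih (A (timeNode τ N n))) Th (fun n => hIh _) hdisc PA PT hPA hPT
  have hPA0 : 0 ≤ PA := (sq_nonneg _).trans (hPA 0 (Nat.zero_le N))
  have hPT0 : 0 ≤ PT := (sq_nonneg _).trans (hPT 0 (Nat.zero_le N))
  have i0 := integral_norm_sq_add_le hTt.1.mem hTt.2.mem hTt.2.deriv_mem
  have i1 : 0 ≤ ∫ t in Ioo 0 τ, ‖Tt t - (H1.fn (Qh (Tt t)))‖ ^ 2 :=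
    integral_nonneg fun _ => sq_nonneg _
  have i2 : 0 ≤ ∫ t in Ioo 0 τ, ‖Tc' t‖ ^ 2 := integral_nonneg fun _ => sq_nonneg _
  have i3 : 0 ≤ ∫ t in Ioo 0 τ, (‖H1.fn (T t)‖ ^ 2 + ‖Tt t‖ ^ 2 + ‖Ttt t‖ ^ 2) :=
    integral_nonneg fun _ => add_nonneg (add_nonneg (sq_nonneg _) (sq_nonneg _)) (sq_nonneg _)
  have i4 : 0 ≤ ∫ t in Ioo 0 τ, ‖At t‖ ^ 2 := integral_nonneg fun _ => sq_nonneg _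
  have hdef := defect_bound_le (Δ := timeStep τ N) hτ hPA0 hPT0 i1 i2 i3 i4 i0
  have hB0 : PA + PT ≤ PA + PT + (∫ t in Ioo 0 τ, ‖Tt t - (H1.fn (Qh (Tt t)))‖ ^ 2)
      + timeStep τ N ^ 2 * ((∫ t in Ioo 0 τ, ‖Tc' t‖ ^ 2)
        + (∫ t in Ioo 0 τ, (‖H1.fn (T t)‖ ^ 2 + ‖Tt t‖ ^ 2 + ‖Ttt t‖ ^ 2))
        + ∫ t in Ioo 0 τ, ‖At t‖ ^ 2) := by
    rw [add_assoc (PA + PT)]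
    exact le_add_of_nonneg_right (add_nonneg i1
      (mul_nonneg (sq_nonneg _) (add_nonneg (add_nonneg i2 i3) i4)))
  have herr := fun n hn => (herr n hn).trans (mul_le_mul_of_nonneg_left hdef hc)
  generalize PA + PT + (∫ t in Ioo 0 τ, ‖Tt t - (H1.fn (Qh (Tt t)))‖ ^ 2)
      + timeStep τ N ^ 2 * ((∫ t in Ioo 0 τ, ‖Tc' t‖ ^ 2)
        + (∫ t in Ioo 0 τ, (‖H1.fn (T t)‖ ^ 2 + ‖Tt t‖ ^ 2 + ‖Ttt t‖ ^ 2))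
        + ∫ t in Ioo 0 τ, ‖At t‖ ^ 2) = B at hB0 herr ⊢
  have hΔ := timeStep_pos hτ hN
  -- The triangle inequality through `Q_h T`. The case `n = 0`, absent from the maximum over
  -- temperatures, is needed for the potential, whose maximum starts at zero.
  have hfn : ∀ n ≤ N, ‖H1.fn (Th n) - H1.fn (T (timeNode τ N n))‖ ^ 2
      ≤ (2 * (c * (2 * τ + 1)) + 2) * B := by
    intro n hn
    have h1 := norm_sq_sub_le_two (H1.fn (Th n)) (H1.fn (Qh (H1.fn (T (timeNode τ N n)))))
      (H1.fn (T (timeNode τ N n)))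
    have h2 : ‖H1.fn (T (timeNode τ N n)) - H1.fn (Qh (H1.fn (T (timeNode τ N n))))‖ ^ 2 ≤ PT :=
      (pow_le_pow_left₀ (norm_nonneg _)
        (H1.norm_fn_le (T (timeNode τ N n) - Qh (H1.fn (T (timeNode τ N n))))) 2).trans (hPT n hn)
    have h3 := (le_add_of_nonneg_right (mul_nonneg hΔ.le
      (Finset.sum_nonneg fun j _ => sq_nonneg _))).trans (herr n hn)
    linarith
  have hsum : timeStep τ N * ∑ n ∈ Finset.Icc 1 N, ‖Th n - T (timeNode τ N n)‖ ^ 2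
      ≤ (2 * (c * (2 * τ + 1)) + 2 * τ) * B := by
    have h1 : ∑ n ∈ Finset.Icc 1 N, ‖Th n - T (timeNode τ N n)‖ ^ 2
        ≤ 2 * (∑ n ∈ Finset.Icc 1 N, ‖Th n - Qh (H1.fn (T (timeNode τ N n)))‖ ^ 2)
          + N * (2 * PT) := by
      refine (Finset.sum_le_sum (g := fun n => 2 * ‖Th n - Qh (H1.fn (T (timeNode τ N n)))‖ ^ 2
        + 2 * PT) fun n hn => (norm_sq_sub_le_two (Th n) (Qh (H1.fn (T (timeNode τ N n))))
          (T (timeNode τ N n))).trans (add_le_add le_rfl (mul_le_mul_of_nonneg_left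
            (hPT n (Finset.mem_Icc.1 hn).2) zero_le_two))).trans_eq ?_
      rw [Finset.sum_add_distrib, ← Finset.mul_sum, Finset.sum_const, Nat.card_Icc, nsmul_eq_mul,
        Nat.add_sub_cancel]
    have h2 := mul_le_mul_of_nonneg_left h1 hΔ.le
    have h3 := (le_add_of_nonneg_left (sq_nonneg _)).trans (herr N le_rfl)
    have h4 := card_mul_timeStep (τ := τ) hN
    have h5 : timeStep τ N * (N * (2 * PT)) = 2 * τ * PT := by
      linear_combination 2 * PT * h4
    have h6 : 2 * τ * PT ≤ 2 * τ * B := mul_le_mul_of_nonneg_left (by linarith) (by positivity)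
    linarith
  -- The potential error at a node depends only on the temperature error and the approximation error
  -- at that same node.
  have hpotn : ∀ n ≤ N, ‖Ah n - A (timeNode τ N n)‖ ^ 2
      ≤ C * ((2 * (c * (2 * τ + 1)) + 2) + 1) * B := by
    intro n hn
    have hel := D.electricEq_of_ae hτ hA hsol.cont hsol.electric (timeNode_mem hτ hN hn)
    refine (hpot (H1.fn (T (timeNode τ N n))) (H1.fn (Th n)) (A (timeNode τ N n)) (Ah n)
      (Ih (A (timeNode τ N n))) ((2 * (c * (2 * τ + 1)) + 2) * B) B (hel _) (hel _)
      (hdisc.electric n hn _ (sub_mem_meshY (hdisc.memY n hn) (hIh _))) (hfn n hn)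
      ((hPA n hn).trans (by linarith))).trans_eq (by ring)
  have s1 : (Finset.Icc 1 N).sup' (Finset.nonempty_Icc.2 hN)
      (fun n => ‖(H1.fn (Th n)) - (H1.fn (T (timeNode τ N n)))‖ ^ 2)
      ≤ (2 * (c * (2 * τ + 1)) + 2) * B :=
    Finset.sup'_le _ _ fun n hn => hfn n (Finset.mem_Icc.1 hn).2
  have s2 : (Finset.Icc 0 N).sup' (Finset.nonempty_Icc.2 (Nat.zero_le N))
      (fun n => ‖Ah n - A (timeNode τ N n)‖ ^ 2) ≤ C * ((2 * (c * (2 * τ + 1)) + 2) + 1) * B :=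
    Finset.sup'_le _ _ fun n hn => hpotn n (Finset.mem_Icc.1 hn).2
  rw [add_mul, add_mul]
  exact add_le_add (add_le_add s1 hsum) s2
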